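/- Let $N\ge 3$ and $k\ge 1$ be integers. **Assumptions on $f_1$.** Let $f_1:\mathbb R\to\mathbb R$ be odd and write $F_1(s)=\int_0^s f_1(t)\,dt$. Assume: * $(H_1)$ $f_1\in C[0,\infty)$, and $f_1$ is $C^1$ on $(0,\infty)$ except possibly at finitely many points; $f_1(0)=0$; there is $b\ge 0$ with $f_1>0$ on $(b,\infty)$ and $f_1\le 0$ on $[0,b]$; $f_1<0$ on $(0,\delta)$ for some $\delta>0$; and there is a unique $\beta\ge b$ with $F_1(\beta)=0$. * $(H_2)$ $(F_1/f_1)'(s)>\frac{N-2}{2N}$ for all $s>\beta$ at which $f_1$ is differentiable. * $(H_3)$ $s\mapsto s f_1'(s)/f_1(s)$ is decreasing (non-increasing suffices) on the set of $s>b$ at which $f_1$ is differentiable; $f_1$ is differentiable at $\beta$ and $\beta f_1'(\beta)/f_1(\beta)<\frac{N}{N-2}$. * $(H_4)$ There is $\alpha_*^k>0$ such that the problem $$u''+\tfrac{N-1}{r}u'+f_1(u)=0\ (r>0),\qquad u(0)=\alpha_*^k,\ u'(0)=0$$ has a solution on $[0,\infty)$ with $\lim_{r\to\infty}u(r)=0$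 that changes sign exactly $k-1$ times. **Assumptions on $f_2$.** Let $f_2\in C[0,\infty)$ be $C^1$ on $(0,\infty)$ except possibly at finitely many points, with $f_2>0$ on $(0,\infty)$. Assume: * $(H_5)$ There are $\widehat\alpha>\alpha_*^k$ and $r_0>0$ such that the problem $$v''+\tfrac{N-1}{r}v'+f_2(v)=0\ (0<r\le r_0),\qquad v(0)=\widehat\alpha,\ v'(0)=0$$ has a solution on $[0,r_0]$ with $v>0$ on $[0,r_0)$, $v(r_0)=0$ and $v'(r_0)<0$. Let $0<\epsilon<\min\{\beta/4,(\widehat\alpha-\alpha_*^k)/2\}$ and $\alpha_1=\alpha_*^k+\epsilon$. For $\mu,\lambda>0$ let $f_\mu=f_{\mu,\lambda}:\mathbb R\to\mathbb R$ be the odd function given for $s\ge 0$ by $$f_\mu(s)=\begin{cases} f_1(s), & s\le \alpha_1,\\ L(s), & \alpha_1\le s\le \alpha_1+\epsilon,\\ \lambda^2 f_2(s/\mu), & s\ge\alpha_1+\epsilon,\end{cases}$$ where $L$ is the affine function whose graph joins $(\alpha_1,f_1(\alpha_1))$ to $\big(\alpha_1+\epsilon,\lambda^2 f_2((\alpha_1+\epsilon)/\mu)\big)$.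 **Theorem A.** There is $\bar\mu>0$ (depending on $\epsilon$ and the data above) such that for every $\mu>\bar\mu$ there is $\bar\lambda=\bar\lambda(\mu)>0$ such that for all $\lambda>\bar\lambda$ and every $j=1,\dots,k-1$ the problem $$\Delta u+f_\mu(u)=0\ \text{ in }\mathbb R^N,\qquad \lim_{|x|\to\infty}u(x)=0$$ has at least two nonconstant radial classical ($C^2$) solutions that change sign exactly $j$ times as functions of $|x|\in[0,\infty)$; both are positive at the origin and their values there are different (so they are not merely $u$ and $-u$). -/

import Mathlib

open Set Filter Topology MeasureTheory

noncomputable section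

namespace RadialBoundStates

/-- The primitive `F(s) = ∫₀ˢ f`. -/
def prim (f : ℝ → ℝ) (s : ℝ) : ℝ := ∫ t in (0 : ℝ)..s, f t

/-- `f ∈ C[0,∞) ∩ C¹(0,∞)`, except that `C¹` may fail at finitely many points. -/
structure Regular (f : ℝ → ℝ) : Prop where
  cont : ContinuousOn f (Ici 0)
  c1 : ∃ S : Finset ℝ, ∀ s, 0 < s → s ∉ S → ContDiffAt ℝ 1 f s

/-- Condition `(H₁)`: regularity and shape of the nonlinearity, with its zero `b` and the
zero `β` of its primitive. -/
structure H1 (f : ℝ → ℝ) (b β : ℝ) : Prop where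
  regular : Regular f
  zero : f 0 = 0
  odd : ∀ s, f (-s) = -f s
  b_nonneg : 0 ≤ b
  pos : ∀ s, b < s → 0 < f s
  nonpos : ∀ s ∈ Icc 0 b, f s ≤ 0
  neg_near_zero : ∃ δ > 0, ∀ s ∈ Ioo 0 δ, f s < 0
  b_le : b ≤ β
  prim_zero : prim f β = 0
  prim_zero_unique : ∀ t, b ≤ t → prim f t = 0 → t = β

/-- Condition `(H₂)`: `(F/f)'(s) > (N-2)/(2N)` for `s > β`, wherever `f` is differentiable. -/
def H2 (N : ℕ) (f : ℝ → ℝ) (β : ℝ) : Prop :=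
  ∀ s, β < s → DifferentiableAt ℝ f s →
    ((N : ℝ) - 2) / (2 * N) < deriv (fun t => prim f t / f t) s

/-- Condition `(H₃)`: `s f'(s) / f(s)` is decreasing for `s > b` (wherever `f` is
differentiable), and its value at `β` exists and is less than `N/(N-2)`. -/
structure H3 (N : ℕ) (f : ℝ → ℝ) (b β : ℝ) : Prop where
  decreasing : AntitoneOn (fun s => s * deriv f s / f s) {s | b < s ∧ DifferentiableAt ℝ f s}
  diff_beta : DifferentiableAt ℝ f β
  lt_beta : β * deriv f β / f β < (N : ℝ) / ((N : ℝ) - 2)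

/-- On the interval `I` (with left end point `0 ∈ I`), `u` is `C¹` with derivative `u'` and solves
`u'' + (N-1)/r u' + f(u) = 0` for `r > 0`, `u(0) = α`, `u'(0) = 0`. -/
structure SolvesIVP (N : ℕ) (f : ℝ → ℝ) (α : ℝ) (I : Set ℝ) (u u' : ℝ → ℝ) : Prop where
  init : u 0 = α
  init_deriv : u' 0 = 0
  hasDeriv : ∀ r ∈ I, HasDerivWithinAt u (u' r) I r
  cont_deriv : ContinuousOn u' I
  equation : ∀ r ∈ I, 0 < r →
    HasDerivWithinAt u' (-(((N : ℝ) - 1) / r * u' r) - f (u r)) I r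

/-- There are points `0 ≤ t₀ < ⋯ < t_m` at which `w` is nonzero with alternating signs. -/
def Alternates (w : ℝ → ℝ) (m : ℕ) : Prop :=
  ∃ t : Fin (m + 1) → ℝ, StrictMono t ∧ (∀ i, 0 ≤ t i) ∧
    ∀ i : Fin m, w (t i.castSucc) * w (t i.succ) < 0

/-- `w` changes sign exactly `j` times on `[0,∞)`. -/
def ChangesSign (w : ℝ → ℝ) (j : ℕ) : Prop :=
  Alternates w j ∧ ¬ Alternates w (j + 1)

/-- Condition `(H₄)`: `α > 0` and the solution of the initial value problem that starts at `α` is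
a `k`-th bound state, i.e. it tends to `0` at infinity and changes sign `k - 1` times. -/
def H4 (N : ℕ) (f : ℝ → ℝ) (k : ℕ) (α : ℝ) : Prop :=
  0 < α ∧ ∃ u u' : ℝ → ℝ, SolvesIVP N f α (Ici 0) u u' ∧ Tendsto u atTop (𝓝 0) ∧
    ChangesSign u (k - 1)

/-- Condition `(H₅)`: the solution that starts at `αhat > α` reaches `0` with nonzero slope. -/
def H5 (N : ℕ) (f : ℝ → ℝ) (α αhat : ℝ) : Prop :=
  α < αhat ∧ ∃ (v v' : ℝ → ℝ) (r₀ : ℝ), 0 < r₀ ∧ SolvesIVP N f αhat (Icc 0 r₀) v v' ∧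
    (∀ r ∈ Ico 0 r₀, 0 < v r) ∧ v r₀ = 0 ∧ v' r₀ < 0

/-- For `s ≥ 0`: `f₁(s)` up to `a`, then the line from `(a, f₁(a))` to
`(a + ε, l² f₂((a + ε)/μ))`, then `l² f₂(s/μ)`. -/
def glued (f₁ f₂ : ℝ → ℝ) (a ε μ l : ℝ) (s : ℝ) : ℝ :=
  if s ≤ a then f₁ s
  else if s ≤ a + ε then f₁ a + (s - a) / ε * (l ^ 2 * f₂ ((a + ε) / μ) - f₁ a)
  else l ^ 2 * f₂ (s / μ)

/-- The nonlinearity `f_μ`: the odd extension to `ℝ` of the glued function. -/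
def fMu (f₁ f₂ : ℝ → ℝ) (a ε μ l : ℝ) (s : ℝ) : ℝ :=
  if 0 ≤ s then glued f₁ f₂ a ε μ l s else -glued f₁ f₂ a ε μ l (-s)

/-- `u` is a bound state: a nonconstant classical solution of `Δu + f(u) = 0` in `ℝᴺ` that tends
to `0` at infinity. -/
structure IsBoundState (N : ℕ) (f : ℝ → ℝ) (u : EuclideanSpace ℝ (Fin N) → ℝ) : Prop where
  smooth : ContDiff ℝ 2 u
  equation : ∀ x, Laplacian.laplacian u x + f (u x) = 0
  decay : Tendsto u (cocompact (EuclideanSpace ℝ (Fin N))) (𝓝 0)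
  nonconstant : ∃ x y, u x ≠ u y

/-- `w` is the profile of a radial bound state `x ↦ w(|x|)` in `ℝᴺ` that is positive at the origin
and changes sign exactly `j` times. -/
structure IsRadialBoundState (N : ℕ) (f : ℝ → ℝ) (j : ℕ) (w : ℝ → ℝ) : Prop where
  boundState : IsBoundState N f (fun x => w ‖x‖)
  pos_origin : 0 < w 0
  signChanges : ChangesSign w j

end RadialBoundStates

end

open Set Filter Topology MeasureTheory

noncomputable section

namespace RadialBoundStates

/-! ### Monotonicity from the sign of the derivative off a finite set -/

/-! Write `n = d + 3` for the dimension, `F` for the primitive of the nonlinearity and `E = u'^2/2 +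
F(u)` for the energy. The modified nonlinearity agrees with `f₁` up to `α + ε`, so the given bound
state `u` with `u 0 = α` is also a solution of the modified problem. For each `j` one profile is
found by shooting from `[β, α]` and a second one by shooting from above `α`.

Shooting rests on one fact (`tendsto_zero_of_altFrom_lost`): if solutions with at least `j + 1` sign
changes converge to a solution with fewer, the limit tends to zero and has exactly `j` sign changes.
Indeed, negative energy forbids further sign changes, and nonnegative energy with finitely many sign
changes forces decay to zero. So the property "at least `j + 1` sign changes" is both open and
closed along an interval of initial values unless a bound state with `j` sign changes starts there.
Below `α`, a solution starting at `β` loses energy at once and has no sign change, while `u` has `k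
- 1`; this gives the first profile (`exists_boundState_below`), and `u` itself serves for `j = k -
1`.

Above `α` there are two ends. Slightly above `α`, solutions change sign once more than `u`
(`exists_altFrom_succ_above`). At the far end `μ αhat`, the solution begins as the rescaled solution
for `f₂`, concentrated at a tiny radius, and its flux carries it below a level `s₀` in `(b, β)`
before a fixed radius `η` (`Sol.leaves`). The shooting property therefore includes staying above
`s₀` on `[0, η]`. A limit can violate this clause only by touching `s₀` exactly at `η`. Then a
strong nonlinearity has already brought it below `α + ε` at some `ρ` much smaller than `η`, the
remaining descent was slow, and the energy at `η` is negative (`Sol.energy_neg_of_slow`), so no sign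
change follows. Hence the property can end only at a bound state with `j` sign changes
(`exists_boundState_above`).

The extra sign change near `α` is a comparison argument. Above the level `β` the equation is
linearized in the initial value. The growth condition on `s f₁'/f₁` gives `(F/f)' > (n - 2)/(2 (n -
1))`, which makes a Pohozaev type variation monotone (`Lin.var_pos`, `Lin.var_pos_of_start`). It
follows that at the level `β` both `E` and `r^(2 (n - 1)) E` are larger for the perturbed solution.
Between `β` and `-β`, where `F ≤ 0`, this double order is inherited along branches parametrized by
their values (`Branch.order_preserved`). In the final descent two ordered branches cannot both lose
all their energy (`Branch.false_of_tendsto_zero`), so the perturbed solution crosses zero once more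
(`OrdAt.altFrom_succ`).

The nonlinearity is only continuous, so initial values need not determine solutions. Uniqueness is
proved while the energy is positive (`Sol.eq_of_energy_pos`), and the connectedness argument runs
through Tonelli approximations, which do depend continuously on the initial value
(`solutions_connected`). -/

lemma le_of_hasDerivAt_nonneg_off_finite {g g' : ℝ → ℝ} {D : Set ℝ} (hD : D.Finite) :
    ∀ {a b : ℝ}, a ≤ b → ContinuousOn g (Icc a b) →
      (∀ x ∈ Ioo a b, x ∉ D → HasDerivAt g (g' x) x) →
      (∀ x ∈ Ioo a b, x ∉ D → 0 ≤ g' x) → g a ≤ g b := by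
  induction D, hD using Set.Finite.induction_on with
  | empty =>
    intro a b hab hc hd h0
    refine monotoneOn_of_deriv_nonneg (convex_Icc a b) hc ?_ ?_ (left_mem_Icc.2 hab)
      (right_mem_Icc.2 hab) hab
    · rw [interior_Icc]
      exact fun x hx => (hd x hx (by simp)).differentiableAt.differentiableWithinAt
    · rw [interior_Icc]
      intro x hx
      rw [(hd x hx (by simp)).deriv]
      exact h0 x hx (by simp)
  | @insert y S _ _ ih =>
    intro a b hab hc hd h0
    -- An exceptional point inside the interval splits it in two; continuity of `g` there is all
    -- that is needed.
    by_cases hy : y ∈ Ioo a b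
    · have h1 : g a ≤ g y := by
        refine ih hy.1.le (hc.mono (Icc_subset_Icc_right hy.2.le)) ?_ ?_ <;> intro x hx hxS
        · exact hd x ⟨hx.1, hx.2.trans hy.2⟩ (by simp [hxS, hx.2.ne])
        · exact h0 x ⟨hx.1, hx.2.trans hy.2⟩ (by simp [hxS, hx.2.ne])
      have h2 : g y ≤ g b := by
        refine ih hy.2.le (hc.mono (Icc_subset_Icc_left hy.1.le)) ?_ ?_ <;> intro x hx hxS
        · exact hd x ⟨hy.1.trans hx.1, hx.2⟩ (by simp [hxS, hx.1.ne'])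
        · exact h0 x ⟨hy.1.trans hx.1, hx.2⟩ (by simp [hxS, hx.1.ne'])
      exact h1.trans h2
    · refine ih hab hc ?_ ?_ <;> intro x hx hxS
      · exact hd x hx (by rintro (rfl | h) <;> [exact hy hx; exact hxS h])
      · exact h0 x hx (by rintro (rfl | h) <;> [exact hy hx; exact hxS h])

lemma lt_of_hasDerivAt_pos_off_finite {g g' : ℝ → ℝ} {D : Set ℝ} (hD : D.Finite) :
    ∀ {a b : ℝ}, a < b → ContinuousOn g (Icc a b) →
      (∀ x ∈ Ioo a b, x ∉ D → HasDerivAt g (g' x) x) →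
      (∀ x ∈ Ioo a b, x ∉ D → 0 < g' x) → g a < g b := by
  induction D, hD using Set.Finite.induction_on with
  | empty =>
    intro a b hab hc hd h0
    refine strictMonoOn_of_deriv_pos (convex_Icc a b) hc ?_ (left_mem_Icc.2 hab.le)
      (right_mem_Icc.2 hab.le) hab
    rw [interior_Icc]
    intro x hx
    rw [(hd x hx (by simp)).deriv]
    exact h0 x hx (by simp)
  | @insert y S _ _ ih =>
    intro a b hab hc hd h0
    by_cases hy : y ∈ Ioo a b
    · have h1 : g a < g y := by
        refine ih hy.1 (hc.mono (Icc_subset_Icc_right hy.2.le)) ?_ ?_ <;> intro x hx hxS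
        · exact hd x ⟨hx.1, hx.2.trans hy.2⟩ (by simp [hxS, hx.2.ne])
        · exact h0 x ⟨hx.1, hx.2.trans hy.2⟩ (by simp [hxS, hx.2.ne])
      have h2 : g y < g b := by
        refine ih hy.2 (hc.mono (Icc_subset_Icc_left hy.1.le)) ?_ ?_ <;> intro x hx hxS
        · exact hd x ⟨hy.1.trans hx.1, hx.2⟩ (by simp [hxS, hx.1.ne'])
        · exact h0 x ⟨hy.1.trans hx.1, hx.2⟩ (by simp [hxS, hx.1.ne'])
      exact h1.trans h2
    · refine ih hab hc ?_ ?_ <;> intro x hx hxS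
      · exact hd x hx (by rintro (rfl | h) <;> [exact hy hx; exact hxS h])
      · exact h0 x hx (by rintro (rfl | h) <;> [exact hy hx; exact hxS h])

lemma le_of_hasDerivAt_nonneg {g g' : ℝ → ℝ} {a b : ℝ} (hab : a ≤ b)
    (hc : ContinuousOn g (Icc a b)) (hd : ∀ x ∈ Ioo a b, HasDerivAt g (g' x) x)
    (h0 : ∀ x ∈ Ioo a b, 0 ≤ g' x) : g a ≤ g b :=
  le_of_hasDerivAt_nonneg_off_finite finite_empty hab hc (fun x hx _ => hd x hx)
    (fun x hx _ => h0 x hx)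

lemma lt_of_hasDerivAt_pos {g g' : ℝ → ℝ} {a b : ℝ} (hab : a < b)
    (hc : ContinuousOn g (Icc a b)) (hd : ∀ x ∈ Ioo a b, HasDerivAt g (g' x) x)
    (h0 : ∀ x ∈ Ioo a b, 0 < g' x) : g a < g b :=
  lt_of_hasDerivAt_pos_off_finite finite_empty hab hc (fun x hx _ => hd x hx)
    (fun x hx _ => h0 x hx)

lemma ge_of_hasDerivAt_nonpos {g g' : ℝ → ℝ} {a b : ℝ} (hab : a ≤ b)
    (hc : ContinuousOn g (Icc a b)) (hd : ∀ x ∈ Ioo a b, HasDerivAt g (g' x) x)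
    (h0 : ∀ x ∈ Ioo a b, g' x ≤ 0) : g b ≤ g a := by
  have := le_of_hasDerivAt_nonneg (g := fun x => -g x) (g' := fun x => -g' x) hab hc.neg
    (fun x hx => (hd x hx).neg) (fun x hx => by have := h0 x hx; linarith)
  linarith

lemma gt_of_hasDerivAt_neg {g g' : ℝ → ℝ} {a b : ℝ} (hab : a < b)
    (hc : ContinuousOn g (Icc a b)) (hd : ∀ x ∈ Ioo a b, HasDerivAt g (g' x) x)
    (h0 : ∀ x ∈ Ioo a b, g' x < 0) : g b < g a := by
  have := lt_of_hasDerivAt_pos (g := fun x => -g x) (g' := fun x => -g' x) hab hc.neg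
    (fun x hx => (hd x hx).neg) (fun x hx => by have := h0 x hx; linarith)
  linarith

lemma abs_sub_le_of_hasDerivAt {g g' : ℝ → ℝ} {a b C : ℝ} (hab : a ≤ b)
    (hc : ContinuousOn g (Icc a b)) (hd : ∀ x ∈ Ioo a b, HasDerivAt g (g' x) x)
    (h0 : ∀ x ∈ Ioo a b, |g' x| ≤ C) : |g b - g a| ≤ C * (b - a) := by
  have h1 := le_of_hasDerivAt_nonneg (g := fun x => C * x - g x) (g' := fun x => C - g' x) hab
    (by fun_prop) (fun x hx => (((hasDerivAt_id x).const_mul C).sub (hd x hx)).congr_deriv (by simp))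
    (fun x hx => by have := abs_le.1 (h0 x hx); linarith)
  have h2 := le_of_hasDerivAt_nonneg (g := fun x => C * x + g x) (g' := fun x => C + g' x) hab
    (by fun_prop) (fun x hx => (((hasDerivAt_id x).const_mul C).add (hd x hx)).congr_deriv (by simp))
    (fun x hx => by have := abs_le.1 (h0 x hx); linarith)
  rw [abs_le]; constructor <;> linarith

/-! ### Solutions of the radial equation -/

/-- On `[0, R)`, `u` is a regular solution, with derivative `u'`, of
`u'' + (d + 2) / r * u' + f u = 0`. -/
structure SolOn (d : ℕ) (f : ℝ → ℝ) (R : ℝ) (u u' : ℝ → ℝ) : Prop where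
  init : u' 0 = 0
  cont : ContinuousOn u (Ico 0 R)
  cont' : ContinuousOn u' (Ico 0 R)
  hasDeriv : ∀ r, 0 < r → r < R → HasDerivAt u (u' r) r
  hasDeriv' : ∀ r, 0 < r → r < R → HasDerivAt u' (-((d + 2 : ℝ) / r * u' r) - f (u r)) r

/-- A regular solution on `[0, ∞)` of `u'' + (d + 2) / r * u' + f u = 0`. -/
structure Sol (d : ℕ) (f : ℝ → ℝ) (u u' : ℝ → ℝ) : Prop where
  init : u' 0 = 0
  cont : ContinuousOn u (Ici 0)
  cont' : ContinuousOn u' (Ici 0)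
  hasDeriv : ∀ r, 0 < r → HasDerivAt u (u' r) r
  hasDeriv' : ∀ r, 0 < r → HasDerivAt u' (-((d + 2 : ℝ) / r * u' r) - f (u r)) r

/-- The energy `u'² / 2 + F(u)`. -/
def energy (f u u' : ℝ → ℝ) (r : ℝ) : ℝ := u' r ^ 2 / 2 + prim f (u r)

lemma hasDerivAt_prim {f : ℝ → ℝ} (hf : Continuous f) (s : ℝ) : HasDerivAt (prim f) (f s) s :=
  intervalIntegral.integral_hasDerivAt_right (hf.intervalIntegrable _ _)
    hf.stronglyMeasurable.stronglyMeasurableAtFilter hf.continuousAt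

lemma continuous_prim {f : ℝ → ℝ} (hf : Continuous f) : Continuous (prim f) :=
  continuous_iff_continuousAt.2 fun s => (hasDerivAt_prim hf s).continuousAt

@[simp] lemma prim_zero_right (f : ℝ → ℝ) : prim f 0 = 0 := by simp [prim]

lemma prim_neg {f : ℝ → ℝ} (hodd : ∀ s, f (-s) = -f s) (s : ℝ) : prim f (-s) = prim f s := by
  unfold prim
  have h := intervalIntegral.integral_comp_neg (a := 0) (b := s) (f := f)
  simp only [hodd, neg_zero, intervalIntegral.integral_neg] at h
  rw [intervalIntegral.integral_symm, ← h]; ring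

lemma prim_abs {f : ℝ → ℝ} (hodd : ∀ s, f (-s) = -f s) (s : ℝ) : prim f |s| = prim f s := by
  rcases abs_cases s with ⟨h, _⟩ | ⟨h, _⟩ <;> rw [h]
  exact prim_neg hodd s

lemma prim_congr {f g : ℝ → ℝ} {A : ℝ} (hfg : ∀ s, |s| ≤ A → f s = g s) {s : ℝ} (hs : |s| ≤ A) :
    prim f s = prim g s := by
  refine intervalIntegral.integral_congr fun t ht => hfg t ?_
  have := abs_sub_left_of_mem_uIcc ht
  simp only [sub_zero] at this
  linarith

lemma SolOn.mono {d : ℕ} {f : ℝ → ℝ} {R R' : ℝ} {u u' : ℝ → ℝ} (h : SolOn d f R u u')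
    (hR : R' ≤ R) : SolOn d f R' u u' where
  init := h.init
  cont := h.cont.mono (Ico_subset_Ico_right hR)
  cont' := h.cont'.mono (Ico_subset_Ico_right hR)
  hasDeriv := fun r h0 h1 => h.hasDeriv r h0 (h1.trans_le hR)
  hasDeriv' := fun r h0 h1 => h.hasDeriv' r h0 (h1.trans_le hR)

lemma SolOn.congr {d : ℕ} {f g : ℝ → ℝ} {R : ℝ} {u u' : ℝ → ℝ} (h : SolOn d f R u u')
    (hfg : ∀ r, 0 < r → r < R → f (u r) = g (u r)) : SolOn d g R u u' where
  init := h.init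
  cont := h.cont
  cont' := h.cont'
  hasDeriv := h.hasDeriv
  hasDeriv' := fun r h0 h1 => hfg r h0 h1 ▸ h.hasDeriv' r h0 h1

/-! ### Symmetry and energy identities -/

namespace Sol

variable {d : ℕ} {f g u u' : ℝ → ℝ}

lemma solOn (h : Sol d f u u') (R : ℝ) : SolOn d f R u u' where
  init := h.init
  cont := h.cont.mono Ico_subset_Ici_self
  cont' := h.cont'.mono Ico_subset_Ici_self
  hasDeriv := fun r h0 _ => h.hasDeriv r h0
  hasDeriv' := fun r h0 _ => h.hasDeriv' r h0

lemma congr (h : Sol d f u u') (hfg : ∀ r, 0 < r → f (u r) = g (u r)) : Sol d g u u' where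
  init := h.init
  cont := h.cont
  cont' := h.cont'
  hasDeriv := h.hasDeriv
  hasDeriv' := fun r h0 => hfg r h0 ▸ h.hasDeriv' r h0

lemma neg (hodd : ∀ s, f (-s) = -f s) (h : Sol d f u u') :
    Sol d f (fun r => -u r) (fun r => -u' r) where
  init := by simp [h.init]
  cont := h.cont.neg
  cont' := h.cont'.neg
  hasDeriv := fun r h0 => (h.hasDeriv r h0).neg
  hasDeriv' := fun r h0 => by
    refine (h.hasDeriv' r h0).neg.congr_deriv ?_
    rw [hodd]; ring

lemma continuousOn_energy (hf : Continuous f) (h : Sol d f u u') :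
    ContinuousOn (energy f u u') (Ici 0) :=
  ((h.cont'.pow 2).div_const 2).add ((continuous_prim hf).comp_continuousOn h.cont)

lemma hasDerivAt_energy (hf : Continuous f) (h : Sol d f u u') {r : ℝ} (hr : 0 < r) :
    HasDerivAt (energy f u u') (-((d + 2 : ℝ) / r * u' r ^ 2)) r := by
  refine ((((h.hasDeriv' r hr).pow 2).div_const 2).add
    ((hasDerivAt_prim hf (u r)).comp r (h.hasDeriv r hr))).congr_deriv ?_
  simp; ring

lemma energy_antitone (hf : Continuous f) (h : Sol d f u u') {r s : ℝ} (hr : 0 ≤ r)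
    (hrs : r ≤ s) : energy f u u' s ≤ energy f u u' r := by
  refine ge_of_hasDerivAt_nonpos hrs
    ((h.continuousOn_energy hf).mono fun x hx => hr.trans hx.1)
    (fun x hx => h.hasDerivAt_energy hf (hr.trans_lt hx.1)) fun x hx => ?_
  have : 0 < x := hr.trans_lt hx.1
  have : 0 ≤ (d + 2 : ℝ) / x * u' x ^ 2 := by positivity
  linarith

/-- The derivative of `r ^ (2 (n - 1)) E`, where `n = d + 3`. -/
lemma hasDerivAt_pow_mul_energy (hf : Continuous f) (h : Sol d f u u') {r : ℝ} (hr : 0 < r) :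
    HasDerivAt (fun r => r ^ (2 * d + 4) * energy f u u' r)
      ((2 * d + 4) * r ^ (2 * d + 3) * prim f (u r)) r := by
  refine ((hasDerivAt_pow (2 * d + 4) r).mul (h.hasDerivAt_energy hf hr)).congr_deriv ?_
  have : r ^ (2 * d + 4) = r ^ (2 * d + 3) * r := by ring
  simp only [energy, show 2 * d + 4 - 1 = 2 * d + 3 by omega, this]
  push_cast
  field_simp; ring

/-- Where `F(u) ≤ 0` the weight `r^2` still leaves a nonincreasing quantity, because the dimension
is at least three. This controls late excursions of small solutions. -/
lemma hasDerivAt_sq_mul_energy (hf : Continuous f) (h : Sol d f u u') {r : ℝ} (hr : 0 < r) :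
    HasDerivAt (fun r => r ^ 2 * energy f u u' r)
      (2 * r * prim f (u r) - (d + 1) * r * u' r ^ 2) r := by
  refine ((hasDerivAt_pow 2 r).mul (h.hasDerivAt_energy hf hr)).congr_deriv ?_
  simp only [energy]
  push_cast
  field_simp; ring

end Sol

/-- The weight `r^(n-1)` puts the equation in divergence form, so the sign of `f` decides the
monotonicity of the flux. -/
lemma SolOn.hasDerivAt_flux {d : ℕ} {f : ℝ → ℝ} {R : ℝ} {u u' : ℝ → ℝ} (h : SolOn d f R u u')
    {r : ℝ} (hr : 0 < r) (hrR : r < R) :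
    HasDerivAt (fun r => r ^ (d + 2) * u' r) (-(r ^ (d + 2) * f (u r))) r := by
  refine ((hasDerivAt_pow (d + 2) r).mul (h.hasDeriv' r hr hrR)).congr_deriv ?_
  have : r ^ (d + 2) = r ^ (d + 1) * r := by ring
  simp only [show d + 2 - 1 = d + 1 by omega, this]
  push_cast
  field_simp; ring

lemma SolOn.continuousOn_flux {d : ℕ} {f : ℝ → ℝ} {R : ℝ} {u u' : ℝ → ℝ} (h : SolOn d f R u u') :
    ContinuousOn (fun r => r ^ (d + 2) * u' r) (Ico 0 R) :=
  (continuousOn_pow _).mul h.cont'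

/-- A lower bound `m` for `f ∘ u` on `(0, r)` gives `u' r ≤ - m r / n`. -/
lemma SolOn.deriv_le_of_le {d : ℕ} {f : ℝ → ℝ} {R : ℝ} {u u' : ℝ → ℝ} (h : SolOn d f R u u')
    {r m : ℝ} (hr : 0 ≤ r) (hrR : r < R) (hm : ∀ t, 0 < t → t < r → m ≤ f (u t)) :
    u' r ≤ -(m * r / (d + 3)) := by
  rcases hr.eq_or_lt with rfl | hr
  · simp [h.init]
  have hsub : Icc 0 r ⊆ Ico 0 R := fun x hx => ⟨hx.1, hx.2.trans_lt hrR⟩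
  -- Comparison with the constant nonlinearity `m`, whose regular solution has derivative `-m r /
  -- n`.
  have key := ge_of_hasDerivAt_nonpos (g := fun t => t ^ (d + 2) * u' t + m * t ^ (d + 3) / (d + 3))
    (g' := fun t => -(t ^ (d + 2) * f (u t)) + m * t ^ (d + 2)) hr.le
    ((h.continuousOn_flux.mono hsub).add (by fun_prop))
    (fun t ht => (h.hasDerivAt_flux ht.1 (ht.2.trans hrR)).add (by
      refine (((hasDerivAt_pow (d + 3) t).const_mul m).div_const (d + 3 : ℝ)).congr_deriv ?_
      simp only [show d + 3 - 1 = d + 2 by omega]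
      push_cast; field_simp))
    (fun t ht => by
      have h1 := hm t ht.1 ht.2
      have h2 : 0 < t ^ (d + 2) := pow_pos ht.1 _
      nlinarith)
  simp only [h.init, mul_zero, zero_add] at key
  have h0 : (0 : ℝ) ^ (d + 3) = 0 := by simp
  rw [h0] at key
  have hp : 0 < r ^ (d + 2) := pow_pos hr _
  have : r ^ (d + 2) * (u' r + m * r / (d + 3)) ≤ 0 := by
    calc _ = r ^ (d + 2) * u' r + m * r ^ (d + 3) / (d + 3) := by ring
      _ ≤ _ := by simpa using key
  have := nonpos_of_mul_nonpos_right this hp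
  linarith

lemma SolOn.le_deriv_of_le {d : ℕ} {f : ℝ → ℝ} {R : ℝ} {u u' : ℝ → ℝ} (h : SolOn d f R u u')
    {r M : ℝ} (hr : 0 ≤ r) (hrR : r < R) (hM : ∀ t, 0 < t → t < r → f (u t) ≤ M) :
    -(M * r / (d + 3)) ≤ u' r := by
  -- Reflection: `-u` solves the equation with nonlinearity `-f(-s)`, which turns upper bounds into
  -- lower ones.
  have h' : SolOn d (fun s => -f (-s)) R (fun r => -u r) (fun r => -u' r) :=
    { init := by simp [h.init]
      cont := h.cont.neg
      cont' := h.cont'.neg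
      hasDeriv := fun r a b => (h.hasDeriv r a b).neg
      hasDeriv' := fun r a b => by
        refine (h.hasDeriv' r a b).neg.congr_deriv ?_
        simp only [neg_neg]; ring }
  have := h'.deriv_le_of_le (m := -M) hr hrR (fun t a b => by simpa using hM t a b)
  have e : -(-M * r / ((d : ℝ) + 3)) = M * r / (d + 3) := by ring
  linarith

lemma SolOn.abs_deriv_le {d : ℕ} {f : ℝ → ℝ} {R : ℝ} {u u' : ℝ → ℝ} (h : SolOn d f R u u')
    {r C : ℝ} (hr : 0 ≤ r) (hrR : r < R) (hC : ∀ t, 0 < t → t < r → |f (u t)| ≤ C) :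
    |u' r| ≤ C * r := by
  rcases hr.eq_or_lt with rfl | hr
  · simp [h.init]
  have hC0 : 0 ≤ C := (abs_nonneg _).trans (hC (r / 2) (by linarith) (by linarith))
  have h1 := h.deriv_le_of_le (m := -C) hr.le hrR fun t a b => (abs_le.1 (hC t a b)).1
  have h2 := h.le_deriv_of_le (M := C) hr.le hrR fun t a b => (abs_le.1 (hC t a b)).2
  have h3 : C * r / ((d : ℝ) + 3) ≤ C * r :=
    div_le_self (by positivity) (by have : (0 : ℝ) ≤ d := d.cast_nonneg; linarith)
  rw [abs_le]; constructor
  · linarith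
  · have : -(-C * r / ((d : ℝ) + 3)) = C * r / (d + 3) := by ring
    linarith

/-- The linear bound on `u'` cancels the singular coefficient `1/r`, so `u''` is bounded up to the
origin. -/
lemma SolOn.abs_second_deriv_le {d : ℕ} {f : ℝ → ℝ} {R : ℝ} {u u' : ℝ → ℝ}
    (h : SolOn d f R u u') {r C : ℝ} (hr : 0 < r) (hrR : r < R)
    (hC : ∀ t, 0 < t → t ≤ r → |f (u t)| ≤ C) :
    |-((d + 2 : ℝ) / r * u' r) - f (u r)| ≤ (d + 3) * C := by
  have h1 := h.abs_deriv_le hr.le hrR fun t a b => hC t a b.le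
  have h2 := hC r hr le_rfl
  have h3 : |(d + 2 : ℝ) / r * u' r| ≤ (d + 2) * C := by
    rw [abs_mul, abs_of_pos (by positivity : (0 : ℝ) < (d + 2) / r)]
    calc (d + 2 : ℝ) / r * |u' r| ≤ (d + 2) / r * (C * r) := by gcongr
      _ = _ := by field_simp
  calc _ ≤ |-((d + 2 : ℝ) / r * u' r)| + |f (u r)| := abs_sub _ _
    _ ≤ (d + 2) * C + C := by rw [abs_neg]; gcongr
    _ = _ := by ring

/-! ### Alternation of signs -/

/-- Starting from `r`, there are `j` further points in `P` at which the sign of `u` alternates. -/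
def AltIn (P : ℝ → Prop) (u : ℝ → ℝ) : ℕ → ℝ → Prop
  | 0, _ => True
  | j + 1, r => ∃ t, r < t ∧ P t ∧ u r * u t < 0 ∧ AltIn P u j t

/-- Starting from `r`, the sign of `u` alternates `j` times. -/
abbrev AltFrom (u : ℝ → ℝ) (j : ℕ) (r : ℝ) : Prop := AltIn (fun _ => True) u j r

lemma AltIn.pred {P : ℝ → Prop} {u : ℝ → ℝ} : ∀ {j : ℕ} {r : ℝ}, AltIn P u (j + 1) r → AltIn P u j r
  | 0, _, _ => trivial
  | _ + 1, _, ⟨t, h1, h2, h3, h4⟩ => ⟨t, h1, h2, h3, h4.pred⟩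

lemma AltIn.of_le {P : ℝ → Prop} {u : ℝ → ℝ} {i j : ℕ} {r : ℝ} (hij : i ≤ j) (h : AltIn P u j r) :
    AltIn P u i r := by
  induction hij with
  | refl => exact h
  | step _ ih => exact ih h.pred

lemma AltFrom.neg {u : ℝ → ℝ} : ∀ {j : ℕ} {r : ℝ}, AltFrom u j r → AltFrom (fun x => -u x) j r
  | 0, _, _ => trivial
  | _ + 1, _, ⟨t, h1, _, h3, h4⟩ => ⟨t, h1, trivial, by simpa using h3, AltFrom.neg h4⟩

lemma altFrom_of_strictMono {u : ℝ → ℝ} : ∀ {m : ℕ} (t : Fin (m + 1) → ℝ), StrictMono t →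
    (∀ i : Fin m, u (t i.castSucc) * u (t i.succ) < 0) → AltFrom u m (t 0)
  | 0, _, _, _ => trivial
  | m + 1, t, ht, h => by
    refine ⟨t (Fin.succ 0), ht (Fin.succ_pos 0), trivial, by simpa using h 0, ?_⟩
    exact altFrom_of_strictMono (fun i => t i.succ) (fun i j hij => ht (Fin.succ_lt_succ_iff.2 hij))
      (fun i => by simpa using h i.succ)

lemma exists_strictMono_of_altFrom {u : ℝ → ℝ} : ∀ {m : ℕ} {r : ℝ}, AltFrom u m r →
    ∃ t : Fin (m + 1) → ℝ, StrictMono t ∧ t 0 = r ∧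
      ∀ i : Fin m, u (t i.castSucc) * u (t i.succ) < 0
  | 0, r, _ => ⟨fun _ => r, fun i j hij => absurd hij (by omega), rfl, fun i => i.elim0⟩
  | m + 1, r, ⟨s, h1, _, h3, h4⟩ => by
    obtain ⟨t, ht, ht0, h⟩ := exists_strictMono_of_altFrom h4
    refine ⟨Fin.cons r t, ?_, by simp, ?_⟩
    · rw [Fin.strictMono_iff_lt_succ]
      intro i
      refine Fin.cases ?_ (fun i => ?_) i
      · simpa [ht0] using h1
      · simpa [← Fin.succ_castSucc] using ht i.castSucc_lt_succ
    · intro i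
      refine Fin.cases ?_ (fun i => ?_) i
      · simpa [ht0] using h3
      · simpa [← Fin.succ_castSucc] using h i

/-- A chain of alternations may start anywhere; when `u 0 ≠ 0` the origin can either precede or
replace its first point without losing an alternation. -/
lemma alternates_iff_altFrom {u : ℝ → ℝ} (h0 : u 0 ≠ 0) {m : ℕ} :
    Alternates u m ↔ AltFrom u m 0 := by
  constructor
  · rintro ⟨t, ht, hpos, h⟩
    have key := altFrom_of_strictMono t ht h
    rcases m with _ | m
    · trivial
    rcases (hpos 0).eq_or_lt with h00 | h00
    · rwa [← h00] at key
    have key' := key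
    obtain ⟨s, h1, _, h3, h4⟩ := key
    have hne : u (t 0) ≠ 0 := fun h => by simp [h] at h3
    rcases lt_or_gt_of_ne (mul_ne_zero h0 hne) with hneg | hpos'
    · exact AltIn.pred (j := m + 1) ⟨t 0, h00, trivial, hneg, key'⟩
    · refine ⟨s, h00.trans h1, trivial, ?_, h4⟩
      rcases mul_pos_iff.1 hpos' with ⟨a, b⟩ | ⟨a, b⟩
      · exact mul_neg_of_pos_of_neg a (by nlinarith)
      · exact mul_neg_of_neg_of_pos a (by nlinarith)
  · intro h
    obtain ⟨t, ht, ht0, h⟩ := exists_strictMono_of_altFrom h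
    exact ⟨t, ht, fun i => ht0 ▸ ht.monotone (Fin.zero_le i), h⟩

/-! ### Limits along a fixed nonprincipal ultrafilter -/

/-- A fixed nonprincipal ultrafilter on `ℕ`. -/
abbrev hyp : Filter ℕ := (hyperfilter ℕ : Filter ℕ)

lemma hyp_le_atTop : hyp ≤ atTop := by
  rw [← Nat.cofinite_eq_atTop]; exact hyperfilter_le_cofinite

/-- Along an ultrafilter bounded sequences converge outright, so no subsequences are extracted in
the compactness arguments. -/
lemma exists_tendsto_hyp {a b : ℝ} {x : ℕ → ℝ} (hx : ∀ᶠ m in hyp, x m ∈ Icc a b) :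
    ∃ y ∈ Icc a b, Tendsto x hyp (𝓝 y) := by
  obtain ⟨y, hy, h⟩ := (isCompact_Icc (a := a) (b := b)).ultrafilter_le_nhds
    ((hyperfilter ℕ).map x) (le_principal_iff.2 hx)
  exact ⟨y, hy, h⟩

lemma eventually_hyp_or_not (p : ℕ → Prop) : (∀ᶠ m in hyp, p m) ∨ ∀ᶠ m in hyp, ¬ p m :=
  (hyperfilter ℕ).em p

lemma tendsto_one_div_hyp : Tendsto (fun m : ℕ => 1 / ((m : ℝ) + 1)) hyp (𝓝 0) :=
  tendsto_one_div_add_atTop_nhds_zero_nat.mono_left hyp_le_atTop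

/-- Continuous convergence on `s` along the ultrafilter. -/
def ConvOn (s : Set ℝ) (u : ℕ → ℝ → ℝ) (v : ℝ → ℝ) : Prop :=
  ∀ (x : ℕ → ℝ) (y : ℝ), (∀ᶠ m in hyp, x m ∈ s) → y ∈ s → Tendsto x hyp (𝓝 y) →
    Tendsto (fun m => u m (x m)) hyp (𝓝 (v y))

lemma ConvOn.mono {s t : Set ℝ} {u : ℕ → ℝ → ℝ} {v : ℝ → ℝ} (h : ConvOn s u v) (hts : t ⊆ s) :
    ConvOn t u v :=
  fun x y hx hy hxy => h x y (hx.mono fun _ hm => hts hm) (hts hy) hxy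

lemma ConvOn.tendsto {s : Set ℝ} {u : ℕ → ℝ → ℝ} {v : ℝ → ℝ} (h : ConvOn s u v) {y : ℝ}
    (hy : y ∈ s) : Tendsto (fun m => u m y) hyp (𝓝 (v y)) :=
  h _ y (Eventually.of_forall fun _ => hy) hy tendsto_const_nhds

lemma ConvOn.neg {s : Set ℝ} {u : ℕ → ℝ → ℝ} {v : ℝ → ℝ} (h : ConvOn s u v) :
    ConvOn s (fun m x => -u m x) (fun x => -v x) :=
  fun x y hx hy hxy => (h x y hx hy hxy).neg

lemma ConvOn.congr {s : Set ℝ} {u : ℕ → ℝ → ℝ} {v w : ℝ → ℝ} (h : ConvOn s u v)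
    (hvw : ∀ y ∈ s, v y = w y) : ConvOn s u w :=
  fun x y hx hy hxy => hvw y hy ▸ h x y hx hy hxy

/-- If uniformity failed, points violating it would converge along the ultrafilter inside `K`,
against continuous convergence at their limit. -/
lemma ConvOn.tendstoUniformlyOn {s K : Set ℝ} {u : ℕ → ℝ → ℝ} {v : ℝ → ℝ} (h : ConvOn s u v)
    (hv : ContinuousOn v s) (hK : IsCompact K) (hKs : K ⊆ s) : TendstoUniformlyOn u v hyp K := by
  rw [Metric.tendstoUniformlyOn_iff]
  intro ε hε
  rcases eventually_hyp_or_not (fun m => ∀ x ∈ K, dist (v x) (u m x) < ε) with h1 | h1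
  · exact h1
  exfalso
  -- Indices without a violating point receive the default `0`; they are negligible along the
  -- ultrafilter.
  have h2 : ∀ m, ∃ x, (¬ ∀ x ∈ K, dist (v x) (u m x) < ε) → x ∈ K ∧ ε ≤ dist (v x) (u m x) := by
    intro m
    by_cases hm : ∀ x ∈ K, dist (v x) (u m x) < ε
    · exact ⟨0, fun h => (h hm).elim⟩
    · push Not at hm
      obtain ⟨x, hx, hx'⟩ := hm
      exact ⟨x, fun _ => ⟨hx, hx'⟩⟩
  choose x hx using h2
  have hxK : ∀ᶠ m in hyp, x m ∈ K := h1.mono fun m hm => (hx m hm).1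
  have hxe : ∀ᶠ m in hyp, ε ≤ dist (v (x m)) (u m (x m)) := h1.mono fun m hm => (hx m hm).2
  obtain ⟨y, hy, hlim⟩ := hK.ultrafilter_le_nhds ((hyperfilter ℕ).map x)
    (le_principal_iff.2 hxK)
  have hlim : Tendsto x hyp (𝓝 y) := hlim
  have t1 := h x y (hxK.mono fun _ hm => hKs hm) (hKs hy) hlim
  have t2 : Tendsto (fun m => v (x m)) hyp (𝓝 (v y)) :=
    (hv y (hKs hy)).tendsto.comp
      (tendsto_nhdsWithin_iff.2 ⟨hlim, hxK.mono fun _ hm => hKs hm⟩)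
  have t3 := t2.dist t1
  rw [dist_self] at t3
  exact absurd (le_of_tendsto_of_tendsto tendsto_const_nhds t3 hxe) (not_le.2 hε)

/-- Arzelà–Ascoli along the ultrafilter: bounded values have pointwise limits, and the Lipschitz
bounds upgrade pointwise to continuous convergence. The endpoint in `WithTop ℝ` covers bounded and
unbounded intervals together, and the constant `K` may grow with the point. -/
lemma exists_convOn_of_lipschitz {a : ℝ} {g : ℕ → ℝ → ℝ} {A : ℝ} {K : ℝ → ℝ}
    (h0 : ∀ᶠ m in hyp, |g m a| ≤ A) {b : WithTop ℝ}
    (hL : ∀ᶠ m in hyp, ∀ x y, a ≤ x → x ≤ y → (y : WithTop ℝ) ≤ b →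
      |g m y - g m x| ≤ K y * (y - x))
    (hK : Monotone K) :
    ∃ v : ℝ → ℝ, ConvOn {x | a ≤ x ∧ (x : WithTop ℝ) ≤ b} g v ∧
      ContinuousOn v {x | a ≤ x ∧ (x : WithTop ℝ) ≤ b} := by
  set s : Set ℝ := {x | a ≤ x ∧ (x : WithTop ℝ) ≤ b} with hs
  have hlim : ∀ x, ∃ y, x ∈ s → Tendsto (fun m => g m x) hyp (𝓝 y) := by
    intro x
    by_cases hx : x ∈ s
    · obtain ⟨y, _, hy⟩ := exists_tendsto_hyp (x := fun m => g m x)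
        (a := -(A + |K x * (x - a)|)) (b := A + |K x * (x - a)|) (by
          filter_upwards [h0, hL] with m h1 h2
          have h3 := h2 a x le_rfl hx.1 hx.2
          have h4 := le_abs_self (K x * (x - a))
          rw [abs_le] at h1 h3
          constructor <;> linarith)
      exact ⟨y, fun _ => hy⟩
    · exact ⟨0, fun h => (hx h).elim⟩
  choose v hv using hlim
  have hvL : ∀ x y, x ∈ s → y ∈ s → x ≤ y → |v y - v x| ≤ K y * (y - x) := by
    intro x y hx hy hxy
    refine le_of_tendsto ((hv y hy).sub (hv x hx)).abs ?_
    filter_upwards [hL] with m h2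
    exact h2 x y hx.1 hxy hy.2
  have bound : ∀ x y, x ∈ s → y ∈ s → ∀ R, x ≤ R → y ≤ R → ∀ w : ℝ → ℝ,
      (∀ x y, x ∈ s → y ∈ s → x ≤ y → |w y - w x| ≤ K y * (y - x)) →
      |w x - w y| ≤ |K R| * |x - y| := by
    intro x y hx hy R hxR hyR w hw
    rcases le_total x y with h | h
    · have h1 := hw x y hx hy h
      rw [abs_sub_comm, abs_sub_comm x y, abs_of_nonneg (sub_nonneg.2 h)]
      exact h1.trans (mul_le_mul_of_nonneg_right ((hK hyR).trans (le_abs_self _))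
        (sub_nonneg.2 h))
    · have h1 := hw y x hy hx h
      rw [abs_of_nonneg (sub_nonneg.2 h)]
      exact h1.trans (mul_le_mul_of_nonneg_right ((hK hxR).trans (le_abs_self _))
        (sub_nonneg.2 h))
  refine ⟨v, ?_, ?_⟩
  · intro x y hx hy hxy
    have hR : ∀ᶠ m in hyp, x m ≤ y + 1 := (hxy.eventually_lt_const (by linarith)).mono
      fun _ h => h.le
    have h1 : Tendsto (fun m => g m (x m) - g m y) hyp (𝓝 0) := by
      refine squeeze_zero_norm' (a := fun m => |K (y + 1)| * |x m - y|) ?_ ?_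
      · filter_upwards [hL, hx, hR] with m h1 h2 h3
        exact bound _ _ h2 hy (y + 1) h3 (by linarith) (g m)
          fun a' b' ha hb hab => h1 a' b' ha.1 hab hb.2
      · have : Tendsto (fun m => |K (y + 1)| * |x m - y|) hyp (𝓝 (|K (y + 1)| * |y - y|)) :=
          ((hxy.sub_const y).abs).const_mul _
        simpa using this
    simpa using h1.add (hv y hy)
  · intro y hy
    have : Tendsto (fun x => v x - v y) (𝓝[s] y) (𝓝 0) := by
      refine squeeze_zero_norm' (a := fun x => |K (y + 1)| * |x - y|) ?_ ?_
      · filter_upwards [self_mem_nhdsWithin,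
          nhdsWithin_le_nhds (Iio_mem_nhds (show y < y + 1 by linarith))] with x hx hx'
        exact bound _ _ hx hy (y + 1) (le_of_lt hx') (by linarith) v hvL
      · have : Tendsto (fun x => |K (y + 1)| * |x - y|) (𝓝 y) (𝓝 (|K (y + 1)| * |y - y|)) :=
          ((tendsto_id.sub_const y).abs).const_mul _
        simp only [sub_self, abs_zero, mul_zero] at this
        exact this.mono_left nhdsWithin_le_nhds
    have h2 := this.add_const (v y)
    simpa [ContinuousWithinAt] using h2

lemma hasDerivAt_of_convOn {a b : ℝ} {g g' : ℕ → ℝ → ℝ} {v v' : ℝ → ℝ}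
    (h : ConvOn (Ioo a b) g v) (h' : ConvOn (Ioo a b) g' v') (hv' : ContinuousOn v' (Ioo a b))
    (hd : ∀ᶠ m in hyp, ∀ x ∈ Ioo a b, HasDerivAt (g m) (g' m x) x) {x : ℝ} (hx : x ∈ Ioo a b) :
    HasDerivAt v (v' x) x := by
  obtain ⟨c, hac, hcx⟩ := exists_between hx.1
  obtain ⟨e, hxe, heb⟩ := exists_between hx.2
  have hsub : Icc c e ⊆ Ioo a b := fun y hy => ⟨hac.trans_le hy.1, hy.2.trans_lt heb⟩
  exact hasDerivAt_of_tendstoUniformlyOn (l := hyp) isOpen_Ioo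
    ((h'.tendstoUniformlyOn hv' isCompact_Icc hsub).mono Ioo_subset_Icc_self)
    (hd.mono fun m hm y hy => hm y (hsub (Ioo_subset_Icc_self hy)))
    (fun y hy => h.tendsto (hsub (Ioo_subset_Icc_self hy))) ⟨hcx, hxe⟩

/-! ### Compactness of families of solutions -/

lemma Sol.abs_deriv_sub_le {d : ℕ} {f u u' : ℝ → ℝ} {C : ℝ} (hC : ∀ s, |f s| ≤ C)
    (h : Sol d f u u') {x y : ℝ} (hx : 0 ≤ x) (hxy : x ≤ y) :
    |u' y - u' x| ≤ (d + 3) * C * (y - x) :=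
  abs_sub_le_of_hasDerivAt hxy (h.cont'.mono fun _ ht => hx.trans ht.1)
    (fun t ht => h.hasDeriv' t (hx.trans_lt ht.1)) fun t ht =>
      (h.solOn (t + 1)).abs_second_deriv_le (hx.trans_lt ht.1) (by linarith) fun _ _ _ => hC _

lemma Sol.abs_sub_le {d : ℕ} {f u u' : ℝ → ℝ} {C : ℝ} (hC : ∀ s, |f s| ≤ C)
    (h : Sol d f u u') {x y : ℝ} (hx : 0 ≤ x) (hxy : x ≤ y) :
    |u y - u x| ≤ C * y * (y - x) :=
  abs_sub_le_of_hasDerivAt hxy (h.cont.mono fun _ ht => hx.trans ht.1)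
    (fun t ht => h.hasDeriv t (hx.trans_lt ht.1)) fun t ht =>
      ((h.solOn (t + 1)).abs_deriv_le (hx.trans ht.1.le) (by linarith) fun _ _ _ => hC _).trans
        (mul_le_mul_of_nonneg_left ht.2.le ((abs_nonneg _).trans (hC 0)))

/-- A bounded family of solutions has a limit, in the `C¹` sense, that is a solution. -/
theorem exists_limit_solution {d : ℕ} {f : ℝ → ℝ} (hf : Continuous f) {C : ℝ}
    (hC : ∀ s, |f s| ≤ C) {u u' : ℕ → ℝ → ℝ} (hu : ∀ᶠ m in hyp, Sol d f (u m) (u' m)) {A : ℝ}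
    (hA : ∀ᶠ m in hyp, |u m 0| ≤ A) :
    ∃ v v' : ℝ → ℝ, Sol d f v v' ∧ ConvOn (Ici 0) u v ∧ ConvOn (Ici 0) u' v' := by
  have hC0 : 0 ≤ C := (abs_nonneg _).trans (hC 0)
  obtain ⟨v, hv, hvc⟩ := exists_convOn_of_lipschitz (a := 0) (b := ⊤) (g := u)
    (K := fun y => C * y) hA
    (hu.mono fun m hm x y hx hxy _ => hm.abs_sub_le hC hx hxy)
    (fun x y hxy => mul_le_mul_of_nonneg_left hxy hC0)
  obtain ⟨v', hv', hvc'⟩ := exists_convOn_of_lipschitz (a := 0) (b := ⊤) (g := u') (A := 0)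
    (K := fun _ => (d + 3) * C) (hu.mono fun m hm => by simp [hm.init])
    (hu.mono fun m hm x y hx hxy _ => hm.abs_deriv_sub_le hC hx hxy)
    (fun x y _ => le_rfl)
  have hs : {x : ℝ | 0 ≤ x ∧ (x : WithTop ℝ) ≤ ⊤} = Ici 0 := by ext; simp
  rw [hs] at hv hvc hv' hvc'
  refine ⟨v, v', ⟨?_, hvc, hvc', ?_, ?_⟩, hv, hv'⟩
  · have h1 := hv'.tendsto (y := 0) (by simp)
    exact tendsto_nhds_unique h1 (tendsto_const_nhds.congr' (hu.mono fun m hm => hm.init.symm))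
  · intro r hr
    have hsub : Ioo 0 (r + 1) ⊆ Ici 0 := fun x hx => hx.1.le
    exact hasDerivAt_of_convOn (hv.mono hsub) (hv'.mono hsub) (hvc'.mono hsub)
      (hu.mono fun m hm x hx => hm.hasDeriv x hx.1) ⟨hr, by linarith⟩
  · intro r hr
    have hsub : Ioo 0 (r + 1) ⊆ Ici 0 := fun x hx => hx.1.le
    refine hasDerivAt_of_convOn (a := 0) (b := r + 1)
      (g' := fun m x => -((d + 2 : ℝ) / x * u' m x) - f (u m x))
      (v' := fun x => -((d + 2 : ℝ) / x * v' x) - f (v x)) (hv'.mono hsub) ?_ ?_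
      (hu.mono fun m hm x hx => hm.hasDeriv' x hx.1) ⟨hr, by linarith⟩
    · intro x y hx hy hxy
      exact ((tendsto_const_nhds.div hxy hy.1.ne').mul
        (hv' x y (hx.mono fun _ h => hsub h) (hsub hy) hxy)).neg.sub
        ((hf.tendsto _).comp (hv x y (hx.mono fun _ h => hsub h) (hsub hy) hxy))
    · refine ((ContinuousOn.mul ?_ (hvc'.mono hsub)).neg).sub (hf.comp_continuousOn (hvc.mono hsub))
      exact continuousOn_const.div continuousOn_id fun x hx => hx.1.ne'

/-! ### Delayed approximations and existence of solutions -/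

/-- The mean `∫₀¹ σ ^ (d + 2) f(g(σ t)) dσ`; a solution satisfies `u' r = - r * ballMean d f u r`. -/
def ballMean (d : ℕ) (f g : ℝ → ℝ) (t : ℝ) : ℝ := ∫ σ in (0 : ℝ)..1, σ ^ (d + 2) * f (g (σ * t))

/-- Tonelli's approximations with delay `δ` to the solution starting from `α`. -/
def tonelli (d : ℕ) (f : ℝ → ℝ) (δ : ℝ) : ℕ → ℝ → ℝ → ℝ
  | 0, α, _ => α
  | k + 1, α, r => α - ∫ t in (0 : ℝ)..max (r - δ) 0, t * ballMean d f (tonelli d f δ k α) t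

lemma continuous_ballMean {d : ℕ} {f : ℝ → ℝ} (hf : Continuous f) {X : Type*} [TopologicalSpace X]
    {g : X → ℝ → ℝ} (hg : Continuous fun p : X × ℝ => g p.1 p.2) :
    Continuous fun p : X × ℝ => ballMean d f (g p.1) p.2 := by
  unfold ballMean
  refine intervalIntegral.continuous_parametric_intervalIntegral_of_continuous'
    (f := fun (p : X × ℝ) (σ : ℝ) => σ ^ (d + 2) * f (g p.1 (σ * p.2))) ?_ 0 1
  have h1 : Continuous fun q : (X × ℝ) × ℝ => g q.1.1 (q.2 * q.1.2) :=
    hg.comp (f := fun q : (X × ℝ) × ℝ => (q.1.1, q.2 * q.1.2)) (by fun_prop)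
  simp only [Function.uncurry_def]
  fun_prop

lemma continuous_ballMean' {d : ℕ} {f g : ℝ → ℝ} (hf : Continuous f) (hg : Continuous g) :
    Continuous (ballMean d f g) := by
  have := (continuous_ballMean (d := d) hf (X := Unit) (g := fun _ => g)
    (hg.comp continuous_snd)).comp (f := fun t : ℝ => ((), t)) (by fun_prop)
  exact this

lemma continuous_tonelli {d : ℕ} {f : ℝ → ℝ} (hf : Continuous f) (δ : ℝ) (k : ℕ) :
    Continuous fun p : ℝ × ℝ => tonelli d f δ k p.1 p.2 := by
  induction k with
  | zero => exact continuous_fst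
  | succ k ih =>
    simp only [tonelli]
    refine continuous_fst.sub ?_
    refine intervalIntegral.continuous_parametric_intervalIntegral_of_continuous
      (f := fun (p : ℝ × ℝ) (t : ℝ) => t * ballMean d f (tonelli d f δ k p.1) t) ?_ ?_
    · have h1 : Continuous fun q : (ℝ × ℝ) × ℝ => ballMean d f (tonelli d f δ k q.1.1) q.2 :=
        (continuous_ballMean (d := d) hf ih).comp (f := fun q : (ℝ × ℝ) × ℝ => (q.1.1, q.2))
          (by fun_prop)
      simp only [Function.uncurry_def]
      fun_prop
    · fun_prop

lemma continuous_tonelli_apply {d : ℕ} {f : ℝ → ℝ} (hf : Continuous f) (δ : ℝ) (k : ℕ) (α : ℝ) :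
    Continuous (tonelli d f δ k α) :=
  (continuous_tonelli hf δ k).comp (f := fun r : ℝ => (α, r)) (by fun_prop)

lemma ballMean_congr {d : ℕ} {f g h : ℝ → ℝ} {t : ℝ} (ht : 0 ≤ t)
    (hgh : ∀ x ∈ Icc 0 t, g x = h x) : ballMean d f g t = ballMean d f h t := by
  refine intervalIntegral.integral_congr fun σ hσ => ?_
  rw [uIcc_of_le zero_le_one] at hσ
  rw [hgh _ ⟨mul_nonneg hσ.1 ht, mul_le_of_le_one_left ht hσ.2⟩]

lemma abs_ballMean_sub_le {d : ℕ} {f g h : ℝ → ℝ} (hf : Continuous f) (hg : Continuous g)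
    (hh : Continuous h) {t ε : ℝ} (ht : 0 ≤ t) (hgh : ∀ x ∈ Icc 0 t, |f (g x) - f (h x)| ≤ ε) :
    |ballMean d f g t - ballMean d f h t| ≤ ε := by
  unfold ballMean
  rw [← intervalIntegral.integral_sub (Continuous.intervalIntegrable (by fun_prop) _ _)
    (Continuous.intervalIntegrable (by fun_prop) _ _)]
  have := intervalIntegral.norm_integral_le_of_norm_le_const (a := 0) (b := 1) (C := ε)
    (f := fun σ : ℝ => σ ^ (d + 2) * f (g (σ * t)) - σ ^ (d + 2) * f (h (σ * t))) (by
      intro σ hσ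
      rw [uIoc_of_le zero_le_one] at hσ
      have h1 := hgh _ ⟨mul_nonneg hσ.1.le ht, mul_le_of_le_one_left ht hσ.2⟩
      rw [← mul_sub, norm_mul, Real.norm_eq_abs, Real.norm_eq_abs,
        abs_of_nonneg (pow_nonneg hσ.1.le _)]
      have h2 : σ ^ (d + 2) ≤ 1 := pow_le_one₀ hσ.1.le hσ.2
      have h3 : 0 ≤ σ ^ (d + 2) := pow_nonneg hσ.1.le _
      nlinarith [abs_nonneg (f (g (σ * t)) - f (h (σ * t)))])
  simpa using this

lemma abs_ballMean_le {d : ℕ} {f g : ℝ → ℝ} {C : ℝ} (hC : ∀ s, |f s| ≤ C) (t : ℝ) :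
    |ballMean d f g t| ≤ C := by
  have := intervalIntegral.norm_integral_le_of_norm_le_const (a := 0) (b := 1) (C := C)
    (f := fun σ : ℝ => σ ^ (d + 2) * f (g (σ * t))) (by
      intro σ hσ
      rw [uIoc_of_le zero_le_one] at hσ
      rw [norm_mul, Real.norm_eq_abs, Real.norm_eq_abs, abs_of_nonneg (pow_nonneg hσ.1.le _)]
      have h2 : σ ^ (d + 2) ≤ 1 := pow_le_one₀ hσ.1.le hσ.2
      have h3 : 0 ≤ σ ^ (d + 2) := pow_nonneg hσ.1.le _
      nlinarith [abs_nonneg (f (g (σ * t))), hC (g (σ * t))])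
  simpa [ballMean] using this

lemma abs_integral_mul_ballMean_sub_le {d : ℕ} {f g : ℝ → ℝ} (hf : Continuous f)
    (hg : Continuous g) {C : ℝ} (hC : ∀ s, |f s| ≤ C) {x y : ℝ} (hx : 0 ≤ x) (hxy : x ≤ y) :
    |(∫ t in (0 : ℝ)..y, t * ballMean d f g t) - ∫ t in (0 : ℝ)..x, t * ballMean d f g t| ≤
      C * y * (y - x) := by
  have hc : Continuous fun t => t * ballMean d f g t := continuous_id.mul (continuous_ballMean' hf hg)
  rw [intervalIntegral.integral_interval_sub_left (hc.intervalIntegrable _ _)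
    (hc.intervalIntegrable _ _)]
  have := intervalIntegral.norm_integral_le_of_norm_le_const (a := x) (b := y) (C := C * y)
    (f := fun t => t * ballMean d f g t) (by
      intro t ht
      rw [uIoc_of_le hxy] at ht
      rw [norm_mul, Real.norm_eq_abs, Real.norm_eq_abs, abs_of_nonneg (hx.trans ht.1.le), mul_comm]
      exact mul_le_mul (abs_ballMean_le hC t) ht.2 (hx.trans ht.1.le)
        ((abs_nonneg _).trans (hC 0)))
  rwa [abs_of_nonneg (sub_nonneg.2 hxy)] at this

/-- Because of the delay, the value at `r` depends only on values up to `r - δ`, so each iteration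
settles one more interval of length `δ`. -/
lemma tonelli_succ_eq {d : ℕ} {f : ℝ → ℝ} {δ : ℝ} (hδ : 0 < δ) (α : ℝ) :
    ∀ (k : ℕ) {r : ℝ}, r ≤ k * δ → tonelli d f δ (k + 1) α r = tonelli d f δ k α r := by
  intro k
  induction k with
  | zero =>
    intro r hr
    simp only [Nat.cast_zero, zero_mul] at hr
    simp [tonelli, max_eq_right (by linarith : r - δ ≤ 0)]
  | succ k ih =>
    intro r hr
    rw [tonelli, tonelli]
    congr 1
    refine intervalIntegral.integral_congr fun t ht => ?_
    rw [uIcc_of_le (le_max_right _ _)] at ht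
    congr 1
    refine ballMean_congr ht.1 fun x hx => ih ?_
    have h1 := hx.2.trans ht.2
    push_cast at hr
    have : (0 : ℝ) ≤ k * δ := by positivity
    exact h1.trans (max_le (by linarith) this)

/-- The `m`-th approximation, with delay `1 / (m + 1)`. -/
def approx (d : ℕ) (f : ℝ → ℝ) (m : ℕ) (α r : ℝ) : ℝ :=
  tonelli d f (1 / (m + 1)) ((m + 1) ^ 2) α r

/-- `(m + 1)^2` steps of length `1/(m + 1)` make the iteration stationary up to the radius `m + 1`.
-/
lemma approx_eq {d : ℕ} {f : ℝ → ℝ} {m : ℕ} {α r : ℝ} (hr : r ≤ m + 1) :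
    approx d f m α r =
      α - ∫ t in (0 : ℝ)..max (r - 1 / (m + 1)) 0, t * ballMean d f (approx d f m α) t := by
  have hδ : (0 : ℝ) < 1 / (m + 1) := by positivity
  have h := tonelli_succ_eq (d := d) (f := f) hδ α ((m + 1) ^ 2) (r := r) (by
    push_cast; field_simp; exact hr)
  unfold approx
  rw [← h, tonelli]

lemma abs_approx_sub_le {d : ℕ} {f : ℝ → ℝ} (hf : Continuous f) {C : ℝ} (hC : ∀ s, |f s| ≤ C)
    (m : ℕ) (α : ℝ) {x y : ℝ} (hx : 0 ≤ x) (hxy : x ≤ y) :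
    |approx d f m α y - approx d f m α x| ≤ C * y * (y - x) := by
  have hC0 : 0 ≤ C := (abs_nonneg _).trans (hC 0)
  have hδ : (0 : ℝ) < 1 / (m + 1) := by positivity
  unfold approx
  generalize (m + 1) ^ 2 = k
  rcases k with _ | k
  · simp only [tonelli, sub_self, abs_zero]
    exact mul_nonneg (mul_nonneg hC0 (hx.trans hxy)) (sub_nonneg.2 hxy)
  simp only [tonelli]
  rw [sub_sub_sub_cancel_left, abs_sub_comm]
  refine (abs_integral_mul_ballMean_sub_le hf (continuous_tonelli_apply hf _ _ _) hC
    (le_max_right _ _) (max_le_max_right 0 (by linarith))).trans ?_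
  have h1 : max (y - 1 / (m + 1 : ℝ)) 0 ≤ y := max_le (by linarith) (hx.trans hxy)
  have h2 : max (y - 1 / (m + 1 : ℝ)) 0 - max (x - 1 / (m + 1 : ℝ)) 0 ≤ y - x := by
    rcases max_cases (y - 1 / (m + 1 : ℝ)) 0 with ⟨h, _⟩ | ⟨h, _⟩ <;>
    rcases max_cases (x - 1 / (m + 1 : ℝ)) 0 with ⟨h', _⟩ | ⟨h', _⟩ <;> rw [h, h'] <;> linarith
  have h3 : 0 ≤ max (y - 1 / (m + 1 : ℝ)) 0 - max (x - 1 / (m + 1 : ℝ)) 0 :=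
    sub_nonneg.2 (max_le_max_right 0 (by linarith))
  exact mul_le_mul (mul_le_mul_of_nonneg_left h1 hC0) h2 h3 (mul_nonneg hC0 (hx.trans hxy))

/-- A continuous solution of the integral equation is a solution of the differential equation. -/
lemma sol_of_integral_eq {d : ℕ} {f v : ℝ → ℝ} (hf : Continuous f) (hv : Continuous v) {α : ℝ}
    (h : ∀ r, 0 ≤ r → v r = α - ∫ t in (0 : ℝ)..r, t * ballMean d f v t) :
    Sol d f v (fun r => -(r * ballMean d f v r)) := by
  have hb : Continuous (ballMean d f v) := continuous_ballMean' hf hv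
  have hc : Continuous fun t => t * ballMean d f v t := continuous_id.mul hb
  -- The substitution `t = σ r` turns the mean into the flux integral, which can be differentiated
  -- away from the origin.
  have hformula : ∀ r, 0 < r →
      -(r * ballMean d f v r) = -((∫ t in (0 : ℝ)..r, t ^ (d + 2) * f (v t)) / r ^ (d + 2)) := by
    intro r hr
    have h1 := intervalIntegral.integral_comp_mul_right (a := 0) (b := 1)
      (fun y => (y / r) ^ (d + 2) * f (v y)) hr.ne'
    have h2 : ballMean d f v r = ∫ σ in (0 : ℝ)..1, (σ * r / r) ^ (d + 2) * f (v (σ * r)) := by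
      unfold ballMean
      congr 1; ext σ
      rw [mul_div_assoc, div_self hr.ne', mul_one]
    have h3 : (fun y => (y / r) ^ (d + 2) * f (v y)) =
        fun y => (1 / r ^ (d + 2)) * (y ^ (d + 2) * f (v y)) := by
      ext y; rw [div_pow]; ring
    rw [h2, h1, h3, intervalIntegral.integral_const_mul, zero_mul, one_mul, smul_eq_mul]
    field_simp
  refine ⟨by simp, hv.continuousOn, (hc.neg).continuousOn, ?_, ?_⟩
  · intro r hr
    have h1 : HasDerivAt (fun r => α - ∫ t in (0 : ℝ)..r, t * ballMean d f v t)
        (-(r * ballMean d f v r)) r := by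
      have := (intervalIntegral.integral_hasDerivAt_right (hc.intervalIntegrable 0 r)
        hc.stronglyMeasurable.stronglyMeasurableAtFilter hc.continuousAt).const_sub α
      exact this
    refine h1.congr_of_eventuallyEq ?_
    filter_upwards [Ioi_mem_nhds hr] with x hx
    exact h x (le_of_lt hx)
  · intro r hr
    have hg : Continuous fun t => t ^ (d + 2) * f (v t) := by fun_prop
    have h1 := ((intervalIntegral.integral_hasDerivAt_right (hg.intervalIntegrable 0 r)
        hg.stronglyMeasurable.stronglyMeasurableAtFilter hg.continuousAt).div
        (hasDerivAt_pow (d + 2) r) (pow_ne_zero _ hr.ne')).neg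
    refine HasDerivAt.congr_of_eventuallyEq (h1.congr_deriv ?_) ?_
    · rw [hformula r hr]
      simp only [show d + 2 - 1 = d + 1 by omega]
      push_cast
      have : r ^ (d + 2) = r ^ (d + 1) * r := by ring
      rw [this]
      field_simp
      ring
    · filter_upwards [Ioi_mem_nhds hr] with x hx
      exact hformula x hx

/-- Peano existence for continuous `f`. The initial values are allowed to vary with `m`, since
closeness of approximations to solutions is needed uniformly in the initial value. -/
theorem exists_limit_approx {d : ℕ} {f : ℝ → ℝ} (hf : Continuous f) {C : ℝ}
    (hC : ∀ s, |f s| ≤ C) {a : ℕ → ℝ} {α : ℝ} (ha : Tendsto a hyp (𝓝 α)) :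
    ∃ v v' : ℝ → ℝ, Sol d f v v' ∧ v 0 = α ∧ ConvOn (Ici 0) (fun m => approx d f m (a m)) v := by
  have hC0 : 0 ≤ C := (abs_nonneg _).trans (hC 0)
  have happrox0 : ∀ m α, approx d f m α 0 = α := by
    intro m α
    rw [approx_eq (by positivity)]
    have hδ : (0 : ℝ) < 1 / (m + 1) := by positivity
    rw [max_eq_right (by linarith : (0 : ℝ) - 1 / (m + 1) ≤ 0)]
    simp
  obtain ⟨w, hw, hwc⟩ := exists_convOn_of_lipschitz (a := 0) (b := ⊤) (A := |α| + 1)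
    (g := fun m => approx d f m (a m)) (K := fun y => C * y) (by
      filter_upwards [ha.abs.eventually_lt_const (lt_add_one |α|)] with m hm
      rw [happrox0]; exact hm.le)
    (Eventually.of_forall fun m x y hx hxy _ => abs_approx_sub_le hf hC m (a m) hx hxy)
    (fun x y hxy => mul_le_mul_of_nonneg_left hxy hC0)
  have hs : {x : ℝ | 0 ≤ x ∧ (x : WithTop ℝ) ≤ ⊤} = Ici 0 := by ext; simp
  rw [hs] at hw hwc
  -- The limit is continued to negative arguments by its value at `0`, so that the means are
  -- continuous on all of `ℝ`.
  set v : ℝ → ℝ := fun x => w (max x 0) with hvdef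
  have hvw : ∀ x ∈ Ici (0 : ℝ), w x = v x := fun x hx => by simp [hvdef, max_eq_left hx.out]
  have hv : Continuous v := hwc.comp_continuous (by fun_prop) fun x => mem_Ici.2 (le_max_right _ _)
  have hconv : ConvOn (Ici 0) (fun m => approx d f m (a m)) v := hw.congr hvw
  have hcont : ∀ m α, Continuous (approx d f m α) := fun m α => continuous_tonelli_apply hf _ _ _
  have key : ∀ r, 0 ≤ r → v r = α - ∫ t in (0 : ℝ)..r, t * ballMean d f v t := by
    intro r hr
    have h1 : Tendsto (fun m => approx d f m (a m) r) hyp (𝓝 (v r)) := hconv.tendsto hr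
    refine tendsto_nhds_unique h1 ?_
    have hfu : TendstoUniformlyOn (fun m x => f (approx d f m (a m) x)) (fun x => f (v x)) hyp
        (Icc 0 r) := by
      refine ConvOn.tendstoUniformlyOn (s := Ici 0) ?_ (hf.comp hv).continuousOn isCompact_Icc
        (fun x hx => hx.1)
      intro x y hx hy hxy
      exact (hf.tendsto _).comp (hconv x y hx hy hxy)
    rw [Metric.tendstoUniformlyOn_iff] at hfu
    have h2 : Tendsto (fun m => ∫ t in (0 : ℝ)..max (r - 1 / ((m : ℝ) + 1)) 0,
        t * ballMean d f (approx d f m (a m)) t) hyp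
        (𝓝 (∫ t in (0 : ℝ)..r, t * ballMean d f v t)) := by
      rw [Metric.tendsto_nhds]
      intro ε hε
      have hδ1 : ∀ᶠ m : ℕ in hyp, C * r * (1 / ((m : ℝ) + 1)) < ε / 2 := by
        have := tendsto_one_div_hyp.const_mul (C * r)
        rw [mul_zero] at this
        exact this.eventually_lt_const (by linarith)
      filter_upwards [hfu (ε / 2 / (r * r + 1)) (by positivity), hδ1] with m hm hm2
      set ρ := max (r - 1 / ((m : ℝ) + 1)) 0 with hρ
      have hδ : (0 : ℝ) < 1 / (m + 1) := by positivity
      have hρr : ρ ≤ r := max_le (by linarith) hr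
      have hρ0 : 0 ≤ ρ := le_max_right _ _
      -- The error has two parts: the integrands differ on `[0, ρ]`, and the delay omits the
      -- interval `[ρ, r]`.
      have e1 : |(∫ t in (0 : ℝ)..ρ, t * ballMean d f (approx d f m (a m)) t) -
          ∫ t in (0 : ℝ)..ρ, t * ballMean d f v t| < ε / 2 := by
        have c1 : Continuous fun t => t * ballMean d f (approx d f m (a m)) t :=
          continuous_id.mul (continuous_ballMean' hf (hcont _ _))
        have c2 : Continuous fun t => t * ballMean d f v t :=
          continuous_id.mul (continuous_ballMean' hf hv)
        rw [← intervalIntegral.integral_sub (c1.intervalIntegrable _ _)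
          (c2.intervalIntegrable _ _)]
        have hb := intervalIntegral.norm_integral_le_of_norm_le_const (a := 0) (b := ρ)
          (C := r * (ε / 2 / (r * r + 1)))
          (f := fun t => t * ballMean d f (approx d f m (a m)) t - t * ballMean d f v t) (by
            intro t ht
            rw [uIoc_of_le hρ0] at ht
            rw [← mul_sub, norm_mul, Real.norm_eq_abs, Real.norm_eq_abs, abs_of_pos ht.1]
            refine mul_le_mul (ht.2.trans hρr) ?_ (abs_nonneg _) hr
            refine abs_ballMean_sub_le hf (hcont _ _) hv ht.1.le fun x hx => ?_
            have := hm x ⟨hx.1, hx.2.trans (ht.2.trans hρr)⟩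
            rw [dist_comm, Real.dist_eq] at this
            exact this.le)
        refine lt_of_le_of_lt hb ?_
        rw [sub_zero, abs_of_nonneg hρ0]
        have : r * (ε / 2 / (r * r + 1)) * ρ ≤ r * (ε / 2 / (r * r + 1)) * r := by gcongr
        refine this.trans_lt ?_
        rw [show r * (ε / 2 / (r * r + 1)) * r = ε / 2 * (r * r / (r * r + 1)) by ring]
        have h4 : r * r / (r * r + 1) < 1 := by
          rw [div_lt_one (by positivity)]; linarith
        have : 0 < ε / 2 := by linarith
        nlinarith
      have e2 := abs_integral_mul_ballMean_sub_le (d := d) hf hv hC hρ0 hρr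
      have e3 : r - ρ ≤ 1 / ((m : ℝ) + 1) := by
        have := le_max_left (r - 1 / ((m : ℝ) + 1)) 0
        linarith
      have e4 : C * r * (r - ρ) ≤ C * r * (1 / ((m : ℝ) + 1)) := by gcongr
      rw [Real.dist_eq]
      rw [abs_sub_comm] at e2
      calc _ ≤ _ := abs_sub_le _ (∫ t in (0 : ℝ)..ρ, t * ballMean d f v t) _
        _ < ε / 2 + ε / 2 := by linarith
        _ = ε := by ring
    refine (ha.sub h2).congr' ?_
    have : ∀ᶠ m : ℕ in hyp, r ≤ (m : ℝ) + 1 := by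
      refine hyp_le_atTop ?_
      filter_upwards [eventually_ge_atTop ⌈r⌉₊] with m hm
      have := Nat.ceil_le.1 hm
      linarith
    filter_upwards [this] with m hm
    rw [approx_eq hm]
  refine ⟨v, _, sol_of_integral_eq hf hv key, ?_, hconv⟩
  rw [key 0 le_rfl]; simp

lemma Sol.deriv_eq_of_eqOn {d : ℕ} {f u u' v v' : ℝ → ℝ} (hu : Sol d f u u') (hv : Sol d f v v')
    (h : ∀ x ∈ Ici (0 : ℝ), u x = v x) : ∀ x ∈ Ici (0 : ℝ), u' x = v' x := by
  intro x hx
  rcases hx.out.eq_or_lt with rfl | hx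
  · rw [hu.init, hv.init]
  · refine (hu.hasDeriv x hx).unique ((hv.hasDeriv x hx).congr_of_eventuallyEq ?_)
    filter_upwards [Ioi_mem_nhds hx] with y hy using h y (mem_Ici.2 (le_of_lt hy))

/-- A property of solutions that is both open and closed cannot hold for all solutions that start
at `a` and fail for all solutions that start at `b`. -/
theorem solutions_connected {d : ℕ} {f : ℝ → ℝ} (hf : Continuous f) {C : ℝ} (hC : ∀ s, |f s| ≤ C)
    {a b : ℝ} (hab : a ≤ b) (P : (ℝ → ℝ) → (ℝ → ℝ) → Prop)
    (hP : ∀ (u u' : ℕ → ℝ → ℝ) (v v' : ℝ → ℝ), (∀ m, Sol d f (u m) (u' m)) →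
      (∀ m, u m 0 ∈ Icc a b) → Sol d f v v' → v 0 ∈ Icc a b → ConvOn (Ici 0) u v →
      ConvOn (Ici 0) u' v' →
      (P v v' → ∀ᶠ m in hyp, P (u m) (u' m)) ∧ (¬ P v v' → ∀ᶠ m in hyp, ¬ P (u m) (u' m)))
    (ha : ∀ u u', Sol d f u u' → u 0 = a → P u u')
    (hb : ∀ u u', Sol d f u u' → u 0 = b → ¬ P u u') : False := by
  set A := max |a| |b| with hA
  have hbd : ∀ x ∈ Icc a b, |x| ≤ A := fun x hx => abs_le_max_abs_abs hx.1 hx.2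
  -- Compactness gives a uniform gap between solutions with and without the property. Otherwise a
  -- sequence of each kind would converge to one common limit, which `hP` forbids whether or not the
  -- limit has the property.
  obtain ⟨n, hn⟩ : ∃ n : ℕ, ∀ u u' v v' : ℝ → ℝ, Sol d f u u' → Sol d f v v' → u 0 ∈ Icc a b →
      v 0 ∈ Icc a b → P u u' → ¬ P v v' →
      ∃ x ∈ Icc (0 : ℝ) (n + 1), 1 / ((n : ℝ) + 1) ≤ |u x - v x| := by
    by_contra hcon
    push Not at hcon
    choose u u' v v' hu hv hu0 hv0 hPu hPv hclose using hcon
    obtain ⟨w, w', hw, hcw, hcw'⟩ := exists_limit_solution hf hC (Eventually.of_forall hu)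
      (Eventually.of_forall fun m => hbd _ (hu0 m))
    obtain ⟨z, z', hz, hcz, hcz'⟩ := exists_limit_solution hf hC (Eventually.of_forall hv)
      (Eventually.of_forall fun m => hbd _ (hv0 m))
    have hwz : ∀ x ∈ Ici (0 : ℝ), z x = w x := by
      intro x hx
      have h1 : Tendsto (fun m => u m x - v m x) hyp (𝓝 (w x - z x)) :=
        (hcw.tendsto hx).sub (hcz.tendsto hx)
      have h2 : Tendsto (fun m => u m x - v m x) hyp (𝓝 0) := by
        refine squeeze_zero_norm' ?_ tendsto_one_div_hyp
        have : ∀ᶠ m : ℕ in hyp, x ≤ (m : ℝ) + 1 := by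
          refine hyp_le_atTop ?_
          filter_upwards [eventually_ge_atTop ⌈x⌉₊] with m hm
          have := Nat.ceil_le.1 hm
          linarith
        filter_upwards [this] with m hm
        exact (hclose m x ⟨hx, hm⟩).le
      linarith [tendsto_nhds_unique h1 h2]
    have hw0 : w 0 ∈ Icc a b := isClosed_Icc.mem_of_tendsto (hcw.tendsto (y := 0) (by simp))
      (Eventually.of_forall hu0)
    obtain ⟨h1, -⟩ := hP v v' w w' hv hv0 hw hw0 (hcz.congr hwz)
      (hcz'.congr (hz.deriv_eq_of_eqOn hw hwz))
    obtain ⟨-, h2⟩ := hP u u' w w' hu hu0 hw hw0 hcw hcw'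
    by_cases hPw : P w w'
    · obtain ⟨m, hm⟩ := (h1 hPw).exists
      exact hPv m hm
    · obtain ⟨m, hm⟩ := (h2 hPw).exists
      exact hm (hPu m)
  set δ : ℝ := 1 / ((n : ℝ) + 1) with hδ
  have hδ0 : 0 < δ := by positivity
  -- approximations are close to solutions
  have near : ∀ (al : ℕ → ℝ) (α : ℝ), Tendsto al hyp (𝓝 α) → ∃ v v', Sol d f v v' ∧ v 0 = α ∧
      ∀ᶠ m in hyp, ∀ x ∈ Icc (0 : ℝ) (n + 1), |approx d f m (al m) x - v x| < δ / 3 := by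
    intro al α hal
    obtain ⟨v, v', h1, h2, h3⟩ := exists_limit_approx (d := d) hf hC hal
    refine ⟨v, v', h1, h2, ?_⟩
    have := h3.tendstoUniformlyOn h1.cont isCompact_Icc
      (show Icc (0 : ℝ) (n + 1) ⊆ Ici 0 from fun x hx => hx.1)
    rw [Metric.tendstoUniformlyOn_iff] at this
    filter_upwards [this (δ / 3) (by positivity)] with m hm x hx
    have := hm x hx
    rwa [dist_comm, Real.dist_eq] at this
  -- For large `m` every approximation is within a third of the gap of a true solution: initial
  -- values of counterexamples would converge, and `near` applies to them.
  have hcover : ∀ᶠ m in hyp, ∀ α ∈ Icc a b, ∃ v v', Sol d f v v' ∧ v 0 ∈ Icc a b ∧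
      ∀ x ∈ Icc (0 : ℝ) (n + 1), |approx d f m α x - v x| < δ / 3 := by
    refine (eventually_hyp_or_not _).resolve_right fun hcon => ?_
    have : ∀ m, ∃ α, (¬ ∀ α ∈ Icc a b, ∃ v v', Sol d f v v' ∧ v 0 ∈ Icc a b ∧
      ∀ x ∈ Icc (0 : ℝ) (n + 1), |approx d f m α x - v x| < δ / 3) → α ∈ Icc a b ∧
      ¬ ∃ v v', Sol d f v v' ∧ v 0 ∈ Icc a b ∧
      ∀ x ∈ Icc (0 : ℝ) (n + 1), |approx d f m α x - v x| < δ / 3 := by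
      intro m
      by_cases h : ∀ α ∈ Icc a b, ∃ v v', Sol d f v v' ∧ v 0 ∈ Icc a b ∧
        ∀ x ∈ Icc (0 : ℝ) (n + 1), |approx d f m α x - v x| < δ / 3
      · exact ⟨0, fun h' => (h' h).elim⟩
      · rw [not_forall] at h
        obtain ⟨α, hα⟩ := h
        rw [Classical.not_imp] at hα
        exact ⟨α, fun _ => hα⟩
    choose al hal using this
    have hal1 : ∀ᶠ m in hyp, al m ∈ Icc a b := hcon.mono fun m hm => (hal m hm).1
    obtain ⟨α, hα, hlim⟩ := exists_tendsto_hyp hal1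
    obtain ⟨v, v', h1, h2, h3⟩ := near al α hlim
    obtain ⟨m, hm, hm'⟩ := (h3.and hcon).exists
    exact (hal m hm').2 ⟨v, v', h1, h2 ▸ hα, hm⟩
  obtain ⟨va, va', hva, hva0, hnear_a⟩ := near (fun _ => a) a tendsto_const_nhds
  obtain ⟨vb, vb', hvb, hvb0, hnear_b⟩ := near (fun _ => b) b tendsto_const_nhds
  obtain ⟨m, hm, hma, hmb⟩ := (hcover.and (hnear_a.and hnear_b)).exists
  -- Unlike solutions, approximations are continuous functions of the initial value, so closeness to
  -- a fixed solution is an open condition on it.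
  have hopen : ∀ Q : (ℝ → ℝ) → (ℝ → ℝ) → Prop, IsOpen {α | ∃ v v', Sol d f v v' ∧ v 0 ∈ Icc a b ∧
      Q v v' ∧ ∀ x ∈ Icc (0 : ℝ) (n + 1), |approx d f m α x - v x| < δ / 3} := by
    intro Q
    rw [isOpen_iff_mem_nhds]
    rintro α ⟨v, v', h1, h2, h3, h4⟩
    have hvc : Continuous fun x => v (max x 0) :=
      h1.cont.comp_continuous (by fun_prop) fun x => mem_Ici.2 (le_max_right _ _)
    have hT : Continuous fun p : ℝ × ℝ => approx d f m p.1 p.2 := continuous_tonelli hf _ _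
    have ho : IsOpen {p : ℝ × ℝ | |approx d f m p.1 p.2 - v (max p.2 0)| < δ / 3} :=
      isOpen_lt (hT.sub (hvc.comp continuous_snd)).abs continuous_const
    have := (isCompact_Icc (a := (0 : ℝ)) (b := (n : ℝ) + 1)).eventually_forall_of_forall_eventually
      (x₀ := α) (P := fun α x => |approx d f m α x - v (max x 0)| < δ / 3) (by
        intro x hx
        exact ho.mem_nhds (by simpa [max_eq_left hx.1] using h4 x hx))
    filter_upwards [this] with β hβ
    exact ⟨v, v', h1, h2, h3, fun x hx => by simpa [max_eq_left hx.1] using hβ x hx⟩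
  -- Connectedness of `[a, b]` yields one approximation close to solutions of both kinds, which are
  -- then less than the gap apart.
  obtain ⟨α, -, ⟨u, u', hu, hu0, hPu, hu1⟩, v, v', hv, hv0, hPv, hv1⟩ :=
    isPreconnected_Icc (a := a) (b := b) _ _ (hopen P) (hopen fun v v' => ¬ P v v')
    (by
      intro α hα
      obtain ⟨v, v', h1, h2, h3⟩ := hm α hα
      by_cases hPv : P v v'
      · exact Or.inl ⟨v, v', h1, h2, hPv, h3⟩
      · exact Or.inr ⟨v, v', h1, h2, hPv, h3⟩)
    ⟨a, left_mem_Icc.2 hab, va, va', hva, by rw [hva0]; exact left_mem_Icc.2 hab,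
      ha _ _ hva hva0, hma⟩
    ⟨b, right_mem_Icc.2 hab, vb, vb', hvb, by rw [hvb0]; exact right_mem_Icc.2 hab,
      hb _ _ hvb hvb0, hmb⟩
  obtain ⟨x, hx, hx'⟩ := hn u u' v v' hu hv hu0 hv0 hPu hPv
  have h1 := hu1 x hx
  have h2 := hv1 x hx
  have h3 := abs_sub_le (u x) (approx d f m α x) (v x)
  rw [abs_sub_comm (u x) (approx d f m α x)] at h3
  linarith

/-! ### Local uniqueness for continuous nonlinearities -/

lemma exists_Icc_of_eventually {r : ℝ} {p : ℝ → Prop} (h : ∀ᶠ x in 𝓝[≥] r, p x) :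
    ∃ τ > 0, ∀ x ∈ Icc r (r + τ), p x := by
  obtain ⟨c, hc, hsub⟩ := mem_nhdsGE_iff_exists_Icc_subset.1 h
  exact ⟨c - r, sub_pos.2 hc, fun x hx => hsub ⟨hx.1, by linarith [hx.2]⟩⟩

lemma exists_abs_le_on_Icc {g : ℝ → ℝ} {a b : ℝ} (hab : a ≤ b) (hg : ContinuousOn g (Icc a b)) :
    ∃ y ∈ Icc a b, ∀ x ∈ Icc a b, |g x| ≤ |g y| :=
  isCompact_Icc.exists_isMaxOn ⟨a, left_mem_Icc.2 hab⟩ hg.abs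

/-- The primitive is differentiable even when `f` is merely continuous. This first order estimate
replaces a Lipschitz bound on `f` in the uniqueness proofs. -/
lemma abs_prim_sub_le {f : ℝ → ℝ} (hf : Continuous f) {c α η ε : ℝ}
    (hε : ∀ s, |s - α| ≤ η → |f s - c| ≤ ε) {x y : ℝ} (hx : |x - α| ≤ η) (hy : |y - α| ≤ η) :
    |prim f x - prim f y - c * (x - y)| ≤ ε * |x - y| := by
  wlog h : y ≤ x generalizing x y
  · have := this hy hx (le_of_not_ge h)
    rw [abs_sub_comm x y]
    rw [← abs_neg] at this
    convert this using 2
    ring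
  have h1 := abs_sub_le_of_hasDerivAt (g := fun s => prim f s - c * s) (g' := fun s => f s - c)
    (C := ε) h (((continuous_prim hf).sub (by fun_prop)).continuousOn)
    (fun s _ => ((hasDerivAt_prim hf s).sub ((hasDerivAt_id s).const_mul c)).congr_deriv (by simp))
    (fun s hs => hε s (by
      rw [abs_le] at hx hy ⊢
      constructor <;> linarith [hs.1, hs.2]))
  rw [abs_of_nonneg (sub_nonneg.2 h)]
  convert h1 using 2
  ring

lemma SolOn.continuousWithinAt_Ici {d : ℕ} {f : ℝ → ℝ} {R : ℝ} {u u' : ℝ → ℝ}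
    (hu : SolOn d f R u u') {r : ℝ} (h0 : 0 ≤ r) (hR : r < R) :
    ContinuousWithinAt u (Ici r) r ∧ ContinuousWithinAt u' (Ici r) r := by
  have hmem : Ico 0 R ∈ 𝓝[≥] r := by
    filter_upwards [Ico_mem_nhdsGE hR] with x hx using ⟨h0.trans hx.1, hx.2⟩
  exact ⟨(hu.cont r ⟨h0, hR⟩).mono_of_mem_nhdsWithin hmem,
    (hu.cont' r ⟨h0, hR⟩).mono_of_mem_nhdsWithin hmem⟩

lemma SolOn.hasDerivAt_energy {d : ℕ} {f : ℝ → ℝ} {R : ℝ} {u u' : ℝ → ℝ} (hf : Continuous f)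
    (h : SolOn d f R u u') {r : ℝ} (hr : 0 < r) (hR : r < R) :
    HasDerivAt (energy f u u') (-((d + 2 : ℝ) / r * u' r ^ 2)) r := by
  refine ((((h.hasDeriv' r hr hR).pow 2).div_const 2).add
    ((hasDerivAt_prim hf (u r)).comp r (h.hasDeriv r hr hR))).congr_deriv ?_
  simp; ring

lemma SolOn.continuousOn_energy {d : ℕ} {f : ℝ → ℝ} {R : ℝ} {u u' : ℝ → ℝ} (hf : Continuous f)
    (h : SolOn d f R u u') : ContinuousOn (energy f u u') (Ico 0 R) :=
  ((h.cont'.pow 2).div_const 2).add ((continuous_prim hf).comp_continuousOn h.cont)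

/-- Uniqueness near the origin, when `f` is continuous and does not vanish at the initial value. -/
lemma SolOn.eq_near_zero {d : ℕ} {f : ℝ → ℝ} {R : ℝ} (hR : 0 < R) (hf : Continuous f)
    {u u' v v' : ℝ → ℝ} (hu : SolOn d f R u u') (hv : SolOn d f R v v') (h0 : u 0 = v 0)
    (hf0 : f (u 0) ≠ 0) :
    ∃ τ > 0, ∀ x ∈ Icc 0 (0 + τ), u x = v x ∧ u' x = v' x := by
  set α := u 0 with hα
  set c := f α with hc
  set n : ℝ := d + 3 with hn
  have hd0 : (0 : ℝ) ≤ d := d.cast_nonneg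
  have hn0 : 0 < n := by positivity
  have hc0 : 0 < |c| := abs_pos.2 hf0
  -- With this choice the error `4 n ε S` becomes `|c| S / (2 n)`, which yields the contraction
  -- factor `1/2` at the end.
  set ε : ℝ := |c| / (8 * n * n) with hε
  have hε0 : 0 < ε := by positivity
  obtain ⟨η, hη0, hη⟩ := Metric.continuousAt_iff.1 (hf.continuousAt (x := α)) ε hε0
  have hη' : ∀ s, |s - α| ≤ η / 2 → |f s - c| ≤ ε := fun s hs =>
    (hη (by rw [Real.dist_eq]; linarith)).le
  have hev : ∀ᶠ x in 𝓝[≥] (0 : ℝ), |u x - α| ≤ η / 2 ∧ |v x - α| ≤ η / 2 ∧ x < R := by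
    have c1 := (hu.continuousWithinAt_Ici le_rfl hR).1
    have c2 := (hv.continuousWithinAt_Ici le_rfl hR).1
    have e1 : ∀ᶠ x in 𝓝[≥] (0 : ℝ), dist (u x) α < η / 2 :=
      c1.eventually (Metric.ball_mem_nhds _ (by positivity))
    have e2 : ∀ᶠ x in 𝓝[≥] (0 : ℝ), dist (v x) α < η / 2 := by
      rw [h0]
      exact c2.eventually (Metric.ball_mem_nhds _ (by positivity))
    filter_upwards [e1, e2, nhdsWithin_le_nhds (Iio_mem_nhds hR)] with x h1 h2 h3
    exact ⟨h1.le, h2.le, h3⟩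
  obtain ⟨τ, hτ, hloc⟩ := exists_Icc_of_eventually hev
  rw [zero_add] at hloc
  refine ⟨τ, hτ, ?_⟩
  rw [zero_add]
  have hτR : τ < R := (hloc τ ⟨hτ.le, le_rfl⟩).2.2
  have hsub : Icc 0 τ ⊆ Ico 0 R := fun x hx => ⟨hx.1, hx.2.trans_lt hτR⟩
  obtain ⟨y, hy, hmax⟩ := exists_abs_le_on_Icc (g := fun x => u' x - v' x) hτ.le
    ((hu.cont'.sub hv.cont').mono hsub)
  set S := |u' y - v' y| with hS
  have hS0 : 0 ≤ S := abs_nonneg _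
  have hder : ∀ w w' : ℝ → ℝ, SolOn d f R w w' → (∀ x ∈ Icc 0 τ, |w x - α| ≤ η / 2) →
      ∀ x ∈ Icc 0 τ, |w' x + c * x / n| ≤ ε * x / n := by
    intro w w' hw hwl x hx
    have a1 := hw.deriv_le_of_le (m := c - ε) hx.1 (hsub hx).2 fun t h1 h2 => by
      have := hη' _ (hwl t ⟨h1.le, h2.le.trans hx.2⟩)
      linarith [(abs_le.1 this).1]
    have a2 := hw.le_deriv_of_le (M := c + ε) hx.1 (hsub hx).2 fun t h1 h2 => by
      have := hη' _ (hwl t ⟨h1.le, h2.le.trans hx.2⟩)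
      linarith [(abs_le.1 this).2]
    rw [← hn] at a1 a2
    have b1 : (c - ε) * x / n = c * x / n - ε * x / n := by ring
    have b2 : (c + ε) * x / n = c * x / n + ε * x / n := by ring
    rw [abs_le]; constructor <;> linarith
  have hdu := hder u u' hu fun x hx => (hloc x hx).1
  have hdv := hder v v' hv fun x hx => (hloc x hx).2.1
  have hD : ∀ x ∈ Icc 0 τ, |u x - v x| ≤ S * x := by
    intro x hx
    have := abs_sub_le_of_hasDerivAt (g := fun x => u x - v x) (g' := fun x => u' x - v' x) (C := S)
      hx.1 ((hu.cont.sub hv.cont).mono fun t ht => hsub ⟨ht.1, ht.2.trans hx.2⟩)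
      (fun t ht => (hu.hasDeriv t ht.1 (hsub ⟨ht.1.le, ht.2.le.trans hx.2⟩).2).sub
        (hv.hasDeriv t ht.1 (hsub ⟨ht.1.le, ht.2.le.trans hx.2⟩).2))
      (fun t ht => hmax t ⟨ht.1.le, ht.2.le.trans hx.2⟩)
    simpa [← hα, h0] using this
  have hsum : ∀ x ∈ Icc 0 τ, |u' x + v' x + 2 * (c * x / n)| ≤ 2 * (ε * x / n) := by
    intro x hx
    have := abs_add_le (u' x + c * x / n) (v' x + c * x / n)
    have e : u' x + c * x / n + (v' x + c * x / n) = u' x + v' x + 2 * (c * x / n) := by ring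
    rw [e] at this
    linarith [hdu x hx, hdv x hx]
  -- Since `u' + v'` is close to `-2 c x / n`, the dissipation difference is almost a constant
  -- multiple of `u' - v'`, and integrates to a multiple of `u - v`.
  have hen : ∀ x ∈ Icc 0 τ, |(energy f u u' x - energy f v v' x) -
      2 * c * (d + 2) / n * (u x - v x)| ≤ 2 * ε * S * x := by
    intro x hx
    have := abs_sub_le_of_hasDerivAt
      (g := fun x => energy f u u' x - energy f v v' x - 2 * c * (d + 2) / n * (u x - v x))
      (g' := fun x => -((d + 2) / x * (u' x + v' x + 2 * (c * x / n)) * (u' x - v' x)))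
      (C := 2 * ε * S) hx.1
      (((((hu.continuousOn_energy hf).sub (hv.continuousOn_energy hf)).sub
        ((hu.cont.sub hv.cont).const_mul _))).mono fun t ht => hsub ⟨ht.1, ht.2.trans hx.2⟩)
      (fun t ht => by
        have hR' := (hsub ⟨ht.1.le, ht.2.le.trans hx.2⟩).2
        refine (((hu.hasDerivAt_energy hf ht.1 hR').sub (hv.hasDerivAt_energy hf ht.1 hR')).sub
          (((hu.hasDeriv t ht.1 hR').sub (hv.hasDeriv t ht.1 hR')).const_mul _)).congr_deriv ?_
        have := ht.1.ne'
        field_simp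
        ring)
      (fun t ht => by
        have ht' : t ∈ Icc 0 τ := ⟨ht.1.le, ht.2.le.trans hx.2⟩
        have a1 := hsum t ht'
        have a2 := hmax t ht'
        have ht0 := ht.1
        rw [abs_neg, abs_mul, abs_mul, abs_of_pos (by positivity : (0 : ℝ) < (d + 2) / t)]
        calc (d + 2) / t * |u' t + v' t + 2 * (c * t / n)| * |u' t - v' t|
            ≤ (d + 2) / t * (2 * (ε * t / n)) * S := by gcongr
          _ = (d + 2) / n * (2 * ε * S) := by field_simp
          _ ≤ 1 * (2 * ε * S) := by
              gcongr
              rw [div_le_one hn0, hn]; linarith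
          _ = _ := one_mul _)
    have e0 : energy f u u' 0 = energy f v v' 0 := by
      simp [energy, hu.init, hv.init, ← h0, hα]
    simpa [e0, ← hα, h0] using this
  -- Expanding the same energy difference directly, with `F` replaced by its linear part, leaves `x
  -- w' + (n - 2) w` small for `w = u - v`.
  have hrel : ∀ x ∈ Icc 0 τ, |c| * |x * (u' x - v' x) + (d + 1) * (u x - v x)| ≤
      4 * n * ε * S * x := by
    intro x hx
    have a1 := hen x hx
    have a2 := abs_prim_sub_le hf hη' (hloc x hx).1 (hloc x hx).2.1
    have a3 := hD x hx
    have a4 := hsum x hx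
    have a5 := hmax x hx
    have a6 : |(u' x + v' x + 2 * (c * x / n)) * (u' x - v' x)| ≤ 2 * (ε * x / n) * S := by
      rw [abs_mul]; gcongr
      exact (abs_nonneg _).trans a4
    have e : c * (x * (u' x - v' x) + (d + 1) * (u x - v x)) =
        -n * ((energy f u u' x - energy f v v' x) - 2 * c * (d + 2) / n * (u x - v x)) +
        n * ((u' x + v' x + 2 * (c * x / n)) * (u' x - v' x)) / 2 +
        n * (prim f (u x) - prim f (v x) - c * (u x - v x)) := by
      unfold energy
      field_simp
      rw [hn]
      ring
    rw [← abs_mul, e]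
    have b1 : |-n * ((energy f u u' x - energy f v v' x) - 2 * c * (d + 2) / n * (u x - v x))| ≤
        n * (2 * ε * S * x) := by
      rw [abs_mul, abs_neg, abs_of_pos hn0]; gcongr
    have b2 : |n * ((u' x + v' x + 2 * (c * x / n)) * (u' x - v' x)) / 2| ≤
        n * (2 * (ε * x / n) * S) / 2 := by
      rw [abs_div, abs_mul, abs_of_pos hn0, abs_two]; gcongr
    have b3 : |n * (prim f (u x) - prim f (v x) - c * (u x - v x))| ≤ n * (ε * (S * x)) := by
      rw [abs_mul, abs_of_pos hn0]
      gcongr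
      exact a2.trans (by gcongr)
    have hx0 := hx.1
    have b4 : n * (2 * (ε * x / n) * S) / 2 ≤ n * (ε * S * x) := by
      rw [show n * (2 * (ε * x / n) * S) / 2 = 1 * (ε * S * x) by field_simp]
      gcongr
      rw [hn]; linarith
    calc _ ≤ _ := abs_add_three _ _ _
      _ ≤ n * (2 * ε * S * x) + n * (ε * S * x) + n * (ε * (S * x)) := by linarith
      _ = _ := by ring
  have hK : ∀ x ∈ Icc 0 τ, |x * (u' x - v' x) + (d + 1) * (u x - v x)| ≤ S / (2 * n) * x := by
    intro x hx
    have a1 := hrel x hx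
    have e : 4 * n * ε * S * x = |c| * (S / (2 * n) * x) := by
      rw [hε]; field_simp; ring
    rw [e] at a1
    exact le_of_mul_le_mul_left a1 hc0
  -- The combination just estimated is, up to `x^d`, the derivative of `x^(d+1) (u - v)`, so it
  -- integrates to a bound on `u - v` itself.
  have hD2 : ∀ x ∈ Icc 0 τ, |u x - v x| ≤ S / (2 * n) * x := by
    intro x hx
    rcases hx.1.eq_or_lt with rfl | hx0
    · simp [← hα, h0]
    have := abs_sub_le_of_hasDerivAt (g := fun x => x ^ (d + 1) * (u x - v x))
      (g' := fun x => x ^ d * (x * (u' x - v' x) + (d + 1) * (u x - v x)))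
      (C := S / (2 * n) * x ^ (d + 1)) hx.1
      (((continuousOn_pow _).mul (hu.cont.sub hv.cont)).mono
        fun t ht => hsub ⟨ht.1, ht.2.trans hx.2⟩)
      (fun t ht => by
        have hR' := (hsub ⟨ht.1.le, ht.2.le.trans hx.2⟩).2
        refine ((hasDerivAt_pow (d + 1) t).mul
          ((hu.hasDeriv t ht.1 hR').sub (hv.hasDeriv t ht.1 hR'))).congr_deriv ?_
        simp only [Nat.add_sub_cancel, Pi.sub_apply]
        push_cast
        ring)
      (fun t ht => by
        have ht' : t ∈ Icc 0 τ := ⟨ht.1.le, ht.2.le.trans hx.2⟩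
        have ht0 := ht.1
        rw [abs_mul, abs_of_pos (pow_pos ht0 d)]
        calc _ ≤ t ^ d * (S / (2 * n) * t) := by gcongr; exact hK t ht'
          _ = S / (2 * n) * t ^ (d + 1) := by ring
          _ ≤ _ := by gcongr; exact ht.2.le)
    simp only [← hα, ← h0, sub_self, mul_zero, sub_zero] at this
    rw [abs_mul, abs_of_pos (pow_pos hx0 _)] at this
    have e : S / (2 * n) * x ^ (d + 1) * x = x ^ (d + 1) * (S / (2 * n) * x) := by ring
    rw [e] at this
    exact le_of_mul_le_mul_left this (pow_pos hx0 _)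
  -- At the point where `|u' - v'|` attains its maximum `S`, the two bounds combine to `S ≤ S/2`.
  have hSz : S = 0 := by
    rcases hy.1.eq_or_lt with h | hy0
    · rw [hS, ← h, hu.init, hv.init]; simp
    have a1 := hK y hy
    have a2 := hD2 y hy
    have a3 : y * S ≤ S / 2 * y := by
      have e : y * S = |y * (u' y - v' y)| := by rw [abs_mul, abs_of_pos hy0]
      have e2 : y * (u' y - v' y) = (y * (u' y - v' y) + (d + 1) * (u y - v y)) -
        (d + 1) * (u y - v y) := by ring
      rw [e, e2]
      calc _ ≤ |y * (u' y - v' y) + (d + 1) * (u y - v y)| + |(d + 1) * (u y - v y)| := abs_sub _ _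
        _ ≤ S / (2 * n) * y + (d + 1) * (S / (2 * n) * y) := by
            rw [abs_mul, abs_of_pos (by positivity : (0 : ℝ) < (d : ℝ) + 1)]
            gcongr
        _ = (d + 2) / n * (S / 2 * y) := by field_simp; ring
        _ ≤ 1 * (S / 2 * y) := by
            gcongr
            rw [div_le_one hn0, hn]; linarith
        _ = _ := one_mul _
    nlinarith
  intro x hx
  constructor
  · have := hD x hx
    rw [hSz, zero_mul] at this
    linarith [abs_nonpos_iff.1 this]
  · have := hmax x hx
    rw [hSz] at this
    linarith [abs_nonpos_iff.1 this]

/-- `f` is Lipschitz near `s`. -/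
def LipNear (f : ℝ → ℝ) (s : ℝ) : Prop :=
  ∃ L η, 0 < η ∧ ∀ x y, |x - s| < η → |y - s| < η → |f x - f y| ≤ L * |x - y|

/-- Uniqueness to the right of a positive radius. -/
lemma SolOn.eq_near_pos {d : ℕ} {f : ℝ → ℝ} {R r : ℝ} (hr : 0 < r) (hrR : r < R)
    (hf : Continuous f) {u u' v v' : ℝ → ℝ} (hu : SolOn d f R u u') (hv : SolOn d f R v v')
    (h0 : u r = v r) (h0' : u' r = v' r) (hloc : u' r ≠ 0 ∨ LipNear f (u r)) :
    ∃ τ > 0, ∀ x ∈ Icc r (r + τ), u x = v x ∧ u' x = v' x := by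
  -- it suffices to contract the supremum of `|u' - v'|`
  suffices H : ∃ K τ₀, 0 < τ₀ ∧ r + τ₀ < R ∧ ∀ τ, 0 < τ → τ ≤ τ₀ → ∀ S,
      (∀ x ∈ Icc r (r + τ), |u' x - v' x| ≤ S) → (∀ x ∈ Icc r (r + τ), |u x - v x| ≤ S * τ) →
      ∀ x ∈ Icc r (r + τ), |u' x - v' x| ≤ K * S * τ by
    obtain ⟨K, τ₀, hτ₀, hτR, H⟩ := H
    set τ := min τ₀ (1 / (2 * (|K| + 1))) with hτ
    have hτ0 : 0 < τ := lt_min hτ₀ (by positivity)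
    have hsub : Icc r (r + τ) ⊆ Ico 0 R := fun x hx =>
      ⟨hr.le.trans hx.1, hx.2.trans_lt (by linarith [min_le_left τ₀ (1 / (2 * (|K| + 1)))])⟩
    obtain ⟨y, hy, hmax⟩ := exists_abs_le_on_Icc (g := fun x => u' x - v' x)
      (by linarith : r ≤ r + τ) ((hu.cont'.sub hv.cont').mono hsub)
    set S := |u' y - v' y| with hS
    have hS0 : 0 ≤ S := abs_nonneg _
    have hD : ∀ x ∈ Icc r (r + τ), |u x - v x| ≤ S * τ := by
      intro x hx
      have := abs_sub_le_of_hasDerivAt (g := fun x => u x - v x) (g' := fun x => u' x - v' x)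
        (C := S) hx.1 ((hu.cont.sub hv.cont).mono fun t ht => hsub ⟨ht.1, ht.2.trans hx.2⟩)
        (fun t ht => (hu.hasDeriv t (hr.trans ht.1) (hsub ⟨ht.1.le, ht.2.le.trans hx.2⟩).2).sub
          (hv.hasDeriv t (hr.trans ht.1) (hsub ⟨ht.1.le, ht.2.le.trans hx.2⟩).2))
        (fun t ht => hmax t ⟨ht.1.le, ht.2.le.trans hx.2⟩)
      simp only [h0, sub_self, sub_zero] at this
      exact this.trans (by gcongr; linarith [hx.2])
    have h1 := H τ hτ0 (min_le_left _ _) S hmax hD y hy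
    have hSz : S = 0 := by
      have h2 : K * S * τ ≤ (|K| + 1) * S * (1 / (2 * (|K| + 1))) := by
        gcongr
        · linarith [le_abs_self K]
        · exact min_le_right _ _
      have h3 : (|K| + 1) * S * (1 / (2 * (|K| + 1))) = S / 2 := by
        have : 0 < |K| + 1 := by positivity
        field_simp
      linarith
    refine ⟨τ, hτ0, fun x hx => ⟨?_, ?_⟩⟩
    · have := hD x hx
      rw [hSz, zero_mul] at this
      linarith [abs_nonpos_iff.1 this]
    · have := hmax x hx
      rw [hSz] at this
      linarith [abs_nonpos_iff.1 this]
  obtain ⟨cu, cu'⟩ := hu.continuousWithinAt_Ici hr.le hrR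
  obtain ⟨cv, cv'⟩ := hv.continuousWithinAt_Ici hr.le hrR
  rw [ContinuousWithinAt, ← h0] at cv
  rw [ContinuousWithinAt, ← h0'] at cv'
  have near : ∀ η > 0, ∃ τ₀ > 0, r + τ₀ < R ∧ ∀ x ∈ Icc r (r + τ₀), |u x - u r| < η ∧
      |v x - u r| < η ∧ |u' x - u' r| < η ∧ |v' x - u' r| < η := by
    intro η hη
    have hev : ∀ᶠ x in 𝓝[≥] r, x < R ∧ |u x - u r| < η ∧
      |v x - u r| < η ∧ |u' x - u' r| < η ∧ |v' x - u' r| < η := by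
      filter_upwards [nhdsWithin_le_nhds (Iio_mem_nhds hrR),
        cu.eventually (Metric.ball_mem_nhds _ hη), cv.eventually (Metric.ball_mem_nhds _ hη),
        cu'.eventually (Metric.ball_mem_nhds _ hη), cv'.eventually (Metric.ball_mem_nhds _ hη)]
        with x h1 h2 h3 h4 h5 using ⟨h1, h2, h3, h4, h5⟩
    obtain ⟨τ₀, h1, h2⟩ := exists_Icc_of_eventually hev
    exact ⟨τ₀, h1, (h2 _ ⟨by linarith, le_rfl⟩).1, fun x hx => (h2 x hx).2⟩
  have hd0 : (0 : ℝ) ≤ d := d.cast_nonneg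
  rcases hloc with hne | ⟨L, η, hη, hL⟩
  -- The identity `(u' + v') (u' - v') = 2 ΔE - 2 ΔF` controls `u' - v'`, because `|u' + v'| ≥ p`
  -- nearby. Only a bound on `f`, not its continuity modulus, enters.
  · set p := |u' r| with hp
    have hp0 : 0 < p := abs_pos.2 hne
    obtain ⟨M, hM⟩ := isCompact_Icc.exists_bound_of_continuousOn (s := Icc (u r - 1) (u r + 1))
      hf.continuousOn
    obtain ⟨τ₀, hτ₀, hτR, hnear⟩ := near (min 1 (p / 2)) (lt_min one_pos (by linarith))
    have hM0 : 0 ≤ M := (norm_nonneg _).trans (hM (u r) ⟨by linarith, by linarith⟩)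
    refine ⟨2 / p * ((d + 2) / r * (3 * p) + M), τ₀, hτ₀, hτR, fun τ hτ hττ S hS hD x hx => ?_⟩
    have hloc' : ∀ x ∈ Icc r (r + τ), |u x - u r| ≤ 1 ∧ |v x - u r| ≤ 1 ∧
        |u' x - u' r| < p / 2 ∧ |v' x - u' r| < p / 2 := by
      intro x hx
      obtain ⟨h1, h2, h3, h4⟩ := hnear x ⟨hx.1, by linarith [hx.2]⟩
      exact ⟨(h1.trans_le (min_le_left _ _)).le, (h2.trans_le (min_le_left _ _)).le,
        h3.trans_le (min_le_right _ _), h4.trans_le (min_le_right _ _)⟩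
    have hsum : ∀ x ∈ Icc r (r + τ), |u' x + v' x - 2 * u' r| ≤ p := by
      intro x hx
      obtain ⟨_, _, h3, h4⟩ := hloc' x hx
      have := abs_add_le (u' x - u' r) (v' x - u' r)
      rw [show u' x - u' r + (v' x - u' r) = u' x + v' x - 2 * u' r by ring] at this
      linarith
    have hsub : Icc r (r + τ) ⊆ Ico 0 R := fun x hx =>
      ⟨hr.le.trans hx.1, hx.2.trans_lt (by linarith)⟩
    have hS0 : 0 ≤ S := (abs_nonneg _).trans (hS x hx)
    have hen := abs_sub_le_of_hasDerivAt
      (g := fun x => energy f u u' x - energy f v v' x)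
      (g' := fun x => -((d + 2) / x * ((u' x + v' x) * (u' x - v' x))))
      (C := (d + 2) / r * (3 * p * S)) hx.1
      (((hu.continuousOn_energy hf).sub (hv.continuousOn_energy hf)).mono
        fun t ht => hsub ⟨ht.1, ht.2.trans hx.2⟩)
      (fun t ht => by
        have hR' := (hsub ⟨ht.1.le, ht.2.le.trans hx.2⟩).2
        refine ((hu.hasDerivAt_energy hf (hr.trans ht.1) hR').sub
          (hv.hasDerivAt_energy hf (hr.trans ht.1) hR')).congr_deriv ?_
        ring)
      (fun t ht => by
        have ht' : t ∈ Icc r (r + τ) := ⟨ht.1.le, ht.2.le.trans hx.2⟩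
        have ht0 : 0 < t := hr.trans ht.1
        have a1 : |u' t + v' t| ≤ 3 * p := by
          have := abs_add_le (u' t + v' t - 2 * u' r) (2 * u' r)
          rw [sub_add_cancel, abs_mul, abs_two, ← hp] at this
          linarith [hsum t ht']
        rw [abs_neg, abs_mul, abs_mul, abs_of_pos (by positivity : (0 : ℝ) < (d + 2) / t)]
        gcongr
        · exact ht.1.le
        · exact hS t ht')
    have e0 : energy f u u' r = energy f v v' r := by simp [energy, h0, h0']
    simp only [e0, sub_self, sub_zero] at hen
    have hprim := abs_prim_sub_le (c := 0) (α := u r) (η := 1) (ε := M) hf (fun s hs => by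
      rw [sub_zero]
      exact hM s (by rw [abs_le] at hs; constructor <;> linarith)) (hloc' x hx).1 (hloc' x hx).2.1
    simp only [zero_mul, sub_zero] at hprim
    have a1 : p ≤ |u' x + v' x| := by
      have := abs_sub (u' x + v' x) (u' x + v' x - 2 * u' r)
      rw [sub_sub_cancel, abs_mul, abs_two, ← hp] at this
      linarith [hsum x hx]
    have a2 : |(u' x + v' x) * (u' x - v' x)| ≤
        2 * ((d + 2) / r * (3 * p * S) * τ) + 2 * (M * (S * τ)) := by
      have e : (u' x + v' x) * (u' x - v' x) =
          2 * (energy f u u' x - energy f v v' x) - 2 * (prim f (u x) - prim f (v x)) := by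
        unfold energy; ring
      rw [e]
      refine (abs_sub _ _).trans ?_
      rw [abs_mul, abs_mul, abs_two]
      have b1 : (d + 2) / r * (3 * p * S) * (x - r) ≤ (d + 2) / r * (3 * p * S) * τ := by
        gcongr; linarith [hx.2]
      have b2 : M * |u x - v x| ≤ M * (S * τ) := by gcongr; exact hD x hx
      linarith
    rw [abs_mul] at a2
    have a3 : p * |u' x - v' x| ≤ 2 * ((d + 2) / r * (3 * p * S) * τ) + 2 * (M * (S * τ)) :=
      (mul_le_mul_of_nonneg_right a1 (abs_nonneg _)).trans a2
    calc |u' x - v' x| = p * |u' x - v' x| / p := by field_simp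
      _ ≤ (2 * ((d + 2) / r * (3 * p * S) * τ) + 2 * (M * (S * τ))) / p := by gcongr
      _ = _ := by field_simp
  · obtain ⟨τ₀, hτ₀, hτR, hnear⟩ := near η hη
    refine ⟨(d + 2) / r + |L| * τ₀, τ₀, hτ₀, hτR, fun τ hτ hττ S hS hD x hx => ?_⟩
    have hsub : Icc r (r + τ) ⊆ Ico 0 R := fun x hx =>
      ⟨hr.le.trans hx.1, hx.2.trans_lt (by linarith)⟩
    have hS0 : 0 ≤ S := (abs_nonneg _).trans (hS x hx)
    have := abs_sub_le_of_hasDerivAt (g := fun x => u' x - v' x)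
      (g' := fun x => -((d + 2 : ℝ) / x * (u' x - v' x)) - (f (u x) - f (v x)))
      (C := ((d + 2) / r + |L| * τ₀) * S) hx.1
      ((hu.cont'.sub hv.cont').mono fun t ht => hsub ⟨ht.1, ht.2.trans hx.2⟩)
      (fun t ht => by
        have hR' := (hsub ⟨ht.1.le, ht.2.le.trans hx.2⟩).2
        refine ((hu.hasDeriv' t (hr.trans ht.1) hR').sub
          (hv.hasDeriv' t (hr.trans ht.1) hR')).congr_deriv ?_
        ring)
      (fun t ht => by
        have ht' : t ∈ Icc r (r + τ) := ⟨ht.1.le, ht.2.le.trans hx.2⟩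
        have ht0 : 0 < t := hr.trans ht.1
        obtain ⟨n1, n2, _, _⟩ := hnear t ⟨ht'.1, by linarith [ht'.2]⟩
        have a1 := hL _ _ n1 n2
        have a2 : L * |u t - v t| ≤ |L| * (S * τ₀) := by
          have := hD t ht'
          calc L * |u t - v t| ≤ |L| * |u t - v t| := by gcongr; exact le_abs_self L
            _ ≤ |L| * (S * τ) := by gcongr
            _ ≤ _ := by gcongr
        have a3 : (d + 2) / t * |u' t - v' t| ≤ (d + 2) / r * S := by
          gcongr
          · exact ht.1.le
          · exact hS t ht'
        refine (abs_sub _ _).trans ?_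
        rw [abs_neg, abs_mul, abs_of_pos (by positivity : (0 : ℝ) < (d + 2) / t)]
        calc _ ≤ (d + 2) / r * S + |L| * (S * τ₀) := by linarith
          _ = _ := by ring)
    simp only [h0', sub_self, sub_zero] at this
    exact this.trans (by gcongr; linarith [hx.2])

/-- Two solutions with the same initial value coincide as long as, at every positive radius,
either the derivative is nonzero or `f` is Lipschitz near the value of the solution. -/
theorem SolOn.unique {d : ℕ} {f : ℝ → ℝ} {R : ℝ} (hf : Continuous f)
    {u u' v v' : ℝ → ℝ} (hu : SolOn d f R u u') (hv : SolOn d f R v v') (h0 : u 0 = v 0)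
    (hf0 : f (u 0) ≠ 0) (hloc : ∀ r, 0 < r → r < R → u' r ≠ 0 ∨ LipNear f (u r)) :
    ∀ r ∈ Ico 0 R, u r = v r ∧ u' r = v' r := by
  intro r hr
  have hsub : Icc 0 r ⊆ Ico 0 R := fun x hx => ⟨hx.1, hx.2.trans_lt hr.2⟩
  set T : Set ℝ := {x | u x - v x = 0 ∧ u' x - v' x = 0}
  have hclosed : IsClosed (T ∩ Icc 0 r) := by
    have h1 : IsClosed (Icc 0 r ∩ (fun x => (u x - v x, u' x - v' x)) ⁻¹' {(0, 0)}) :=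
      (((hu.cont.sub hv.cont).mono hsub).prodMk
        ((hu.cont'.sub hv.cont').mono hsub)).preimage_isClosed_of_isClosed isClosed_Icc
        isClosed_singleton
    convert h1 using 1
    ext x
    simp [T, and_comm]
  -- Continuous induction: the set of agreement is closed and extends to the right of each of its
  -- points.
  have key : Icc 0 r ⊆ T := by
    refine hclosed.Icc_subset_of_forall_mem_nhdsWithin ⟨by simp [h0], by simp [hu.init, hv.init]⟩ ?_
    rintro x ⟨⟨hx1, hx2⟩, hx⟩
    have hxR : x < R := hx.2.trans hr.2
    have hstep : ∃ τ > 0, ∀ y ∈ Icc x (x + τ), u y = v y ∧ u' y = v' y := by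
      rcases hx.1.eq_or_lt with rfl | hx0
      · exact hu.eq_near_zero hxR hf hv h0 hf0
      · exact hu.eq_near_pos hx0 hxR hf hv (sub_eq_zero.1 hx1) (sub_eq_zero.1 hx2) (hloc x hx0 hxR)
    obtain ⟨τ, hτ, h⟩ := hstep
    filter_upwards [Ioo_mem_nhdsGT (show x < x + τ by linarith)] with y hy
    have := h y ⟨hy.1.le, hy.2.le⟩
    exact ⟨sub_eq_zero.2 this.1, sub_eq_zero.2 this.2⟩
  have := key ⟨hr.1, le_rfl⟩
  exact ⟨sub_eq_zero.1 this.1, sub_eq_zero.1 this.2⟩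

/-! ### The shape of the nonlinearity and its consequences -/

/-- The nonlinearity is odd and continuous, nonpositive on `[0, b]`, positive on `(b, ∞)`, and its
primitive is negative on `(0, β)` and vanishes at `β`. -/
structure Shape (f : ℝ → ℝ) (b β : ℝ) : Prop where
  cont : Continuous f
  odd : ∀ s, f (-s) = -f s
  b_pos : 0 < b
  b_lt : b < β
  pos : ∀ s, b < s → 0 < f s
  nonpos : ∀ s ∈ Icc 0 b, f s ≤ 0
  prim_neg : ∀ s ∈ Ioo 0 β, prim f s < 0
  prim_beta : prim f β = 0

namespace Shape

variable {f : ℝ → ℝ} {b β : ℝ}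

lemma beta_pos (h : Shape f b β) : 0 < β := h.b_pos.trans h.b_lt

lemma prim_lt (h : Shape f b β) {s t : ℝ} (hs : b ≤ s) (hst : s < t) : prim f s < prim f t :=
  lt_of_hasDerivAt_pos hst (continuous_prim h.cont).continuousOn
    (fun x _ => hasDerivAt_prim h.cont x) fun x hx => h.pos x (hs.trans_lt hx.1)

lemma prim_pos (h : Shape f b β) {s : ℝ} (hs : β < s) : 0 < prim f s :=
  h.prim_beta ▸ h.prim_lt h.b_lt.le hs

lemma prim_nonpos (h : Shape f b β) {s : ℝ} (hs : |s| ≤ β) : prim f s ≤ 0 := by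
  rw [← prim_abs h.odd]
  rcases (abs_nonneg s).eq_or_lt with h0 | h0
  · rw [← h0]; simp
  rcases hs.eq_or_lt with h1 | h1
  · rw [h1, h.prim_beta]
  · exact (h.prim_neg _ ⟨h0, h1⟩).le

lemma prim_neg' (h : Shape f b β) {s : ℝ} (hs : |s| < β) (h0 : s ≠ 0) : prim f s < 0 := by
  rw [← prim_abs h.odd]
  exact h.prim_neg _ ⟨abs_pos.2 h0, hs⟩

lemma beta_le_of_prim_nonneg (h : Shape f b β) {s : ℝ} (h0 : s ≠ 0) (hs : 0 ≤ prim f s) :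
    β ≤ |s| := by
  by_contra hcon
  exact absurd (h.prim_neg' (not_le.1 hcon) h0) (not_lt.2 hs)

lemma prim_nonneg (h : Shape f b β) {s : ℝ} (hs : β ≤ s) : 0 ≤ prim f s := by
  rcases hs.eq_or_lt with rfl | hs
  · rw [h.prim_beta]
  · exact (h.prim_pos hs).le

end Shape

lemma energy_neg {f u u' : ℝ → ℝ} (hodd : ∀ s, f (-s) = -f s) (r : ℝ) :
    energy f (fun x => -u x) (fun x => -u' x) r = energy f u u' r := by
  simp [energy, prim_neg hodd]

lemma energy_of_eq_zero {f u u' : ℝ → ℝ} {r : ℝ} (h : u r = 0) : 0 ≤ energy f u u' r := by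
  simp only [energy, h, prim_zero_right]; positivity

lemma energy_of_deriv_eq_zero {f u u' : ℝ → ℝ} {r : ℝ} (h : u' r = 0) :
    energy f u u' r = prim f (u r) := by
  simp [energy, h]

/-! ### Bounds and sign changes from the energy -/

section Qualitative

variable {d : ℕ} {f : ℝ → ℝ} {b β : ℝ} {u u' : ℝ → ℝ}

/-- A solution that starts above `β` is bounded by its initial value. -/
lemma Sol.abs_le_init (hf : Shape f b β) (h : Sol d f u u') (h0 : β ≤ u 0) {r : ℝ} (hr : 0 ≤ r) :
    |u r| ≤ u 0 := by
  by_contra hcon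
  push Not at hcon
  have h1 := h.energy_antitone hf.cont le_rfl hr
  rw [energy_of_deriv_eq_zero h.init] at h1
  -- Above `β` the primitive is strictly increasing, so a larger modulus would require more than the
  -- initial energy.
  have h2 := hf.prim_lt (hf.b_lt.le.trans h0) hcon
  rw [prim_abs hf.odd] at h2
  have h3 : prim f (u r) ≤ energy f u u' r := by unfold energy; nlinarith [sq_nonneg (u' r)]
  linarith

lemma Sol.exists_zero (h : Sol d f u u') {r t : ℝ} (hr : 0 ≤ r) (hrt : r < t)
    (hneg : u r * u t < 0) : ∃ z ∈ Ioo r t, u z = 0 := by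
  have hc : ContinuousOn u (Icc r t) := h.cont.mono fun x hx => hr.trans hx.1
  rcases mul_neg_iff.1 hneg with ⟨h1, h2⟩ | ⟨h1, h2⟩
  · obtain ⟨z, hz, hz0⟩ := intermediate_value_Ioo' hrt.le hc ⟨h2, h1⟩
    exact ⟨z, hz, hz0⟩
  · obtain ⟨z, hz, hz0⟩ := intermediate_value_Ioo hrt.le hc ⟨h1, h2⟩
    exact ⟨z, hz, hz0⟩

/-- Once the energy is negative, the sign does not change any more. -/
lemma Sol.mul_pos_of_energy_neg (hf : Continuous f) (h : Sol d f u u') {r t : ℝ} (hr : 0 ≤ r)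
    (hrt : r ≤ t) (hE : energy f u u' r < 0) : 0 < u r * u t := by
  have hne : ∀ x, r ≤ x → u x ≠ 0 := fun x hx h0 =>
    absurd (energy_of_eq_zero (f := f) (u' := u') h0)
      (not_le.2 ((h.energy_antitone hf hr hx).trans_lt hE))
  rcases lt_or_gt_of_ne (mul_ne_zero (hne r le_rfl) (hne t hrt)) with h1 | h1
  · rcases hrt.eq_or_lt with rfl | hrt
    · exact absurd h1 (not_lt.2 (mul_self_nonneg _))
    obtain ⟨z, hz, hz0⟩ := h.exists_zero hr hrt h1
    exact absurd hz0 (hne z hz.1.le)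
  · exact h1

/-- Between two sign changes, the solution reaches `β` in absolute value. -/
lemma Sol.exists_extremum (hf : Shape f b β) (h : Sol d f u u') {r t t' : ℝ} (hr : 0 ≤ r)
    (hrt : r < t) (htt : t < t') (h1 : u r * u t < 0) (h2 : u t * u t' < 0) :
    ∃ x ∈ Ioo r t', u r * u x < 0 ∧ u x * u t' < 0 ∧ β ≤ |u x| ∧ 0 ≤ energy f u u' x := by
  wlog hpos : 0 < u r generalizing u u'
  · have hneg : u r < 0 := lt_of_le_of_ne (not_lt.1 hpos) fun h0 => by simp [h0] at h1
    obtain ⟨x, hx, a1, a2, a3, a4⟩ := this (h.neg hf.odd) (by simpa using h1) (by simpa using h2)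
      (by simpa using hneg)
    exact ⟨x, hx, by simpa using a1, by simpa using a2, by simpa using a3,
      by rwa [energy_neg hf.odd] at a4⟩
  have ht : u t < 0 := by
    by_contra hc
    exact absurd h1 (not_lt.2 (mul_nonneg hpos.le (not_lt.1 hc)))
  have ht' : 0 < u t' := by
    by_contra hc
    exact absurd h2 (not_lt.2 (mul_nonneg_of_nonpos_of_nonpos ht.le (not_lt.1 hc)))
  have hrt' := hrt.trans htt
  -- At the minimum between the sign changes the energy is `F(u)`; a zero occurs later, where the
  -- energy is nonnegative, and energy only decreases.
  obtain ⟨x, hx, hmin⟩ := isCompact_Icc.exists_isMinOn (s := Icc r t') ⟨r, left_mem_Icc.2 hrt'.le⟩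
    (h.cont.mono fun y hy => hr.trans hy.1)
  have hxt : u x ≤ u t := hmin ⟨hrt.le, htt.le⟩
  have hx0 : u x < 0 := hxt.trans_lt ht
  have hxr : r < x := lt_of_le_of_ne hx.1 fun e => by rw [← e] at hx0; linarith
  have hxt' : x < t' := lt_of_le_of_ne hx.2 fun e => by rw [e] at hx0; linarith
  have hlm : IsLocalMin u x := by
    filter_upwards [Ioo_mem_nhds hxr hxt'] with y hy using hmin ⟨hy.1.le, hy.2.le⟩
  have hd := hlm.hasDerivAt_eq_zero (h.hasDeriv x (hr.trans_lt hxr))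
  have hneg : u x * u t' < 0 := mul_neg_of_neg_of_pos hx0 ht'
  obtain ⟨z, hz, hz0⟩ := h.exists_zero (hr.trans hxr.le) hxt' hneg
  have hE : 0 ≤ energy f u u' x := (energy_of_eq_zero (u' := u') hz0).trans
    (h.energy_antitone hf.cont (hr.trans hxr.le) hz.1.le)
  refine ⟨x, ⟨hxr, hxt'⟩, mul_neg_of_pos_of_neg hpos hx0, hneg, ?_, hE⟩
  rw [energy_of_deriv_eq_zero hd] at hE
  exact hf.beta_le_of_prim_nonneg hx0.ne hE

/-! ### Solutions of nonnegative energy with finitely many sign changes -/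

/-- A maximal chain of alternations ends at a point whose sign is never opposed afterwards; the
bound on its length drives the induction. -/
lemma exists_oneSigned : ∀ {j : ℕ} {r : ℝ}, u r ≠ 0 → ¬ AltFrom u (j + 1) r →
    ∃ R, r ≤ R ∧ ((∀ t, R < t → 0 ≤ u t) ∨ ∀ t, R < t → u t ≤ 0) := by
  intro j
  induction j with
  | zero =>
    intro r h0 h
    refine ⟨r, le_rfl, ?_⟩
    have h1 : ∀ t, r < t → 0 ≤ u r * u t := fun t ht => by
      by_contra hc
      exact h ⟨t, ht, trivial, not_le.1 hc, trivial⟩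
    rcases lt_or_gt_of_ne h0 with h2 | h2
    · exact Or.inr fun t ht => by nlinarith [h1 t ht]
    · exact Or.inl fun t ht => by
        by_contra hc
        nlinarith [h1 t ht, mul_neg_of_pos_of_neg h2 (not_le.1 hc)]
  | succ j ih =>
    intro r h0 h
    by_cases hex : ∃ t, r < t ∧ u r * u t < 0
    · obtain ⟨t, ht, hneg⟩ := hex
      have hne : u t ≠ 0 := fun e => by simp [e] at hneg
      obtain ⟨R, hR, hR'⟩ := ih hne fun hc => h ⟨t, ht, trivial, hneg, hc⟩
      exact ⟨R, ht.le.trans hR, hR'⟩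
    · push Not at hex
      refine ⟨r, le_rfl, ?_⟩
      rcases lt_or_gt_of_ne h0 with h2 | h2
      · exact Or.inr fun t ht => by nlinarith [hex t ht]
      · exact Or.inl fun t ht => by
          by_contra hc
          nlinarith [hex t ht, mul_neg_of_pos_of_neg h2 (not_le.1 hc)]

lemma not_deriv_le_neg (h : Sol d f u u') {A R c : ℝ} (hR : 0 ≤ R) (hc : 0 < c)
    (hA : ∀ r, 0 ≤ r → |u r| ≤ A) (hle : ∀ r, R < r → u' r ≤ -c) : False := by
  have hA0 : 0 ≤ A := (abs_nonneg _).trans (hA 0 le_rfl)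
  set t := R + (2 * A + 1) / c with ht
  have htR : R ≤ t := by
    have : 0 ≤ (2 * A + 1) / c := by positivity
    linarith
  have h1 := ge_of_hasDerivAt_nonpos (g := fun r => u r + c * r) (g' := fun r => u' r + c) htR
    ((h.cont.mono fun x hx => hR.trans hx.1).add (by fun_prop))
    (fun x hx => ((h.hasDeriv x (hR.trans_lt hx.1)).add
      ((hasDerivAt_id x).const_mul c)).congr_deriv (by simp))
    (fun x hx => by linarith [hle x hx.1])
  have h2 : c * t = c * R + (2 * A + 1) := by rw [ht]; field_simp
  have h3 := abs_le.1 (hA t (hR.trans htR))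
  have h4 := abs_le.1 (hA R hR)
  linarith [h3.1, h4.2]

/-- If `f ℓ > 0`, the flux decreases at least like a multiple of `-r^n`, so `u'` tends to `-∞` and
`u` could not stay bounded. -/
lemma apply_limit_nonpos (hf : Continuous f) (h : Sol d f u u') {A ℓ : ℝ}
    (hA : ∀ r, 0 ≤ r → |u r| ≤ A) (hlim : Tendsto u atTop (𝓝 ℓ)) : f ℓ ≤ 0 := by
  by_contra hcon
  push Not at hcon
  set c := f ℓ / 2 with hc
  have hc0 : 0 < c := by linarith
  have hev : ∀ᶠ r in atTop, c < f (u r) :=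
    ((hf.tendsto ℓ).comp hlim).eventually_const_lt (by linarith)
  obtain ⟨R, hR⟩ := eventually_atTop.1 (hev.and (eventually_ge_atTop 1))
  have hR1 : 1 ≤ R := (hR R le_rfl).2
  set K := R ^ (d + 2) * u' R + c * R ^ (d + 3) / (d + 3) with hK
  have hn : (0 : ℝ) < d + 3 := by positivity
  have hflux : ∀ r, R < r → u' r * r ^ (d + 2) ≤ K - c * r ^ (d + 3) / (d + 3) := by
    intro r hr
    have key := ge_of_hasDerivAt_nonpos
      (g := fun t => t ^ (d + 2) * u' t + c * t ^ (d + 3) / (d + 3))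
      (g' := fun t => -(t ^ (d + 2) * f (u t)) + c * t ^ (d + 2)) hr.le
      (((continuousOn_pow _).mul (h.cont'.mono fun x hx => by
        have : R ≤ x := hx.1
        exact mem_Ici.2 (by linarith))).add (by fun_prop))
      (fun t ht => ((h.solOn (t + 1)).hasDerivAt_flux (by linarith [ht.1]) (by linarith)).add (by
        refine (((hasDerivAt_pow (d + 3) t).const_mul c).div_const (d + 3 : ℝ)).congr_deriv ?_
        simp only [show d + 3 - 1 = d + 2 by omega]
        push_cast; field_simp))
      (fun t ht => by
        have h1 := (hR t ht.1.le).1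
        have h2 : 0 < t ^ (d + 2) := pow_pos (by linarith [ht.1]) _
        nlinarith)
    linarith
  refine not_deriv_le_neg h (A := A) (R := max R ((|K| + 1) * (d + 3) / c)) (c := 1)
    (le_max_of_le_left (by linarith)) one_pos hA fun r hr => ?_
  have hrR : R < r := (le_max_left _ _).trans_lt hr
  have hrK : (|K| + 1) * (d + 3) / c < r := (le_max_right _ _).trans_lt hr
  have hr0 : 1 ≤ r := by linarith
  have h1 := hflux r hrR
  have hp : 1 ≤ r ^ (d + 2) := one_le_pow₀ hr0
  have h2 : c * r ^ (d + 3) / (d + 3) = (c * r / (d + 3)) * r ^ (d + 2) := by ring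
  have h3 : K ≤ |K| * r ^ (d + 2) := (le_abs_self K).trans (le_mul_of_one_le_right (abs_nonneg _) hp)
  have h4 : u' r * r ^ (d + 2) ≤ (|K| - c * r / (d + 3)) * r ^ (d + 2) := by
    rw [sub_mul]; linarith
  have h5 := le_of_mul_le_mul_right h4 (by linarith)
  have h6 : |K| + 1 ≤ c * r / (d + 3) := by
    rw [le_div_iff₀ hn]
    rw [div_lt_iff₀ hc0] at hrK
    linarith
  linarith

/-- Constant energy means no dissipation, hence `u' = 0`. This argument needs no uniqueness for the
initial value problem. -/
lemma Sol.eq_of_energy_eq_zero (hf : Continuous f) (h : Sol d f u u') {z : ℝ} (hz : 0 ≤ z)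
    (hE : ∀ r, z ≤ r → energy f u u' r = 0) {r : ℝ} (hr : z ≤ r) : u r = u z := by
  have hd : ∀ t, z < t → u' t = 0 := by
    intro t ht
    have h1 := h.hasDerivAt_energy hf (hz.trans_lt ht)
    have h2 : HasDerivAt (energy f u u') 0 t :=
      (hasDerivAt_const t (0 : ℝ)).congr_of_eventuallyEq
        (by filter_upwards [lt_mem_nhds ht] with x hx using hE x hx.le)
    have h3 := h1.unique h2
    have h4 : 0 < (d + 2 : ℝ) / t := div_pos (by positivity) (hz.trans_lt ht)
    have h5 : u' t ^ 2 = 0 := by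
      by_contra hne
      have : 0 < u' t ^ 2 := lt_of_le_of_ne (sq_nonneg _) (Ne.symm hne)
      nlinarith [mul_pos h4 this]
    exact pow_eq_zero_iff two_ne_zero |>.1 h5
  have h1 := abs_sub_le_of_hasDerivAt (C := 0) hr (h.cont.mono fun x hx => hz.trans hx.1)
    (fun x hx => h.hasDeriv x (hz.trans_lt hx.1)) (fun x hx => by simp [hd x hx.1])
  rw [zero_mul] at h1
  exact sub_eq_zero.1 (abs_nonpos_iff.1 h1)

lemma tendsto_of_deriv_sign (h : Sol d f u u') {A R : ℝ} (hR : 0 ≤ R)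
    (hA : ∀ r, 0 ≤ r → |u r| ≤ A) (hs : ∀ r, R < r → u' r ≤ 0) : ∃ ℓ, Tendsto u atTop (𝓝 ℓ) := by
  have hanti : Antitone fun r => u (max r R) := by
    intro x y hxy
    exact ge_of_hasDerivAt_nonpos (max_le_max_right R hxy)
      (h.cont.mono fun t ht => hR.trans ((le_max_right _ _).trans ht.1))
      (fun t ht => h.hasDeriv t (hR.trans_lt ((le_max_right _ _).trans_lt ht.1)))
      (fun t ht => hs t ((le_max_right _ _).trans_lt ht.1))
  have heq : (fun r => u (max r R)) =ᶠ[atTop] u := by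
    filter_upwards [eventually_ge_atTop R] with r hr
    rw [max_eq_left hr]
  rcases tendsto_atTop_of_antitone hanti with h1 | ⟨ℓ, h1⟩
  · have h2 := (h1.eventually (eventually_lt_atBot (-A))).exists
    obtain ⟨r, hr⟩ := h2
    have := abs_le.1 (hA (max r R) (hR.trans (le_max_right _ _)))
    linarith [this.1]
  · exact ⟨ℓ, h1.congr' heq⟩

/-- Monotonicity gives a limit `ℓ ≥ 0`. If `ℓ > 0`, then `f ℓ ≤ 0` puts `ℓ` below `β`, so `F(ℓ) <
0`, and nonnegative energy keeps `|u'|` away from zero, against boundedness. -/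
lemma tendsto_zero_of_deriv_nonpos (hf : Shape f b β) (h : Sol d f u u') {A R : ℝ} (hR : 0 ≤ R)
    (hA : ∀ r, 0 ≤ r → |u r| ≤ A) (hE : ∀ r, 0 ≤ r → 0 ≤ energy f u u' r)
    (hpos : ∀ t, R < t → 0 ≤ u t) (hs : (∀ r, R < r → u' r ≤ 0) ∨ ∀ r, R < r → 0 ≤ u' r) :
    Tendsto u atTop (𝓝 0) := by
  obtain ⟨ℓ, hℓ⟩ : ∃ ℓ, Tendsto u atTop (𝓝 ℓ) := by
    rcases hs with hs | hs
    · exact tendsto_of_deriv_sign h hR hA hs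
    · obtain ⟨ℓ, hℓ⟩ := tendsto_of_deriv_sign (h.neg hf.odd) hR (A := A)
        (fun r hr => by simpa using hA r hr) (fun r hr => by simpa using hs r hr)
      exact ⟨-ℓ, by simpa using hℓ.neg⟩
  have hℓ0 : 0 ≤ ℓ := ge_of_tendsto hℓ (by
    filter_upwards [eventually_gt_atTop R] with t ht using hpos t ht)
  rcases hℓ0.eq_or_lt with rfl | hℓ0
  · exact hℓ
  exfalso
  have hℓβ : ℓ < β := by
    by_contra hc
    exact absurd (apply_limit_nonpos hf.cont h hA hℓ)
      (not_le.2 (hf.pos ℓ (hf.b_lt.trans_le (not_lt.1 hc))))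
  set c := -prim f ℓ with hc
  have hc0 : 0 < c := by have := hf.prim_neg ℓ ⟨hℓ0, hℓβ⟩; linarith
  have hev : ∀ᶠ r in atTop, prim f (u r) < -(c / 2) :=
    (((continuous_prim hf.cont).tendsto ℓ).comp hℓ).eventually_lt_const (by linarith)
  obtain ⟨R', hR'⟩ := eventually_atTop.1 hev
  have hsq : ∀ r, max R R' < r → √c ≤ |u' r| := by
    intro r hr
    have h1 := hE r (hR.trans ((le_max_left _ _).trans hr.le))
    have h2 := hR' r ((le_max_right _ _).trans hr.le)
    refine Real.sqrt_le_iff.2 ⟨abs_nonneg _, ?_⟩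
    rw [sq_abs]
    unfold energy at h1
    linarith
  have hm : 0 ≤ max R R' := hR.trans (le_max_left _ _)
  rcases hs with hs | hs
  · refine not_deriv_le_neg h hm (Real.sqrt_pos.2 hc0) hA fun r hr => ?_
    have := hsq r hr
    rw [abs_of_nonpos (hs r ((le_max_left _ _).trans_lt hr))] at this
    linarith
  · refine not_deriv_le_neg (h.neg hf.odd) hm (Real.sqrt_pos.2 hc0) (A := A)
      (fun r hr => by simpa using hA r hr) fun r hr => ?_
    have := hsq r hr
    rw [abs_of_nonneg (hs r ((le_max_left _ _).trans_lt hr))] at this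
    simpa using this

/-- A zero of `u` would be a minimum of zero energy, after which `u` vanishes. Otherwise nonnegative
energy forces `u ≥ β` at critical points, so `u'' < 0` there and `u` is eventually monotone. -/
lemma tendsto_zero_of_nonneg (hf : Shape f b β) (h : Sol d f u u') {A R : ℝ} (hR : 0 ≤ R)
    (hA : ∀ r, 0 ≤ r → |u r| ≤ A) (hE : ∀ r, 0 ≤ r → 0 ≤ energy f u u' r)
    (hpos : ∀ t, R < t → 0 ≤ u t) : Tendsto u atTop (𝓝 0) := by
  by_cases hz : ∃ z, R < z ∧ u z = 0
  · obtain ⟨z, hz, hz0⟩ := hz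
    have hz' : 0 < z := hR.trans_lt hz
    have hlm : IsLocalMin u z := by
      filter_upwards [lt_mem_nhds hz] with y hy
      rw [hz0]; exact hpos y hy
    have hd := hlm.hasDerivAt_eq_zero (h.hasDeriv z hz')
    have hE0 : energy f u u' z = 0 := by rw [energy_of_deriv_eq_zero hd, hz0, prim_zero_right]
    have hE' : ∀ r, z ≤ r → energy f u u' r = 0 := fun r hr =>
      le_antisymm (hE0 ▸ h.energy_antitone hf.cont hz'.le hr) (hE r (hz'.le.trans hr))
    refine tendsto_const_nhds.congr' ?_
    filter_upwards [eventually_ge_atTop z] with r hr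
    exact ((h.eq_of_energy_eq_zero hf.cont hz'.le hE' hr).trans hz0).symm
  · push Not at hz
    have hpos' : ∀ t, R < t → 0 < u t := fun t ht => lt_of_le_of_ne (hpos t ht) (hz t ht).symm
    have hcrit : ∀ t, R < t → u' t = 0 → 0 < f (u t) := by
      intro t ht h0
      have h1 := hE t (hR.trans ht.le)
      rw [energy_of_deriv_eq_zero h0] at h1
      have h2 := hf.beta_le_of_prim_nonneg (hz t ht) h1
      rw [abs_of_pos (hpos' t ht)] at h2
      exact hf.pos _ (hf.b_lt.trans_le h2)
    by_cases hneg : ∃ t, R < t ∧ u' t ≤ 0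
    · obtain ⟨t, ht, ht0⟩ := hneg
      have ht' : 0 < t := hR.trans_lt ht
      refine tendsto_zero_of_deriv_nonpos hf h ht'.le hA hE
        (fun x hx => hpos x (ht.trans hx)) (Or.inl fun r hr => ?_)
      -- Once `u'` is nonpositive it stays so, because it is strictly decreasing at each of its
      -- zeros.
      refine image_le_of_deriv_right_lt_deriv_boundary' (a := t) (b := r)
        (h.cont'.mono fun x hx => ht'.le.trans hx.1)
        (fun x hx => (h.hasDeriv' x (ht'.trans_le hx.1)).hasDerivWithinAt)
        (B := fun _ => 0) (B' := fun _ => 0) ht0 continuousOn_const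
        (fun x _ => hasDerivWithinAt_const _ _ _) (fun x hx h0 => ?_) ⟨hr.le, le_rfl⟩
      have := hcrit x (ht.trans_le hx.1) h0
      rw [h0]; simpa using this
    · push Not at hneg
      exact tendsto_zero_of_deriv_nonpos hf h hR hA hE hpos (Or.inr fun r hr => (hneg r hr).le)

/-- A solution of nonnegative energy with finitely many sign changes tends to zero. -/
lemma Sol.tendsto_zero (hf : Shape f b β) (h : Sol d f u u') (h0 : β ≤ u 0)
    (hE : ∀ r, 0 ≤ r → 0 ≤ energy f u u' r) {j : ℕ} (hj : ¬ AltFrom u (j + 1) 0) :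
    Tendsto u atTop (𝓝 0) := by
  have hA : ∀ r, 0 ≤ r → |u r| ≤ u 0 := fun r hr => h.abs_le_init hf h0 hr
  obtain ⟨R, hR, h1 | h1⟩ := exists_oneSigned (hf.beta_pos.trans_le h0).ne' hj
  · exact tendsto_zero_of_nonneg hf h hR hA hE h1
  · have := tendsto_zero_of_nonneg hf (h.neg hf.odd) hR (fun r hr => by simpa using hA r hr)
      (fun r hr => by rw [energy_neg hf.odd]; exact hE r hr) (fun t ht => by simpa using h1 t ht)
    simpa using this.neg

end Qualitative

/-! ### Sign changes of limits of solutions -/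

lemma eventually_altFrom {u : ℕ → ℝ → ℝ} {v : ℝ → ℝ} (h : ConvOn (Ici 0) u v) :
    ∀ {j : ℕ} {r : ℝ}, 0 ≤ r → AltFrom v j r → ∀ᶠ m in hyp, AltFrom (u m) j r
  | 0, _, _, _ => Eventually.of_forall fun _ => trivial
  | j + 1, r, hr, ⟨t, h1, _, h3, h4⟩ => by
    have ht : 0 ≤ t := hr.trans h1.le
    filter_upwards [((h.tendsto hr).mul (h.tendsto ht)).eventually_lt_const h3,
      eventually_altFrom h ht h4] with m hm hm'
    exact ⟨t, h1, trivial, hm, hm'⟩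

/-- The alternation points stay in a compact interval and so converge; the lower bound `c` keeps the
limiting products strictly negative. -/
lemma altFrom_of_convOn {u : ℕ → ℝ → ℝ} {v : ℝ → ℝ} (h : ConvOn (Ici 0) u v) {R c : ℝ} (hc : 0 < c)
    {P : ℕ → ℝ → Prop} (hP : ∀ᶠ m in hyp, ∀ t, P m t → 0 ≤ t ∧ t ≤ R ∧ c ≤ |u m t|) :
    ∀ {j : ℕ} {x : ℕ → ℝ} {y : ℝ}, (∀ᶠ m in hyp, AltIn (P m) (u m) j (x m)) →
      (∀ᶠ m in hyp, 0 ≤ x m) → 0 ≤ y → Tendsto x hyp (𝓝 y) → v y ≠ 0 → AltFrom v j y := by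
  intro j
  induction j with
  | zero => intros; trivial
  | succ j ih =>
    intro x y halt hx0 hy0 hxy hvy
    have hex : ∀ m, ∃ t, AltIn (P m) (u m) (j + 1) (x m) →
        x m < t ∧ P m t ∧ u m (x m) * u m t < 0 ∧ AltIn (P m) (u m) j t := by
      intro m
      by_cases hm : AltIn (P m) (u m) (j + 1) (x m)
      · obtain ⟨t, ht⟩ := hm
        exact ⟨t, fun _ => ht⟩
      · exact ⟨0, fun h => (hm h).elim⟩
    choose t ht using hex
    have hPt : ∀ᶠ m in hyp, 0 ≤ t m ∧ t m ≤ R ∧ c ≤ |u m (t m)| := by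
      filter_upwards [halt, hP] with m h1 h2 using h2 _ (ht m h1).2.1
    obtain ⟨z, hz, htz⟩ := exists_tendsto_hyp (x := t) (a := 0) (b := R)
      (hPt.mono fun m h => ⟨h.1, h.2.1⟩)
    have hlim := h t z (hPt.mono fun m h => h.1) hz.1 htz
    have hvz : c ≤ |v z| := ge_of_tendsto hlim.abs (hPt.mono fun m h => h.2.2)
    have hvz0 : v z ≠ 0 := abs_pos.1 (hc.trans_le hvz)
    have hprod : v y * v z ≤ 0 := le_of_tendsto ((h x y hx0 hy0 hxy).mul hlim)
      (halt.mono fun m hm => (ht m hm).2.2.1.le)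
    have hneg : v y * v z < 0 := lt_of_le_of_ne hprod (mul_ne_zero hvy hvz0)
    have hyz : y ≤ z := le_of_tendsto_of_tendsto hxy htz (halt.mono fun m hm => (ht m hm).1.le)
    refine ⟨z, lt_of_le_of_ne hyz ?_, trivial, hneg, ih (halt.mono fun m hm => (ht m hm).2.2.2)
      (hPt.mono fun m h => h.1) hz.1 htz hvz0⟩
    rintro rfl
    exact absurd hneg (not_lt.2 (mul_self_nonneg _))

/-! ### Control of late sign changes -/

section

variable {d : ℕ} {f : ℝ → ℝ} {b β : ℝ} {u u' : ℝ → ℝ}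

/-- The extrema between consecutive sign changes replace the alternation points, at the cost of the
last one. -/
lemma Sol.altIn_large (hf : Shape f b β) (h : Sol d f u u') :
    ∀ {j : ℕ} {r : ℝ}, 0 ≤ r → AltFrom u (j + 1) r →
      AltIn (fun t => 0 ≤ t ∧ β ≤ |u t| ∧ 0 ≤ energy f u u' t) u j r
  | 0, _, _, _ => trivial
  | j + 1, r, hr, ⟨t, h1, _, h2, t', h3, _, h4, h5⟩ => by
    obtain ⟨x, hx, a1, a2, a3, a4⟩ := h.exists_extremum hf hr h1 h3 h2 h4
    have hx0 : 0 ≤ x := hr.trans hx.1.le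
    exact ⟨x, hx.1, ⟨hx0, a3, a4⟩, a1, h.altIn_large hf hx0 ⟨t', hx.2, trivial, a2, h5⟩⟩

/-- No sign change occurs after `R`, so `R` itself can be the last alternation point and, in
contrast to `Sol.altIn_large`, none is lost. -/
lemma Sol.altIn_of_energy_neg (hf : Shape f b β) (h : Sol d f u u') {R : ℝ}
    (hR : energy f u u' R < 0) : ∀ {j : ℕ} {r : ℝ}, 0 ≤ r → r < R → AltFrom u (j + 1) r →
      AltIn (fun t => 0 ≤ t ∧ ((β ≤ |u t| ∧ 0 ≤ energy f u u' t) ∨ t = R)) u (j + 1) r := by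
  intro j
  induction j with
  | zero =>
    rintro r hr hrR ⟨t, h1, _, h2, _⟩
    have hR0 : 0 ≤ R := hr.trans hrR.le
    have huR : u R ≠ 0 := fun e => absurd (energy_of_eq_zero (u' := u') e) (not_le.2 hR)
    rcases lt_or_ge (u r * u R) 0 with hneg | hpos
    · exact ⟨R, hrR, ⟨hR0, Or.inr rfl⟩, hneg, trivial⟩
    have hur : u r ≠ 0 := fun e => by simp [e] at h2
    have hpos : 0 < u r * u R := lt_of_le_of_ne hpos (mul_ne_zero hur huR).symm
    have hneg : u t * u R < 0 := by
      rcases mul_pos_iff.1 hpos with ⟨a, b⟩ | ⟨a, b⟩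
      · exact mul_neg_of_neg_of_pos (by nlinarith) b
      · exact mul_neg_of_pos_of_neg (by nlinarith) b
    rcases le_or_gt R t with htR | htR
    · have := h.mul_pos_of_energy_neg hf.cont hR0 htR hR
      linarith [mul_comm (u R) (u t)]
    obtain ⟨x, hx, a1, a2, a3, a4⟩ := h.exists_extremum hf hr h1 htR h2 hneg
    exact ⟨x, hx.1, ⟨hr.trans hx.1.le, Or.inl ⟨a3, a4⟩⟩, a1, trivial⟩
  | succ j ih =>
    rintro r hr hrR ⟨t, h1, _, h2, t', h3, _, h4, h5⟩
    obtain ⟨x, hx, a1, a2, a3, a4⟩ := h.exists_extremum hf hr h1 h3 h2 h4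
    have hx0 : 0 ≤ x := hr.trans hx.1.le
    have hxR : x < R := by
      by_contra hc
      exact absurd (h.energy_antitone hf.cont (hr.trans hrR.le) (not_lt.1 hc))
        (not_le.2 (hR.trans_le a4))
    exact ⟨x, hx.1, ⟨hx0, Or.inl ⟨a3, a4⟩⟩, a1, ih hx0 hxR ⟨t', hx.2, trivial, a2, h5⟩⟩

/-- A small value together with a small energy prevents any later excursion. -/
lemma Sol.no_excursion (hf : Shape f b β) (h : Sol d f u u') {R S : ℝ} (hR : 0 < R) (hS : 0 ≤ S)
    (hSp : ∀ s, β / 4 ≤ s → s ≤ β / 2 → prim f s ≤ -(S ^ 2 / 2)) (huR : |u R| ≤ β / 4)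
    (hER : R * energy f u u' R < (d + 1) * S * (β / 4)) {t : ℝ} (ht : R ≤ t)
    (hut : β / 2 ≤ |u t|) (hEt : 0 ≤ energy f u u' t) : False := by
  have hβ := hf.beta_pos
  have hcont : ∀ {x y}, R ≤ x → ContinuousOn u (Icc x y) := fun hx =>
    h.cont.mono fun z hz => hR.le.trans (hx.trans hz.1)
  -- `t₂` is the first radius with `|u| ≥ β/2`; below, `t₁` is the last radius before it with `u ≤
  -- β/4`.
  obtain ⟨t₂, ⟨ht₂, hut₂⟩, hmin⟩ : ∃ t₂, IsLeast (Icc R t ∩ (fun x => |u x|) ⁻¹' Ici (β / 2)) t₂ :=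
    (isCompact_Icc.of_isClosed_subset ((hcont le_rfl).abs.preimage_isClosed_of_isClosed isClosed_Icc
      isClosed_Ici) inter_subset_left).exists_isLeast ⟨t, ⟨ht, le_rfl⟩, hut⟩
  replace hut₂ : β / 2 ≤ |u t₂| := hut₂
  have hlt : ∀ x, R ≤ x → x < t₂ → |u x| < β / 2 := fun x hx hxt => by
    by_contra hc
    exact absurd (hmin ⟨⟨hx, hxt.le.trans ht₂.2⟩, not_lt.1 hc⟩) (not_le.2 hxt)
  clear hmin
  wlog hpos : 0 ≤ u t₂ generalizing u u'
  · refine this (h.neg hf.odd) (by simpa using huR) (by rwa [energy_neg hf.odd])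
      (by simpa using hut) (by rwa [energy_neg hf.odd]) (fun hx => h.neg hf.odd |>.cont.mono fun z hz =>
        hR.le.trans (hx.trans hz.1)) (by simpa using hut₂)
      (fun x hx hx' => by simpa using hlt x hx hx') (by simpa using (not_le.1 hpos).le)
  rw [abs_of_nonneg hpos] at hut₂
  obtain ⟨t₁, ⟨ht₁, hut₁⟩, hmax⟩ : ∃ t₁, IsGreatest (Icc R t₂ ∩ u ⁻¹' Iic (β / 4)) t₁ :=
    (isCompact_Icc.of_isClosed_subset ((hcont le_rfl).preimage_isClosed_of_isClosed isClosed_Icc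
      isClosed_Iic) inter_subset_left).exists_isGreatest
      ⟨R, ⟨le_rfl, ht₂.1⟩, (le_abs_self _).trans huR⟩
  have hut₁ : u t₁ ≤ β / 4 := hut₁
  have hgt : ∀ x, t₁ < x → x < t₂ → β / 4 < u x := fun x hx hxt => by
    by_contra hc
    exact absurd (hmax ⟨⟨ht₁.1.trans hx.le, hxt.le⟩, not_lt.1 hc⟩) (not_le.2 hx)
  have hEc : ∀ {x y}, R ≤ x → ContinuousOn (fun r => r ^ 2 * energy f u u' r) (Icc x y) := fun hx =>
    (continuousOn_pow 2).mul ((h.continuousOn_energy hf.cont).mono fun z hz =>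
      hR.le.trans (hx.trans hz.1))
  have step1 : t₁ ^ 2 * energy f u u' t₁ ≤ R ^ 2 * energy f u u' R := by
    refine ge_of_hasDerivAt_nonpos ht₁.1 (hEc le_rfl)
      (fun x hx => h.hasDerivAt_sq_mul_energy hf.cont (hR.trans hx.1)) fun x hx => ?_
    have hx0 : 0 < x := hR.trans hx.1
    have h1 := hf.prim_nonpos (s := u x)
      ((hlt x hx.1.le (hx.2.trans_le ht₁.2)).le.trans (by linarith))
    have h2 : 0 ≤ (d + 1 : ℝ) * x * u' x ^ 2 := by positivity
    nlinarith
  -- In the band between `β/4` and `β/2`, nonnegative energy forces `|u'| ≥ S`. Crossing it costs at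
  -- least `(d + 1) R S β/4` of `r^2 E`, more than is available at `R`.
  have step2 : t₂ ^ 2 * energy f u u' t₂ + (d + 1) * R * S * u t₂
      ≤ t₁ ^ 2 * energy f u u' t₁ + (d + 1) * R * S * u t₁ := by
    refine ge_of_hasDerivAt_nonpos (g := fun r => r ^ 2 * energy f u u' r + (d + 1) * R * S * u r)
      (g' := fun r => 2 * r * prim f (u r) - (d + 1) * r * u' r ^ 2 + (d + 1) * R * S * u' r) ht₁.2
      ((hEc ht₁.1).add (continuousOn_const.mul (hcont ht₁.1)))
      (fun x hx => (h.hasDerivAt_sq_mul_energy hf.cont (hR.trans_le (ht₁.1.trans hx.1.le))).add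
        ((h.hasDeriv x (hR.trans_le (ht₁.1.trans hx.1.le))).const_mul _)) fun x hx => ?_
    have hRx : R ≤ x := ht₁.1.trans hx.1.le
    have hx0 : 0 < x := hR.trans_le hRx
    have h1 := hSp (u x) (hgt x hx.1 hx.2).le ((le_abs_self _).trans (hlt x hRx hx.2).le)
    have h2 : 0 ≤ energy f u u' x := hEt.trans
      (h.energy_antitone hf.cont hx0.le (hx.2.le.trans ht₂.2))
    unfold energy at h2
    have h3 : S ≤ |u' x| := abs_le_of_sq_le_sq' (by rw [sq_abs]; linarith) (abs_nonneg _) |>.2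
    have h4 : R * S * u' x ≤ x * u' x ^ 2 := by
      have e1 : R * S * u' x ≤ R * S * |u' x| :=
        mul_le_mul_of_nonneg_left (le_abs_self _) (mul_nonneg hR.le hS)
      have e2 : R * S * |u' x| ≤ x * |u' x| * |u' x| :=
        mul_le_mul_of_nonneg_right (mul_le_mul hRx h3 hS hx0.le) (abs_nonneg _)
      have e3 : x * |u' x| * |u' x| = x * u' x ^ 2 := by rw [mul_assoc, abs_mul_abs_self]; ring
      linarith
    have h5 : x * prim f (u x) ≤ 0 := mul_nonpos_of_nonneg_of_nonpos hx0.le (by nlinarith [sq_nonneg S])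
    nlinarith [mul_le_mul_of_nonneg_left h4 (show (0 : ℝ) ≤ d + 1 by positivity)]
  have hE2 : 0 ≤ t₂ ^ 2 * energy f u u' t₂ := mul_nonneg (sq_nonneg _)
    (hEt.trans (h.energy_antitone hf.cont (hR.le.trans ht₂.1) ht₂.2))
  have h6 : (d + 1) * R * S * (β / 4) ≤ (d + 1) * R * S * (u t₂ - u t₁) :=
    mul_le_mul_of_nonneg_left (by linarith) (by positivity)
  have h7 : R ^ 2 * energy f u u' R < R * ((d + 1) * S * (β / 4)) := by
    rw [sq, mul_assoc]; exact mul_lt_mul_of_pos_left hER hR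
  nlinarith

/-- For a solution that tends to zero, `r` times the energy is eventually small. -/
lemma Sol.eventually_mul_energy_lt (hf : Shape f b β) (h : Sol d f u u')
    (hlim : Tendsto u atTop (𝓝 0)) {c : ℝ} (hc : 0 < c) :
    ∀ᶠ r in atTop, r * energy f u u' r < c := by
  have hβ := hf.beta_pos
  have hev : ∀ᶠ r in atTop, |u r| < β := by
    have := hlim.abs
    rw [abs_zero] at this
    exact this.eventually_lt_const hβ
  obtain ⟨R₀, hR₀⟩ := eventually_atTop.1 (hev.and (eventually_gt_atTop 0))
  have hR0 : 0 < R₀ := (hR₀ R₀ le_rfl).2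
  set K := R₀ ^ 2 * energy f u u' R₀ with hK
  filter_upwards [eventually_ge_atTop R₀, eventually_gt_atTop (K / c)] with r hr hrK
  have hr0 : 0 < r := hR0.trans_le hr
  -- Once `|u| < β` the quantity `r^2 E` no longer increases, so `r E` is at most `K / r`.
  have h1 : r ^ 2 * energy f u u' r ≤ K := by
    refine ge_of_hasDerivAt_nonpos hr ((continuousOn_pow 2).mul ((h.continuousOn_energy hf.cont).mono
      fun z hz => hR0.le.trans hz.1))
      (fun x hx => h.hasDerivAt_sq_mul_energy hf.cont (hR0.trans hx.1)) fun x hx => ?_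
    have hx0 : 0 < x := hR0.trans hx.1
    have h1 := hf.prim_nonpos (s := u x) (hR₀ x hx.1.le).1.le
    have h2 : 0 ≤ (d + 1 : ℝ) * x * u' x ^ 2 := by positivity
    nlinarith
  rw [div_lt_iff₀ hc] at hrK
  by_contra hcon
  nlinarith [mul_le_mul_of_nonneg_left (not_lt.1 hcon) hr0.le]

lemma Shape.exists_prim_le (hf : Shape f b β) :
    ∃ S, 0 < S ∧ ∀ s, β / 4 ≤ s → s ≤ β / 2 → prim f s ≤ -(S ^ 2 / 2) := by
  have hβ := hf.beta_pos
  obtain ⟨x, hx, hmax⟩ := isCompact_Icc.exists_isMaxOn (s := Icc (β / 4) (β / 2))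
    ⟨β / 4, left_mem_Icc.2 (by linarith)⟩ (continuous_prim hf.cont).continuousOn
  have h1 := hf.prim_neg x ⟨by linarith [hx.1], by linarith [hx.2]⟩
  refine ⟨√(-(2 * prim f x)), Real.sqrt_pos.2 (by linarith), fun s h2 h3 => ?_⟩
  rw [Real.sq_sqrt (by linarith)]
  have : prim f s ≤ prim f x := hmax ⟨h2, h3⟩
  linarith

/-- If infinitely many sign changes are lost in the limit, the limit is a bound state. -/
theorem tendsto_zero_of_altFrom_lost (hf : Shape f b β) {u u' : ℕ → ℝ → ℝ} {v v' : ℝ → ℝ}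
    (hu : ∀ᶠ m in hyp, Sol d f (u m) (u' m)) (hv : Sol d f v v') (h0 : β ≤ v 0)
    (hc : ConvOn (Ici 0) u v) (hc' : ConvOn (Ici 0) u' v') {j : ℕ}
    (hj : ∀ᶠ m in hyp, AltFrom (u m) (j + 1) 0) (hnot : ¬ AltFrom v (j + 1) 0) :
    Tendsto v atTop (𝓝 0) ∧ AltFrom v j 0 := by
  have hβ := hf.beta_pos
  have hv0 : v 0 ≠ 0 := (hβ.trans_le h0).ne'
  have hEc : ∀ r, 0 ≤ r → Tendsto (fun m => energy f (u m) (u' m) r) hyp (𝓝 (energy f v v' r)) :=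
    fun r hr => (((hc'.tendsto hr).pow 2).div_const 2).add
      (((continuous_prim hf.cont).tendsto _).comp (hc.tendsto hr))
  have hx0 : ∀ᶠ _ in hyp, (0 : ℝ) ≤ 0 := Eventually.of_forall fun _ => le_rfl
  -- If the limit keeps nonnegative energy it decays, and beyond a large `R` the nearby solutions
  -- make no further excursion, so `j` alternations survive in `[0, R]`. If its energy is negative
  -- at some `R`, all sign changes happen by `R` and none can be lost.
  by_cases hE : ∀ r, 0 ≤ r → 0 ≤ energy f v v' r
  · have hlim := hv.tendsto_zero hf h0 hE hnot
    refine ⟨hlim, ?_⟩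
    obtain ⟨S, hS, hSp⟩ := hf.exists_prim_le
    have habs := hlim.abs
    rw [abs_zero] at habs
    obtain ⟨R, hR1, hR2, hR3⟩ := ((hv.eventually_mul_energy_lt hf hlim
      (show 0 < (d + 1) * S * (β / 4) by positivity)).and ((habs.eventually_lt_const
        (show 0 < β / 4 by positivity)).and (eventually_gt_atTop 0))).exists
    refine altFrom_of_convOn hc (R := R) hβ ?_ (x := fun _ => 0) (hj.mp (hu.mono fun m hm hm' =>
      hm.altIn_large hf le_rfl hm')) hx0 le_rfl tendsto_const_nhds hv0
    filter_upwards [hu, (hc.tendsto hR3.le).abs.eventually_lt_const hR2,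
      ((hEc R hR3.le).const_mul R).eventually_lt_const hR1] with m h1 h2 h3 t ht
    refine ⟨ht.1, ?_, ht.2.1⟩
    by_contra htR
    exact h1.no_excursion hf hR3 hS.le hSp h2.le h3 (not_le.1 htR).le
      (by linarith [ht.2.1]) ht.2.2
  · exfalso
    push Not at hE
    obtain ⟨R, hR, hER⟩ := hE
    have hR0 : 0 < R := lt_of_le_of_ne hR fun e => by
      rw [← e, energy_of_deriv_eq_zero hv.init] at hER
      exact absurd (hf.prim_nonneg h0) (not_le.2 hER)
    have hvR : v R ≠ 0 := fun e => absurd (energy_of_eq_zero (u' := v') e) (not_le.2 hER)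
    have hvR' : 0 < |v R| := abs_pos.2 hvR
    have hER' := (hEc R hR).eventually_lt_const hER
    refine hnot (altFrom_of_convOn hc (R := R) (c := min β (|v R| / 2)) (by positivity) ?_
      (x := fun _ => 0) (P := fun m t => 0 ≤ t ∧
        ((β ≤ |u m t| ∧ 0 ≤ energy f (u m) (u' m) t) ∨ t = R)) ?_ hx0 le_rfl
        tendsto_const_nhds hv0)
    · filter_upwards [hu, hER', (hc.tendsto hR).abs.eventually_const_lt
        (show |v R| / 2 < |v R| by linarith)] with m h1 h2 h3 t ht
      rcases ht.2 with ⟨h4, h5⟩ | rfl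
      · refine ⟨ht.1, ?_, (min_le_left _ _).trans h4⟩
        by_contra hc
        exact absurd (h1.energy_antitone hf.cont hR (not_le.1 hc).le) (not_le.2 (h2.trans_le h5))
      · exact ⟨ht.1, le_rfl, (min_le_right _ _).trans h3.le⟩
    · filter_upwards [hu, hER', hj] with m h1 h2 h3
      exact h1.altIn_of_energy_neg hf h2 le_rfl hR0 h3

end

/-! ### Monotone branches of solutions, parametrized by their values -/

/-- `R s` is the radius at which a decreasing solution has the value `s`, and `p s` is minus its
derivative there. -/
structure Branch (d : ℕ) (f : ℝ → ℝ) (s₀ s₁ : ℝ) (R p : ℝ → ℝ) : Prop where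
  contR : ContinuousOn R (Ioc s₀ s₁)
  contp : ContinuousOn p (Ioc s₀ s₁)
  posR : ∀ s ∈ Ioc s₀ s₁, 0 < R s
  posp : ∀ s ∈ Ioc s₀ s₁, 0 < p s
  derivR : ∀ s ∈ Ioo s₀ s₁, HasDerivAt R (-(1 / p s)) s
  derivp : ∀ s ∈ Ioo s₀ s₁, HasDerivAt p ((d + 2 : ℝ) / R s - f s / p s) s

/-- The energy along a branch. -/
def lev (f p : ℝ → ℝ) (s : ℝ) : ℝ := p s ^ 2 / 2 + prim f s

/-- On a strictly decreasing arc the level determines the radius. Slopes are bounded away from zero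
over compact radius intervals, which makes `R` Lipschitz there; its derivative then follows by
inversion. -/
lemma Sol.branch {d : ℕ} {f u u' R : ℝ → ℝ} (h : Sol d f u u') {a s₀ s₁ : ℝ} (ha : 0 < a)
    (hR : ∀ s ∈ Ioc s₀ s₁, a ≤ R s ∧ u (R s) = s ∧ ∀ r ∈ Icc a (R s), u' r < 0) :
    Branch d f s₀ s₁ R (fun s => -u' (R s)) := by
  have hanti : ∀ s ∈ Ioc s₀ s₁, ∀ t ∈ Ioc s₀ s₁, s < t → R t < R s := by
    intro s hs t ht hst
    by_contra hc
    have h1 := ge_of_hasDerivAt_nonpos (not_lt.1 hc)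
      (h.cont.mono fun x hx => ha.le.trans ((hR s hs).1.trans hx.1))
      (fun x hx => h.hasDeriv x (ha.trans_le ((hR s hs).1.trans hx.1.le)))
      (fun x hx => ((hR t ht).2.2 x ⟨(hR s hs).1.trans hx.1.le, hx.2.le⟩).le)
    rw [(hR s hs).2.1, (hR t ht).2.1] at h1
    linarith
  have hcont : ContinuousOn R (Ioc s₀ s₁) := by
    intro t ht
    obtain ⟨t', ht0, ht't⟩ := exists_between ht.1
    have ht' : t' ∈ Ioc s₀ s₁ := ⟨ht0, ht't.le.trans ht.2⟩
    obtain ⟨y, hy, hmax⟩ := isCompact_Icc.exists_isMaxOn (s := Icc a (R t'))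
      ⟨a, left_mem_Icc.2 (hR t' ht').1⟩ (h.cont'.mono fun x hx => ha.le.trans hx.1)
    have hm : u' y < 0 := (hR t' ht').2.2 y hy
    have hlip : ∀ x ∈ Icc t' s₁, ∀ z ∈ Icc t' s₁, x < z → R x - R z ≤ (z - x) / (-u' y) := by
      intro x hx z hz hxz
      have hx' : x ∈ Ioc s₀ s₁ := ⟨ht0.trans_le hx.1, hx.2⟩
      have hz' : z ∈ Ioc s₀ s₁ := ⟨ht0.trans_le hz.1, hz.2⟩
      have hRx : R x ≤ R t' := by
        rcases hx.1.eq_or_lt with e | e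
        · rw [e]
        · exact (hanti _ ht' _ hx' e).le
      have h1 := ge_of_hasDerivAt_nonpos (g := fun r => u r - u' y * r) (g' := fun r => u' r - u' y)
        (hanti x hx' z hz' hxz).le
        ((h.cont.mono fun x hx => ha.le.trans ((hR z hz').1.trans hx.1)).sub (by fun_prop))
        (fun r hr => ((h.hasDeriv r (ha.trans_le ((hR z hz').1.trans hr.1.le))).sub
          ((hasDerivAt_id r).const_mul _)).congr_deriv (by simp))
        (fun r hr => sub_nonpos.2 (hmax ⟨(hR z hz').1.trans hr.1.le, hr.2.le.trans hRx⟩))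
      simp only [(hR x hx').2.1, (hR z hz').2.1] at h1
      rw [le_div_iff₀ (by linarith)]
      linarith
    have hc : ContinuousOn R (Icc t' s₁) := by
      have hL : LipschitzOnWith (Real.toNNReal (1 / (-u' y))) R (Icc t' s₁) := by
        refine LipschitzOnWith.of_dist_le_mul fun x hx z hz => ?_
        rw [Real.coe_toNNReal _ (by rw [one_div]; exact inv_nonneg.2 (by linarith)),
          Real.dist_eq, Real.dist_eq]
        rcases lt_trichotomy x z with e | e | e
        · have h1 := hlip x hx z hz e
          have h2 := hanti x ⟨ht0.trans_le hx.1, hx.2⟩ z ⟨ht0.trans_le hz.1, hz.2⟩ e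
          rw [abs_of_pos (by linarith), abs_sub_comm, abs_of_pos (by linarith)]
          exact h1.trans (le_of_eq (by ring))
        · simp [e]
        · have h1 := hlip z hz x hx e
          have h2 := hanti z ⟨ht0.trans_le hz.1, hz.2⟩ x ⟨ht0.trans_le hx.1, hx.2⟩ e
          rw [abs_sub_comm, abs_of_pos (by linarith), abs_of_pos (by linarith)]
          exact h1.trans (le_of_eq (by ring))
      exact hL.continuousOn
    refine (hc t ⟨ht't.le, ht.2⟩).mono_of_mem_nhdsWithin ?_
    filter_upwards [self_mem_nhdsWithin, nhdsWithin_le_nhds (lt_mem_nhds ht't)] with x hx hx'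
    exact ⟨le_of_lt hx', hx.2⟩
  have hpos : ∀ s ∈ Ioc s₀ s₁, 0 < R s := fun s hs => ha.trans_le (hR s hs).1
  have hneg : ∀ s ∈ Ioc s₀ s₁, u' (R s) < 0 := fun s hs =>
    (hR s hs).2.2 _ ⟨(hR s hs).1, le_rfl⟩
  have hder : ∀ s ∈ Ioo s₀ s₁, HasDerivAt R (u' (R s))⁻¹ s := by
    intro s hs
    have hs' : s ∈ Ioc s₀ s₁ := Ioo_subset_Ioc_self hs
    have hnh : Ioc s₀ s₁ ∈ 𝓝 s := mem_of_superset (Ioo_mem_nhds hs.1 hs.2) Ioo_subset_Ioc_self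
    refine HasDerivAt.of_local_left_inverse (hcont.continuousAt hnh)
      (h.hasDeriv _ (hpos s hs')) (hneg s hs').ne ?_
    filter_upwards [hnh] with x hx using (hR x hx).2.1
  refine ⟨hcont, (h.cont'.comp hcont fun s hs => (hpos s hs).le).neg, hpos,
    fun s hs => by linarith [hneg s hs], fun s hs => (hder s hs).congr_deriv ?_, fun s hs => ?_⟩
  · rw [one_div, inv_neg, neg_neg]
  · have hs' : s ∈ Ioc s₀ s₁ := Ioo_subset_Ioc_self hs
    have h1 := (hneg s hs').ne
    have h2 := (hpos s hs').ne'
    refine ((h.hasDeriv' _ (hpos s hs')).comp s (hder s hs)).neg.congr_deriv ?_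
    rw [(hR s hs').2.1]
    field_simp
    ring

namespace Branch

variable {d : ℕ} {f : ℝ → ℝ} {s₀ s₁ : ℝ} {R p R₁ p₁ R₂ p₂ : ℝ → ℝ}

lemma continuousOn_lev (hf : Continuous f) (h : Branch d f s₀ s₁ R p) :
    ContinuousOn (lev f p) (Ioc s₀ s₁) :=
  ((h.contp.pow 2).div_const 2).add (continuous_prim hf).continuousOn

lemma hasDerivAt_lev (hf : Continuous f) (h : Branch d f s₀ s₁ R p) {s : ℝ} (hs : s ∈ Ioo s₀ s₁) :
    HasDerivAt (lev f p) ((d + 2) * p s / R s) s := by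
  have h1 := (h.posp s (Ioo_subset_Ioc_self hs)).ne'
  have h2 := (h.posR s (Ioo_subset_Ioc_self hs)).ne'
  refine ((((h.derivp s hs).pow 2).div_const 2).add (hasDerivAt_prim hf s)).congr_deriv ?_
  field_simp
  push_cast
  ring

lemma hasDerivAt_pow_mul_lev (hf : Continuous f) (h : Branch d f s₀ s₁ R p) {s : ℝ}
    (hs : s ∈ Ioo s₀ s₁) :
    HasDerivAt (fun s => R s ^ (2 * d + 4) * lev f p s)
      (-((2 * d + 4) * prim f s * (R s ^ (2 * d + 3) / p s))) s := by
  have h1 := (h.posp s (Ioo_subset_Ioc_self hs)).ne'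
  have h2 := (h.posR s (Ioo_subset_Ioc_self hs)).ne'
  refine (((h.derivR s hs).pow (2 * d + 4)).mul (h.hasDerivAt_lev hf hs)).congr_deriv ?_
  have h3 : R s ^ (2 * d + 4) = R s ^ (2 * d + 3) * R s := by ring
  simp only [lev, show 2 * d + 4 - 1 = 2 * d + 3 by omega, h3, Pi.pow_apply]
  field_simp
  push_cast
  ring

/-- Along a branch the squared flux is monotone in the level wherever `f` has a sign. -/
lemma hasDerivAt_flux_sq (h : Branch d f s₀ s₁ R p) {s : ℝ} (hs : s ∈ Ioo s₀ s₁) :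
    HasDerivAt (fun s => (R s ^ (d + 2) * p s) ^ 2 / 2) (-(R s ^ (2 * d + 4) * f s)) s := by
  have h1 := (h.posp s (Ioo_subset_Ioc_self hs)).ne'
  have h2 := (h.posR s (Ioo_subset_Ioc_self hs)).ne'
  refine (((((h.derivR s hs).pow (d + 2)).mul (h.derivp s hs)).pow 2).div_const 2).congr_deriv ?_
  have h3 : R s ^ (2 * d + 4) = (R s ^ (d + 1) * R s) ^ 2 := by ring
  have h4 : R s ^ (d + 2) = R s ^ (d + 1) * R s := by ring
  simp only [show d + 2 - 1 = d + 1 by omega, h3, h4, Pi.pow_apply, Pi.mul_apply]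
  field_simp
  push_cast
  ring

/-- `r^(-(n-2))` is the radial harmonic function, so its derivative along a branch involves the flux
alone. -/
lemma hasDerivAt_inv_pow (h : Branch d f s₀ s₁ R p) {s : ℝ} (hs : s ∈ Ioo s₀ s₁) :
    HasDerivAt (fun s => (R s ^ (d + 1))⁻¹) ((d + 1) / (R s ^ (d + 2) * p s)) s := by
  have h1 := (h.posp s (Ioo_subset_Ioc_self hs)).ne'
  have h2 := (h.posR s (Ioo_subset_Ioc_self hs)).ne'
  refine (((h.derivR s hs).pow (d + 1)).inv (pow_ne_zero _ h2)).congr_deriv ?_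
  have h4 : R s ^ (d + 1) = R s ^ d * R s := by ring
  have h5 : R s ^ (d + 2) = R s ^ d * R s * R s := by ring
  simp only [show d + 1 - 1 = d by omega, h4, h5, Pi.pow_apply]
  field_simp
  push_cast
  ring

lemma lev_lt_iff (h₁ : Branch d f s₀ s₁ R₁ p₁) (h₂ : Branch d f s₀ s₁ R₂ p₂) {s : ℝ}
    (hs : s ∈ Ioc s₀ s₁) : lev f p₁ s < lev f p₂ s ↔ p₁ s < p₂ s := by
  unfold lev
  have h1 := h₁.posp s hs
  have h2 := h₂.posp s hs
  rw [← pow_lt_pow_iff_left₀ h1.le h2.le two_ne_zero]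
  constructor <;> intro h <;> linarith

/-- The difference of the radii is increasing in the level as long as the second branch is
steeper. -/
lemma sub_le_sub (h₁ : Branch d f s₀ s₁ R₁ p₁) (h₂ : Branch d f s₀ s₁ R₂ p₂) {s t : ℝ}
    (hs : s₀ < s) (hst : s ≤ t) (ht : t ≤ s₁) (hp : ∀ x ∈ Ioo s t, p₁ x ≤ p₂ x) :
    R₂ s - R₁ s ≤ R₂ t - R₁ t := by
  have hsub : Icc s t ⊆ Ioc s₀ s₁ := fun x hx => ⟨hs.trans_le hx.1, hx.2.trans ht⟩
  refine le_of_hasDerivAt_nonneg (g := fun x => R₂ x - R₁ x)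
    (g' := fun x => -(1 / p₂ x) - -(1 / p₁ x)) hst
    ((h₂.contR.sub h₁.contR).mono hsub) (fun x hx => ?_) fun x hx => ?_
  · have hx' : x ∈ Ioo s₀ s₁ := ⟨hs.trans hx.1, hx.2.trans_le ht⟩
    exact (h₂.derivR x hx').sub (h₁.derivR x hx')
  · have := one_div_le_one_div_of_le (h₁.posp x (hsub (Ioo_subset_Icc_self hx))) (hp x hx)
    linarith

/-- Where the second branch is steeper and farther out, `(e₂ - e₁) R₁ⁿ⁻¹` is decreasing. -/
lemma lev_sub_mul_pow_le (hf : Continuous f) (h₁ : Branch d f s₀ s₁ R₁ p₁)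
    (h₂ : Branch d f s₀ s₁ R₂ p₂) {s t : ℝ} (hs : s₀ < s) (hst : s ≤ t) (ht : t ≤ s₁)
    (hp : ∀ x ∈ Ioo s t, p₁ x ≤ p₂ x) (hR : ∀ x ∈ Ioo s t, R₁ x ≤ R₂ x) :
    (lev f p₂ t - lev f p₁ t) * R₁ t ^ (d + 2) ≤ (lev f p₂ s - lev f p₁ s) * R₁ s ^ (d + 2) := by
  have hsub : Icc s t ⊆ Ioc s₀ s₁ := fun x hx => ⟨hs.trans_le hx.1, hx.2.trans ht⟩
  refine ge_of_hasDerivAt_nonpos (g := fun x => (lev f p₂ x - lev f p₁ x) * R₁ x ^ (d + 2)) hst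
    ((((h₂.continuousOn_lev hf).sub (h₁.continuousOn_lev hf)).mul (h₁.contR.pow _)).mono hsub)
    (g' := fun x => (d + 2) * R₁ x ^ (d + 1) / p₁ x *
      ((R₁ x / R₂ x) * p₂ x * p₁ x - p₁ x ^ 2 - (p₂ x ^ 2 - p₁ x ^ 2) / 2)) (fun x hx => ?_)
    fun x hx => ?_
  · have hx' : x ∈ Ioo s₀ s₁ := ⟨hs.trans hx.1, hx.2.trans_le ht⟩
    have a1 := (h₁.posp x (Ioo_subset_Ioc_self hx')).ne'
    have a2 := (h₁.posR x (Ioo_subset_Ioc_self hx')).ne'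
    have a3 := (h₂.posR x (Ioo_subset_Ioc_self hx')).ne'
    refine (((h₂.hasDerivAt_lev hf hx').sub (h₁.hasDerivAt_lev hf hx')).mul
      ((h₁.derivR x hx').pow (d + 2))).congr_deriv ?_
    have h4 : R₁ x ^ (d + 2) = R₁ x ^ (d + 1) * R₁ x := by ring
    simp only [show d + 2 - 1 = d + 1 by omega, h4, Pi.pow_apply, Pi.sub_apply, lev]
    field_simp
    push_cast
    ring
  · have hx' := hsub (Ioo_subset_Icc_self hx)
    have a1 := h₁.posp x hx'
    have a2 := h₁.posR x hx'
    have a3 := h₂.posR x hx'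
    have a4 := hp x hx
    have a5 : R₁ x / R₂ x ≤ 1 := (div_le_one a3).2 (hR x hx)
    refine mul_nonpos_of_nonneg_of_nonpos (by positivity) ?_
    have a6 : (R₁ x / R₂ x) * p₂ x * p₁ x ≤ 1 * p₂ x * p₁ x := by
      have := mul_pos (a1.trans_le a4) a1
      rw [mul_assoc, mul_assoc]
      exact mul_le_mul_of_nonneg_right a5 this.le
    nlinarith [sq_nonneg (p₂ x - p₁ x)]

/-- Where the second branch is steeper and closer to the origin, the difference of the weighted
energies is decreasing. -/
lemma pow_mul_lev_sub_le (hf : Continuous f) (h₁ : Branch d f s₀ s₁ R₁ p₁)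
    (h₂ : Branch d f s₀ s₁ R₂ p₂) {s t : ℝ} (hs : s₀ < s) (hst : s ≤ t) (ht : t ≤ s₁)
    (hF : ∀ x ∈ Ioo s t, prim f x ≤ 0)
    (hp : ∀ x ∈ Ioo s t, p₁ x ≤ p₂ x) (hR : ∀ x ∈ Ioo s t, R₂ x ≤ R₁ x) :
    R₂ t ^ (2 * d + 4) * lev f p₂ t - R₁ t ^ (2 * d + 4) * lev f p₁ t
      ≤ R₂ s ^ (2 * d + 4) * lev f p₂ s - R₁ s ^ (2 * d + 4) * lev f p₁ s := by
  have hsub : Icc s t ⊆ Ioc s₀ s₁ := fun x hx => ⟨hs.trans_le hx.1, hx.2.trans ht⟩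
  refine ge_of_hasDerivAt_nonpos
    (g := fun x => R₂ x ^ (2 * d + 4) * lev f p₂ x - R₁ x ^ (2 * d + 4) * lev f p₁ x)
    (g' := fun x => -((2 * d + 4) * prim f x * (R₂ x ^ (2 * d + 3) / p₂ x))
      - -((2 * d + 4) * prim f x * (R₁ x ^ (2 * d + 3) / p₁ x))) hst
    ((((h₂.contR.pow _).mul (h₂.continuousOn_lev hf)).sub
      ((h₁.contR.pow _).mul (h₁.continuousOn_lev hf))).mono hsub) (fun x hx => ?_) fun x hx => ?_
  · have hx' : x ∈ Ioo s₀ s₁ := ⟨hs.trans hx.1, hx.2.trans_le ht⟩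
    exact (h₂.hasDerivAt_pow_mul_lev hf hx').sub (h₁.hasDerivAt_pow_mul_lev hf hx')
  · have hx' := hsub (Ioo_subset_Icc_self hx)
    have a1 : R₂ x ^ (2 * d + 3) / p₂ x ≤ R₁ x ^ (2 * d + 3) / p₁ x :=
      div_le_div₀ (pow_nonneg (h₁.posR x hx').le _)
        (pow_le_pow_left₀ (h₂.posR x hx').le (hR x hx) _) (h₁.posp x hx') (hp x hx)
    have a2 : (2 * d + 4) * prim f x ≤ 0 :=
      mul_nonpos_of_nonneg_of_nonpos (by positivity) (hF x hx)
    nlinarith [mul_le_mul_of_nonpos_left a1 a2]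

/-- The order of two branches, in terms of energy and weighted energy, is preserved downwards where
the primitive is nonpositive. -/
theorem order_preserved (hf : Continuous f) (h₁ : Branch d f s₀ s₁ R₁ p₁)
    (h₂ : Branch d f s₀ s₁ R₂ p₂) {t : ℝ} (ht : t ∈ Ioc s₀ s₁)
    (hF : ∀ x ∈ Icc t s₁, prim f x ≤ 0) (he : ∀ x ∈ Icc t s₁, 0 < lev f p₁ x)
    (h1 : lev f p₁ s₁ < lev f p₂ s₁)
    (h2 : R₁ s₁ ^ (2 * d + 4) * lev f p₁ s₁ < R₂ s₁ ^ (2 * d + 4) * lev f p₂ s₁) :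
    lev f p₁ t < lev f p₂ t ∧
      R₁ t ^ (2 * d + 4) * lev f p₁ t < R₂ t ^ (2 * d + 4) * lev f p₂ t := by
  by_contra hcon
  have hsub : Icc t s₁ ⊆ Ioc s₀ s₁ := fun x hx => ⟨ht.1.trans_le hx.1, hx.2⟩
  set D : ℝ → ℝ := fun x => min (lev f p₂ x - lev f p₁ x)
    (R₂ x ^ (2 * d + 4) * lev f p₂ x - R₁ x ^ (2 * d + 4) * lev f p₁ x) with hD
  have hDc : ContinuousOn D (Icc t s₁) :=
    (continuous_min.comp_continuousOn (((h₂.continuousOn_lev hf).sub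
      (h₁.continuousOn_lev hf)).prodMk (((h₂.contR.pow _).mul (h₂.continuousOn_lev hf)).sub
        ((h₁.contR.pow _).mul (h₁.continuousOn_lev hf))))).mono hsub
  -- `s` is the highest level at which one of the two strict inequalities fails; above it the second
  -- branch is steeper.
  obtain ⟨s, ⟨hs, hDs⟩, hmax⟩ : ∃ s, IsGreatest (Icc t s₁ ∩ D ⁻¹' Iic 0) s := by
    refine (isCompact_Icc.of_isClosed_subset (hDc.preimage_isClosed_of_isClosed isClosed_Icc
      isClosed_Iic) inter_subset_left).exists_isGreatest ⟨t, ⟨le_rfl, ht.2⟩, ?_⟩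
    rw [not_and_or, not_lt, not_lt] at hcon
    exact min_le_iff.2 (hcon.imp sub_nonpos.2 sub_nonpos.2)
  have hgt : ∀ x, s < x → x ≤ s₁ → 0 < D x := fun x hx hx' => by
    by_contra hc
    exact absurd (hmax ⟨⟨hs.1.trans hx.le, hx'⟩, not_lt.1 hc⟩) (not_le.2 hx)
  have hD1 : 0 < D s₁ := lt_min (sub_pos.2 h1) (sub_pos.2 h2)
  have hss : s < s₁ := lt_of_le_of_ne hs.2 fun e => by
    rw [← e] at hD1
    exact absurd hDs (not_le.2 hD1)
  have hs0 : s₀ < s := ht.1.trans_le hs.1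
  have hD0 : 0 ≤ D s := by
    have h3 : Tendsto D (𝓝[>] s) (𝓝 (D s)) :=
      ((hDc s hs).mono_of_mem_nhdsWithin (by
        filter_upwards [Ioc_mem_nhdsGT hss] with x hx using ⟨hs.1.trans hx.1.le, hx.2⟩)).tendsto
    refine ge_of_tendsto h3 ?_
    filter_upwards [Ioc_mem_nhdsGT hss] with x hx using (hgt x hx.1 hx.2).le
  have hD0' : D s = 0 := le_antisymm hDs hD0
  have hp : ∀ x, s < x → x ≤ s₁ → p₁ x < p₂ x := fun x hx hx' =>
    (lev_lt_iff h₁ h₂ ⟨hs0.trans hx, hx'⟩).1 (sub_pos.1 (lt_min_iff.1 (hgt x hx hx')).1)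
  have hE1 : 0 < lev f p₁ s := he s hs
  have hEge : lev f p₁ s ≤ lev f p₂ s := sub_nonneg.1 (hD0.trans (min_le_left _ _))
  have hQge := sub_nonneg.1 (hD0.trans (min_le_right _ _))
  have hR1 := h₁.posR s (hsub hs)
  have hR2 := h₂.posR s (hsub hs)
  rcases hEge.eq_or_lt with heq | hlt
  -- If the energies agree at `s`, the second branch is farther out there and hence above `s`. Then
  -- `lev_sub_mul_pow_le` forbids a positive energy gap at the top level.
  · have hRR : R₁ s ≤ R₂ s := by
      rw [← heq] at hQge
      exact (pow_le_pow_iff_left₀ hR1.le hR2.le (by omega)).1 (le_of_mul_le_mul_right hQge hE1)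
    have hR : ∀ x ∈ Ioo s s₁, R₁ x ≤ R₂ x := fun x hx => by
      have := sub_le_sub h₁ h₂ hs0 hx.1.le hx.2.le
        (fun y hy => (hp y hy.1 (hy.2.le.trans hx.2.le)).le)
      linarith
    have h3 := lev_sub_mul_pow_le hf h₁ h₂ hs0 hss.le le_rfl
      (fun y hy => (hp y hy.1 hy.2.le).le) hR
    rw [heq, sub_self, zero_mul] at h3
    have h4 : 0 < (lev f p₂ s₁ - lev f p₁ s₁) * R₁ s₁ ^ (d + 2) :=
      mul_pos (sub_pos.2 h1) (pow_pos (h₁.posR _ ⟨hs0.trans hss, le_rfl⟩) _)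
    linarith
  -- If instead the weighted energies agree, the second branch is closer to the origin just above
  -- `s`, and `pow_mul_lev_sub_le` forbids a positive weighted gap there.
  · have hQeq : R₂ s ^ (2 * d + 4) * lev f p₂ s - R₁ s ^ (2 * d + 4) * lev f p₁ s = 0 := by
      rcases min_choice (lev f p₂ s - lev f p₁ s)
        (R₂ s ^ (2 * d + 4) * lev f p₂ s - R₁ s ^ (2 * d + 4) * lev f p₁ s) with h3 | h3
      · have : D s = _ := h3
        linarith
      · rw [← h3]; exact hD0'
    have hRR : R₂ s < R₁ s := by
      by_contra hc
      have h3 : R₁ s ^ (2 * d + 4) ≤ R₂ s ^ (2 * d + 4) := pow_le_pow_left₀ hR1.le (not_lt.1 hc) _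
      have h4 : 0 < R₁ s ^ (2 * d + 4) := pow_pos hR1 _
      nlinarith [mul_lt_mul_of_pos_left hlt h4, mul_le_mul_of_nonneg_right h3 (hE1.trans hlt).le]
    have hev : ∀ᶠ x in 𝓝[≥] s, R₂ x - R₁ x < 0 := by
      have hc : ContinuousWithinAt (fun x => R₂ x - R₁ x) (Ici s) s :=
        ((h₂.contR.sub h₁.contR) s (hsub hs)).mono_of_mem_nhdsWithin (by
          filter_upwards [Icc_mem_nhdsGE hss] with x hx using ⟨hs0.trans_le hx.1, hx.2⟩)
      exact hc.tendsto.eventually_lt_const (by linarith)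
    obtain ⟨τ, hτ, hτ'⟩ := exists_Icc_of_eventually hev
    set x := min (s + τ) s₁ with hx
    have hsx : s < x := lt_min (by linarith) hss
    have hx1 : x ≤ s₁ := min_le_right _ _
    have h3 := pow_mul_lev_sub_le hf h₁ h₂ hs0 hsx.le hx1
      (fun y hy => hF y ⟨hs.1.trans hy.1.le, hy.2.le.trans hx1⟩)
      (fun y hy => (hp y hy.1 (hy.2.le.trans hx1)).le)
      (fun y hy => by
        have := hτ' y ⟨hy.1.le, hy.2.le.trans (min_le_left _ _)⟩
        linarith)
    have h4 := (lt_min_iff.1 (hgt x hsx hx1)).2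
    linarith

end Branch

/-! ### Branches near the level zero -/

namespace Branch

variable {d : ℕ} {f : ℝ → ℝ} {s₀ s₁ : ℝ} {R p R₁ p₁ R₂ p₂ : ℝ → ℝ}

lemma pow_mul_lev_le (hf : Continuous f) (h : Branch d f s₀ s₁ R p) {s t : ℝ} (hs : s₀ < s)
    (hst : s ≤ t) (ht : t ≤ s₁) (hF : ∀ x ∈ Ioo s t, prim f x ≤ 0) :
    R s ^ (2 * d + 4) * lev f p s ≤ R t ^ (2 * d + 4) * lev f p t := by
  have hsub : Icc s t ⊆ Ioc s₀ s₁ := fun x hx => ⟨hs.trans_le hx.1, hx.2.trans ht⟩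
  refine le_of_hasDerivAt_nonneg (g := fun x => R x ^ (2 * d + 4) * lev f p x) hst
    (((h.contR.pow _).mul (h.continuousOn_lev hf)).mono hsub)
    (fun x hx => h.hasDerivAt_pow_mul_lev hf ⟨hs.trans hx.1, hx.2.trans_le ht⟩) fun x hx => ?_
  have hx' := hsub (Ioo_subset_Icc_self hx)
  have a1 : 0 ≤ R x ^ (2 * d + 3) / p x :=
    div_nonneg (pow_nonneg (h.posR x hx').le _) (h.posp x hx').le
  have a2 : (2 * d + 4) * prim f x ≤ 0 :=
    mul_nonpos_of_nonneg_of_nonpos (by positivity) (hF x hx)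
  nlinarith

lemma R_le (h : Branch d f s₀ s₁ R p) {s t : ℝ} (hs : s₀ < s) (hst : s ≤ t) (ht : t ≤ s₁) :
    R t ≤ R s := by
  have hsub : Icc s t ⊆ Ioc s₀ s₁ := fun x hx => ⟨hs.trans_le hx.1, hx.2.trans ht⟩
  refine ge_of_hasDerivAt_nonpos hst (h.contR.mono hsub)
    (fun x hx => h.derivR x ⟨hs.trans hx.1, hx.2.trans_le ht⟩) fun x hx => ?_
  have := one_div_pos.2 (h.posp x (hsub (Ioo_subset_Icc_self hx)))
  linarith

lemma lev_mul_pow (s : ℝ) : R s ^ (2 * d + 4) * lev f p s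
    = (R s ^ (d + 2) * p s) ^ 2 / 2 + R s ^ (2 * d + 4) * prim f s := by
  unfold lev
  ring

/-- Near the level zero, the weighted primitive is small along a branch of positive energy. -/
lemma exists_pow_mul_prim_ge (hf : Continuous f) (h : Branch d f 0 s₁ R p) {b' c : ℝ} (hb : 0 < b')
    (hbs : b' ≤ s₁) (hneg : ∀ x ∈ Ioc 0 b', f x ≤ 0) (hc : 0 < c) :
    ∃ s₅ ∈ Ioc 0 b', ∀ s ∈ Ioc 0 s₅, -c ≤ R s ^ (2 * d + 4) * prim f s := by
  set g : ℝ → ℝ := fun s => (R s ^ (d + 2) * p s) ^ 2 / 2 with hg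
  have hbdd : BddBelow (g '' Ioc 0 b') := ⟨0, by rintro _ ⟨x, _, rfl⟩; simp only [hg]; positivity⟩
  -- The squared flux increases with the level here; nearly attaining its infimum at `s₅` makes its
  -- variation below `s₅` less than `c`.
  obtain ⟨_, ⟨s₅, hs₅, rfl⟩, hlt⟩ := exists_lt_of_csInf_lt
    (⟨_, mem_image_of_mem g (right_mem_Ioc.2 hb)⟩ : (g '' Ioc 0 b').Nonempty)
    (show sInf (g '' Ioc 0 b') < sInf (g '' Ioc 0 b') + c by linarith)
  refine ⟨s₅, hs₅, fun s hs => ?_⟩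
  have hgc : ∀ {x y}, 0 < x → y ≤ s₁ → ContinuousOn g (Icc x y) := fun hx hy =>
    (((h.contR.pow _).mul h.contp).pow 2 |>.div_const 2).mono fun z hz =>
      ⟨hx.trans_le hz.1, hz.2.trans hy⟩
  have hsb : s ≤ b' := hs.2.trans hs₅.2
  have hgs : g s ≤ g s₅ := by
    refine le_of_hasDerivAt_nonneg hs.2 (hgc hs.1 (hs₅.2.trans hbs))
      (fun x hx => h.hasDerivAt_flux_sq ⟨hs.1.trans hx.1, hx.2.trans_le (hs₅.2.trans hbs)⟩)
      fun x hx => ?_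
    have := hneg x ⟨hs.1.trans hx.1, hx.2.le.trans hs₅.2⟩
    have h2 : 0 ≤ R x ^ (2 * d + 4) := pow_nonneg
      (h.posR x ⟨hs.1.trans hx.1, hx.2.le.trans (hs₅.2.trans hbs)⟩).le _
    nlinarith
  -- Radii grow towards the level zero, so the variation of the squared flux dominates the variation
  -- of `F` weighted with the smallest radius `R s`.
  have key : ∀ x ∈ Ioo 0 s, R s ^ (2 * d + 4) * (prim f x - prim f s) ≤ c := by
    intro x hx
    have h1 := le_of_hasDerivAt_nonneg (g := fun y => g y + R s ^ (2 * d + 4) * prim f y)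
      (g' := fun y => -(R y ^ (2 * d + 4) * f y) + R s ^ (2 * d + 4) * f y) hx.2.le
      ((hgc hx.1 (hsb.trans hbs)).add (continuousOn_const.mul (continuous_prim hf).continuousOn))
      (fun y hy => (h.hasDerivAt_flux_sq ⟨hx.1.trans hy.1, hy.2.trans_le (hsb.trans hbs)⟩).add
        ((hasDerivAt_prim hf y).const_mul _))
      (fun y hy => by
        have e1 := hneg y ⟨hx.1.trans hy.1, hy.2.le.trans hsb⟩
        have e2 : R s ^ (2 * d + 4) ≤ R y ^ (2 * d + 4) :=
          pow_le_pow_left₀ (h.posR s ⟨hs.1, hsb.trans hbs⟩).le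
            (h.R_le (hx.1.trans hy.1) hy.2.le (hsb.trans hbs)) _
        nlinarith)
    have h2 : sInf (g '' Ioc 0 b') ≤ g x :=
      csInf_le hbdd (mem_image_of_mem g ⟨hx.1, hx.2.le.trans hsb⟩)
    linarith
  have hlim : Tendsto (fun x => R s ^ (2 * d + 4) * (prim f x - prim f s)) (𝓝[>] 0)
      (𝓝 (R s ^ (2 * d + 4) * (prim f 0 - prim f s))) :=
    ((((continuous_prim hf).tendsto 0).mono_left nhdsWithin_le_nhds).sub_const _).const_mul _
  have := le_of_tendsto hlim (by filter_upwards [Ioo_mem_nhdsGT hs.1] with x hx using key x hx)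
  rw [prim_zero_right] at this
  linarith

/-- Two ordered branches of positive energy down to the level zero cannot both lose all their energy
there. -/
theorem false_of_tendsto_zero (hf : Continuous f) (h₁ : Branch d f 0 s₁ R₁ p₁)
    (h₂ : Branch d f 0 s₁ R₂ p₂) (hs₁ : 0 < s₁) (hF : ∀ x ∈ Ioc 0 s₁, prim f x ≤ 0) {b' : ℝ}
    (hb : 0 < b') (hneg : ∀ x ∈ Ioc 0 b', f x ≤ 0) (he₁ : ∀ x ∈ Ioc 0 s₁, 0 < lev f p₁ x)
    (he : ∀ x ∈ Ioc 0 s₁, lev f p₁ x < lev f p₂ x)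
    (hQ : ∀ x ∈ Ioc 0 s₁,
      R₁ x ^ (2 * d + 4) * lev f p₁ x < R₂ x ^ (2 * d + 4) * lev f p₂ x)
    (hlim : Tendsto (lev f p₂) (𝓝[>] 0) (𝓝 0)) : False := by
  have hp : ∀ x ∈ Ioc 0 s₁, p₁ x ≤ p₂ x := fun x hx => ((lev_lt_iff h₁ h₂ hx).1 (he x hx)).le
  -- If the second branch is somewhere not farther out, a gap of weighted energies persists down to
  -- the level zero while its radius stays bounded, so its energy cannot vanish in the limit.
  by_cases hR : ∃ s ∈ Ioc 0 s₁, R₂ s ≤ R₁ s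
  · obtain ⟨s', hs', hR'⟩ := hR
    have hR : ∀ s ∈ Ioc 0 s', R₂ s ≤ R₁ s := fun s hs => by
      have := sub_le_sub h₁ h₂ hs.1 hs.2 hs'.2
        fun x hx => hp x ⟨hs.1.trans hx.1, hx.2.le.trans hs'.2⟩
      linarith
    set c := R₂ s' ^ (2 * d + 4) * lev f p₂ s' - R₁ s' ^ (2 * d + 4) * lev f p₁ s' with hcdef
    have hc : 0 < c := sub_pos.2 (hQ s' hs')
    have hcQ : ∀ s ∈ Ioc 0 s', c ≤ R₂ s ^ (2 * d + 4) * lev f p₂ s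
        - R₁ s ^ (2 * d + 4) * lev f p₁ s := fun s hs =>
      pow_mul_lev_sub_le hf h₁ h₂ hs.1 hs.2 hs'.2
        (fun x hx => hF x ⟨hs.1.trans hx.1, hx.2.le.trans hs'.2⟩)
        (fun x hx => hp x ⟨hs.1.trans hx.1, hx.2.le.trans hs'.2⟩)
        (fun x hx => hR x ⟨hs.1.trans hx.1, hx.2.le⟩)
    obtain ⟨s₅, hs₅, hsmall⟩ := h₁.exists_pow_mul_prim_ge hf (b' := min b' s') (c := c / 2)
      (lt_min hb hs'.1) ((min_le_right _ _).trans hs'.2)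
      (fun x hx => hneg x ⟨hx.1, hx.2.trans (min_le_left _ _)⟩) (by linarith)
    have hs₅' : s₅ ≤ s' := hs₅.2.trans (min_le_right _ _)
    have hs₅1 : s₅ ≤ s₁ := hs₅'.trans hs'.2
    -- Near the level zero the potential part of the first weighted energy is negligible, so the gap
    -- becomes an order of the fluxes.
    have hq : ∀ s ∈ Ioc 0 s₅, R₁ s ^ (d + 2) * p₁ s < R₂ s ^ (d + 2) * p₂ s := by
      intro s hs
      have hs1 : s ∈ Ioc 0 s₁ := ⟨hs.1, hs.2.trans hs₅1⟩
      have a1 := hcQ s ⟨hs.1, hs.2.trans hs₅'⟩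
      have a2 := hsmall s hs
      have a3 : R₂ s ^ (2 * d + 4) * prim f s ≤ 0 :=
        mul_nonpos_of_nonneg_of_nonpos (pow_nonneg (h₂.posR s hs1).le _) (hF s hs1)
      rw [lev_mul_pow, lev_mul_pow] at a1
      have b1 : 0 ≤ R₂ s ^ (d + 2) * p₂ s :=
        mul_nonneg (pow_nonneg (h₂.posR s hs1).le _) (h₂.posp s hs1).le
      exact lt_of_pow_lt_pow_left₀ 2 b1 (by linarith)
    set ρ : ℝ → ℝ := fun s => (R₂ s ^ (d + 1))⁻¹ - (R₁ s ^ (d + 1))⁻¹ with hρ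
    have hρanti : ∀ s t, 0 < s → s < t → t ≤ s₅ → ρ t < ρ s := by
      intro s t hs hst ht
      have hsub : Icc s t ⊆ Ioc 0 s₁ := fun x hx => ⟨hs.trans_le hx.1, hx.2.trans (ht.trans hs₅1)⟩
      refine gt_of_hasDerivAt_neg hst
        (((h₂.contR.pow _).inv₀ fun x hx => pow_ne_zero _ (h₂.posR x hx).ne').sub
          ((h₁.contR.pow _).inv₀ fun x hx => pow_ne_zero _ (h₁.posR x hx).ne') |>.mono hsub)
        (fun x hx => ?_) (g' := fun x => (d + 1) / (R₂ x ^ (d + 2) * p₂ x)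
          - (d + 1) / (R₁ x ^ (d + 2) * p₁ x)) fun x hx => ?_
      · have hx' : x ∈ Ioo 0 s₁ := ⟨hs.trans hx.1, hx.2.trans_le (ht.trans hs₅1)⟩
        exact (h₂.hasDerivAt_inv_pow hx').sub (h₁.hasDerivAt_inv_pow hx')
      · have hx' := hsub (Ioo_subset_Icc_self hx)
        exact sub_neg.2 (div_lt_div_of_pos_left (by positivity)
          (mul_pos (pow_pos (h₁.posR x hx') _) (h₁.posp x hx'))
          (hq x ⟨hs.trans hx.1, hx.2.le.trans ht⟩))
    have hρ5 : 0 ≤ ρ s₅ := by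
      have hm : s₅ ∈ Ioc 0 s₁ := ⟨hs₅.1, hs₅1⟩
      exact sub_nonneg.2 (inv_anti₀ (pow_pos (h₂.posR _ hm) _)
        (pow_le_pow_left₀ (h₂.posR _ hm).le (hR s₅ ⟨hs₅.1, hs₅'⟩) _))
    set s₄ := s₅ / 2 with hs₄
    have hs4 : 0 < s₄ := half_pos hs₅.1
    -- The difference `ρ` grows strictly as the level decreases and is nonnegative at `s₅`; below
    -- `s₄` it stays above `ρ s₄ > 0`, which bounds `R₂`.
    have hδ : 0 < ρ s₄ := hρ5.trans_lt (hρanti _ _ hs4 (half_lt_self hs₅.1) le_rfl)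
    set K := max 1 (1 / ρ s₄) with hK
    have hbound : ∀ s ∈ Ioo 0 s₄, c ≤ K ^ (2 * d + 4) * lev f p₂ s := by
      intro s hs
      have hs1 : s ∈ Ioc 0 s₁ := ⟨hs.1, hs.2.le.trans ((half_le_self hs₅.1.le).trans hs₅1)⟩
      have a1 := hρanti s s₄ hs.1 hs.2 (half_le_self hs₅.1.le)
      have hR2 := h₂.posR s hs1
      have a2 : ρ s₄ ≤ (R₂ s ^ (d + 1))⁻¹ := by
        have : 0 < (R₁ s ^ (d + 1))⁻¹ := inv_pos.2 (pow_pos (h₁.posR s hs1) _)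
        simp only [hρ] at a1 ⊢
        linarith
      have a3 : R₂ s ^ (d + 1) ≤ 1 / ρ s₄ := by
        rw [one_div]; exact (le_inv_comm₀ (pow_pos hR2 _) hδ).2 a2
      have a4 : R₂ s ≤ K := by
        rcases le_total (R₂ s) 1 with h | h
        · exact h.trans (le_max_left _ _)
        · exact (le_self_pow₀ h (by omega)).trans (a3.trans (le_max_right _ _))
      have a5 := hcQ s ⟨hs.1, hs.2.le.trans ((half_le_self hs₅.1.le).trans hs₅')⟩
      have a6 : 0 < R₁ s ^ (2 * d + 4) * lev f p₁ s :=
        mul_pos (pow_pos (h₁.posR s hs1) _) (he₁ s hs1)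
      have a7 : R₂ s ^ (2 * d + 4) * lev f p₂ s ≤ K ^ (2 * d + 4) * lev f p₂ s :=
        mul_le_mul_of_nonneg_right (pow_le_pow_left₀ hR2.le a4 _)
          ((he₁ s hs1).trans (he s hs1)).le
      linarith
    have hl := hlim.const_mul (K ^ (2 * d + 4))
    rw [mul_zero] at hl
    exact absurd (ge_of_tendsto hl (by
      filter_upwards [Ioo_mem_nhdsGT hs4] with x hx using hbound x hx)) (not_le.2 hc)
  -- Otherwise the first branch is closer to the origin throughout. With `e₂` the energy and `Q₂`
  -- the weighted energy of the second branch, `c^2 ≤ (e₂ R₂^(n-1))^2 = Q₂ e₂ ≤ M e₂`.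
  · push Not at hR
    have hm1 : s₁ ∈ Ioc 0 s₁ := ⟨hs₁, le_rfl⟩
    set c := (lev f p₂ s₁ - lev f p₁ s₁) * R₁ s₁ ^ (d + 2) with hcdef
    have hc : 0 < c := mul_pos (sub_pos.2 (he s₁ hm1)) (pow_pos (h₁.posR _ hm1) _)
    set M := R₂ s₁ ^ (2 * d + 4) * lev f p₂ s₁ with hM
    have hbound : ∀ s ∈ Ioo 0 s₁, c ^ 2 ≤ M * lev f p₂ s := by
      intro s hs
      have hs1 : s ∈ Ioc 0 s₁ := Ioo_subset_Ioc_self hs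
      have a1 := lev_sub_mul_pow_le hf h₁ h₂ hs.1 hs.2.le le_rfl
        (fun x hx => hp x ⟨hs.1.trans hx.1, hx.2.le⟩)
        (fun x hx => (hR x ⟨hs.1.trans hx.1, hx.2.le⟩).le)
      have a2 := h₂.pow_mul_lev_le hf hs.1 hs.2.le le_rfl
        (fun x hx => hF x ⟨hs.1.trans hx.1, hx.2.le⟩)
      have e1 := he₁ s hs1
      have e2 := e1.trans (he s hs1)
      have a3 : (lev f p₂ s - lev f p₁ s) * R₁ s ^ (d + 2) ≤ lev f p₂ s * R₂ s ^ (d + 2) :=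
        mul_le_mul (by linarith) (pow_le_pow_left₀ (h₁.posR s hs1).le (hR s hs1).le _)
          (pow_nonneg (h₁.posR s hs1).le _) e2.le
      have a4 : c ^ 2 ≤ (lev f p₂ s * R₂ s ^ (d + 2)) ^ 2 :=
        pow_le_pow_left₀ hc.le (a1.trans a3) 2
      have a5 : (lev f p₂ s * R₂ s ^ (d + 2)) ^ 2
          = (R₂ s ^ (2 * d + 4) * lev f p₂ s) * lev f p₂ s := by ring
      rw [a5] at a4
      exact a4.trans (mul_le_mul_of_nonneg_right a2 e2.le)
    have hl := hlim.const_mul M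
    rw [mul_zero] at hl
    exact absurd (ge_of_tendsto hl (by
      filter_upwards [Ioo_mem_nhdsGT hs₁] with x hx using hbound x hx))
      (not_le.2 (pow_pos hc 2))

end Branch

/-! ### The linearized equation above the level `β` -/

lemma exists_first_zero {g : ℝ → ℝ} {a x : ℝ} (hc : ContinuousOn g (Icc a x)) (hax : a ≤ x)
    (ha : 0 < g a) (hx : g x ≤ 0) : ∃ t ∈ Ioc a x, g t = 0 ∧ ∀ y ∈ Ico a t, 0 < g y := by
  obtain ⟨t, ⟨ht, hgt⟩, hmin⟩ : ∃ t, IsLeast (Icc a x ∩ g ⁻¹' Iic 0) t :=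
    (isCompact_Icc.of_isClosed_subset (hc.preimage_isClosed_of_isClosed isClosed_Icc
      isClosed_Iic) inter_subset_left).exists_isLeast ⟨x, ⟨hax, le_rfl⟩, hx⟩
  have hgt : g t ≤ 0 := hgt
  have hat : a < t := lt_of_le_of_ne ht.1 fun e => by rw [← e] at hgt; linarith
  have hpos : ∀ y ∈ Ico a t, 0 < g y := fun y hy => by
    by_contra hcon
    exact absurd (hmin ⟨⟨hy.1, hy.2.le.trans ht.2⟩, not_lt.1 hcon⟩) (not_le.2 hy.2)
  refine ⟨t, ⟨hat, ht.2⟩, le_antisymm hgt ?_, hpos⟩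
  have h1 : Tendsto g (𝓝[<] t) (𝓝 (g t)) := ((hc t ht).mono_of_mem_nhdsWithin (by
    filter_upwards [Ico_mem_nhdsLT hat] with y hy using ⟨hy.1, hy.2.le.trans ht.2⟩)).tendsto
  exact ge_of_tendsto h1 (by filter_upwards [Ico_mem_nhdsLT hat] with y hy using (hpos y hy).le)

lemma exists_last_zero {g : ℝ → ℝ} {a x : ℝ} (hc : ContinuousOn g (Icc a x)) (hax : a ≤ x)
    (ha : g a ≤ 0) (hx : 0 < g x) : ∃ t ∈ Ico a x, g t = 0 ∧ ∀ y ∈ Ioc t x, 0 < g y := by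
  obtain ⟨t, ht, h0, h1⟩ := exists_first_zero (g := fun y => g (-y)) (a := -x) (x := -a)
    (hc.comp continuousOn_neg fun y hy => ⟨by linarith [hy.2], by linarith [hy.1]⟩) (by linarith)
    (by simpa using hx) (by simpa using ha)
  refine ⟨-t, ⟨by linarith [ht.2], by linarith [ht.1]⟩, h0, fun y hy => ?_⟩
  have := h1 (-y) ⟨by linarith [hy.2], by linarith [hy.1]⟩
  simpa using this

lemma hasDerivAt_nonpos_of_pos_left {g : ℝ → ℝ} {g' a t : ℝ} (hat : a < t) (h : HasDerivAt g g' t)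
    (h0 : g t = 0) (hpos : ∀ y ∈ Ico a t, 0 < g y) : g' ≤ 0 := by
  have h1 := (hasDerivAt_iff_tendsto_slope.1 h).mono_left (nhdsWithin_mono t
    (fun y hy => ne_of_lt hy : Iio t ⊆ {t}ᶜ))
  refine le_of_tendsto h1 ?_
  filter_upwards [Ico_mem_nhdsLT hat] with y hy
  rw [slope_def_field, h0]
  exact div_nonpos_of_nonneg_of_nonpos (by linarith [hpos y hy]) (by linarith [hy.2]) 

lemma hasDerivAt_nonneg_of_pos_right {g : ℝ → ℝ} {g' t x : ℝ} (htx : t < x) (h : HasDerivAt g g' t)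
    (h0 : g t = 0) (hpos : ∀ y ∈ Ioc t x, 0 < g y) : 0 ≤ g' := by
  have h1 := (hasDerivAt_iff_tendsto_slope.1 h).mono_left (nhdsWithin_mono t
    (fun y hy => ne_of_gt hy : Ioi t ⊆ {t}ᶜ))
  refine ge_of_tendsto h1 ?_
  filter_upwards [Ioc_mem_nhdsGT htx] with y hy
  rw [slope_def_field, h0]
  exact div_nonneg (by linarith [hpos y hy]) (by linarith [hy.1])

/-- `u` is a solution on `[a, e)` and `φ` a solution of the equation linearized at `u`, whose
derivative `ψ` may fail to be differentiable on the finite set `D`. -/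
structure Lin (d : ℕ) (f : ℝ → ℝ) (D : Set ℝ) (a e : ℝ) (u u' φ ψ : ℝ → ℝ) : Prop where
  fin : D.Finite
  contf : Continuous f
  contu : ContinuousOn u (Ico a e)
  contu' : ContinuousOn u' (Ico a e)
  contφ : ContinuousOn φ (Ico a e)
  contψ : ContinuousOn ψ (Ico a e)
  derivu : ∀ r ∈ Ioo a e, HasDerivAt u (u' r) r
  derivu' : ∀ r ∈ Ioo a e, HasDerivAt u' (-((d + 2 : ℝ) / r * u' r) - f (u r)) r
  derivφ : ∀ r ∈ Ioo a e, HasDerivAt φ (ψ r) r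
  derivψ : ∀ r ∈ Ioo a e, r ∉ D →
    HasDerivAt ψ (-((d + 2 : ℝ) / r * ψ r) - deriv f (u r) * φ r) r
  derivf : ∀ r ∈ Ioo a e, r ∉ D → DifferentiableAt ℝ f (u r)

namespace Lin

variable {d : ℕ} {f : ℝ → ℝ} {D : Set ℝ} {a c e e' T : ℝ} {u u' φ ψ : ℝ → ℝ}

lemma mono_left (h : Lin d f D a e u u' φ ψ) (hac : a ≤ c) : Lin d f D c e u u' φ ψ where
  fin := h.fin
  contf := h.contf
  contu := h.contu.mono (Ico_subset_Ico_left hac)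
  contu' := h.contu'.mono (Ico_subset_Ico_left hac)
  contφ := h.contφ.mono (Ico_subset_Ico_left hac)
  contψ := h.contψ.mono (Ico_subset_Ico_left hac)
  derivu := fun r hr => h.derivu r (Ioo_subset_Ioo_left hac hr)
  derivu' := fun r hr => h.derivu' r (Ioo_subset_Ioo_left hac hr)
  derivφ := fun r hr => h.derivφ r (Ioo_subset_Ioo_left hac hr)
  derivψ := fun r hr => h.derivψ r (Ioo_subset_Ioo_left hac hr)
  derivf := fun r hr => h.derivf r (Ioo_subset_Ioo_left hac hr)

/-- The derivative of the energy in the direction of `φ`, at a fixed radius. -/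
def varE (f u u' φ ψ : ℝ → ℝ) (r : ℝ) : ℝ := u' r * ψ r + f (u r) * φ r

/-- `rⁿ⁻¹` times the derivative of the energy in the direction of `φ`, at a fixed level. -/
def varLev (d : ℕ) (f u u' φ ψ : ℝ → ℝ) (r : ℝ) : ℝ :=
  r ^ (d + 2) * varE f u u' φ ψ r + (d + 2) * r ^ (d + 1) * (u' r * φ r)

/-- The derivative of a Pohozaev type functional in the direction of `φ`. -/
def varX (d : ℕ) (f u u' φ ψ : ℝ → ℝ) (r : ℝ) : ℝ :=
  r ^ (d + 3) * varE f u u' φ ψ r + 2 * (d + 2) * (r ^ (d + 2) * (prim f (u r) / f (u r) * ψ r))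

lemma continuousOn_varE (h : Lin d f D a e u u' φ ψ) : ContinuousOn (varE f u u' φ ψ) (Ico a e) :=
  (h.contu'.mul h.contψ).add ((h.contf.comp_continuousOn h.contu).mul h.contφ)

lemma continuousOn_varLev (h : Lin d f D a e u u' φ ψ) :
    ContinuousOn (varLev d f u u' φ ψ) (Ico a e) :=
  ((continuousOn_pow _).mul h.continuousOn_varE).add
    ((continuousOn_const.mul (continuousOn_pow _)).mul (h.contu'.mul h.contφ))

lemma continuousOn_varX (h : Lin d f D a e u u' φ ψ) {s : Set ℝ} (hs : s ⊆ Ico a e)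
    (hf : ∀ r ∈ s, f (u r) ≠ 0) : ContinuousOn (varX d f u u' φ ψ) s :=
  ((continuousOn_pow _).mul (h.continuousOn_varE.mono hs)).add
    (continuousOn_const.mul ((continuousOn_pow _).mul
      ((((continuous_prim h.contf).comp_continuousOn (h.contu.mono hs)).div
        (h.contf.comp_continuousOn (h.contu.mono hs)) hf).mul (h.contψ.mono hs))))

/-- The terms containing `deriv f` cancel, which is why the variation of the energy is easier to
follow than `φ` itself. -/
lemma hasDerivAt_varE (h : Lin d f D a e u u' φ ψ) {r : ℝ} (hr : r ∈ Ioo a e) (hD : r ∉ D) :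
    HasDerivAt (varE f u u' φ ψ) (-(2 * ((d + 2) / r) * (u' r * ψ r))) r := by
  refine (((h.derivu' r hr).mul (h.derivψ r hr hD)).add
    (((h.derivf r hr hD).hasDerivAt.comp r (h.derivu r hr)).mul (h.derivφ r hr))).congr_deriv ?_
  simp only [Function.comp]
  ring

lemma hasDerivAt_pow_mul_varE (h : Lin d f D a e u u' φ ψ) {r : ℝ} (hr : r ∈ Ioo a e) (hD : r ∉ D)
    (h0 : 0 < r) : HasDerivAt (fun r => r ^ (2 * d + 4) * varE f u u' φ ψ r)
      ((2 * d + 4) * r ^ (2 * d + 3) * (f (u r) * φ r)) r := by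
  refine ((hasDerivAt_pow (2 * d + 4) r).mul (h.hasDerivAt_varE hr hD)).congr_deriv ?_
  have : r ^ (2 * d + 4) = r ^ (2 * d + 3) * r := by ring
  simp only [show 2 * d + 4 - 1 = 2 * d + 3 by omega, this, varE]
  push_cast
  field_simp
  ring

lemma hasDerivAt_varLev (h : Lin d f D a e u u' φ ψ) {r : ℝ} (hr : r ∈ Ioo a e) (hD : r ∉ D)
    (h0 : 0 < r) : HasDerivAt (varLev d f u u' φ ψ) (-((d + 2) * r ^ d * (u' r * φ r))) r := by
  refine (((hasDerivAt_pow (d + 2) r).mul (h.hasDerivAt_varE hr hD)).add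
    (((hasDerivAt_pow (d + 1) r).const_mul (d + 2 : ℝ)).mul
      ((h.derivu' r hr).mul (h.derivφ r hr)))).congr_deriv ?_
  have h1 : r ^ (d + 2) = r ^ d * r * r := by ring
  have h2 : r ^ (d + 1) = r ^ d * r := by ring
  simp only [show d + 2 - 1 = d + 1 by omega, show d + 1 - 1 = d by omega, h1, h2, varE,
    Pi.mul_apply]
  push_cast
  field_simp
  ring

/-- The coefficient is `r^(n-1)` times `2 (n - 1) (F/f)' - (n - 2)`; its positivity is exactly the
condition imposed on `F/f` above `β`. -/
lemma hasDerivAt_varX (h : Lin d f D a e u u' φ ψ) {r : ℝ} (hr : r ∈ Ioo a e) (hD : r ∉ D)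
    (h0 : 0 < r) (hf0 : f (u r) ≠ 0) : HasDerivAt (varX d f u u' φ ψ)
      (r ^ (d + 2) * (2 * (d + 2) * (1 - prim f (u r) * deriv f (u r) / f (u r) ^ 2) - (d + 1))
        * varE f u u' φ ψ r) r := by
  have hF := (hasDerivAt_prim h.contf (u r)).comp r (h.derivu r hr)
  have hf := (h.derivf r hr hD).hasDerivAt.comp r (h.derivu r hr)
  refine (((hasDerivAt_pow (d + 3) r).mul (h.hasDerivAt_varE hr hD)).add
    (((hasDerivAt_pow (d + 2) r).mul ((hF.div hf hf0).mul (h.derivψ r hr hD))).const_mul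
      (2 * (d + 2) : ℝ))).congr_deriv ?_
  have h1 : r ^ (d + 2) = r ^ (d + 1) * r := by ring
  have h2 : r ^ (d + 3) = r ^ (d + 1) * r * r := by ring
  simp only [show d + 2 - 1 = d + 1 by omega, show d + 3 - 1 = d + 2 by omega, h1, h2, varE,
    Function.comp, Pi.mul_apply, Pi.div_apply]
  push_cast
  field_simp
  ring

/-- If `φ` is positive on `(c, t)`, the variation of the energy is positive at `t`. -/
lemma varE_pos (h : Lin d f D c e' u u' φ ψ) (hc : 0 ≤ c) {t : ℝ} (hct : c < t) (hte : t < e')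
    (hf : ∀ r ∈ Icc c t, 0 < f (u r)) (hE : 0 ≤ varE f u u' φ ψ c)
    (hφ : ∀ r ∈ Ioo c t, 0 < φ r) : 0 < varE f u u' φ ψ t := by
  have h1 := lt_of_hasDerivAt_pos_off_finite h.fin hct
    (g := fun r => r ^ (2 * d + 4) * varE f u u' φ ψ r)
    ((continuousOn_pow _).mul (h.continuousOn_varE.mono fun x hx => ⟨hx.1, hx.2.trans_lt hte⟩))
    (fun x hx hD => h.hasDerivAt_pow_mul_varE ⟨hx.1, hx.2.trans hte⟩ hD (hc.trans_lt hx.1))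
    (fun x hx _ => by
      have e1 := hf x (Ioo_subset_Icc_self hx)
      have e2 := hφ x hx
      have e3 : 0 < x := hc.trans_lt hx.1
      positivity)
  have h2 : 0 ≤ c ^ (2 * d + 4) * varE f u u' φ ψ c := mul_nonneg (pow_nonneg hc _) hE
  exact pos_of_mul_pos_right (h2.trans_lt h1) (pow_nonneg (hc.trans hct.le) _)

lemma eventually_varE_pos (h : Lin d f D c e' u u' φ ψ) (hc : 0 ≤ c) (hce : c < e)
    (hee : e < e') (hf : ∀ r ∈ Icc c e, 0 < f (u r)) (hE : 0 ≤ varE f u u' φ ψ c)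
    (hφ : ∀ᶠ r in 𝓝[>] c, 0 < φ r) :
    ∃ c' ∈ Ioo c e, (∀ r ∈ Ioc c c', 0 < φ r) ∧ ∀ r ∈ Ioc c c', 0 < varE f u u' φ ψ r := by
  obtain ⟨x, hx, hsub⟩ := mem_nhdsGT_iff_exists_Ioc_subset.1 hφ
  have hx : c < x := hx
  have hm : c < min x ((c + e) / 2) := lt_min hx (by linarith)
  have hme : min x ((c + e) / 2) < e := (min_le_right _ _).trans_lt (by linarith)
  have hpos : ∀ r ∈ Ioc c (min x ((c + e) / 2)), 0 < φ r := fun r hr =>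
    hsub ⟨hr.1, hr.2.trans (min_le_left _ _)⟩
  exact ⟨_, ⟨hm, hme⟩, hpos, fun r hr =>
    h.varE_pos hc hr.1 (hr.2.trans_lt (hme.trans hee))
      (fun y hy => hf y ⟨hy.1, hy.2.trans (hr.2.trans hme.le)⟩) hE
      fun y hy => hpos y ⟨hy.1, hy.2.le.trans hr.2⟩⟩

/-- If the variation of the energy is positive on `(c, t)`, then `φ` does not vanish on `(c, t)`
before the maximum of `u`, and at most once after it. -/
lemma phi_pos (h : Lin d f D c e' u u' φ ψ) {c' t : ℝ} (hcc : c < c') (hct : c' ≤ t)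
    (hte : t < e') (hup : ∀ r ∈ Icc c T, 0 ≤ u' r) (hdn : ∀ r ∈ Ioc T t, u' r < 0)
    (hφ : ∀ r ∈ Ioc c c', 0 < φ r) (hE : ∀ r ∈ Ioo c t, 0 < varE f u u' φ ψ r)
    (ht : 0 < φ t ∨ t ≤ T ∧ 0 < ψ t) : ∀ r ∈ Ioc c t, 0 < φ r := by
  intro r hr
  by_contra hcon
  have hcr : c' < r := by
    by_contra hc
    exact hcon (hφ r ⟨hr.1, not_lt.1 hc⟩)
  have hcont : ContinuousOn φ (Icc c' t) :=
    h.contφ.mono fun x hx => ⟨hcc.le.trans hx.1, hx.2.trans_lt hte⟩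
  obtain ⟨t₀, ht₀, h0, hpos⟩ := exists_first_zero (hcont.mono (Icc_subset_Icc_right hr.2)) hcr.le
    (hφ c' ⟨hcc, le_rfl⟩) (not_lt.1 hcon)
  have hψ0 : ψ t₀ ≤ 0 := hasDerivAt_nonpos_of_pos_left ht₀.1
    (h.derivφ t₀ ⟨hcc.trans ht₀.1, ht₀.2.trans_lt (hr.2.trans_lt hte)⟩) h0 hpos
  -- At a zero of `φ` the variation of the energy reduces to `u' ψ`. While `u` does not decrease,
  -- its positivity excludes a zero reached from positive values.
  have hT : t₀ < t → T < t₀ := by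
    intro hlt
    by_contra hc
    have h1 := hE t₀ ⟨hcc.trans ht₀.1, hlt⟩
    have h2 := hup t₀ ⟨(hcc.trans ht₀.1).le, not_lt.1 hc⟩
    simp only [varE, h0, mul_zero, add_zero] at h1
    exact absurd (mul_nonpos_of_nonneg_of_nonpos h2 hψ0) (not_le.2 h1)
  rcases (ht₀.2.trans hr.2).eq_or_lt with heq | hlt
  · subst heq
    rcases ht with h1 | ⟨-, h1⟩ <;> linarith
  · have hTt := hT hlt
    rcases ht with h1 | ⟨h1, -⟩
    -- After the maximum of `u` every zero of `φ` is a downward crossing, so `φ` cannot become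
    -- positive again.
    · obtain ⟨t₉, ht₉, h9, hpos9⟩ := exists_last_zero
        (hcont.mono (Icc_subset_Icc_left ht₀.1.le)) hlt.le h0.le h1
      have hψ9 : 0 ≤ ψ t₉ := hasDerivAt_nonneg_of_pos_right ht₉.2
        (h.derivφ t₉ ⟨hcc.trans (ht₀.1.trans_le ht₉.1), ht₉.2.trans hte⟩) h9 hpos9
      have h2 := hE t₉ ⟨hcc.trans (ht₀.1.trans_le ht₉.1), ht₉.2⟩
      have h3 := hdn t₉ ⟨hTt.trans_le ht₉.1, ht₉.2.le⟩
      simp only [varE, h9, mul_zero, add_zero] at h2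
      exact absurd (mul_nonpos_of_nonpos_of_nonneg h3.le hψ9) (not_le.2 h2)
    · linarith

/-- Propagation of positivity from a point before the maximum of `u` to a point after it. -/
theorem var_pos (h : Lin d f D c e' u u' φ ψ) (hc : 0 ≤ c) (hcT : c ≤ T) (hTe : T < e)
    (hee : e < e') (hup : ∀ r ∈ Icc c T, 0 ≤ u' r) (hdn : ∀ r ∈ Ioc T e, u' r < 0)
    (hf : ∀ r ∈ Icc c e, 0 < f (u r)) (hF : ∀ r ∈ Icc c e, 0 ≤ prim f (u r))
    (hh : ∀ r ∈ Ioo c e, r ∉ D → (d + 1 : ℝ) / (2 * (d + 2))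
      < 1 - prim f (u r) * deriv f (u r) / f (u r) ^ 2)
    (hφ0 : 0 ≤ φ c) (hφ : ∀ᶠ r in 𝓝[>] c, 0 < φ r) (hE0 : 0 ≤ varE f u u' φ ψ c)
    (hX0 : 0 ≤ varX d f u u' φ ψ c) :
    0 < varE f u u' φ ψ e ∧ 0 < varLev d f u u' φ ψ e := by
  have hce : c < e := hcT.trans_lt hTe
  obtain ⟨c', hc', hφ', hE'⟩ := h.eventually_varE_pos hc hce hee hf hE0 hφ
  have hEall : ∀ r ∈ Ioc c e, 0 < varE f u u' φ ψ r := by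
    intro r hr
    by_contra hcon
    have hcr : c' < r := by
      by_contra hc
      exact hcon (hE' r ⟨hr.1, not_lt.1 hc⟩)
    -- Up to a first zero `t` of `varE`, the functional `varX` increases, which forces `ψ t > 0`.
    -- Then `φ` is positive on `(c, t]`, and `varE_pos` contradicts the vanishing at `t`.
    obtain ⟨t, ht, h0, hpos⟩ := exists_first_zero (h.continuousOn_varE.mono fun x hx =>
      (⟨hc'.1.le.trans hx.1, hx.2.trans_lt (hr.2.trans_lt hee)⟩ : x ∈ Ico c e')) hcr.le
      (hE' c' ⟨hc'.1, le_rfl⟩) (not_lt.1 hcon)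
    have hte : t ≤ e := ht.2.trans hr.2
    have hct : c < t := hc'.1.trans ht.1
    have hEt : ∀ r ∈ Ioo c t, 0 < varE f u u' φ ψ r := fun x hx => by
      rcases le_or_gt x c' with h1 | h1
      · exact hE' x ⟨hx.1, h1⟩
      · exact hpos x ⟨h1.le, hx.2⟩
    have hX : varX d f u u' φ ψ c < varX d f u u' φ ψ t := by
      refine lt_of_hasDerivAt_pos_off_finite h.fin hct
        (h.continuousOn_varX (fun x hx => ⟨hx.1, hx.2.trans_lt (hte.trans_lt hee)⟩)
          fun x hx => (hf x ⟨hx.1, hx.2.trans hte⟩).ne')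
        (fun x hx hD => h.hasDerivAt_varX ⟨hx.1, hx.2.trans (hte.trans_lt hee)⟩ hD
          (hc.trans_lt hx.1) (hf x ⟨hx.1.le, hx.2.le.trans hte⟩).ne') fun x hx hD => ?_
      have h1 := hh x ⟨hx.1, hx.2.trans_le hte⟩ hD
      rw [div_lt_iff₀ (by positivity)] at h1
      exact mul_pos (mul_pos (pow_pos (hc.trans_lt hx.1) _) (by linarith)) (hEt x hx)
    have hft := hf t ⟨hct.le, hte⟩
    have ht0 : 0 < t := hc.trans_lt hct
    have hψt : 0 < ψ t := by
      have h1 := hX0.trans_lt hX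
      simp only [varX, h0, mul_zero, zero_add] at h1
      by_contra hcon
      have h2 : 0 ≤ prim f (u t) / f (u t) := div_nonneg (hF t ⟨hct.le, hte⟩) hft.le
      have h3 := mul_nonpos_of_nonneg_of_nonpos h2 (not_lt.1 hcon)
      have h4 := mul_nonpos_of_nonneg_of_nonpos (pow_nonneg ht0.le (d + 2)) h3
      have h5 : 2 * ((d : ℝ) + 2) * (t ^ (d + 2) * (prim f (u t) / f (u t) * ψ t)) ≤ 0 :=
        mul_nonpos_of_nonneg_of_nonpos (by positivity) h4
      linarith
    have hφt : ∀ r ∈ Ioc c t, 0 < φ r := by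
      refine h.phi_pos hc'.1 ht.1.le (hte.trans_lt hee) hup
        (fun x hx => hdn x ⟨hx.1, hx.2.trans hte⟩) hφ' hEt ?_
      rcases le_or_gt t T with htT | htT
      · exact Or.inr ⟨htT, hψt⟩
      · left
        have h1 := hdn t ⟨htT, hte⟩
        have h2 : u' t * ψ t + f (u t) * φ t = 0 := h0
        have h3 := mul_neg_of_neg_of_pos h1 hψt
        exact pos_of_mul_pos_right (by linarith : 0 < f (u t) * φ t) hft.le
    have h1 := h.varE_pos hc hct (hte.trans_lt hee) (fun x hx => hf x ⟨hx.1, hx.2.trans hte⟩) hE0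
      fun x hx => hφt x (Ioo_subset_Ioc_self hx)
    linarith
  have hEe := hEall e ⟨hce, le_rfl⟩
  have he0 : 0 < e := hc.trans_lt hce
  refine ⟨hEe, ?_⟩
  have hu'e := hdn e ⟨hTe, le_rfl⟩
  -- If `φ e ≤ 0` both terms of `varLev` have the right sign. Otherwise `φ` is positive on the whole
  -- interval and `varLev` increases from a nonnegative value at `T`.
  rcases le_or_gt (φ e) 0 with hφe | hφe
  · have h1 : 0 ≤ u' e * φ e := mul_nonneg_of_nonpos_of_nonpos hu'e.le hφe
    exact add_pos_of_pos_of_nonneg (mul_pos (pow_pos he0 _) hEe) (by positivity)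
  · have hφe' := h.phi_pos hc'.1 hc'.2.le hee hup hdn hφ'
      (fun x hx => hEall x (Ioo_subset_Ioc_self hx)) (Or.inl hφe)
    have hT0 : 0 ≤ varLev d f u u' φ ψ T := by
      have hT0 : 0 ≤ T := hc.trans hcT
      have h1 : 0 ≤ φ T ∧ 0 ≤ varE f u u' φ ψ T := by
        rcases hcT.eq_or_lt with rfl | hcT
        · exact ⟨hφ0, hE0⟩
        · exact ⟨(hφe' T ⟨hcT, hTe.le⟩).le, (hEall T ⟨hcT, hTe.le⟩).le⟩
      have h2 := mul_nonneg (hup T ⟨hcT, le_rfl⟩) h1.1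
      have h3 := mul_nonneg (pow_nonneg hT0 (d + 2)) h1.2
      exact add_nonneg h3 (by positivity)
    refine hT0.trans_lt (lt_of_hasDerivAt_pos_off_finite h.fin hTe
      (h.continuousOn_varLev.mono fun x hx => ⟨hcT.trans hx.1, hx.2.trans_lt hee⟩)
      (fun x hx hD => h.hasDerivAt_varLev ⟨hcT.trans_lt hx.1, hx.2.trans hee⟩ hD
        (hc.trans_lt (hcT.trans_lt hx.1))) fun x hx _ => ?_)
    have h1 := hdn x ⟨hx.1, hx.2.le⟩
    have h2 := hφe' x ⟨hcT.trans_lt hx.1, hx.2.le⟩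
    have h3 : 0 < x := hc.trans_lt (hcT.trans_lt hx.1)
    have h4 := mul_neg_of_neg_of_pos h1 h2
    have h5 : 0 < ((d : ℝ) + 2) * x ^ d := by positivity
    nlinarith [mul_neg_of_pos_of_neg h5 h4]

/-- The same for an interval that starts at a zero of the primitive, with `u` increasing. -/
theorem var_pos_of_start (h : Lin d f D a e' u u' φ ψ) (ha : 0 < a) (haT : a < T) (hTe : T < e)
    (hee : e < e') (hup : ∀ r ∈ Ico a T, 0 < u' r) (hT : u' T = 0) (hdn : ∀ r ∈ Ioc T e, u' r < 0)
    (hf : ∀ r ∈ Icc a e, 0 < f (u r)) (hF : ∀ r ∈ Icc a e, 0 ≤ prim f (u r))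
    (hFa : prim f (u a) = 0)
    (hh : ∀ r ∈ Ioo a e, r ∉ D → (d + 1 : ℝ) / (2 * (d + 2))
      < 1 - prim f (u r) * deriv f (u r) / f (u r) ^ 2)
    (hne : φ a ≠ 0 ∨ ψ a ≠ 0) (hE0 : 0 ≤ varE f u u' φ ψ a) (hL0 : 0 ≤ varLev d f u u' φ ψ a) :
    0 < varE f u u' φ ψ e ∧ 0 < varLev d f u u' φ ψ e := by
  have hup' : ∀ r ∈ Icc a T, 0 ≤ u' r := fun r hr => by
    rcases hr.2.eq_or_lt with rfl | h1
    · rw [hT]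
    · exact (hup r ⟨hr.1, h1⟩).le
  have hae : a < e' := haT.trans (hTe.trans hee)
  rcases le_or_gt 0 (φ a) with hφa | hφa
  · refine h.var_pos ha.le haT.le hTe hee hup' hdn hf hF hh hφa ?_ hE0 ?_
    · rcases hφa.eq_or_lt with h0 | h0
      · have h1 : 0 ≤ ψ a := by
          simp only [varE, ← h0, mul_zero, add_zero] at hE0
          exact le_of_mul_le_mul_left (by simpa using hE0) (hup a ⟨le_rfl, haT⟩)
        have h2 : 0 < ψ a := lt_of_le_of_ne h1 (by
          rcases hne with h3 | h3
          · exact (h3 h0.symm).elim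
          · exact h3.symm)
        have h3 : ContinuousWithinAt ψ (Ici a) a := (h.contψ a ⟨le_rfl, hae⟩).mono_of_mem_nhdsWithin
          (Ico_mem_nhdsGE hae)
        obtain ⟨τ, hτ, hτ'⟩ := exists_Icc_of_eventually (h3.tendsto.eventually_const_lt h2)
        filter_upwards [Ioo_mem_nhdsGT (show a < min (a + τ) e' from lt_min (by linarith) hae)]
          with r hr
        have h4 := lt_of_hasDerivAt_pos hr.1
          (h.contφ.mono fun x hx => ⟨hx.1, hx.2.trans_lt (hr.2.trans_le (min_le_right _ _))⟩)
          (fun x hx => h.derivφ x ⟨hx.1, hx.2.trans (hr.2.trans_le (min_le_right _ _))⟩)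
          (fun x hx => hτ' x ⟨hx.1.le, hx.2.le.trans (hr.2.le.trans (min_le_left _ _))⟩)
        linarith
      · exact ((h.contφ a ⟨le_rfl, hae⟩).mono_of_mem_nhdsWithin (mem_of_superset
          (Ioo_mem_nhdsGT hae) Ioo_subset_Ico_self)).tendsto.eventually_const_lt h0
    · simp only [varX, hFa, zero_div, zero_mul, mul_zero, add_zero]
      exact mul_nonneg (pow_nonneg ha.le _) hE0
  -- While `φ < 0` and `u` increases, `varLev` grows. Were `φ` negative up to `T`, `varLev` would
  -- equal `T^(n-1) f φ < 0` there; so `φ` first vanishes earlier, with `ψ > 0`, and `var_pos`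
  -- applies from that zero.
  · have hB : ∀ t, a < t → t ≤ T → (∀ r ∈ Ioo a t, φ r < 0) → 0 < varLev d f u u' φ ψ t := by
      intro t hat htT hneg
      refine hL0.trans_lt (lt_of_hasDerivAt_pos_off_finite h.fin hat
        (h.continuousOn_varLev.mono fun x hx => ⟨hx.1, hx.2.trans_lt (htT.trans_lt (hTe.trans hee))⟩)
        (fun x hx hD => h.hasDerivAt_varLev ⟨hx.1, hx.2.trans (htT.trans_lt (hTe.trans hee))⟩ hD
          (ha.trans hx.1)) fun x hx _ => ?_)
      have h1 := hup x ⟨hx.1.le, hx.2.trans_le htT⟩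
      have h2 := hneg x hx
      have h3 : 0 < x := ha.trans hx.1
      have h5 : 0 < ((d : ℝ) + 2) * x ^ d := by positivity
      nlinarith [mul_neg_of_pos_of_neg h5 (mul_neg_of_pos_of_neg h1 h2)]
    obtain ⟨x, hx, hφx⟩ : ∃ x ∈ Icc a T, 0 ≤ φ x := by
      by_contra hcon
      push Not at hcon
      have h1 := hB T haT le_rfl fun r hr => hcon r (Ioo_subset_Icc_self hr)
      simp only [varLev, varE, hT, zero_mul, zero_add, mul_zero, add_zero] at h1
      have h2 := mul_neg_of_pos_of_neg (hf T ⟨haT.le, hTe.le⟩) (hcon T ⟨haT.le, le_rfl⟩)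
      have h3 := mul_neg_of_pos_of_neg (pow_pos (ha.trans haT) (d + 2)) h2
      linarith
    obtain ⟨t, ht, h0, hpos⟩ := exists_first_zero (g := fun r => -φ r) (a := a) (x := x)
      (h.contφ.mono fun y hy =>
        ⟨hy.1, hy.2.trans_lt (hx.2.trans_lt (hTe.trans hee))⟩).neg hx.1 (by linarith) (by linarith)
    have h0 : φ t = 0 := by linarith
    have htT : t ≤ T := ht.2.trans hx.2
    have ht0 : 0 < t := ha.trans ht.1
    have h1 := hB t ht.1 htT fun r hr => by linarith [hpos r (Ioo_subset_Ico_self hr)]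
    have h2 : 0 < varE f u u' φ ψ t := by
      simp only [varLev, h0, mul_zero, add_zero] at h1
      exact pos_of_mul_pos_right h1 (pow_nonneg ht0.le _)
    have h3 : 0 < u' t * ψ t := by simpa only [varE, h0, mul_zero, add_zero] using h2
    have h4 : 0 < ψ t := pos_of_mul_pos_right h3 (hup' t ⟨ht.1.le, htT⟩)
    have hte : t < e := htT.trans_lt hTe
    refine (h.mono_left ht.1.le).var_pos ht0.le htT hTe hee
      (fun r hr => hup' r ⟨ht.1.le.trans hr.1, hr.2⟩) hdn
      (fun r hr => hf r ⟨ht.1.le.trans hr.1, hr.2⟩) (fun r hr => hF r ⟨ht.1.le.trans hr.1, hr.2⟩)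
      (fun r hr => hh r ⟨ht.1.trans hr.1, hr.2⟩) h0.ge ?_ h2.le ?_
    · have h5 := (hasDerivAt_iff_tendsto_slope.1 (h.derivφ t ⟨ht.1, hte.trans hee⟩)).mono_left
        (nhdsWithin_mono t (fun y hy => ne_of_gt hy : Ioi t ⊆ {t}ᶜ))
      filter_upwards [h5.eventually_const_lt h4, self_mem_nhdsWithin] with y hy hy'
      rw [slope_def_field, h0, sub_zero] at hy
      have : 0 < y - t := sub_pos.2 hy'
      exact (div_pos_iff_of_pos_right this).1 hy
    · have h5 := hf t ⟨ht.1.le, hte.le⟩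
      have h6 := hF t ⟨ht.1.le, hte.le⟩
      unfold varX
      positivity

end Lin

/-! ### A Gronwall estimate for the radial operator -/

/-- Bounds for `r^(d+2) w'` from bounds for its derivative. -/
lemma abs_le_of_flux {d : ℕ} {w' g B B' : ℝ → ℝ} {a r : ℝ} (ha : 0 ≤ a) (har : a ≤ r)
    (cw' : ContinuousOn w' (Icc a r))
    (dw' : ∀ t ∈ Ioo a r, HasDerivAt w' (-((d + 2 : ℝ) / t * w' t) - g t) t)
    (cB : ContinuousOn B (Icc a r)) (dB : ∀ t ∈ Ioo a r, HasDerivAt B (B' t) t)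
    (hB : ∀ t ∈ Ioo a r, |g t| ≤ (d + 2) * B t / t + B' t) (h0 : |w' a| ≤ B a) : |w' r| ≤ B r := by
  rcases har.eq_or_lt with rfl | har
  · exact h0
  have hr : 0 < r := ha.trans_lt har
  have dy : ∀ t ∈ Ioo a r, HasDerivAt (fun t => t ^ (d + 2) * w' t) (-(t ^ (d + 2) * g t)) t := by
    intro t ht
    have h1 : 0 < t := ha.trans_lt ht.1
    refine ((hasDerivAt_pow (d + 2) t).mul (dw' t ht)).congr_deriv ?_
    have : t ^ (d + 2) = t ^ (d + 1) * t := by ring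
    simp only [show d + 2 - 1 = d + 1 by omega, this]
    push_cast
    field_simp
    ring
  have dY : ∀ t ∈ Ioo a r, HasDerivAt (fun t => t ^ (d + 2) * B t)
      (t ^ (d + 2) * ((d + 2) * B t / t + B' t)) t := by
    intro t ht
    have h1 : 0 < t := ha.trans_lt ht.1
    refine ((hasDerivAt_pow (d + 2) t).mul (dB t ht)).congr_deriv ?_
    have : t ^ (d + 2) = t ^ (d + 1) * t := by ring
    simp only [show d + 2 - 1 = d + 1 by omega, this]
    push_cast
    field_simp
  have cy : ContinuousOn (fun t => t ^ (d + 2) * w' t) (Icc a r) := (continuousOn_pow _).mul cw'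
  have cY : ContinuousOn (fun t => t ^ (d + 2) * B t) (Icc a r) := (continuousOn_pow _).mul cB
  have hpow : ∀ t ∈ Ioo a r, 0 < t ^ (d + 2) := fun t ht => pow_pos (ha.trans_lt ht.1) _
  have h1 := le_of_hasDerivAt_nonneg har.le (cY.sub cy) (fun t ht => (dY t ht).sub (dy t ht))
    (fun t ht => by
      have := mul_le_mul_of_nonneg_left ((neg_le_abs (g t)).trans (hB t ht)) (hpow t ht).le
      linarith)
  have h2 := le_of_hasDerivAt_nonneg har.le (cY.add cy) (fun t ht => (dY t ht).add (dy t ht))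
    (fun t ht => by
      have := mul_le_mul_of_nonneg_left ((le_abs_self (g t)).trans (hB t ht)) (hpow t ht).le
      linarith)
  simp only [Pi.sub_apply, Pi.add_apply] at h1 h2
  have h3 := abs_le.1 h0
  have h4 : 0 ≤ a ^ (d + 2) := pow_nonneg ha _
  have h5 : 0 < r ^ (d + 2) := pow_pos hr _
  refine abs_le.2 ⟨?_, ?_⟩
  · refine le_of_mul_le_mul_left ?_ h5
    nlinarith [mul_le_mul_of_nonneg_left h3.1 h4]
  · refine le_of_mul_le_mul_left ?_ h5
    nlinarith [mul_le_mul_of_nonneg_left h3.2 h4]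

/-- In the supremum norm weighted by `exp (-K (r - a))` with `K^2 ≥ 2 L`, the integral operator has
norm at most `1/2`. The constant `M` is independent of `w`, so the estimate is uniform along
sequences. -/
lemma radial_gronwall (d : ℕ) {a e L : ℝ} (ha : 0 ≤ a) (hae : a ≤ e) (hL : 0 ≤ L) :
    ∃ M, 0 ≤ M ∧ ∀ w w' g : ℝ → ℝ, ContinuousOn w (Icc a e) → ContinuousOn w' (Icc a e) →
      (∀ r ∈ Ioo a e, HasDerivAt w (w' r) r) →
      (∀ r ∈ Ioo a e, HasDerivAt w' (-((d + 2 : ℝ) / r * w' r) - g r) r) →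
      (∀ r ∈ Ioo a e, |g r| ≤ L * |w r|) → (0 < a ∨ w' a = 0) →
      ∀ r ∈ Icc a e, |w r| ≤ M * (|w a| + |w' a|) ∧ |w' r| ≤ M * (|w a| + |w' a|) ∧
        (r ∈ Ioo a e → |-((d + 2 : ℝ) / r * w' r) - g r| ≤ M * (|w a| + |w' a|)) := by
  set K := √(2 * L) + 1 with hK
  have hK0 : 0 < K := by positivity
  have hKL : 2 * L ≤ K ^ 2 := by
    have := Real.sq_sqrt (show 0 ≤ 2 * L by positivity)
    have := Real.sqrt_nonneg (2 * L)
    nlinarith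
  set X := Real.exp (K * (e - a)) with hX
  have hX1 : 1 ≤ X := Real.one_le_exp (mul_nonneg hK0.le (by linarith))
  set M₁ := 2 * (1 + (e - a)) * X with hM₁
  set M₂ := 1 + L / K * M₁ with hM₂
  have hea : 0 ≤ e - a := by linarith
  have hM₁0 : 0 ≤ M₁ := by positivity
  have hM₂0 : 0 ≤ M₂ := by positivity
  -- For `a = 0` the coefficient `(n - 1)/r` is singular, and the bound for the second derivative
  -- uses `w' = O(r)` instead.
  set M₃ := (if 0 < a then (d + 2) / a * M₂ else (d + 2) * (L * M₁)) + L * M₁ with hM₃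
  have hM₃0 : 0 ≤ M₃ := by
    have : 0 ≤ L * M₁ := by positivity
    rw [hM₃]
    split_ifs <;> positivity
  refine ⟨M₁ + M₂ + M₃, by positivity, fun w w' g cw cw' dw dw' hg h0 => ?_⟩
  set N := |w a| + |w' a| with hN
  have hN0 : 0 ≤ N := by positivity
  have cexp : ContinuousOn (fun r => Real.exp (-(K * (r - a)))) (Icc a e) := by fun_prop
  obtain ⟨x, hx, hmax⟩ := isCompact_Icc.exists_isMaxOn (s := Icc a e) ⟨a, left_mem_Icc.2 hae⟩
    (cw.abs.mul cexp)
  set S := |w x| * Real.exp (-(K * (x - a))) with hS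
  have hS0 : 0 ≤ S := by positivity
  have hw : ∀ r ∈ Icc a e, |w r| ≤ S * Real.exp (K * (r - a)) := by
    intro r hr
    have h1 : |w r| * Real.exp (-(K * (r - a))) ≤ S := hmax hr
    have h2 := mul_le_mul_of_nonneg_right h1 (Real.exp_pos (K * (r - a))).le
    rwa [mul_assoc, ← Real.exp_add, neg_add_cancel, Real.exp_zero, mul_one] at h2
  have dexp : ∀ t c : ℝ, HasDerivAt (fun t => c * Real.exp (K * (t - a)))
      (c * (Real.exp (K * (t - a)) * K)) t := fun t c =>
    ((((hasDerivAt_id t).sub_const a).const_mul K).exp.const_mul c).congr_deriv (by simp)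
  have hw' : ∀ r ∈ Icc a e, |w' r| ≤ |w' a| + L * S / K * Real.exp (K * (r - a)) := by
    intro r hr
    refine abs_le_of_flux (d := d) (g := g)
      (B := fun t => |w' a| + L * S / K * Real.exp (K * (t - a)))
      (B' := fun t => L * S / K * (Real.exp (K * (t - a)) * K)) ha hr.1
      (cw'.mono (Icc_subset_Icc_right hr.2))
      (fun t ht => dw' t ⟨ht.1, ht.2.trans_le hr.2⟩) (by fun_prop)
      (fun t ht => (dexp t _).const_add _) (fun t ht => ?_) ?_
    · have ht' : t ∈ Ioo a e := ⟨ht.1, ht.2.trans_le hr.2⟩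
      have h1 := (hg t ht').trans (mul_le_mul_of_nonneg_left (hw t (Ioo_subset_Icc_self ht')) hL)
      have h2 : 0 < t := ha.trans_lt ht.1
      have h3 : 0 ≤ (d + 2) * (|w' a| + L * S / K * Real.exp (K * (t - a))) / t := by positivity
      have h4 : L * S / K * (Real.exp (K * (t - a)) * K) = L * (S * Real.exp (K * (t - a))) := by
        field_simp
      linarith
    · have : 0 ≤ L * S / K * Real.exp (K * (a - a)) := by positivity
      linarith
  have hw2 : ∀ r ∈ Icc a e, |w r| ≤ |w a| + |w' a| * (r - a)
      + L * S / K ^ 2 * Real.exp (K * (r - a)) := by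
    intro r hr
    set V : ℝ → ℝ := fun t => |w a| + |w' a| * (t - a) + L * S / K ^ 2 * Real.exp (K * (t - a))
    have dV : ∀ t, HasDerivAt V (|w' a| + L * S / K * Real.exp (K * (t - a))) t := fun t =>
      ((((((hasDerivAt_id t).sub_const a).const_mul |w' a|).const_add |w a|)).add
        (dexp t _)).congr_deriv (by field_simp)
    have cV : ContinuousOn V (Icc a r) := fun t _ => (dV t).continuousAt.continuousWithinAt
    have cw2 := cw.mono (Icc_subset_Icc_right hr.2)
    have hI : ∀ t ∈ Ioo a r, t ∈ Ioo a e := fun t ht => ⟨ht.1, ht.2.trans_le hr.2⟩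
    have h1 := le_of_hasDerivAt_nonneg hr.1 (cV.sub cw2)
      (fun t ht => (dV t).sub (dw t (hI t ht))) (fun t ht => by
        have := (le_abs_self _).trans (hw' t (Ioo_subset_Icc_self (hI t ht)))
        linarith)
    have h2 := le_of_hasDerivAt_nonneg hr.1 (cV.add cw2)
      (fun t ht => (dV t).add (dw t (hI t ht))) (fun t ht => by
        have := (neg_le_abs _).trans (hw' t (Ioo_subset_Icc_self (hI t ht)))
        linarith)
    simp only [Pi.sub_apply, Pi.add_apply] at h1 h2
    have hVa : |w a| ≤ V a := by
      have : 0 ≤ L * S / K ^ 2 * Real.exp (K * (a - a)) := by positivity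
      simp only [V, sub_self, mul_zero] at this ⊢
      linarith
    have h3 := le_abs_self (w a)
    have h4 := neg_le_abs (w a)
    exact abs_le.2 ⟨by linarith, by linarith⟩
  have hLS : L * S / K ^ 2 ≤ S / 2 := by
    rw [div_le_div_iff₀ (by positivity) two_pos]
    nlinarith
  have hSN : S ≤ 2 * (1 + (e - a)) * N := by
    have h1 := hw2 x hx
    have h2 : |w x| = S * Real.exp (K * (x - a)) := by
      rw [hS, mul_assoc, ← Real.exp_add, neg_add_cancel, Real.exp_zero, mul_one]
    have h3 : 1 ≤ Real.exp (K * (x - a)) := Real.one_le_exp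
      (mul_nonneg hK0.le (by linarith [hx.1]))
    have h4 := mul_le_mul_of_nonneg_right hLS (zero_le_one.trans h3)
    have h5 : |w' a| * (x - a) ≤ |w' a| * (e - a) :=
      mul_le_mul_of_nonneg_left (by linarith [hx.2]) (abs_nonneg _)
    have h6 := le_mul_of_one_le_right hS0 h3
    have h7 : 0 ≤ |w a| * (e - a) := by positivity
    have h8 : 0 ≤ |w' a| := abs_nonneg _
    rw [hN]
    nlinarith
  have hexp : ∀ r ∈ Icc a e, Real.exp (K * (r - a)) ≤ X := fun r hr =>
    Real.exp_le_exp.2 (mul_le_mul_of_nonneg_left (by linarith [hr.2]) hK0.le)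
  have b1 : ∀ r ∈ Icc a e, |w r| ≤ M₁ * N := fun r hr =>
    (hw r hr).trans ((mul_le_mul hSN (hexp r hr) (Real.exp_pos _).le (by positivity)).trans
      (le_of_eq (by rw [hM₁]; ring)))
  have b2 : ∀ r ∈ Icc a e, |w' r| ≤ M₂ * N := by
    intro r hr
    have h1 : L * S / K * Real.exp (K * (r - a)) ≤ L / K * M₁ * N := by
      have := mul_le_mul hSN (hexp r hr) (Real.exp_pos _).le (by positivity)
      have h2 : 0 ≤ L / K := by positivity
      calc L * S / K * Real.exp (K * (r - a)) = L / K * (S * Real.exp (K * (r - a))) := by ring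
        _ ≤ L / K * (2 * (1 + (e - a)) * N * X) := mul_le_mul_of_nonneg_left this h2
        _ = L / K * M₁ * N := by rw [hM₁]; ring
    have h2 := hw' r hr
    have h3 : |w' a| ≤ N := le_add_of_nonneg_left (abs_nonneg _)
    rw [hM₂]
    linarith
  have b3 : ∀ r ∈ Ioo a e, |g r| ≤ L * M₁ * N := fun r hr =>
    (hg r hr).trans ((mul_le_mul_of_nonneg_left (b1 r (Ioo_subset_Icc_self hr)) hL).trans
      (le_of_eq (by ring)))
  have b4 : ∀ r ∈ Ioo a e, |-((d + 2 : ℝ) / r * w' r) - g r| ≤ M₃ * N := by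
    intro r hr
    have hr0 : 0 < r := ha.trans_lt hr.1
    have h1 : |-((d + 2 : ℝ) / r * w' r) - g r| ≤ (d + 2) / r * |w' r| + |g r| := by
      refine (abs_sub _ _).trans (add_le_add (le_of_eq ?_) le_rfl)
      rw [abs_neg, abs_mul, abs_of_pos (by positivity)]
    have h2 : (d + 2) / r * |w' r| ≤
        (if 0 < a then (d + 2) / a * M₂ else (d + 2) * (L * M₁)) * N := by
      split_ifs with hpos
      · have h3 : (d + 2 : ℝ) / r ≤ (d + 2) / a :=
          div_le_div_of_nonneg_left (by positivity) hpos hr.1.le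
        rw [mul_assoc]
        exact mul_le_mul h3 (b2 r (Ioo_subset_Icc_self hr)) (abs_nonneg _) (by positivity)
      · have ha0 : a = 0 := le_antisymm (not_lt.1 hpos) ha
        have hw'0 : w' a = 0 := h0.resolve_left hpos
        have h3 : |w' r| ≤ L * M₁ * N * r := by
          refine abs_le_of_flux (d := d) (g := g) (B := fun t => L * M₁ * N * t)
            (B' := fun _ => L * M₁ * N) ha hr.1.le
            (cw'.mono (Icc_subset_Icc_right hr.2.le)) (fun t ht => dw' t ⟨ht.1, ht.2.trans hr.2⟩)
            (by fun_prop) (fun t _ => ((hasDerivAt_id t).const_mul _).congr_deriv (by simp))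
            (fun t ht => ?_) (by rw [hw'0, ha0]; simp)
          have h4 := b3 t ⟨ht.1, ht.2.trans hr.2⟩
          have h5 : 0 < t := ha.trans_lt ht.1
          have h6 : 0 ≤ (d + 2) * (L * M₁ * N * t) / t := by positivity
          linarith
        calc (d + 2) / r * |w' r| ≤ (d + 2) / r * (L * M₁ * N * r) :=
              mul_le_mul_of_nonneg_left h3 (by positivity)
          _ = (d + 2) * (L * M₁) * N := by field_simp
    have h3 := b3 r hr
    rw [hM₃, add_mul]
    linarith
  intro r hr
  have e1 : 0 ≤ M₁ * N := by positivity
  have e2 : 0 ≤ M₂ * N := by positivity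
  have e3 : 0 ≤ M₃ * N := by positivity
  have hsum : (M₁ + M₂ + M₃) * N = M₁ * N + M₂ * N + M₃ * N := by ring
  rw [hsum]
  exact ⟨by linarith [b1 r hr], by linarith [b2 r hr], fun hr' => by linarith [b4 r hr']⟩

/-! ### Linearization along a sequence of solutions -/

/-- The regularity of the nonlinearity on `[b₀, α₁]`, where `b < b₀ < β`, and the bound for the
derivative of `F/f` on `(β, α₁)`. -/
structure Nice (d : ℕ) (f : ℝ → ℝ) (b β b₀ α₁ : ℝ) (D : Set ℝ) : Prop where
  shape : Shape f b β
  lt_b₀ : b < b₀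
  b₀_lt : b₀ < β
  fin : D.Finite
  lip : ∃ L, 0 ≤ L ∧ ∀ x ∈ Icc b₀ α₁, ∀ y ∈ Icc b₀ α₁, |f x - f y| ≤ L * |x - y|
  smooth : ∀ s ∈ Ioo b₀ α₁, s ∉ D → ContDiffAt ℝ 1 f s
  quot : ∀ s ∈ Ioo β α₁, s ∉ D →
    (d + 1 : ℝ) / (2 * (d + 2)) < 1 - prim f s * deriv f s / f s ^ 2

lemma ContDiffAt.continuousAt_deriv_of_one {f : ℝ → ℝ} {x : ℝ} (h : ContDiffAt ℝ 1 f x) :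
    ContinuousAt (deriv f) x := by
  have h1 : ContDiffAt ℝ 0 (fderiv ℝ f) x := h.fderiv_right (by norm_num)
  exact (h1.continuousAt.clm_apply continuousAt_const : ContinuousAt (fun y => fderiv ℝ f y 1) x)

/-- Difference quotients of `f` along two sequences with the same limit. -/
lemma tendsto_sub_div {f : ℝ → ℝ} {x f' ℓ : ℝ} (hf : HasStrictDerivAt f f' x) {y z N : ℕ → ℝ}
    (hy : Tendsto y hyp (𝓝 x)) (hz : Tendsto z hyp (𝓝 x))
    (hq : Tendsto (fun m => (y m - z m) / N m) hyp (𝓝 ℓ)) :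
    Tendsto (fun m => (f (y m) - f (z m)) / N m) hyp (𝓝 (f' * ℓ)) := by
  have h1 := hf.hasStrictFDerivAt.isLittleO.comp_tendsto (hy.prodMk_nhds hz)
  have h2 : (fun m => (f (y m) - f (z m) - (y m - z m) * f') * (N m)⁻¹)
      =o[hyp] fun m => (y m - z m) * (N m)⁻¹ := by
    have := h1.mul_isBigO (Asymptotics.isBigO_refl (fun m => (N m)⁻¹) hyp)
    simpa [Function.comp_def, smul_eq_mul] using this
  have h3 : (fun m => (y m - z m) * (N m)⁻¹) =O[hyp] fun _ => (1 : ℝ) := by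
    simpa only [div_eq_mul_inv] using hq.isBigO_one ℝ
  have h4 := (Asymptotics.isLittleO_one_iff ℝ).1 (h2.trans_isBigO h3)
  have h5 := h4.add (hq.const_mul f')
  rw [zero_add] at h5
  refine h5.congr fun m => ?_
  rw [div_eq_mul_inv, div_eq_mul_inv]
  ring

section

variable {d : ℕ} {f : ℝ → ℝ} {b β b₀ α₁ : ℝ} {D : Set ℝ} {u u' : ℝ → ℝ} {U U' : ℕ → ℝ → ℝ}

lemma eventually_mem_Icc {a e p q : ℝ} (hae : a ≤ e) (hu : ContinuousOn u (Icc a e))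
    (hc : ConvOn (Icc a e) U u) (hr : ∀ r ∈ Icc a e, u r ∈ Ioo p q) :
    ∀ᶠ m in hyp, ∀ r ∈ Icc a e, U m r ∈ Icc p q := by
  obtain ⟨x, hx, hmin⟩ := isCompact_Icc.exists_isMinOn ⟨a, left_mem_Icc.2 hae⟩ hu
  obtain ⟨y, hy, hmax⟩ := isCompact_Icc.exists_isMaxOn ⟨a, left_mem_Icc.2 hae⟩ hu
  have h1 := hr x hx
  have h2 := hr y hy
  have hδ : 0 < min (u x - p) (q - u y) := lt_min (by linarith [h1.1]) (by linarith [h2.2])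
  have h3 := Metric.tendstoUniformlyOn_iff.1
    (hc.tendstoUniformlyOn hu isCompact_Icc subset_rfl) _ hδ
  filter_upwards [h3] with m hm r hr'
  have h4 := hm r hr'
  rw [Real.dist_eq] at h4
  obtain ⟨h5, h6⟩ := lt_min_iff.1 h4
  have h7 : u x ≤ u r := hmin hr'
  have h8 : u r ≤ u y := hmax hr'
  have h9 := abs_lt.1 h5
  have h10 := abs_lt.1 h6
  exact ⟨by linarith [h9.2], by linarith [h10.1]⟩

/-- The normalized differences of a converging sequence of solutions and its limit converge to a
nontrivial solution of the linearized equation. -/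
theorem exists_linearization (hN : Nice d f b β b₀ α₁ D) (hu : Sol d f u u')
    (hU : ∀ᶠ m in hyp, Sol d f (U m) (U' m)) {a e : ℝ} (ha : 0 ≤ a) (hae : a < e)
    (hc : ConvOn (Icc a e) U u) (hur : ∀ r ∈ Icc a e, u r ∈ Ioo b₀ α₁)
    (hD : {r | r ∈ Icc a e ∧ u r ∈ D}.Finite) {N : ℕ → ℝ}
    (hNdef : ∀ m, N m = |U m a - u a| + |U' m a - u' a|) (hNpos : ∀ᶠ m in hyp, 0 < N m) :
    ∃ φ ψ : ℝ → ℝ, Lin d f {r | r ∈ Icc a e ∧ u r ∈ D} a e u u' φ ψ ∧ |φ a| + |ψ a| = 1 ∧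
      ConvOn (Icc a e) (fun m r => (U m r - u r) / N m) φ ∧
      ConvOn (Icc a e) (fun m r => (U' m r - u' r) / N m) ψ := by
  have hsub0 : Icc a e ⊆ Ici 0 := fun x hx => ha.trans hx.1
  have hcu := hu.cont.mono hsub0
  have hcu' := hu.cont'.mono hsub0
  obtain ⟨L, hL, hlip⟩ := hN.lip
  obtain ⟨M, hM, hgron⟩ := radial_gronwall d ha hae.le hL
  have hrange := eventually_mem_Icc hae.le hcu hc hur
  -- The differences and their first two derivatives are all of the size of the initial difference
  -- `N m`, so the quotients by `N m` and their derivatives are equi-Lipschitz.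
  have key : ∀ᶠ m in hyp, ∀ r ∈ Icc a e, |U m r - u r| ≤ M * N m ∧ |U' m r - u' r| ≤ M * N m ∧
      (r ∈ Ioo a e → |(-((d + 2 : ℝ) / r * U' m r) - f (U m r))
        - (-((d + 2 : ℝ) / r * u' r) - f (u r))| ≤ M * N m) := by
    filter_upwards [hU, hrange] with m h1 h2
    have h3 := hgron (fun r => U m r - u r) (fun r => U' m r - u' r)
      (fun r => f (U m r) - f (u r)) ((h1.cont.mono hsub0).sub hcu) ((h1.cont'.mono hsub0).sub hcu')
      (fun r hr => (h1.hasDeriv r (ha.trans_lt hr.1)).sub (hu.hasDeriv r (ha.trans_lt hr.1)))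
      (fun r hr => ((h1.hasDeriv' r (ha.trans_lt hr.1)).sub
        (hu.hasDeriv' r (ha.trans_lt hr.1))).congr_deriv (by ring))
      (fun r hr => hlip _ (h2 r (Ioo_subset_Icc_self hr)) _
        (Ioo_subset_Icc_self (hur r (Ioo_subset_Icc_self hr))))
      (by
        rcases ha.eq_or_lt with h0 | h0
        · right; rw [← h0, h1.init, hu.init, sub_self]
        · exact Or.inl h0)
    intro r hr
    obtain ⟨e1, e2, e3⟩ := h3 r hr
    rw [← hNdef] at e1 e2 e3
    refine ⟨e1, e2, fun hr' => ?_⟩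
    have := e3 hr'
    convert this using 2
    ring
  have hset : {x : ℝ | a ≤ x ∧ (x : WithTop ℝ) ≤ (e : WithTop ℝ)} = Icc a e := by
    ext x; simp [WithTop.coe_le_coe]
  have hdiv : ∀ {m : ℕ} {x y : ℝ}, 0 < N m → |x| ≤ M * N m * y → |x / N m| ≤ M * y := by
    intro m x y h1 h2
    rw [abs_div, abs_of_pos h1, div_le_iff₀ h1]
    linarith
  have hI : ∀ {x y : ℝ}, a ≤ x → (y : WithTop ℝ) ≤ (e : WithTop ℝ) → Icc x y ⊆ Icc a e :=
    fun h1 h2 => Icc_subset_Icc h1 (WithTop.coe_le_coe.1 h2)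
  obtain ⟨φ, hφ, hφc⟩ := exists_convOn_of_lipschitz (a := a) (b := (e : WithTop ℝ)) (A := M)
    (g := fun m r => (U m r - u r) / N m) (K := fun _ => M)
    (by
      filter_upwards [key, hNpos] with m h1 h2
      have := hdiv (y := 1) h2 (by simpa using (h1 a ⟨le_rfl, hae.le⟩).1)
      simpa using this)
    (by
      filter_upwards [key, hNpos, hU] with m h1 h2 h3 x y hx hxy hy
      rw [← sub_div]
      refine hdiv h2 (abs_sub_le_of_hasDerivAt (g := fun r => U m r - u r) hxy
        (((h3.cont.mono hsub0).sub hcu).mono (hI hx hy))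
        (fun t ht => (h3.hasDeriv t (ha.trans_lt (hx.trans_lt ht.1))).sub
          (hu.hasDeriv t (ha.trans_lt (hx.trans_lt ht.1))))
        fun t ht => (h1 t (hI hx hy (Ioo_subset_Icc_self ht))).2.1))
    (fun _ _ _ => le_rfl)
  obtain ⟨ψ, hψ, hψc⟩ := exists_convOn_of_lipschitz (a := a) (b := (e : WithTop ℝ)) (A := M)
    (g := fun m r => (U' m r - u' r) / N m) (K := fun _ => M)
    (by
      filter_upwards [key, hNpos] with m h1 h2
      have := hdiv (y := 1) h2 (by simpa using (h1 a ⟨le_rfl, hae.le⟩).2.1)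
      simpa using this)
    (by
      filter_upwards [key, hNpos, hU] with m h1 h2 h3 x y hx hxy hy
      rw [← sub_div]
      refine hdiv h2 (abs_sub_le_of_hasDerivAt (g := fun r => U' m r - u' r) hxy
        (((h3.cont'.mono hsub0).sub hcu').mono (hI hx hy))
        (fun t ht => (h3.hasDeriv' t (ha.trans_lt (hx.trans_lt ht.1))).sub
          (hu.hasDeriv' t (ha.trans_lt (hx.trans_lt ht.1))))
        fun t ht => (h1 t (hI hx hy (Ioo_subset_Icc_self ht))).2.2
          ⟨hx.trans_lt ht.1, ht.2.trans_le (WithTop.coe_le_coe.1 hy)⟩))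
    (fun _ _ _ => le_rfl)
  rw [hset] at hφ hφc hψ hψc
  have hIc : Ioo a e ⊆ Icc a e := Ioo_subset_Icc_self
  refine ⟨φ, ψ, ⟨hD, hN.shape.cont, hcu.mono Ico_subset_Icc_self, hcu'.mono Ico_subset_Icc_self,
    hφc.mono Ico_subset_Icc_self, hψc.mono Ico_subset_Icc_self,
    fun r hr => hu.hasDeriv r (ha.trans_lt hr.1), fun r hr => hu.hasDeriv' r (ha.trans_lt hr.1),
    fun r hr => ?_, fun r hr hrD => ?_, fun r hr hrD => ?_⟩, ?_, hφ, hψ⟩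
  · refine hasDerivAt_of_convOn (hφ.mono hIc) (hψ.mono hIc) (hψc.mono hIc) ?_ hr
    filter_upwards [hU] with m h1 x hx
    exact ((h1.hasDeriv x (ha.trans_lt hx.1)).sub (hu.hasDeriv x (ha.trans_lt hx.1))).div_const _
  -- Away from the exceptional radii `f` is `C¹` near `u r`, so its difference quotients converge to
  -- `deriv f (u r) * φ r`.
  · have hurD : u r ∉ D := fun h => hrD ⟨hIc hr, h⟩
    have hev : ∀ᶠ x in 𝓝 r, x ∈ Ioo a e ∧ u x ∉ D :=
      Filter.Eventually.and (Ioo_mem_nhds hr.1 hr.2)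
        ((hu.hasDeriv r (ha.trans_lt hr.1)).continuousAt.eventually
          (hN.fin.isClosed.isOpen_compl.mem_nhds hurD))
    obtain ⟨p, q, hpq, hsub⟩ := mem_nhds_iff_exists_Ioo_subset.1 hev
    have hsubI : Ioo p q ⊆ Icc a e := fun x hx => hIc (hsub hx).1
    have hsm : ∀ x ∈ Ioo p q, ContDiffAt ℝ 1 f (u x) := fun x hx =>
      hN.smooth _ (hur x (hsubI hx)) (hsub hx).2
    have hpos : ∀ x ∈ Ioo p q, 0 < x := fun x hx => ha.trans_lt (hsub hx).1.1
    refine hasDerivAt_of_convOn (a := p) (b := q)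
      (g' := fun m x => -((d + 2 : ℝ) / x * ((U' m x - u' x) / N m)) - (f (U m x) - f (u x)) / N m)
      (v' := fun x => -((d + 2 : ℝ) / x * ψ x) - deriv f (u x) * φ x) (hψ.mono hsubI) ?_ ?_ ?_ hpq
    · intro x y hx hy hxy
      have hx' : ∀ᶠ m in hyp, x m ∈ Icc a e := hx.mono fun m h => hsubI h
      refine ((tendsto_const_nhds.div hxy (hpos y hy).ne').mul
        (hψ x y hx' (hsubI hy) hxy)).neg.sub (tendsto_sub_div
        ((hsm y hy).hasStrictDerivAt (by norm_num)) (hc x y hx' (hsubI hy) hxy) ?_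
        (hφ x y hx' (hsubI hy) hxy))
      exact ((hu.hasDeriv y (hpos y hy)).continuousAt.tendsto).comp hxy
    · refine ((ContinuousOn.mul (continuousOn_const.div continuousOn_id fun x hx =>
        (hpos x hx).ne') (hψc.mono hsubI)).neg).sub (ContinuousOn.mul ?_ (hφc.mono hsubI))
      intro x hx
      exact ((ContDiffAt.continuousAt_deriv_of_one (hsm x hx)).comp
        (hu.hasDeriv x (hpos x hx)).continuousAt).continuousWithinAt
    · filter_upwards [hU] with m h1 x hx
      refine (((h1.hasDeriv' x (hpos x hx)).sub (hu.hasDeriv' x (hpos x hx))).div_const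
        (N m)).congr_deriv ?_
      ring
  · exact (hN.smooth _ (hur r (hIc hr)) fun h => hrD ⟨hIc hr, h⟩).differentiableAt (by norm_num)
  · have ha' : a ∈ Icc a e := ⟨le_rfl, hae.le⟩
    refine tendsto_nhds_unique ((hφ.tendsto ha').abs.add (hψ.tendsto ha').abs)
      (tendsto_const_nhds.congr' ?_)
    filter_upwards [hNpos] with m hm
    rw [abs_div, abs_div, ← add_div, ← hNdef, abs_of_pos hm, div_self hm.ne']

end

/-! ### Comparison of nearby solutions at a fixed level -/

lemma exists_mean_value {g g' : ℝ → ℝ} {x y : ℝ} (hc : ContinuousOn g (uIcc x y))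
    (hd : ∀ t ∈ uIcc x y, HasDerivAt g (g' t) t) : ∃ ξ ∈ uIcc x y, g y - g x = g' ξ * (y - x) := by
  rcases lt_trichotomy x y with h | h | h
  · rw [uIcc_of_le h.le] at hc hd ⊢
    obtain ⟨ξ, hξ, e⟩ := exists_hasDerivAt_eq_slope g g' h hc
      fun t ht => hd t (Ioo_subset_Icc_self ht)
    refine ⟨ξ, Ioo_subset_Icc_self hξ, ?_⟩
    rw [e, div_mul_cancel₀ _ (sub_pos.2 h).ne']
  · exact ⟨x, left_mem_uIcc, by simp [h]⟩
  · rw [uIcc_of_ge h.le] at hc hd ⊢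
    obtain ⟨ξ, hξ, e⟩ := exists_hasDerivAt_eq_slope g g' h hc
      fun t ht => hd t (Ioo_subset_Icc_self ht)
    refine ⟨ξ, Ioo_subset_Icc_self hξ, ?_⟩
    have := (sub_pos.2 h).ne'
    rw [e]
    field_simp
    ring

lemma tendsto_of_mem_uIcc {x : ℝ} {c ξ : ℕ → ℝ} (hc : Tendsto c hyp (𝓝 x))
    (hξ : ∀ᶠ m in hyp, ξ m ∈ uIcc x (c m)) : Tendsto ξ hyp (𝓝 x) := by
  refine tendsto_of_tendsto_of_tendsto_of_le_of_le' (g := fun m => min x (c m))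
    (h := fun m => max x (c m)) ?_ ?_ (hξ.mono fun m h => h.1) (hξ.mono fun m h => h.2)
  · simpa using (tendsto_const_nhds (x := x)).min hc
  · simpa using (tendsto_const_nhds (x := x)).max hc

/-- Increments of a converging sequence of functions along a converging sequence of points. -/
lemma tendsto_increment_div {p q r κ : ℝ} (hr : r ∈ Ioo p q) {g g' : ℕ → ℝ → ℝ} {v' : ℝ → ℝ}
    (hd : ∀ᶠ m in hyp, ∀ x ∈ Icc p q, HasDerivAt (g m) (g' m x) x)
    (hg' : ConvOn (Icc p q) g' v') {c N : ℕ → ℝ} (hc : Tendsto c hyp (𝓝 r))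
    (hκ : Tendsto (fun m => (c m - r) / N m) hyp (𝓝 κ)) :
    Tendsto (fun m => (g m (c m) - g m r) / N m) hyp (𝓝 (v' r * κ)) := by
  have hr' := Ioo_subset_Icc_self hr
  have hcm : ∀ᶠ m in hyp, c m ∈ Icc p q := hc.eventually (Icc_mem_nhds hr.1 hr.2)
  have hex : ∀ m, ∃ ξ, (c m ∈ Icc p q ∧ ∀ x ∈ Icc p q, HasDerivAt (g m) (g' m x) x) →
      ξ ∈ uIcc r (c m) ∧ g m (c m) - g m r = g' m ξ * (c m - r) := by
    intro m
    by_cases h : c m ∈ Icc p q ∧ ∀ x ∈ Icc p q, HasDerivAt (g m) (g' m x) x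
    · have hsub : uIcc r (c m) ⊆ Icc p q := uIcc_subset_Icc hr' h.1
      obtain ⟨ξ, h1, h2⟩ := exists_mean_value (x := r) (y := c m)
        (fun t ht => (h.2 t (hsub ht)).continuousAt.continuousWithinAt) fun t ht => h.2 t (hsub ht)
      exact ⟨ξ, fun _ => ⟨h1, h2⟩⟩
    · exact ⟨0, fun h' => (h h').elim⟩
  choose ξ hξ using hex
  have hξ' := (hcm.and hd).mono fun m hm => hξ m hm
  have hlim := tendsto_of_mem_uIcc hc (hξ'.mono fun m h => h.1)
  have h1 := (hg' ξ r (hξ'.mp (hcm.mono fun m h h' => uIcc_subset_Icc hr' h h'.1)) hr' hlim).mul hκ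
  refine h1.congr' (hξ'.mono fun m h => ?_)
  simp only [h.2]
  ring

/-- The solutions `U m` pass the level `u r` near `r` with more energy and with more weighted energy
than `u`. -/
def OrdAt (d : ℕ) (f : ℝ → ℝ) (U U' : ℕ → ℝ → ℝ) (u u' : ℝ → ℝ) (r : ℝ) : Prop :=
  ∃ c : ℕ → ℝ, Tendsto c hyp (𝓝 r) ∧ ∀ᶠ m in hyp, U m (c m) = u r ∧
    energy f u u' r < energy f (U m) (U' m) (c m) ∧
    r ^ (2 * d + 4) * energy f u u' r < c m ^ (2 * d + 4) * energy f (U m) (U' m) (c m)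

lemma OrdAt.neg {d : ℕ} {f : ℝ → ℝ} (hodd : ∀ s, f (-s) = -f s) {U U' : ℕ → ℝ → ℝ} {u u' : ℝ → ℝ}
    {r : ℝ} (h : OrdAt d f U U' u u' r) :
    OrdAt d f (fun m x => -U m x) (fun m x => -U' m x) (fun x => -u x) (fun x => -u' x) r := by
  obtain ⟨c, h1, h2⟩ := h
  refine ⟨c, h1, h2.mono fun m hm => ?_⟩
  rw [energy_neg hodd, energy_neg hodd]
  exact ⟨congrArg Neg.neg hm.1, hm.2⟩

section

variable {d : ℕ} {f : ℝ → ℝ} {b β b₀ α₁ : ℝ} {D : Set ℝ} {u u' : ℝ → ℝ} {U U' : ℕ → ℝ → ℝ}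

lemma tendsto_energy_sub_div (hf : Continuous f) {r φ₀ ψ₀ : ℝ} {N : ℕ → ℝ}
    (hc : Tendsto (fun m => U m r) hyp (𝓝 (u r))) (hc' : Tendsto (fun m => U' m r) hyp (𝓝 (u' r)))
    (hφ : Tendsto (fun m => (U m r - u r) / N m) hyp (𝓝 φ₀))
    (hψ : Tendsto (fun m => (U' m r - u' r) / N m) hyp (𝓝 ψ₀)) :
    Tendsto (fun m => (energy f (U m) (U' m) r - energy f u u' r) / N m) hyp
      (𝓝 (u' r * ψ₀ + f (u r) * φ₀)) := by
  have h1 : Tendsto (fun m => (U' m r + u' r) / 2 * ((U' m r - u' r) / N m)) hyp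
      (𝓝 ((u' r + u' r) / 2 * ψ₀)) := ((hc'.add_const _).div_const 2).mul hψ
  have h2 := tendsto_increment_div (p := u r - 1) (q := u r + 1) (r := u r)
    ⟨by linarith, by linarith⟩ (g := fun _ => prim f) (g' := fun _ => f) (v' := f)
    (Eventually.of_forall fun m x _ => hasDerivAt_prim hf x)
    (fun x y _ _ hxy => (hf.tendsto y).comp hxy) hc hφ
  have h3 := h1.add h2
  rw [show (u' r + u' r) / 2 * ψ₀ = u' r * ψ₀ by ring] at h3
  refine h3.congr fun m => ?_
  simp only [energy]
  ring

/-- First order expansion of the energy and of the weighted energy at a fixed level. -/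
lemma level_expansion (hf : Continuous f)
    (hU : ∀ᶠ m in hyp, Sol d f (U m) (U' m)) {p q r : ℝ} (hp : 0 < p) (hr : r ∈ Ioo p q)
    (hc : ConvOn (Icc p q) U u) (hc' : ConvOn (Icc p q) U' u') (hu' : u' r ≠ 0)
    {c N : ℕ → ℝ} (hcr : Tendsto c hyp (𝓝 r)) (hlev : ∀ᶠ m in hyp, U m (c m) = u r) {φ₀ ψ₀ : ℝ}
    (hφ : Tendsto (fun m => (U m r - u r) / N m) hyp (𝓝 φ₀))
    (hψ : Tendsto (fun m => (U' m r - u' r) / N m) hyp (𝓝 ψ₀)) :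
    Tendsto (fun m => (energy f (U m) (U' m) (c m) - energy f u u' r) / N m) hyp
      (𝓝 (u' r * ψ₀ + f (u r) * φ₀ + (d + 2) / r * (u' r * φ₀))) ∧
    (prim f (u r) = 0 → Tendsto (fun m => (c m ^ (2 * d + 4) * energy f (U m) (U' m) (c m)
      - r ^ (2 * d + 4) * energy f u u' r) / N m) hyp
      (𝓝 (r ^ (2 * d + 4) * (u' r * ψ₀ + f (u r) * φ₀)))) := by
  have hr' := Ioo_subset_Icc_self hr
  have hr0 : 0 < r := hp.trans hr.1
  have hpos : ∀ x ∈ Icc p q, 0 < x := fun x hx => hp.trans_le hx.1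
  have hE := tendsto_energy_sub_div hf (hc.tendsto hr') (hc'.tendsto hr') hφ hψ
  -- To first order, the radius at which `U m` attains the level `u r` moves by `-φ₀ / u' r` times
  -- `N m`.
  have hκ : Tendsto (fun m => (c m - r) / N m) hyp (𝓝 (-(φ₀ / u' r))) := by
    have hcm : ∀ᶠ m in hyp, c m ∈ Icc p q := hcr.eventually (Icc_mem_nhds hr.1 hr.2)
    have hex : ∀ m, ∃ ξ, (c m ∈ Icc p q ∧ Sol d f (U m) (U' m)) →
        ξ ∈ uIcc r (c m) ∧ U m (c m) - U m r = U' m ξ * (c m - r) := by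
      intro m
      by_cases h : c m ∈ Icc p q ∧ Sol d f (U m) (U' m)
      · have hsub : uIcc r (c m) ⊆ Icc p q := uIcc_subset_Icc hr' h.1
        obtain ⟨ξ, h1, h2⟩ := exists_mean_value (g := U m) (g' := U' m) (x := r) (y := c m)
          (fun t ht => (h.2.hasDeriv t (hpos t (hsub ht))).continuousAt.continuousWithinAt)
          fun t ht => h.2.hasDeriv t (hpos t (hsub ht))
        exact ⟨ξ, fun _ => ⟨h1, h2⟩⟩
      · exact ⟨0, fun h' => (h h').elim⟩
    choose ξ hξ using hex
    have hξ' := (hcm.and hU).mono fun m hm => hξ m hm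
    have hlim := tendsto_of_mem_uIcc hcr (hξ'.mono fun m h => h.1)
    have h1 := hc' ξ r (hξ'.mp (hcm.mono fun m h h' => uIcc_subset_Icc hr' h h'.1)) hr' hlim
    refine ((hφ.div h1 hu').neg).congr' ?_
    filter_upwards [hξ', hlev, h1.eventually_ne hu'] with m e1 e2 e3
    simp only [Pi.div_apply]
    have e4 : c m - r = -(U m r - u r) / U' m (ξ m) := by
      rw [eq_div_iff e3, mul_comm, ← e1.2, e2]
      ring
    rw [e4]
    ring
  constructor
  · have h1 := tendsto_increment_div hr (g := fun m => energy f (U m) (U' m))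
      (g' := fun m x => -((d + 2 : ℝ) / x * U' m x ^ 2))
      (v' := fun x => -((d + 2 : ℝ) / x * u' x ^ 2))
      (hU.mono fun m hm x hx => hm.hasDerivAt_energy hf (hpos x hx))
      (fun x y hx hy hxy => ((tendsto_const_nhds.div hxy (hpos y hy).ne').mul
        ((hc' x y hx hy hxy).pow 2)).neg) hcr hκ
    have h2 := hE.add h1
    have h3 : -((d + 2 : ℝ) / r * u' r ^ 2) * -(φ₀ / u' r) = (d + 2) / r * (u' r * φ₀) := by
      field_simp
    rw [h3] at h2
    refine h2.congr fun m => ?_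
    ring
  -- At a zero of `F(u)` the weighted energy is stationary in `r`, so the shift of the radius has no
  -- first order effect on it.
  · intro hF
    have h1 := tendsto_increment_div hr (g := fun m x => x ^ (2 * d + 4) * energy f (U m) (U' m) x)
      (g' := fun m x => (2 * d + 4) * x ^ (2 * d + 3) * prim f (U m x))
      (v' := fun x => (2 * d + 4) * x ^ (2 * d + 3) * prim f (u x))
      (hU.mono fun m hm x hx => hm.hasDerivAt_pow_mul_energy hf (hpos x hx))
      (fun x y hx hy hxy => ((hxy.pow _).const_mul _).mul
        (((continuous_prim hf).tendsto _).comp (hc x y hx hy hxy))) hcr hκ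
    have h2 := (hE.const_mul (r ^ (2 * d + 4))).add h1
    simp only [hF, mul_zero, zero_mul, add_zero] at h2
    refine h2.congr fun m => ?_
    ring

lemma injOn_of_deriv_ne {p q : ℝ} (hd : ∀ x ∈ Icc p q, HasDerivAt u (u' x) x)
    (hne : ∀ x ∈ Icc p q, u' x ≠ 0) : InjOn u (Icc p q) := by
  intro x hx y hy hxy
  by_contra hcon
  wlog h : x < y generalizing x y
  · exact this hy hx hxy.symm (Ne.symm hcon) (lt_of_le_of_ne (not_lt.1 h) (Ne.symm hcon))
  have hsub : Icc x y ⊆ Icc p q := Icc_subset_Icc hx.1 hy.2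
  obtain ⟨ξ, hξ, e⟩ := exists_hasDerivAt_eq_zero h
    (fun t ht => (hd t (hsub ht)).continuousAt.continuousWithinAt) hxy
    fun t ht => hd t (hsub (Ioo_subset_Icc_self ht))
  exact hne ξ (hsub (Ioo_subset_Icc_self hξ)) e

/-- If `u` is injective near `r`, then solutions that converge to `u` and take the value `u r`
between `p` and `q` do so near `r`. -/
lemma tendsto_of_level {p q r : ℝ} (hr : r ∈ Icc p q) (hinj : InjOn u (Icc p q))
    (hc : ConvOn (Icc p q) U u) {c : ℕ → ℝ} (hcm : ∀ᶠ m in hyp, c m ∈ Icc p q)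
    (hlev : ∀ᶠ m in hyp, U m (c m) = u r) : Tendsto c hyp (𝓝 r) := by
  obtain ⟨y, hy, hlim⟩ := exists_tendsto_hyp hcm
  have h1 := tendsto_nhds_unique (hc c y hcm hy hlim)
    (tendsto_const_nhds.congr' (hlev.mono fun m hm => hm.symm))
  rwa [hinj hy hr h1] at hlim

lemma exists_level_seq {p q r : ℝ} (hp : 0 < p) (hr : r ∈ Ioo p q) (hu : Sol d f u u')
    (hU : ∀ᶠ m in hyp, Sol d f (U m) (U' m)) (hc : ConvOn (Icc p q) U u)
    (hneg : ∀ x ∈ Icc p q, u' x < 0) :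
    ∃ c : ℕ → ℝ, Tendsto c hyp (𝓝 r) ∧ ∀ᶠ m in hyp, U m (c m) = u r := by
  have hpq : p ≤ q := hr.1.le.trans hr.2.le
  have hanti : ∀ {x y}, p ≤ x → x < y → y ≤ q → u y < u x := fun hx hxy hy =>
    gt_of_hasDerivAt_neg hxy (hu.cont.mono fun t ht => hp.le.trans (hx.trans ht.1))
      (fun t ht => hu.hasDeriv t (hp.trans_le (hx.trans ht.1.le)))
      fun t ht => hneg t ⟨hx.trans ht.1.le, ht.2.le.trans hy⟩
  have h1 := (hc.tendsto (left_mem_Icc.2 hpq)).eventually_const_lt (hanti le_rfl hr.1 hr.2.le)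
  have h2 := (hc.tendsto (right_mem_Icc.2 hpq)).eventually_lt_const (hanti hr.1.le hr.2 le_rfl)
  have hex : ∀ m, ∃ x, (Sol d f (U m) (U' m) ∧ u r < U m p ∧ U m q < u r) →
      x ∈ Icc p q ∧ U m x = u r := by
    intro m
    by_cases h : Sol d f (U m) (U' m) ∧ u r < U m p ∧ U m q < u r
    · obtain ⟨x, hx, e⟩ := intermediate_value_Icc' hpq (h.1.cont.mono fun t ht => hp.le.trans ht.1)
        ⟨h.2.2.le, h.2.1.le⟩
      exact ⟨x, fun _ => ⟨hx, e⟩⟩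
    · exact ⟨0, fun h' => (h h').elim⟩
  choose c hcc using hex
  have h3 := (hU.and (h1.and h2)).mono fun m hm => hcc m hm
  exact ⟨c, tendsto_of_level (Ioo_subset_Icc_self hr)
    (injOn_of_deriv_ne (fun x hx => hu.hasDeriv x (hp.trans_le hx.1)) fun x hx => (hneg x hx).ne) hc
    (h3.mono fun m h => h.1) (h3.mono fun m h => h.2), h3.mono fun m h => h.2⟩

/-- A positive variation implies the order at the level. -/
lemma ordAt_of_var_pos (hf : Continuous f) (hu : Sol d f u u')
    (hU : ∀ᶠ m in hyp, Sol d f (U m) (U' m)) {p q r : ℝ} (hp : 0 < p) (hr : r ∈ Ioo p q)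
    (hc : ConvOn (Icc p q) U u) (hc' : ConvOn (Icc p q) U' u') (hneg : ∀ x ∈ Icc p q, u' x < 0)
    (hF : prim f (u r) = 0) {N : ℕ → ℝ} (hN : ∀ᶠ m in hyp, 0 < N m) {φ ψ : ℝ → ℝ}
    (hφ : Tendsto (fun m => (U m r - u r) / N m) hyp (𝓝 (φ r)))
    (hψ : Tendsto (fun m => (U' m r - u' r) / N m) hyp (𝓝 (ψ r)))
    (hE : 0 < Lin.varE f u u' φ ψ r) (hL : 0 < Lin.varLev d f u u' φ ψ r) :
    OrdAt d f U U' u u' r := by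
  obtain ⟨c, hcr, hlev⟩ := exists_level_seq hp hr hu hU hc hneg
  have hr0 : 0 < r := hp.trans hr.1
  obtain ⟨h1, h2⟩ := level_expansion hf hU hp hr hc hc' (hneg r (Ioo_subset_Icc_self hr)).ne hcr
    hlev hφ hψ
  have hA : 0 < u' r * ψ r + f (u r) * φ r + (d + 2) / r * (u' r * φ r) := by
    have : Lin.varLev d f u u' φ ψ r = r ^ (d + 2) *
        (u' r * ψ r + f (u r) * φ r + (d + 2) / r * (u' r * φ r)) := by
      unfold Lin.varLev Lin.varE
      have : r ^ (d + 2) = r ^ (d + 1) * r := by ring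
      rw [this]
      field_simp
    rw [this] at hL
    exact pos_of_mul_pos_right hL (pow_nonneg hr0.le _)
  have hG : 0 < r ^ (2 * d + 4) * (u' r * ψ r + f (u r) * φ r) := mul_pos (pow_pos hr0 _) hE
  refine ⟨c, hcr, ?_⟩
  filter_upwards [hlev, hN, h1.eventually_const_lt hA, (h2 hF).eventually_const_lt hG]
    with m e1 e2 e3 e4
  exact ⟨e1, sub_pos.1 ((div_pos_iff_of_pos_right e2).1 e3),
    sub_pos.1 ((div_pos_iff_of_pos_right e2).1 e4)⟩

/-- The order at a level implies that the variations are nonnegative. -/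
lemma OrdAt.var_nonneg {r : ℝ} (h : OrdAt d f U U' u u' r) (hf : Continuous f)
    (hU : ∀ᶠ m in hyp, Sol d f (U m) (U' m)) {p q : ℝ} (hp : 0 < p) (hr : r ∈ Ioo p q)
    (hc : ConvOn (Icc p q) U u) (hc' : ConvOn (Icc p q) U' u') (hne : u' r ≠ 0)
    (hF : prim f (u r) = 0) {N : ℕ → ℝ} (hN : ∀ᶠ m in hyp, 0 < N m) {φ ψ : ℝ → ℝ}
    (hφ : Tendsto (fun m => (U m r - u r) / N m) hyp (𝓝 (φ r)))
    (hψ : Tendsto (fun m => (U' m r - u' r) / N m) hyp (𝓝 (ψ r))) :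
    0 ≤ Lin.varE f u u' φ ψ r ∧ 0 ≤ Lin.varLev d f u u' φ ψ r := by
  obtain ⟨c, hcr, hord⟩ := h
  have hr0 : 0 < r := hp.trans hr.1
  obtain ⟨h1, h2⟩ := level_expansion hf hU hp hr hc hc' hne hcr (hord.mono fun m h => h.1) hφ hψ
  constructor
  · have h3 : 0 ≤ r ^ (2 * d + 4) * (u' r * ψ r + f (u r) * φ r) := by
      refine ge_of_tendsto (h2 hF) ?_
      filter_upwards [hord, hN] with m e1 e2
      exact div_nonneg (sub_nonneg.2 e1.2.2.le) e2.le
    exact nonneg_of_mul_nonneg_right h3 (pow_pos hr0 _)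
  · have h3 : 0 ≤ u' r * ψ r + f (u r) * φ r + (d + 2) / r * (u' r * φ r) := by
      refine ge_of_tendsto h1 ?_
      filter_upwards [hord, hN] with m e1 e2
      exact div_nonneg (sub_nonneg.2 e1.2.1.le) e2.le
    have : Lin.varLev d f u u' φ ψ r = r ^ (d + 2) *
        (u' r * ψ r + f (u r) * φ r + (d + 2) / r * (u' r * φ r)) := by
      unfold Lin.varLev Lin.varE
      have : r ^ (d + 2) = r ^ (d + 1) * r := by ring
      rw [this]
      field_simp
    rw [this]
    exact mul_nonneg (pow_nonneg hr0.le _) h3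

/-- The order at a level excludes that `U m` and `u` have the same Cauchy data there. -/
lemma OrdAt.eventually_ne {r : ℝ} (h : OrdAt d f U U' u u' r)
    (hU : ∀ᶠ m in hyp, Sol d f (U m) (U' m)) {p q : ℝ} (hp : 0 < p) (hr : r ∈ Ioo p q)
    (hcu' : ContinuousOn u' (Icc p q)) (hc' : ConvOn (Icc p q) U' u')
    (hne : ∀ x ∈ Icc p q, 0 < u' x) : ∀ᶠ m in hyp, 0 < |U m r - u r| + |U' m r - u' r| := by
  obtain ⟨c, hcr, hord⟩ := h
  have hpq : p ≤ q := hr.1.le.trans hr.2.le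
  have hr' := Ioo_subset_Icc_self hr
  obtain ⟨y, hy, hmin⟩ := isCompact_Icc.exists_isMinOn ⟨p, left_mem_Icc.2 hpq⟩ hcu'
  have hu := Metric.tendstoUniformlyOn_iff.1
    (hc'.tendstoUniformlyOn hcu' isCompact_Icc subset_rfl) _ (hne y hy)
  filter_upwards [hord, hU, hu, hcr.eventually (Icc_mem_nhds hr.1 hr.2)] with m e1 e2 e3 e4
  by_contra hcon
  have h1 : |U m r - u r| = 0 := le_antisymm (by linarith [abs_nonneg (U' m r - u' r)])
    (abs_nonneg _)
  have h2 : |U' m r - u' r| = 0 := le_antisymm (by linarith [abs_nonneg (U m r - u r)])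
    (abs_nonneg _)
  have h3 : U m r = u r := sub_eq_zero.1 (abs_eq_zero.1 h1)
  have h4 : U' m r = u' r := sub_eq_zero.1 (abs_eq_zero.1 h2)
  have hpos : ∀ x ∈ Icc p q, U' m x ≠ 0 := fun x hx => by
    have a1 := e3 x hx
    have a2 : u' y ≤ u' x := hmin hx
    rw [Real.dist_eq] at a1
    have := (abs_lt.1 a1).2
    linarith
  -- Equal Cauchy data and injectivity of `U m` near `r` would give `c m = r`, against the strict
  -- energy inequality.
  have h5 : c m = r := injOn_of_deriv_ne (fun x hx => e2.hasDeriv x (hp.trans_le hx.1)) hpos e4 hr'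
    (e1.1.trans h3.symm)
  have h6 := e1.2.1
  simp only [h5, energy, h3, h4, lt_irrefl] at h6

end

/-! ### Propagation of the order through the regions above and below the level `β` -/

section

variable {d : ℕ} {f : ℝ → ℝ} {b β b₀ α₁ : ℝ} {D : Set ℝ} {u u' : ℝ → ℝ} {U U' : ℕ → ℝ → ℝ}

lemma Sol.continuousAt_deriv (hu : Sol d f u u') {r : ℝ} (hr : 0 < r) : ContinuousAt u' r :=
  (hu.hasDeriv' r hr).continuousAt

lemma Sol.continuousAt (hu : Sol d f u u') {r : ℝ} (hr : 0 < r) : ContinuousAt u r :=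
  (hu.hasDeriv r hr).continuousAt

lemma exists_right_of_eventually {p : ℝ → Prop} {r e : ℝ} (hre : r < e) (h : ∀ᶠ x in 𝓝 r, p x) :
    ∃ q ∈ Ioo r e, ∀ x ∈ Icc r q, p x := by
  obtain ⟨τ, hτ, h1⟩ := exists_Icc_of_eventually (h.filter_mono nhdsWithin_le_nhds)
  have h2 : 0 < min τ ((e - r) / 2) := lt_min hτ (by linarith)
  have h3 := min_le_left τ ((e - r) / 2)
  have h4 := min_le_right τ ((e - r) / 2)
  exact ⟨r + min τ ((e - r) / 2), ⟨by linarith, by linarith⟩,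
    fun x hx => h1 x ⟨hx.1, by linarith [hx.2]⟩⟩

lemma exists_left_of_eventually {p : ℝ → Prop} {r e : ℝ} (her : e < r) (h : ∀ᶠ x in 𝓝 r, p x) :
    ∃ q ∈ Ioo e r, ∀ x ∈ Icc q r, p x := by
  obtain ⟨q, hq, h1⟩ := exists_right_of_eventually (p := fun x => p (-x)) (r := -r) (e := -e)
    (by linarith) ((continuous_neg.tendsto' (-r) r (by simp)).eventually h)
  refine ⟨-q, ⟨by linarith [hq.2], by linarith [hq.1]⟩, fun x hx => ?_⟩
  have := h1 (-x) ⟨by linarith [hx.2], by linarith [hx.1]⟩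
  simpa using this

lemma eventually_neg_of_convOn {p q : ℝ} (hpq : p ≤ q) (hu' : ContinuousOn u' (Icc p q))
    (hc : ConvOn (Icc p q) U' u') (h : ∀ x ∈ Icc p q, u' x < 0) :
    ∀ᶠ m in hyp, ∀ x ∈ Icc p q, U' m x < 0 := by
  obtain ⟨y, hy, hmax⟩ := isCompact_Icc.exists_isMaxOn ⟨p, left_mem_Icc.2 hpq⟩ hu'
  have h1 := Metric.tendstoUniformlyOn_iff.1
    (hc.tendstoUniformlyOn hu' isCompact_Icc subset_rfl) (-u' y) (by linarith [h y hy])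
  filter_upwards [h1] with m hm x hx
  have h2 := hm x hx
  have h3 : u' x ≤ u' y := hmax hx
  rw [Real.dist_eq] at h2
  linarith [(abs_lt.1 h2).1]

lemma Sol.injOn_of_deriv_ne (hu : Sol d f u u') {p q : ℝ} (hp : 0 ≤ p)
    (hne : ∀ x ∈ Ioo p q, u' x ≠ 0) : InjOn u (Icc p q) := by
  intro x hx y hy hxy
  by_contra hcon
  wlog h : x < y generalizing x y
  · exact this hy hx hxy.symm (Ne.symm hcon) (lt_of_le_of_ne (not_lt.1 h) (Ne.symm hcon))
  obtain ⟨ξ, hξ, e⟩ := exists_hasDerivAt_eq_zero h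
    (hu.cont.mono fun t ht => hp.trans (hx.1.trans ht.1)) hxy
    fun t ht => hu.hasDeriv t (hp.trans_lt (hx.1.trans_lt ht.1))
  exact hne ξ ⟨hx.1.trans_lt hξ.1, hξ.2.trans_le hy.2⟩ e

/-- The order after the first region above `β`, for solutions with larger initial values. -/
theorem ordAt_of_init (hN : Nice d f b β b₀ α₁ D) (hu : Sol d f u u')
    (hU : ∀ᶠ m in hyp, Sol d f (U m) (U' m)) {e e' : ℝ} (he : 0 < e) (hee : e < e')
    (hc : ConvOn (Icc 0 e') U u) (hc' : ConvOn (Icc 0 e') U' u')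
    (h0 : ∀ᶠ m in hyp, u 0 < U m 0) (hα : u 0 < α₁) (hgt : ∀ r ∈ Ico 0 e, β < u r)
    (hue : u e = β) : OrdAt d f U U' u u' e := by
  have hf := hN.shape
  have hge : ∀ r ∈ Icc 0 e, β ≤ u r := fun r hr => by
    rcases hr.2.eq_or_lt with rfl | h1
    · exact hue.ge
    · exact (hgt r ⟨hr.1, h1⟩).le
  have hle : ∀ r, 0 ≤ r → u r < α₁ := fun r hr =>
    ((le_abs_self _).trans (hu.abs_le_init hf (hge 0 ⟨le_rfl, he.le⟩) hr)).trans_lt hα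
  have hfpos : ∀ r ∈ Icc 0 e, 0 < f (u r) := fun r hr => hf.pos _ (hf.b_lt.trans_le (hge r hr))
  obtain ⟨y, hy, hmin⟩ := isCompact_Icc.exists_isMinOn (s := Icc 0 e) ⟨0, left_mem_Icc.2 he.le⟩
    (hf.cont.comp_continuousOn (hu.cont.mono fun x hx => hx.1))
  have hdn : ∀ r ∈ Ioc 0 e, u' r < 0 := fun r hr => by
    have h1 := (hu.solOn (r + 1)).deriv_le_of_le (m := f (u y)) hr.1.le (by linarith)
      fun t ht htr => hmin ⟨ht.le, htr.le.trans hr.2⟩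
    have h2 : 0 < f (u y) * r / (d + 3) := by
      have := hfpos y hy
      have := hr.1
      positivity
    linarith
  obtain ⟨q, hq, hq'⟩ := exists_right_of_eventually hee
    (((hu.continuousAt_deriv he).eventually_lt_const (hdn e ⟨he, le_rfl⟩)).and
      ((hu.continuousAt he).eventually_const_lt (hue ▸ hN.b₀_lt)))
  have hq0 : 0 < q := he.trans hq.1
  have hdnq : ∀ r ∈ Ioc 0 q, u' r < 0 := fun r hr => by
    rcases le_total r e with h1 | h1
    · exact hdn r ⟨hr.1, h1⟩
    · exact (hq' r ⟨h1, hr.2⟩).1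
  have hur : ∀ r ∈ Icc 0 q, u r ∈ Ioo b₀ α₁ := fun r hr => by
    refine ⟨?_, hle r hr.1⟩
    rcases le_total r e with h1 | h1
    · exact hN.b₀_lt.trans_le (hge r ⟨hr.1, h1⟩)
    · exact (hq' r ⟨h1, hr.2⟩).2
  have hinj : InjOn u (Icc 0 q) :=
    hu.injOn_of_deriv_ne le_rfl fun x hx => (hdnq x (Ioo_subset_Ioc_self hx)).ne
  have hsubq : Icc 0 q ⊆ Icc 0 e' := Icc_subset_Icc_right hq.2.le
  have hNpos : ∀ᶠ m in hyp, 0 < |U m 0 - u 0| + |U' m 0 - u' 0| := h0.mono fun m hm =>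
    add_pos_of_pos_of_nonneg (abs_pos.2 (sub_pos.2 hm).ne') (abs_nonneg _)
  obtain ⟨φ, ψ, hLin, hnorm, hφ, hψ⟩ := exists_linearization hN hu hU le_rfl hq0 (hc.mono hsubq) hur
    (Finite.of_injOn (f := u) (t := D) (fun r hr => hr.2) (hinj.mono fun r hr => hr.1) hN.fin)
    (fun _ => rfl) hNpos
  have hmem0 : (0 : ℝ) ∈ Icc 0 q := ⟨le_rfl, hq0.le⟩
  have hψ0 : ψ 0 = 0 := by
    refine tendsto_nhds_unique (hψ.tendsto hmem0) (tendsto_const_nhds.congr' ?_)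
    filter_upwards [hU] with m hm
    rw [hm.init, hu.init, sub_self, zero_div]
  have hφ0 : φ 0 = 1 := by
    have h1 : 0 ≤ φ 0 := by
      refine ge_of_tendsto (hφ.tendsto hmem0) ?_
      filter_upwards [h0, hNpos] with m e1 e2
      exact div_nonneg (sub_nonneg.2 e1.le) e2.le
    rwa [hψ0, abs_zero, add_zero, abs_of_nonneg h1] at hnorm
  have hf0 := hfpos 0 ⟨le_rfl, he.le⟩
  -- The first region starts at the maximum of `u`: the rising part is reduced to the point `0`,
  -- where `φ = 1` and `ψ = 0`.
  obtain ⟨hE, hL⟩ := hLin.var_pos (T := 0) (e := e) le_rfl le_rfl he hq.1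
    (fun r hr => by rw [le_antisymm hr.2 hr.1, hu.init]) hdn hfpos
    (fun r hr => hf.prim_nonneg (hge r hr))
    (fun r hr hrD => hN.quot _ ⟨hgt r ⟨hr.1.le, hr.2⟩, hle r hr.1.le⟩ fun h =>
      hrD ⟨⟨hr.1.le, hr.2.le.trans hq.1.le⟩, h⟩) (by rw [hφ0]; norm_num)
    (((hLin.contφ 0 ⟨le_rfl, hq0⟩).mono_of_mem_nhdsWithin (mem_of_superset
      (Ioo_mem_nhdsGT hq0) Ioo_subset_Ico_self)).tendsto.eventually_const_lt
        (by rw [hφ0]; norm_num))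
    (by simp only [Lin.varE, hφ0, hψ0]; linarith) (by simp [Lin.varX])
  have hsub2 : Icc (e / 2) q ⊆ Icc 0 e' := Icc_subset_Icc (by linarith) hq.2.le
  have hmeme : e ∈ Icc 0 q := ⟨he.le, hq.1.le⟩
  exact ordAt_of_var_pos hf.cont hu hU (p := e / 2) (q := q) (by linarith)
    ⟨by linarith, hq.1⟩ (hc.mono hsub2) (hc'.mono hsub2)
    (fun x hx => hdnq x ⟨by linarith [hx.1], hx.2⟩) (by rw [hue, hf.prim_beta]) hNpos
    (hφ.tendsto hmeme) (hψ.tendsto hmeme) hE hL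

/-- The order is carried over a later region above `β`. -/
theorem OrdAt.over (hN : Nice d f b β b₀ α₁ D) (hu : Sol d f u u')
    (hU : ∀ᶠ m in hyp, Sol d f (U m) (U' m)) {a T e e' : ℝ} (hord : OrdAt d f U U' u u' a)
    (ha : 0 < a) (haT : a < T) (hTe : T < e) (hee : e < e')
    (hc : ConvOn (Icc 0 e') U u) (hc' : ConvOn (Icc 0 e') U' u') (hle : ∀ r, 0 ≤ r → u r < α₁)
    (hgt : ∀ r ∈ Ioo a e, β < u r) (hua : u a = β) (hue : u e = β)
    (hup : ∀ r ∈ Ico a T, 0 < u' r) (hT : u' T = 0) (hdn : ∀ r ∈ Ioc T e, u' r < 0) :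
    OrdAt d f U U' u u' e := by
  have hf := hN.shape
  have hae : a < e := haT.trans hTe
  have he : 0 < e := ha.trans hae
  have hge : ∀ r ∈ Icc a e, β ≤ u r := fun r hr => by
    rcases hr.2.eq_or_lt with rfl | h1
    · exact hue.ge
    rcases hr.1.eq_or_lt with rfl | h2
    · exact hua.ge
    · exact (hgt r ⟨h2, h1⟩).le
  have hfpos : ∀ r ∈ Icc a e, 0 < f (u r) := fun r hr => hf.pos _ (hf.b_lt.trans_le (hge r hr))
  obtain ⟨q, hq, hq'⟩ := exists_right_of_eventually hee
    (((hu.continuousAt_deriv he).eventually_lt_const (hdn e ⟨hTe, le_rfl⟩)).and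
      ((hu.continuousAt he).eventually_const_lt (hue ▸ hN.b₀_lt)))
  have hdnq : ∀ r ∈ Ioc T q, u' r < 0 := fun r hr => by
    rcases le_total r e with h1 | h1
    · exact hdn r ⟨hr.1, h1⟩
    · exact (hq' r ⟨h1, hr.2⟩).1
  have hur : ∀ r ∈ Icc a q, u r ∈ Ioo b₀ α₁ := fun r hr => by
    refine ⟨?_, hle r (ha.le.trans hr.1)⟩
    rcases le_total r e with h1 | h1
    · exact hN.b₀_lt.trans_le (hge r ⟨hr.1, h1⟩)
    · exact (hq' r ⟨h1, hr.2⟩).2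
  have haq : a < q := hae.trans hq.1
  -- `u` is injective on either side of its maximum `T`, so each exceptional value is taken at most
  -- twice.
  have hDfin : {r | r ∈ Icc a q ∧ u r ∈ D}.Finite := by
    have h1 : InjOn u (Icc a T) :=
      hu.injOn_of_deriv_ne ha.le fun x hx => (hup x (Ioo_subset_Ico_self hx)).ne'
    have h2 : InjOn u (Icc T q) := hu.injOn_of_deriv_ne (ha.le.trans haT.le)
      fun x hx => (hdnq x (Ioo_subset_Ioc_self hx)).ne
    refine ((Finite.of_injOn (s := {r | r ∈ Icc a T ∧ u r ∈ D}) (f := u) (t := D)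
      (fun r hr => hr.2) (h1.mono fun r hr => hr.1) hN.fin).union
      (Finite.of_injOn (s := {r | r ∈ Icc T q ∧ u r ∈ D}) (f := u) (t := D)
      (fun r hr => hr.2) (h2.mono fun r hr => hr.1) hN.fin)).subset fun r hr => ?_
    rcases le_total r T with h3 | h3
    · exact Or.inl ⟨⟨hr.1.1, h3⟩, hr.2⟩
    · exact Or.inr ⟨⟨h3, hr.1.2⟩, hr.2⟩
  have hsubq : Icc a q ⊆ Icc 0 e' := Icc_subset_Icc ha.le hq.2.le
  obtain ⟨p₁, hp₁, hp₁'⟩ := exists_left_of_eventually ha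
    ((hu.continuousAt_deriv ha).eventually_const_lt (hup a ⟨le_rfl, haT⟩))
  have hmid : a < (a + T) / 2 := by linarith
  have hsub1 : Icc p₁ ((a + T) / 2) ⊆ Icc 0 e' := Icc_subset_Icc hp₁.1.le (by linarith)
  have hpos1 : ∀ x ∈ Icc p₁ ((a + T) / 2), 0 < u' x := fun x hx => by
    rcases le_total x a with h1 | h1
    · exact hp₁' x ⟨hx.1, h1⟩
    · exact hup x ⟨h1, by linarith [hx.2]⟩
  have hNpos := hord.eventually_ne hU hp₁.1 ⟨hp₁.2, hmid⟩
    (hu.cont'.mono fun x hx => hp₁.1.le.trans hx.1) (hc'.mono hsub1) hpos1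
  obtain ⟨φ, ψ, hLin, hnorm, hφ, hψ⟩ := exists_linearization hN hu hU ha.le haq (hc.mono hsubq) hur
    hDfin (fun _ => rfl) hNpos
  have hmema : a ∈ Icc a q := ⟨le_rfl, haq.le⟩
  have hmeme : e ∈ Icc a q := ⟨hae.le, hq.1.le⟩
  obtain ⟨hEa, hLa⟩ := hord.var_nonneg hf.cont hU hp₁.1 ⟨hp₁.2, hmid⟩ (hc.mono hsub1)
    (hc'.mono hsub1) (hup a ⟨le_rfl, haT⟩).ne' (by rw [hua, hf.prim_beta]) hNpos
    (hφ.tendsto hmema) (hψ.tendsto hmema)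
  obtain ⟨hE, hL⟩ := hLin.var_pos_of_start ha haT hTe hq.1 hup hT hdn hfpos
    (fun r hr => hf.prim_nonneg (hge r hr)) (by rw [hua, hf.prim_beta])
    (fun r hr hrD => hN.quot _ ⟨hgt r hr, hle r (ha.le.trans hr.1.le)⟩ fun h =>
      hrD ⟨⟨hr.1.le, hr.2.le.trans hq.1.le⟩, h⟩)
    (by
      by_contra hcon
      push Not at hcon
      rw [hcon.1, hcon.2] at hnorm
      simp at hnorm) hEa hLa
  have hTe2 : T < (T + e) / 2 := by linarith
  have hsub2 : Icc ((T + e) / 2) q ⊆ Icc 0 e' := Icc_subset_Icc (by linarith) hq.2.le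
  exact ordAt_of_var_pos hf.cont hu hU (p := (T + e) / 2) (q := q) (by linarith)
    ⟨by linarith, hq.1⟩ (hc.mono hsub2) (hc'.mono hsub2)
    (fun x hx => hdnq x ⟨by linarith [hx.1], hx.2⟩) (by rw [hue, hf.prim_beta]) hNpos
    (hφ.tendsto hmeme) (hψ.tendsto hmeme) hE hL

lemma lev_eq_energy {R : ℝ → ℝ} {s : ℝ} (h : u (R s) = s) :
    lev f (fun s => -u' (R s)) s = energy f u u' (R s) := by
  simp [lev, energy, h]

lemma Sol.eq_of_deriv_neg (hu : Sol d f u u') {a x : ℝ} (ha : 0 < a) (hax : a ≤ x)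
    (hneg : ∀ t ∈ Icc a x, u' t < 0) (h : u x = u a) : x = a :=
  hu.injOn_of_deriv_ne ha.le (fun t ht => (hneg t (Ioo_subset_Icc_self ht)).ne)
    ⟨hax, le_rfl⟩ ⟨le_rfl, hax⟩ h

/-- The order is carried from the level `β` down to the level `-β`. -/
theorem OrdAt.down (hf : Shape f b β) (hu : Sol d f u u')
    (hU : ∀ᶠ m in hyp, Sol d f (U m) (U' m)) {r r' e' : ℝ} (hord : OrdAt d f U U' u u' r)
    (hr : 0 < r) (hrr : r < r') (hre : r' < e')
    (hc : ConvOn (Icc 0 e') U u) (hc' : ConvOn (Icc 0 e') U' u')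
    (hur : u r = β) (hur' : u r' = -β) (hneg : ∀ x ∈ Icc r r', u' x < 0)
    (hE : 0 < energy f u u' r') : OrdAt d f U U' u u' r' := by
  have hβ := hf.beta_pos
  have hr'0 : 0 < r' := hr.trans hrr
  obtain ⟨q, hq, hq'⟩ := exists_right_of_eventually hre
    (((hu.continuousAt_deriv hr'0).eventually_lt_const (hneg r' ⟨hrr.le, le_rfl⟩)).and
      ((hu.hasDerivAt_energy hf.cont hr'0).continuousAt.eventually_const_lt hE))
  obtain ⟨p, hp, hp'⟩ := exists_left_of_eventually hr
    ((hu.continuousAt_deriv hr).eventually_lt_const (hneg r ⟨le_rfl, hrr.le⟩))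
  have hnegpq : ∀ x ∈ Icc p q, u' x < 0 := fun x hx => by
    rcases le_total x r with h1 | h1
    · exact hp' x ⟨hx.1, h1⟩
    rcases le_total x r' with h2 | h2
    · exact hneg x ⟨h1, h2⟩
    · exact (hq' x ⟨h2, hx.2⟩).1
  have hrq : r < q := hrr.trans hq.1
  have hpq : p ≤ q := hp.2.le.trans hrq.le
  have hsub : Icc p q ⊆ Icc 0 e' := Icc_subset_Icc hp.1.le hq.2.le
  have huq : u q < -β := hur' ▸ gt_of_hasDerivAt_neg hq.1
    (hu.cont.mono fun t ht => hr'0.le.trans ht.1) (fun t ht => hu.hasDeriv t (hr'0.trans ht.1))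
    fun t ht => (hq' t (Ioo_subset_Icc_self ht)).1
  -- The branches are followed slightly below `-β`, so that this level is included and is reached by
  -- the nearby solutions as well.
  set s₀ := (u q + -β) / 2 with hs₀
  have hs1 : u q < s₀ := by linarith
  have hs2 : s₀ < -β := by linarith
  have hR₁ : ∀ s, ∃ x, s ∈ Ioc s₀ β → x ∈ Icc r q ∧ u x = s := by
    intro s
    by_cases hs : s ∈ Ioc s₀ β
    · obtain ⟨x, hx, e⟩ := intermediate_value_Icc' hrq.le (hu.cont.mono fun t ht => hr.le.trans ht.1)
        (show s ∈ Icc (u q) (u r) from ⟨hs1.le.trans hs.1.le, hur ▸ hs.2⟩)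
      exact ⟨x, fun _ => ⟨hx, e⟩⟩
    · exact ⟨0, fun h => (hs h).elim⟩
  choose R₁ hR₁ using hR₁
  have hB₁ := hu.branch hr (R := R₁) (s₀ := s₀) (s₁ := β) fun s hs => ⟨(hR₁ s hs).1.1, (hR₁ s hs).2,
    fun x hx => hnegpq x ⟨hp.2.le.trans hx.1, hx.2.trans (hR₁ s hs).1.2⟩⟩
  have hmβ : β ∈ Ioc s₀ β := ⟨by linarith, le_rfl⟩
  have hmβ' : -β ∈ Ioc s₀ β := ⟨hs2, by linarith⟩
  have hR₁β : R₁ β = r := hu.eq_of_deriv_neg hr (hR₁ β hmβ).1.1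
    (fun x hx => hnegpq x ⟨hp.2.le.trans hx.1, hx.2.trans (hR₁ β hmβ).1.2⟩)
    ((hR₁ β hmβ).2.trans hur.symm)
  have hinj : InjOn u (Icc p q) := Sol.injOn_of_deriv_ne hu hp.1.le
    fun x hx => (hnegpq x (Ioo_subset_Icc_self hx)).ne
  have hR₁β' : R₁ (-β) = r' := hinj ⟨hp.2.le.trans (hR₁ _ hmβ').1.1, (hR₁ _ hmβ').1.2⟩
    ⟨hp.2.le.trans hrr.le, hq.1.le⟩ ((hR₁ _ hmβ').2.trans hur'.symm)
  obtain ⟨c, hcr, hord⟩ := hord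
  have hex : ∀ m, ∃ x, (Sol d f (U m) (U' m) ∧ (∀ x ∈ Icc p q, U' m x < 0) ∧ U m q < s₀ ∧
      c m ∈ Ioo p q ∧ U m (c m) = u r ∧ energy f u u' r < energy f (U m) (U' m) (c m) ∧
      r ^ (2 * d + 4) * energy f u u' r < c m ^ (2 * d + 4) * energy f (U m) (U' m) (c m)) →
      x ∈ Icc p q ∧ U m x = u r' ∧ energy f u u' r' < energy f (U m) (U' m) x ∧
      r' ^ (2 * d + 4) * energy f u u' r' < x ^ (2 * d + 4) * energy f (U m) (U' m) x := by
    intro m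
    by_cases hm : Sol d f (U m) (U' m) ∧ (∀ x ∈ Icc p q, U' m x < 0) ∧ U m q < s₀ ∧
      c m ∈ Ioo p q ∧ U m (c m) = u r ∧ energy f u u' r < energy f (U m) (U' m) (c m) ∧
      r ^ (2 * d + 4) * energy f u u' r < c m ^ (2 * d + 4) * energy f (U m) (U' m) (c m)
    swap
    · exact ⟨0, fun h => (hm h).elim⟩
    obtain ⟨hUm, hneg', hUq, hcm, hlev, hE1, hE2⟩ := hm
    have hcm0 : 0 < c m := hp.1.trans hcm.1
    have hR₂ : ∀ s, ∃ x, s ∈ Ioc s₀ β → x ∈ Icc (c m) q ∧ U m x = s := by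
      intro s
      by_cases hs : s ∈ Ioc s₀ β
      · obtain ⟨x, hx, e⟩ := intermediate_value_Icc' hcm.2.le
          (hUm.cont.mono fun t ht => hcm0.le.trans ht.1)
          (show s ∈ Icc (U m q) (U m (c m)) from ⟨hUq.le.trans hs.1.le, hlev ▸ hur ▸ hs.2⟩)
        exact ⟨x, fun _ => ⟨hx, e⟩⟩
      · exact ⟨0, fun h => (hs h).elim⟩
    choose R₂ hR₂ using hR₂
    have hn2 : ∀ s ∈ Ioc s₀ β, ∀ x ∈ Icc (c m) (R₂ s), U' m x < 0 := fun s hs x hx =>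
      hneg' x ⟨hcm.1.le.trans hx.1, hx.2.trans (hR₂ s hs).1.2⟩
    have hB₂ := hUm.branch hcm0 (R := R₂) (s₀ := s₀) (s₁ := β) fun s hs =>
      ⟨(hR₂ s hs).1.1, (hR₂ s hs).2, hn2 s hs⟩
    have hR₂β : R₂ β = c m := hUm.eq_of_deriv_neg hcm0 (hR₂ β hmβ).1.1 (hn2 β hmβ)
      ((hR₂ β hmβ).2.trans (hur.symm.trans hlev.symm))
    have key := Branch.order_preserved hf.cont hB₁ hB₂ hmβ'
      (fun x hx => hf.prim_nonpos (abs_le.2 hx))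
      (fun x hx => by
        have hx' : x ∈ Ioc s₀ β := ⟨hs2.trans_le hx.1, hx.2⟩
        rw [lev_eq_energy (hR₁ x hx').2]
        exact (hq' q ⟨hq.1.le, le_rfl⟩).2.trans_le (hu.energy_antitone hf.cont
          (hr.le.trans (hR₁ x hx').1.1) (hR₁ x hx').1.2))
      (by rwa [lev_eq_energy (hR₁ β hmβ).2, lev_eq_energy (hR₂ β hmβ).2, hR₁β, hR₂β])
      (by rwa [lev_eq_energy (hR₁ β hmβ).2, lev_eq_energy (hR₂ β hmβ).2, hR₁β, hR₂β])
    rw [lev_eq_energy (hR₁ _ hmβ').2, lev_eq_energy (hR₂ _ hmβ').2, hR₁β'] at key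
    exact ⟨R₂ (-β), fun _ => ⟨⟨hcm.1.le.trans (hR₂ _ hmβ').1.1, (hR₂ _ hmβ').1.2⟩,
      (hR₂ _ hmβ').2.trans hur'.symm, key⟩⟩
  choose c₂ hc₂ using hex
  have hev : ∀ᶠ m in hyp, c₂ m ∈ Icc p q ∧ U m (c₂ m) = u r' ∧
      energy f u u' r' < energy f (U m) (U' m) (c₂ m) ∧
      r' ^ (2 * d + 4) * energy f u u' r' < c₂ m ^ (2 * d + 4) * energy f (U m) (U' m) (c₂ m) := by
    filter_upwards [hU, eventually_neg_of_convOn hpq (hu.cont'.mono fun x hx => hp.1.le.trans hx.1)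
      (hc'.mono hsub) hnegpq,
      (hc.tendsto (hsub (right_mem_Icc.2 hpq))).eventually_lt_const hs1,
      hcr.eventually (Ioo_mem_nhds hp.2 hrq), hord] with m e1 e2 e3 e4 e5
    exact hc₂ m ⟨e1, e2, e3, e4, e5⟩
  exact ⟨c₂, tendsto_of_level ⟨hp.2.le.trans hrr.le, hq.1.le⟩ hinj (hc.mono hsub)
    (hev.mono fun m h => h.1) (hev.mono fun m h => h.2.1), hev.mono fun m h => h.2⟩

end

/-! ### The decay of the last branch -/

section

variable {d : ℕ} {f : ℝ → ℝ} {b β b₀ α₁ : ℝ} {D : Set ℝ} {u u' w w' : ℝ → ℝ} {U U' : ℕ → ℝ → ℝ}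

lemma Sol.energy_nonneg_of_tendsto (hf : Continuous f) (h : Sol d f u u')
    (hlim : Tendsto u atTop (𝓝 0)) {r : ℝ} (hr : 0 ≤ r) : 0 ≤ energy f u u' r := by
  have h1 : Tendsto (fun x => prim f (u x)) atTop (𝓝 (prim f 0)) :=
    ((continuous_prim hf).tendsto 0).comp hlim
  rw [prim_zero_right] at h1
  refine le_of_tendsto h1 ?_
  filter_upwards [eventually_ge_atTop r] with x hx
  have h2 := h.energy_antitone hf hr hx
  have h3 : prim f (u x) ≤ energy f u u' x := by unfold energy; nlinarith [sq_nonneg (u' x)]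
  linarith

lemma Sol.energy_pos_of_tendsto (hf : Continuous f) (h : Sol d f u u')
    (hlim : Tendsto u atTop (𝓝 0)) {r : ℝ} (hr : 0 ≤ r) (hur : u r ≠ 0) :
    0 < energy f u u' r := by
  refine lt_of_le_of_ne (h.energy_nonneg_of_tendsto hf hlim hr) fun h0 => hur ?_
  have hE : ∀ x, r ≤ x → energy f u u' x = 0 := fun x hx =>
    le_antisymm (h0 ▸ h.energy_antitone hf hr hx)
      (h.energy_nonneg_of_tendsto hf hlim (hr.trans hx))
  refine tendsto_nhds_unique (tendsto_const_nhds.congr' ?_) hlim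
  filter_upwards [eventually_ge_atTop r] with x hx
  exact (h.eq_of_energy_eq_zero hf hr hE hx).symm

lemma Shape.energy_nonpos (hf : Shape f b β) {r : ℝ} (h : |u r| ≤ β) (h' : u' r = 0) :
    energy f u u' r ≤ 0 := by
  rw [energy_of_deriv_eq_zero h']
  exact hf.prim_nonpos h

/-- A solution that leaves the level `β` downwards decreases as long as its energy is positive and
its values stay above `-β`. -/
lemma Sol.deriv_neg_of_energy_pos (hf : Shape f b β) (h : Sol d f w w') {r₀ r : ℝ} (hr₀ : 0 < r₀)
    (hw : w r₀ = β) (hw' : w' r₀ < 0) (hge : ∀ x ∈ Icc r₀ r, -β ≤ w x)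
    (hE : ∀ x ∈ Icc r₀ r, 0 < energy f w w' x) : ∀ x ∈ Icc r₀ r, w' x < 0 := by
  intro x hx
  by_contra hcon
  obtain ⟨t, ht, h0, hpos⟩ := exists_first_zero (g := fun x => -w' x) (a := r₀) (x := x)
    (h.cont'.mono fun y hy => hr₀.le.trans hy.1).neg hx.1 (by linarith) (by linarith)
  have ht' : t ∈ Icc r₀ r := ⟨ht.1.le, ht.2.trans hx.2⟩
  have h1 : w t ≤ w r₀ := ge_of_hasDerivAt_nonpos ht.1.le
    (h.cont.mono fun y hy => hr₀.le.trans hy.1) (fun y hy => h.hasDeriv y (hr₀.trans hy.1))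
    fun y hy => by linarith [hpos y (Ioo_subset_Ico_self hy)]
  exact absurd (hE t ht') (not_lt.2 (hf.energy_nonpos (abs_le.2 ⟨hge t ht', hw ▸ h1⟩)
    (by linarith)))

/-- The branch of a solution that leaves the level `β` downwards and stays nonnegative. -/
lemma Sol.exists_descent (hf : Shape f b β) (h : Sol d f w w') {A : ℝ}
    (hA : ∀ r, 0 ≤ r → |w r| ≤ A) {r₀ : ℝ} (hr₀ : 0 < r₀) (hw : w r₀ = β) (hw' : w' r₀ < 0)
    (hnn : ∀ t, r₀ < t → 0 ≤ w t) :
    ∃ s₀ ∈ Ico 0 β, ∃ R : ℝ → ℝ,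
      (∀ s ∈ Ioc s₀ β, r₀ ≤ R s ∧ w (R s) = s ∧ ∀ x ∈ Icc r₀ (R s), w' x < 0) ∧
      (∀ s ∈ Ioc s₀ β, 0 < energy f w w' (R s)) ∧
      Tendsto (fun s => energy f w w' (R s)) (𝓝[>] s₀) (𝓝 0) ∧
      (Tendsto w atTop (𝓝 0) → s₀ = 0) := by
  have hβ := hf.beta_pos
  have hE₀ : 0 < energy f w w' r₀ := by
    rw [energy, hw, hf.prim_beta]
    have := pow_pos (neg_pos.2 hw') 2
    linarith [neg_sq (w' r₀)]
  have hnn' : ∀ t, r₀ ≤ t → 0 ≤ w t := fun t ht => by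
    rcases ht.eq_or_lt with rfl | ht
    · rw [hw]; exact hβ.le
    · exact hnn t ht
  have hEc : ∀ {x}, ContinuousOn (energy f w w') (Icc r₀ x) :=
    (h.continuousOn_energy hf.cont).mono fun y hy => hr₀.le.trans hy.1
  have hdec : ∀ r, r₀ ≤ r → 0 < energy f w w' r → ∀ x ∈ Icc r₀ r, w' x < 0 := fun r hr hE =>
    h.deriv_neg_of_energy_pos hf hr₀ hw hw' (fun x hx => by linarith [hnn' x hx.1])
      fun x hx => hE.trans_le (h.energy_antitone hf.cont (hr₀.le.trans hx.1) hx.2)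
  have hanti : ∀ r, 0 < energy f w w' r → ∀ x, r₀ ≤ x → x < r → w r < w x := fun r hE x hx hxr =>
    gt_of_hasDerivAt_neg hxr (h.cont.mono fun y hy => hr₀.le.trans (hx.trans hy.1))
      (fun y hy => h.hasDeriv y (hr₀.trans_le (hx.trans hy.1.le)))
      fun y hy => hdec r (hx.trans hxr.le) hE y ⟨hx.trans hy.1.le, hy.2.le⟩
  set S : Set ℝ := {r | r₀ ≤ r ∧ 0 < energy f w w' r} with hS
  have hbdd : BddBelow (w '' S) := ⟨0, by rintro _ ⟨x, hx, rfl⟩; exact hnn' x hx.1⟩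
  have hne : (w '' S).Nonempty := ⟨_, mem_image_of_mem w ⟨le_rfl, hE₀⟩⟩
  -- The branch ends at the infimum of the values taken while the energy is still positive.
  set s₀ := sInf (w '' S) with hs₀
  have hlt : ∀ r ∈ S, s₀ < w r := by
    intro r hr
    obtain ⟨q, hq, hq'⟩ := exists_right_of_eventually (show r < r + 1 by linarith)
      ((h.hasDerivAt_energy hf.cont (hr₀.trans_le hr.1)).continuousAt.eventually_const_lt hr.2)
    have hEq := hq' q ⟨hq.1.le, le_rfl⟩
    exact (csInf_le hbdd (mem_image_of_mem w ⟨hr.1.trans hq.1.le, hEq⟩)).trans_lt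
      (hanti q hEq r hr.1 hq.1)
  have hR : ∀ s, ∃ x, s ∈ Ioc s₀ β → x ∈ S ∧ w x = s := by
    intro s
    by_cases hs : s ∈ Ioc s₀ β
    · obtain ⟨_, ⟨r, hr, rfl⟩, hrs⟩ := exists_lt_of_csInf_lt hne hs.1
      obtain ⟨x, hx, e⟩ := intermediate_value_Icc' hr.1 (h.cont.mono fun t ht => hr₀.le.trans ht.1)
        (show s ∈ Icc (w r) (w r₀) from ⟨hrs.le, hw ▸ hs.2⟩)
      exact ⟨x, fun _ => ⟨⟨hx.1, hr.2.trans_le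
        (h.energy_antitone hf.cont (hr₀.le.trans hx.1) hx.2)⟩, e⟩⟩
    · exact ⟨0, fun h => (hs h).elim⟩
  choose R hR using hR
  -- If the energy stays positive, `w` decays and its energy becomes small; if not, the intermediate
  -- value theorem supplies small positive energies.
  have hsmall : ∀ ε > 0, ∃ r ∈ S, energy f w w' r < ε := by
    intro ε hε
    by_cases hall : ∀ r, r₀ ≤ r → 0 < energy f w w' r
    · have hE : ∀ r, 0 ≤ r → 0 ≤ energy f w w' r := fun r hr =>
        (hall (max r r₀) (le_max_right _ _)).le.trans
          (h.energy_antitone hf.cont hr (le_max_left _ _))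
      have hlim := tendsto_zero_of_nonneg hf h hr₀.le hA hE hnn
      obtain ⟨r, h1, h2, h3⟩ := ((h.eventually_mul_energy_lt hf hlim hε).and
        ((eventually_ge_atTop 1).and (eventually_ge_atTop r₀))).exists
      refine ⟨r, ⟨h3, hall r h3⟩, ?_⟩
      nlinarith [hall r h3]
    · push Not at hall
      obtain ⟨r, hr, hEr⟩ := hall
      have hv : 0 < min (ε / 2) (energy f w w' r₀) := lt_min (by linarith) hE₀
      obtain ⟨x, hx, e⟩ := intermediate_value_Icc' hr hEc
        (show min (ε / 2) (energy f w w' r₀) ∈ Icc _ _ from ⟨hEr.trans hv.le, min_le_right _ _⟩)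
      refine ⟨x, ⟨hx.1, e ▸ hv⟩, ?_⟩
      rw [e]
      exact (min_le_left _ _).trans_lt (by linarith)
  refine ⟨s₀, ⟨le_csInf hne (by rintro _ ⟨x, hx, rfl⟩; exact hnn' x hx.1),
    hw ▸ hlt r₀ ⟨le_rfl, hE₀⟩⟩, R, fun s hs => ⟨(hR s hs).1.1, (hR s hs).2,
    hdec _ (hR s hs).1.1 (hR s hs).1.2⟩, fun s hs => (hR s hs).1.2, ?_, fun hlim => ?_⟩
  · rw [Metric.tendsto_nhds]
    intro ε hε
    obtain ⟨r₁, hr₁, hEr₁⟩ := hsmall ε hε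
    have hwr₁ : w r₁ ≤ β := by
      rcases hr₁.1.eq_or_lt with e | e
      · rw [← e, hw]
      · exact hw ▸ (hanti r₁ hr₁.2 r₀ le_rfl e).le
    filter_upwards [Ioo_mem_nhdsGT (hlt r₁ hr₁)] with s hs
    have hs' := hR s ⟨hs.1, hs.2.le.trans hwr₁⟩
    have hge : r₁ ≤ R s := by
      by_contra hc
      have := hanti r₁ hr₁.2 (R s) hs'.1.1 (not_le.1 hc)
      rw [hs'.2] at this
      exact absurd hs.2 (not_lt.2 this.le)
    rw [Real.dist_eq, sub_zero, abs_of_pos hs'.1.2]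
    exact (h.energy_antitone hf.cont (hr₀.le.trans hr₁.1) hge).trans_lt hEr₁
  · by_contra hs
    have hs0 : 0 < s₀ := lt_of_le_of_ne
      (le_csInf hne (by rintro _ ⟨x, hx, rfl⟩; exact hnn' x hx.1)) (Ne.symm hs)
    have hall : ∀ r, r₀ ≤ r → 0 < energy f w w' r := by
      intro r hr
      by_contra hc
      obtain ⟨t, ht, h0, hpos⟩ := exists_first_zero hEc hr hE₀ (not_lt.1 hc)
      have hwt : w t = 0 := by
        by_contra hne
        exact absurd h0 (h.energy_pos_of_tendsto hf.cont hlim (hr₀.le.trans ht.1.le) hne).ne'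
      have h1 : Tendsto w (𝓝[<] t) (𝓝 (w t)) :=
        ((h.continuousAt (hr₀.trans ht.1)).tendsto).mono_left nhdsWithin_le_nhds
      have h2 : s₀ ≤ w t := ge_of_tendsto h1 (by
        filter_upwards [Ico_mem_nhdsLT ht.1] with y hy
        exact (hlt y ⟨hy.1, hpos y hy⟩).le)
      linarith
    have : s₀ ≤ 0 := ge_of_tendsto hlim (by
      filter_upwards [eventually_ge_atTop r₀] with r hr using (hlt r ⟨hr, hall r hr⟩).le)
    linarith

lemma Branch.mono {s₀ s₀' s₁ : ℝ} {R p : ℝ → ℝ} (h : Branch d f s₀ s₁ R p) (hs : s₀ ≤ s₀') :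
    Branch d f s₀' s₁ R p where
  contR := h.contR.mono (Ioc_subset_Ioc_left hs)
  contp := h.contp.mono (Ioc_subset_Ioc_left hs)
  posR := fun s hs' => h.posR s (Ioc_subset_Ioc_left hs hs')
  posp := fun s hs' => h.posp s (Ioc_subset_Ioc_left hs hs')
  derivR := fun s hs' => h.derivR s (Ioo_subset_Ioo_left hs hs')
  derivp := fun s hs' => h.derivp s (Ioo_subset_Ioo_left hs hs')

/-- A solution that is above a decaying solution in the order at the level `β` cannot stay
nonnegative. -/
lemma false_of_order (hf : Shape f b β) (hu : Sol d f u u') (hw : Sol d f w w') {A : ℝ}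
    (hAu : ∀ r, 0 ≤ r → |u r| ≤ A) (hAw : ∀ r, 0 ≤ r → |w r| ≤ A) {r c : ℝ} (hr : 0 < r)
    (hc : 0 < c) (hur : u r = β) (hwc : w c = β) (hu' : u' r < 0) (hw' : w' c < 0)
    (hun : ∀ t, r < t → 0 ≤ u t) (hwn : ∀ t, c < t → 0 ≤ w t) (hlim : Tendsto u atTop (𝓝 0))
    (hE : energy f u u' r < energy f w w' c)
    (hQ : r ^ (2 * d + 4) * energy f u u' r < c ^ (2 * d + 4) * energy f w w' c) : False := by
  have hβ := hf.beta_pos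
  obtain ⟨s₁, hs₁, R₁, hR₁, hE₁, -, hz⟩ := hu.exists_descent hf hAu hr hur hu' hun
  obtain rfl : s₁ = 0 := hz hlim
  obtain ⟨s₀, hs₀, R₂, hR₂, hE₂, hlim₂, -⟩ := hw.exists_descent hf hAw hc hwc hw' hwn
  have hB₁ := hu.branch hr hR₁
  have hB₂ := hw.branch hc hR₂
  have hm : ∀ {s}, s ∈ Ioc s₀ β → s ∈ Ioc 0 β := fun hs => ⟨hs₀.1.trans_lt hs.1, hs.2⟩
  have hβm : β ∈ Ioc s₀ β := ⟨hs₀.2, le_rfl⟩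
  have e1 : R₁ β = r := hu.eq_of_deriv_neg hr (hR₁ β (hm hβm)).1 (hR₁ β (hm hβm)).2.2
    ((hR₁ β (hm hβm)).2.1.trans hur.symm)
  have e2 : R₂ β = c := hw.eq_of_deriv_neg hc (hR₂ β hβm).1 (hR₂ β hβm).2.2
    ((hR₂ β hβm).2.1.trans hwc.symm)
  have l1 : ∀ s ∈ Ioc 0 β, lev f (fun s => -u' (R₁ s)) s = energy f u u' (R₁ s) := fun s hs =>
    lev_eq_energy (hR₁ s hs).2.1
  have l2 : ∀ s ∈ Ioc s₀ β, lev f (fun s => -w' (R₂ s)) s = energy f w w' (R₂ s) := fun s hs =>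
    lev_eq_energy (hR₂ s hs).2.1
  have hF : ∀ x ∈ Ioc 0 β, prim f x ≤ 0 := fun x hx =>
    hf.prim_nonpos (abs_le.2 ⟨by linarith [hx.1], hx.2⟩)
  have key : ∀ s ∈ Ioc s₀ β, _ := fun s hs =>
    Branch.order_preserved hf.cont (hB₁.mono hs₀.1) hB₂ hs
      (fun x hx => hF x (hm ⟨hs.1.trans_le hx.1, hx.2⟩))
      (fun x hx => by
        have hx' : x ∈ Ioc s₀ β := ⟨hs.1.trans_le hx.1, hx.2⟩
        rw [l1 x (hm hx')]; exact hE₁ x (hm hx'))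
      (by rwa [l1 β (hm hβm), l2 β hβm, e1, e2]) (by rwa [l1 β (hm hβm), l2 β hβm, e1, e2])
  have hlim₂' : Tendsto (lev f (fun s => -w' (R₂ s))) (𝓝[>] s₀) (𝓝 0) := by
    refine hlim₂.congr' ?_
    filter_upwards [Ioc_mem_nhdsGT hs₀.2] with s hs using (l2 s hs).symm
  -- If the second descent also reaches the level zero, `Branch.false_of_tendsto_zero` applies. If
  -- it ends at a positive level, its energy vanishes there although it is at least the positive
  -- energy of the first branch.
  rcases hs₀.1.eq_or_lt with h0 | h0
  · subst h0
    exact Branch.false_of_tendsto_zero hf.cont hB₁ hB₂ hβ hF hf.b_pos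
      (fun x hx => hf.nonpos x ⟨hx.1.le, hx.2⟩) (fun x hx => by rw [l1 x hx]; exact hE₁ x hx)
      (fun x hx => (key x hx).1) (fun x hx => (key x hx).2) hlim₂'
  · have hs₀m : s₀ ∈ Ioo 0 β := ⟨h0, hs₀.2⟩
    have hc1 : Tendsto (lev f (fun s => -u' (R₁ s))) (𝓝[>] s₀)
        (𝓝 (lev f (fun s => -u' (R₁ s)) s₀)) :=
      (hB₁.hasDerivAt_lev hf.cont hs₀m).continuousAt.tendsto.mono_left nhdsWithin_le_nhds
    have h1 := le_of_tendsto_of_tendsto hc1 hlim₂' (by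
      filter_upwards [Ioc_mem_nhdsGT hs₀.2] with s hs using (key s hs).1.le)
    rw [l1 s₀ (Ioo_subset_Ioc_self hs₀m)] at h1
    exact absurd (hE₁ s₀ (Ioo_subset_Ioc_self hs₀m)) (not_lt.2 h1)

/-- Solutions that are above a decaying solution in the order at the level `β` become negative. -/
theorem OrdAt.eventually_neg (hf : Shape f b β) (hu : Sol d f u u')
    (hU : ∀ᶠ m in hyp, Sol d f (U m) (U' m)) {r e' A : ℝ} (hord : OrdAt d f U U' u u' r)
    (hr : 0 < r) (hre : r < e') (hc : ConvOn (Icc 0 e') U u) (hc' : ConvOn (Icc 0 e') U' u')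
    (hAu : ∀ r, 0 ≤ r → |u r| ≤ A) (hAU : ∀ᶠ m in hyp, ∀ r, 0 ≤ r → |U m r| ≤ A)
    (hur : u r = β) (hu' : u' r < 0) (hun : ∀ t, r < t → 0 ≤ u t) (hlim : Tendsto u atTop (𝓝 0)) :
    ∀ᶠ m in hyp, ∃ t, r < t ∧ U m t < 0 := by
  rcases eventually_hyp_or_not fun m => ∃ t, r < t ∧ U m t < 0 with h1 | h1
  · exact h1
  exfalso
  have hβ := hf.beta_pos
  have hev := ((hu.continuousAt_deriv hr).eventually_lt_const hu').and
    ((hu.continuousAt hr).eventually_const_lt (hur ▸ hβ : 0 < u r))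
  obtain ⟨q, hq, hq'⟩ := exists_right_of_eventually hre hev
  obtain ⟨p, hp, hp'⟩ := exists_left_of_eventually hr hev
  have hpq' : ∀ x ∈ Icc p q, u' x < 0 ∧ 0 < u x := fun x hx => by
    rcases le_total x r with h2 | h2
    · exact hp' x ⟨hx.1, h2⟩
    · exact hq' x ⟨h2, hx.2⟩
  have hpq : p ≤ q := hp.2.le.trans hq.1.le
  have hsub : Icc p q ⊆ Icc 0 e' := Icc_subset_Icc hp.1.le hq.2.le
  have hp0 : ∀ x ∈ Icc p q, 0 ≤ x := fun x hx => hp.1.le.trans hx.1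
  obtain ⟨c, hcr, hord⟩ := hord
  obtain ⟨m, m1, m2, m3, m4, m5, m6, m7⟩ := (h1.and (hU.and (hAU.and (hord.and
    ((hcr.eventually (Ioo_mem_nhds hp.2 hq.1)).and ((eventually_neg_of_convOn hpq
      (hu.cont'.mono hp0) (hc'.mono hsub) fun x hx => (hpq' x hx).1).and
      (eventually_neg_of_convOn hpq (hu.cont.mono hp0).neg (hc.mono hsub).neg fun x hx =>
        neg_lt_zero.2 (hpq' x hx).2))))))).exists
  push Not at m1
  refine false_of_order hf hu m2 hAu m3 hr (hp.1.trans m5.1) hur (m4.1.trans hur) hu'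
    (m6 _ (Ioo_subset_Icc_self m5)) hun (fun t ht => ?_) hlim m4.2.1 m4.2.2
  rcases le_or_gt t r with h2 | h2
  · have := m7 t ⟨m5.1.le.trans ht.le, h2.trans hq.1.le⟩
    linarith
  · exact m1 t h2

end

/-! ### Solutions near a bound state have one more sign change -/

section

variable {d : ℕ} {f : ℝ → ℝ} {b β b₀ α₁ : ℝ} {D : Set ℝ} {u u' : ℝ → ℝ} {U U' : ℕ → ℝ → ℝ}

lemma Sol.flux_lt (hu : Sol d f u u') {x y : ℝ} (hx : 0 < x) (hxy : x < y)
    (hf : ∀ t ∈ Ioo x y, f (u t) < 0) : x ^ (d + 2) * u' x < y ^ (d + 2) * u' y := by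
  refine lt_of_hasDerivAt_pos (g := fun t => t ^ (d + 2) * u' t) hxy
    ((continuousOn_pow _).mul (hu.cont'.mono fun t ht => hx.le.trans ht.1))
    (fun t ht => (hu.solOn (t + 1)).hasDerivAt_flux (hx.trans ht.1) (by linarith)) fun t ht => ?_
  have h1 : 0 < t ^ (d + 2) := pow_pos (hx.trans ht.1) _
  have := mul_neg_of_pos_of_neg h1 (hf t ht)
  linarith

/-- The next excursion below `-β` of a decaying solution that becomes negative. -/
lemma Sol.exists_next (hf : Shape f b β) (hu : Sol d f u u') (hlim : Tendsto u atTop (𝓝 0))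
    {r t : ℝ} (hr : 0 < r) (hur : u r = β) (hu' : u' r < 0) (hrt : r < t) (hut : u t < 0) :
    ∃ r' T e, r < r' ∧ r' < T ∧ T < e ∧ u r' = -β ∧ (∀ x ∈ Icc r r', u' x < 0) ∧
      (∀ x ∈ Ico r' T, u' x < 0) ∧ u' T = 0 ∧ (∀ x ∈ Ioc T e, 0 < u' x) ∧ u e = -β ∧
      (∀ x ∈ Ioo r' e, u x < -β) ∧ ∀ x, t ≤ x → x ≤ e → u x < 0 := by
  have hβ := hf.beta_pos
  have hcont : ∀ {x y}, r ≤ x → ContinuousOn u (Icc x y) := fun hx =>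
    hu.cont.mono fun z hz => hr.le.trans (hx.trans hz.1)
  have hEt : 0 < energy f u u' t := hu.energy_pos_of_tendsto hf.cont hlim (hr.le.trans hrt.le) hut.ne
  -- If `u` stayed above `-β`, it would keep decreasing from the negative value at `t`, since
  -- critical values in `[-β, β]` have nonpositive energy; this contradicts decay to zero.
  obtain ⟨x₁, hx₁, hux₁⟩ : ∃ x, r < x ∧ u x ≤ -β := by
    by_contra hcon
    push Not at hcon
    have hge : ∀ x, r ≤ x → -β ≤ u x := fun x hx => by
      rcases hx.eq_or_lt with rfl | hx
      · rw [hur]; linarith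
      · exact (hcon x hx).le
    have h1 : ∀ x ∈ Icc r t, u' x < 0 := hu.deriv_neg_of_energy_pos hf hr hur hu'
      (fun x hx => hge x hx.1)
      fun x hx => hEt.trans_le (hu.energy_antitone hf.cont (hr.le.trans hx.1) hx.2)
    have h2 : ∀ x, t ≤ x → u' x < 0 := by
      intro x hx
      by_contra hc
      obtain ⟨y, hy, h0, hpos⟩ := exists_first_zero (g := fun x => -u' x) (a := t) (x := x)
        (hu.cont'.mono fun z hz => hr.le.trans (hrt.le.trans hz.1)).neg hx
        (by linarith [h1 t ⟨hrt.le, le_rfl⟩]) (by linarith)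
      have h3 : u y ≤ u t := ge_of_hasDerivAt_nonpos hy.1.le (hcont hrt.le)
        (fun z hz => hu.hasDeriv z (hr.trans (hrt.trans hz.1)))
        fun z hz => by linarith [hpos z (Ioo_subset_Ico_self hz)]
      exact absurd (hu.energy_pos_of_tendsto hf.cont hlim (hr.le.trans (hrt.le.trans hy.1.le))
        (h3.trans_lt hut).ne) (not_lt.2 (hf.energy_nonpos
          (abs_le.2 ⟨hge y (hrt.le.trans hy.1.le), by linarith⟩) (by linarith)))
    have h3 : (0 : ℝ) ≤ u t := le_of_tendsto hlim (by
      filter_upwards [eventually_ge_atTop t] with x hx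
      exact ge_of_hasDerivAt_nonpos hx (hcont hrt.le)
        (fun z hz => hu.hasDeriv z (hr.trans (hrt.trans hz.1))) fun z hz => (h2 z hz.1.le).le)
    linarith
  obtain ⟨r', hr', h0, hpos⟩ := exists_first_zero (g := fun x => u x + β) (a := r) (x := x₁)
    ((hcont le_rfl).add continuousOn_const) hx₁.le (by rw [hur]; linarith) (by linarith)
  have hur' : u r' = -β := by linarith
  have hr'0 : 0 < r' := hr.trans hr'.1
  have hEr' : 0 < energy f u u' r' :=
    hu.energy_pos_of_tendsto hf.cont hlim hr'0.le (by rw [hur']; linarith)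
  have hneg : ∀ x ∈ Icc r r', u' x < 0 := hu.deriv_neg_of_energy_pos hf hr hur hu'
    (fun x hx => by
      rcases hx.2.eq_or_lt with e | e
      · rw [e, hur']
      · linarith [hpos x ⟨hx.1, e⟩])
    fun x hx => hEr'.trans_le (hu.energy_antitone hf.cont (hr.le.trans hx.1) hx.2)
  obtain ⟨q, hq, hq'⟩ := exists_right_of_eventually (show r' < r' + 1 by linarith)
    ((hu.continuousAt_deriv hr'0).eventually_lt_const (hneg r' ⟨hr'.1.le, le_rfl⟩))
  have hlow : ∀ x ∈ Ioc r' q, u x < -β := fun x hx => hur' ▸ gt_of_hasDerivAt_neg hx.1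
    (hcont hr'.1.le) (fun z hz => hu.hasDeriv z (hr'0.trans hz.1))
    fun z hz => hq' z ⟨hz.1.le, hz.2.le.trans hx.2⟩
  obtain ⟨x₂, hx₂, hx₂q⟩ := ((hlim.eventually_const_lt (show -β < 0 by linarith)).and
    (eventually_ge_atTop q)).exists
  obtain ⟨e, he, he0, hepos⟩ := exists_first_zero (g := fun x => -β - u x) (a := q) (x := x₂)
    (continuousOn_const.sub (hcont (hr'.1.le.trans hq.1.le))) hx₂q
    (by linarith [hlow q ⟨hq.1, le_rfl⟩]) (by linarith)
  have hue : u e = -β := by linarith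
  have hbelow : ∀ x ∈ Ioo r' e, u x < -β := fun x hx => by
    rcases le_total x q with h1 | h1
    · exact hlow x ⟨hx.1, h1⟩
    · linarith [hepos x ⟨h1, hx.2⟩]
  have hr'e : r' < e := hq.1.trans he.1
  obtain ⟨T, hT, hmin⟩ := isCompact_Icc.exists_isMinOn (s := Icc r' e) ⟨r', left_mem_Icc.2 hr'e.le⟩
    (hcont hr'.1.le)
  have huT : u T < -β := lt_of_le_of_lt (hmin ⟨hq.1.le, he.1.le⟩) (hbelow q ⟨hq.1, he.1⟩)
  have hrT : r' < T := lt_of_le_of_ne hT.1 fun h => by rw [← h] at huT; linarith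
  have hTe : T < e := lt_of_le_of_ne hT.2 fun h => by rw [h] at huT; linarith
  have hT0 : 0 < T := hr'0.trans hrT
  have hdT : u' T = 0 := by
    have hlm : IsLocalMin u T := by
      filter_upwards [Ioo_mem_nhds hrT hTe] with y hy using hmin (Ioo_subset_Icc_self hy)
    exact hlm.hasDerivAt_eq_zero (hu.hasDeriv T hT0)
  -- Below `-β` the flux is strictly increasing, so `u'` vanishes only at the minimum `T`.
  have hfneg : ∀ x ∈ Ioo r' e, f (u x) < 0 := fun x hx => by
    have h1 := hf.pos (-u x) (by linarith [hbelow x hx, hf.b_lt])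
    rw [hf.odd] at h1
    linarith
  refine ⟨r', T, e, hr'.1, hrT, hTe, hur', hneg, fun x hx => ?_, hdT, fun x hx => ?_, hue, hbelow,
    fun x h1 h2 => ?_⟩
  · have h1 := hu.flux_lt (hr'0.trans_le hx.1) hx.2
      fun y hy => hfneg y ⟨hx.1.trans_lt hy.1, hy.2.trans hTe⟩
    rw [hdT, mul_zero] at h1
    by_contra hc
    exact absurd h1 (not_lt.2 (mul_nonneg (pow_nonneg (hr'0.le.trans hx.1) _) (not_lt.1 hc)))
  · have h1 := hu.flux_lt hT0 hx.1 fun y hy => hfneg y ⟨hrT.trans hy.1, hy.2.trans_le hx.2⟩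
    rw [hdT, mul_zero] at h1
    exact pos_of_mul_pos_right h1 (pow_nonneg (hT0.le.trans hx.1.le) _)
  · rcases le_or_gt x r' with h3 | h3
    · exact lt_of_le_of_lt (ge_of_hasDerivAt_nonpos h1 (hcont hrt.le)
        (fun z hz => hu.hasDeriv z (hr.trans (hrt.trans hz.1)))
        fun z hz => (hneg z ⟨hrt.le.trans hz.1.le, hz.2.le.trans h3⟩).le) hut
    · rcases h2.eq_or_lt with h4 | h4
      · rw [h4, hue]; linarith
      · linarith [hbelow x ⟨h3, h4⟩]

lemma AltFrom.of_neg {j : ℕ} {r : ℝ} (h : AltFrom (fun x => -u x) j r) : AltFrom u j r := by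
  simpa using h.neg

/-- If solutions are above a decaying solution in the order at the level `β`, they have at least one
more sign change. -/
theorem OrdAt.altFrom_succ (hN : Nice d f b β b₀ α₁ D) {j : ℕ} : ∀ {u u' : ℝ → ℝ}
    {U U' : ℕ → ℝ → ℝ} {r A : ℝ}, Sol d f u u' → (∀ᶠ m in hyp, Sol d f (U m) (U' m)) →
    (∀ e, 0 ≤ e → 0 < energy f u u' e → ConvOn (Icc 0 e) U u ∧ ConvOn (Icc 0 e) U' u') →
    (∀ r, 0 ≤ r → |u r| < α₁) → (∀ᶠ m in hyp, ∀ r, 0 ≤ r → |U m r| ≤ A) →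
    Tendsto u atTop (𝓝 0) → 0 < r → u r = β → u' r < 0 → OrdAt d f U U' u u' r →
    AltFrom u j r → ∀ᶠ m in hyp, AltFrom (U m) (j + 1) r := by
  have hf := hN.shape
  have hβ := hf.beta_pos
  induction j with
  | zero =>
    intro u u' U U' r A hu hU hconv hAu hAU hlim hr hur hu' hord _
    have hEr := hu.energy_pos_of_tendsto hf.cont hlim hr.le (by rw [hur]; exact hβ.ne')
    have hUr : ∀ᶠ m in hyp, 0 < U m r :=
      ((hconv r hr.le hEr).1.tendsto ⟨hr.le, le_rfl⟩).eventually_const_lt (by rw [hur]; exact hβ)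
    suffices H : ∀ᶠ m in hyp, ∃ t, r < t ∧ U m t < 0 by
      filter_upwards [H, hUr] with m ⟨t, h1, h2⟩ h3
      exact ⟨t, h1, trivial, mul_neg_of_pos_of_neg h3 h2, trivial⟩
    by_cases hex : ∃ t, r < t ∧ u t < 0
    · obtain ⟨t, hrt, hut⟩ := hex
      have ht0 : 0 ≤ t := hr.le.trans hrt.le
      have hEt := hu.energy_pos_of_tendsto hf.cont hlim ht0 hut.ne
      filter_upwards [((hconv t ht0 hEt).1.tendsto ⟨ht0, le_rfl⟩).eventually_lt_const hut] with m hm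
      exact ⟨t, hrt, hm⟩
    -- If `u` never becomes negative after `r`, the additional sign change comes from the comparison
    -- of the final descents.
    · push Not at hex
      obtain ⟨q, hq, hq'⟩ := exists_right_of_eventually (show r < r + 1 by linarith)
        ((hu.hasDerivAt_energy hf.cont hr).continuousAt.eventually_const_lt hEr)
      obtain ⟨c1, c2⟩ := hconv q (hr.le.trans hq.1.le) (hq' q ⟨hq.1.le, le_rfl⟩)
      exact hord.eventually_neg hf hu hU hr hq.1 c1 c2 (A := max A α₁)
        (fun x hx => (hAu x hx).le.trans (le_max_right _ _))
        (hAU.mono fun m hm x hx => (hm x hx).trans (le_max_left _ _)) hur hu' hex hlim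
  | succ j ih =>
    rintro u u' U U' r A hu hU hconv hAu hAU hlim hr hur hu' hord ⟨t, hrt, -, hneg, halt⟩
    have hut : u t < 0 := by
      rw [hur] at hneg
      by_contra hc
      exact absurd hneg (not_lt.2 (mul_nonneg hβ.le (not_lt.1 hc)))
    obtain ⟨r', T, e, h1, h2, h3, hur', hd1, hd2, hT, hd3, hue, hbelow, hsign⟩ :=
      hu.exists_next hf hlim hr hur hu' hrt hut
    have hr' : 0 < r' := hr.trans h1
    have he : 0 < e := hr'.trans (h2.trans h3)
    have hne : -β ≠ 0 := by linarith
    have hEe := hu.energy_pos_of_tendsto hf.cont hlim he.le (by rw [hue]; exact hne)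
    obtain ⟨q, hq, hq'⟩ := exists_right_of_eventually (show e < e + 1 by linarith)
      ((hu.hasDerivAt_energy hf.cont he).continuousAt.eventually_const_lt hEe)
    obtain ⟨c1, c2⟩ := hconv q (he.le.trans hq.1.le) (hq' q ⟨hq.1.le, le_rfl⟩)
    -- One excursion is removed at a time: the order descends to `-β`, and after reflection the
    -- excursion below `-β` is a region above `β`.
    have o1 := hord.down hf hu hU hr h1 ((h2.trans h3).trans hq.1) c1 c2 hur hur' hd1
      (hu.energy_pos_of_tendsto hf.cont hlim hr'.le (by rw [hur']; exact hne))
    have hUn : ∀ᶠ m in hyp, Sol d f (fun x => -U m x) (fun x => -U' m x) :=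
      hU.mono fun m hm => hm.neg hf.odd
    have o2 := (o1.neg hf.odd).over hN (hu.neg hf.odd) hUn hr' h2 h3 hq.1 c1.neg c2.neg
      (fun x hx => (neg_le_abs _).trans_lt (hAu x hx)) (fun x hx => by linarith [hbelow x hx])
      (by rw [hur', neg_neg]) (by rw [hue, neg_neg]) (fun x hx => by linarith [hd2 x hx])
      (by rw [hT, neg_zero]) (fun x hx => by linarith [hd3 x hx])
    -- The alternation point `t` is used up by this excursion. Since `u` is negative from `t` to
    -- `e`, the next alternation point lies beyond `e`.
    have halt' : AltFrom u j e := by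
      rcases j with _ | j
      · trivial
      obtain ⟨t₁, ht, -, hn, hrest⟩ := halt
      have hpos : 0 < u t₁ := by
        by_contra hc
        exact absurd hn (not_lt.2 (mul_nonneg_of_nonpos_of_nonpos hut.le (not_lt.1 hc)))
      refine ⟨t₁, ?_, trivial, mul_neg_of_neg_of_pos (by rw [hue]; linarith) hpos, hrest⟩
      by_contra hc
      linarith [hsign t₁ ht.le (not_lt.1 hc)]
    have key := ih (A := A) (hu.neg hf.odd) hUn
      (fun x hx hE => by
        rw [energy_neg hf.odd] at hE
        exact ⟨(hconv x hx hE).1.neg, (hconv x hx hE).2.neg⟩)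
      (fun x hx => by simpa using hAu x hx) (hAU.mono fun m hm x hx => by simpa using hm x hx)
      (by simpa using hlim.neg) he (by rw [hue, neg_neg])
      (by linarith [hd3 e ⟨h3, le_rfl⟩]) o2 halt'.neg
    have hre : r < e := h1.trans (h2.trans h3)
    filter_upwards [key, (c1.tendsto ⟨hr.le, hre.le.trans hq.1.le⟩).eventually_const_lt
      (show 0 < u r by rw [hur]; exact hβ), (c1.tendsto ⟨he.le, hq.1.le⟩).eventually_lt_const
      (show u e < 0 by rw [hue]; linarith)] with m e1 e2 e3
    exact ⟨e, hre, trivial, mul_neg_of_pos_of_neg e2 e3, e1.of_neg⟩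

end

/-! ### Uniqueness at positive energy and perturbation above a bound state -/

section

variable {d : ℕ} {f : ℝ → ℝ} {b β b₀ α₁ : ℝ} {D : Set ℝ} {u u' v v' : ℝ → ℝ}

lemma Nice.lipNear (hN : Nice d f b β b₀ α₁ D) {s : ℝ} (h1 : β ≤ |s|) (h2 : |s| < α₁) :
    LipNear f s := by
  obtain ⟨L, hL, hlip⟩ := hN.lip
  have h3 := hN.b₀_lt
  have h4 := hN.lt_b₀
  have h5 := hN.shape.b_pos
  have hη : 0 < min (|s| - b₀) (α₁ - |s|) := lt_min (by linarith) (by linarith)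
  refine ⟨L, min (|s| - b₀) (α₁ - |s|), hη, ?_⟩
  intro x y hx hy
  have hx1 := hx.le.trans (min_le_left _ _)
  have hx2 := hx.le.trans (min_le_right _ _)
  have hy1 := hy.le.trans (min_le_left _ _)
  have hy2 := hy.le.trans (min_le_right _ _)
  rw [abs_le] at hx1 hx2 hy1 hy2
  rcases abs_cases s with ⟨hs, _⟩ | ⟨hs, _⟩ <;> rw [hs] at hx1 hx2 hy1 hy2
  · exact hlip x ⟨by linarith, by linarith⟩ y ⟨by linarith, by linarith⟩
  · have := hlip (-x) ⟨by linarith, by linarith⟩ (-y) ⟨by linarith, by linarith⟩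
    rw [hN.shape.odd, hN.shape.odd] at this
    rw [abs_sub_comm (f x), abs_sub_comm x]
    convert this using 2 <;> ring_nf

/-- Solutions with a given initial value coincide as long as the energy is positive. -/
lemma Sol.eq_of_energy_pos (hN : Nice d f b β b₀ α₁ D) (hu : Sol d f u u') (hv : Sol d f v v')
    (h0 : u 0 = v 0) (hβ : β ≤ u 0) (hα : u 0 < α₁) {r : ℝ} (hr : 0 ≤ r)
    (hE : 0 < energy f u u' r) : u r = v r ∧ u' r = v' r := by
  have hf := hN.shape
  have hev : ∀ᶠ x in 𝓝[≥] r, 0 < energy f u u' x :=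
    ((hu.continuousOn_energy hf.cont) r hr |>.mono (Ici_subset_Ici.2 hr)).eventually_const_lt hE
  obtain ⟨τ, hτ, h⟩ := exists_Icc_of_eventually hev
  refine SolOn.unique (R := r + τ) hf.cont (hu.solOn _) (hv.solOn _) h0
    (hf.pos _ (hf.b_lt.trans_le hβ)).ne' (fun x hx hxR => ?_) r ⟨hr, by linarith⟩
  -- Only critical points need `f` to be locally Lipschitz, and positive energy places them at
  -- values of modulus at least `β`.
  by_cases hx' : u' x = 0
  · right
    have h1 := hu.energy_antitone hf.cont hx.le hxR.le
    have h2 := h (r + τ) ⟨by linarith, le_rfl⟩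
    have h3 : 0 < prim f (u x) := by
      rw [energy_of_deriv_eq_zero hx'] at h1
      linarith
    have hux : u x ≠ 0 := fun h => by simp [h] at h3
    exact hN.lipNear (hf.beta_le_of_prim_nonneg hux h3.le)
      ((hu.abs_le_init hf hβ hx.le).trans_lt hα)
  · exact Or.inl hx'

lemma AltFrom.of_pos_on {j : ℕ} {r : ℝ} (hr : 0 ≤ r) (hpos : ∀ t ∈ Icc 0 r, 0 < u t)
    (h : AltFrom u j 0) : AltFrom u j r := by
  rcases j with _ | j
  · trivial
  obtain ⟨t, h1, _, h3, h4⟩ := h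
  have h0 := hpos 0 ⟨le_rfl, hr⟩
  have hrr := hpos r ⟨hr, le_rfl⟩
  have hut : u t < 0 := by
    by_contra hcon
    nlinarith
  refine ⟨t, ?_, trivial, mul_neg_of_pos_of_neg hrr hut, h4⟩
  by_contra hcon
  linarith [hpos t ⟨h1.le, not_lt.1 hcon⟩]

lemma AltFrom.to_zero {j : ℕ} {r : ℝ} (hr : 0 ≤ r) (h0 : 0 < u 0) (hur : 0 < u r)
    (h : AltFrom u j r) : AltFrom u j 0 := by
  rcases j with _ | j
  · trivial
  obtain ⟨t, h1, _, h3, h4⟩ := h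
  have hut : u t < 0 := by
    by_contra hcon
    nlinarith
  exact ⟨t, hr.trans_lt h1, trivial, mul_neg_of_pos_of_neg h0 hut, h4⟩

lemma Sol.beta_lt_init_of_tendsto (hf : Shape f b β) (hu : Sol d f u u') (h0 : 0 < u 0)
    (hlim : Tendsto u atTop (𝓝 0)) : β < u 0 := by
  have h1 := hu.energy_pos_of_tendsto hf.cont hlim le_rfl h0.ne'
  rw [energy_of_deriv_eq_zero hu.init] at h1
  by_contra hcon
  exact absurd (hf.prim_nonpos (by rw [abs_of_pos h0]; exact not_lt.1 hcon)) (not_le.2 h1)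

/-- Solutions that start slightly above a bound state change sign once more. -/
theorem exists_altFrom_succ_above (hN : Nice d f b β b₀ α₁ D) {C : ℝ} (hC : ∀ s, |f s| ≤ C)
    (hu : Sol d f u u') (h0 : 0 < u 0) (hα : u 0 < α₁) (hlim : Tendsto u atTop (𝓝 0)) {j : ℕ}
    (hj : AltFrom u j 0) {δ : ℝ} (hδ : 0 < δ) :
    ∃ e ∈ Ioo 0 δ, ∀ U U' : ℝ → ℝ, Sol d f U U' → U 0 = u 0 + e → AltFrom U (j + 1) 0 := by
  by_contra hcon
  push Not at hcon
  have hf := hN.shape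
  have hβ := hf.beta_pos
  have hu0 := hu.beta_lt_init_of_tendsto hf h0 hlim
  have hpos : ∀ m : ℕ, 0 < δ / 2 * (1 / ((m : ℝ) + 1)) := fun m => by positivity
  have hle : ∀ m : ℕ, δ / 2 * (1 / ((m : ℝ) + 1)) ≤ δ / 2 := fun m => by
    have : 1 / ((m : ℝ) + 1) ≤ 1 := by
      rw [div_le_one (by positivity)]; linarith [(Nat.cast_nonneg m : (0 : ℝ) ≤ m)]
    nlinarith
  choose U U' hU hU0 hUn using fun m : ℕ =>
    hcon (δ / 2 * (1 / ((m : ℝ) + 1))) ⟨hpos m, by linarith [hle m]⟩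
  have hUs : ∀ᶠ m in hyp, Sol d f (U m) (U' m) := Eventually.of_forall hU
  obtain ⟨v, v', hv, hcv, hcv'⟩ := exists_limit_solution hf.cont hC hUs (A := u 0 + δ / 2)
    (Eventually.of_forall fun m => by
      rw [hU0, abs_of_pos (by linarith [hpos m])]; linarith [hle m])
  have hv0 : u 0 = v 0 := by
    refine tendsto_nhds_unique ?_ (hcv.tendsto (y := 0) (by simp))
    simp_rw [hU0]
    simpa using (tendsto_one_div_hyp.const_mul (δ / 2)).const_add (u 0)
  -- Convergence to `u` is claimed only while its energy is positive; beyond that range the limit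
  -- `v` may be a different solution with the same initial value.
  have hconv : ∀ e, 0 ≤ e → 0 < energy f u u' e →
      ConvOn (Icc 0 e) U u ∧ ConvOn (Icc 0 e) U' u' := by
    intro e he hEe
    have heq : ∀ x ∈ Icc 0 e, u x = v x ∧ u' x = v' x := fun x hx =>
      hu.eq_of_energy_pos hN hv hv0 hu0.le hα hx.1
        (hEe.trans_le (hu.energy_antitone hf.cont hx.1 hx.2))
    exact ⟨(hcv.mono fun x hx => hx.1).congr fun x hx => (heq x hx).1.symm,
      (hcv'.mono fun x hx => hx.1).congr fun x hx => (heq x hx).2.symm⟩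
  obtain ⟨x, hx0, hx⟩ : ∃ x, 0 ≤ x ∧ u x < β :=
    ((eventually_ge_atTop 0).and (hlim.eventually_lt_const hβ)).exists
  obtain ⟨r, hr, hur, hgt⟩ := exists_first_zero (g := fun y => u y - β) (a := 0) (x := x)
    ((hu.cont.mono fun y hy => hy.1).sub continuousOn_const) hx0 (by linarith) (by linarith)
  replace hur : u r = β := by linarith
  have hgt : ∀ y ∈ Ico 0 r, β < u y := fun y hy => by linarith [hgt y hy]
  have hge : ∀ y ∈ Icc 0 r, β ≤ u y := fun y hy => by
    rcases hy.2.eq_or_lt with rfl | h1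
    · exact hur.ge
    · exact (hgt y ⟨hy.1, h1⟩).le
  have hEr := hu.energy_pos_of_tendsto hf.cont hlim hr.1.le (by rw [hur]; exact hβ.ne')
  have hev : ∀ᶠ x in 𝓝[≥] r, 0 < energy f u u' x :=
    ((hu.continuousOn_energy hf.cont) r hr.1.le |>.mono
      (Ici_subset_Ici.2 hr.1.le)).eventually_const_lt hEr
  obtain ⟨τ, hτ, h⟩ := exists_Icc_of_eventually hev
  have hE' := hconv (r + τ) (by linarith [hr.1]) (h _ ⟨by linarith, le_rfl⟩)
  have hu'r : u' r < 0 := by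
    have h1 := (hu.solOn (r + 1)).deriv_le_of_le (m := 0) hr.1.le (by linarith)
      fun t ht htr => (hf.pos _ (hf.b_lt.trans (hgt t ⟨ht.le, htr⟩))).le
    simp only [zero_mul, zero_div, neg_zero] at h1
    refine lt_of_le_of_ne h1 fun h2 => ?_
    rw [energy_of_deriv_eq_zero h2, hur, hf.prim_beta] at hEr
    exact lt_irrefl _ hEr
  have hord := ordAt_of_init hN hu hUs hr.1 (by linarith) hE'.1 hE'.2
    (Eventually.of_forall fun m => by rw [hU0]; linarith [hpos m]) hα hgt hur
  have hUA : ∀ᶠ m in hyp, ∀ r, 0 ≤ r → |U m r| ≤ u 0 + δ / 2 := Eventually.of_forall fun m r hr =>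
    ((hU m).abs_le_init hf (by rw [hU0]; linarith [hpos m]) hr).trans
      (by rw [hU0]; linarith [hle m])
  have key := hord.altFrom_succ hN hu hUs hconv
    (fun r hr => (hu.abs_le_init hf hu0.le hr).trans_lt hα) hUA hlim hr.1 hur hu'r
    (hj.of_pos_on hr.1.le fun t ht => hβ.trans_le (hge t ht))
  have hUr : ∀ᶠ m in hyp, 0 < U m r :=
    ((hE'.1.tendsto (y := r) ⟨hr.1.le, by linarith⟩).eventually_const_lt (by rw [hur]; exact hβ))
  obtain ⟨m, h1, h2⟩ := (key.and hUr).exists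
  exact hUn m (h1.to_zero hr.1.le (by rw [hU0]; linarith [hpos m]) h2)

end

/-! ### Consequences of the hypotheses on the nonlinearity -/

section

variable {f : ℝ → ℝ} {b β : ℝ}

lemma continuous_of_odd (h0 : f 0 = 0) (hodd : ∀ s, f (-s) = -f s) (hc : ContinuousOn f (Ici 0)) :
    Continuous f := by
  have h : f = fun s => f (max s 0) - f (max (-s) 0) := by
    funext s
    rcases le_total 0 s with h | h
    · rw [max_eq_left h, max_eq_right (by linarith), h0, sub_zero]
    · rw [max_eq_right h, max_eq_left (by linarith), h0, hodd]; ring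
  rw [h]
  exact (hc.comp_continuous (by fun_prop) fun s => mem_Ici.2 (le_max_right _ _)).sub
    (hc.comp_continuous (by fun_prop) fun s => mem_Ici.2 (le_max_right _ _))

lemma H1.continuous (h : H1 f b β) : Continuous f :=
  continuous_of_odd h.zero h.odd h.regular.cont

/-- Negativity near zero rules out `b = 0` and `b = β`; the primitive then falls below zero, does
not rise before `b`, and increases afterwards up to its zero `β`. -/
lemma H1.shape (h : H1 f b β) : Shape f b β := by
  have hc := h.continuous
  obtain ⟨δ, hδ, hneg⟩ := h.neg_near_zero
  have hb : 0 < b := by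
    refine lt_of_le_of_ne h.b_nonneg fun hb => ?_
    have h1 := hneg (δ / 2) ⟨by linarith, by linarith⟩
    have h2 := h.pos (δ / 2) (by linarith)
    linarith
  have h1 : ∀ s ∈ Ioc 0 b, prim f s < 0 := by
    intro s hs
    have hm : 0 < min s (δ / 2) := lt_min hs.1 (by linarith)
    have h2 : prim f (min s (δ / 2)) < prim f 0 :=
      gt_of_hasDerivAt_neg hm (continuous_prim hc).continuousOn (fun x _ => hasDerivAt_prim hc x)
        fun x hx => hneg x ⟨hx.1, by linarith [hx.2, min_le_right s (δ / 2)]⟩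
    have h3 : prim f s ≤ prim f (min s (δ / 2)) :=
      ge_of_hasDerivAt_nonpos (min_le_left _ _) (continuous_prim hc).continuousOn
        (fun x _ => hasDerivAt_prim hc x)
        fun x hx => h.nonpos x ⟨(hm.trans hx.1).le, hx.2.le.trans hs.2⟩
    rw [prim_zero_right] at h2
    linarith
  have hbβ : b < β := by
    refine lt_of_le_of_ne h.b_le fun hb' => ?_
    have h2 := h1 b ⟨hb, le_rfl⟩
    rw [hb', h.prim_zero] at h2
    exact lt_irrefl _ h2
  refine ⟨hc, h.odd, hb, hbβ, h.pos, h.nonpos, fun s hs => ?_, h.prim_zero⟩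
  rcases le_or_gt s b with hsb | hsb
  · exact h1 s ⟨hs.1, hsb⟩
  · rw [← h.prim_zero]
    exact lt_of_hasDerivAt_pos hs.2 (continuous_prim hc).continuousOn
      (fun x _ => hasDerivAt_prim hc x) fun x hx => h.pos x (hsb.trans hx.1)

lemma abs_sub_le_of_hasDerivAt_off_finite {g g' : ℝ → ℝ} {D : Set ℝ} (hD : D.Finite) {a b L : ℝ}
    (hab : a ≤ b) (hc : ContinuousOn g (Icc a b))
    (hd : ∀ x ∈ Ioo a b, x ∉ D → HasDerivAt g (g' x) x)
    (hL : ∀ x ∈ Ioo a b, x ∉ D → |g' x| ≤ L) : |g b - g a| ≤ L * (b - a) := by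
  have h1 := le_of_hasDerivAt_nonneg_off_finite (g := fun x => L * x - g x)
    (g' := fun x => L - g' x) hD hab ((by fun_prop : ContinuousOn _ _).sub hc)
    (fun x hx hxD => (((hasDerivAt_id x).const_mul L).sub (hd x hx hxD)).congr_deriv (by simp))
    fun x hx hxD => by linarith [(abs_le.1 (hL x hx hxD)).2]
  have h2 := le_of_hasDerivAt_nonneg_off_finite (g := fun x => L * x + g x)
    (g' := fun x => L + g' x) hD hab ((by fun_prop : ContinuousOn _ _).add hc)
    (fun x hx hxD => (((hasDerivAt_id x).const_mul L).add (hd x hx hxD)).congr_deriv (by simp))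
    fun x hx hxD => by linarith [(abs_le.1 (hL x hx hxD)).1]
  rw [abs_le]
  constructor <;> linarith

/-- With `θ = s f'/f`, the ratio `F f'/f^2` equals `θ F/(s f)`. For `θ > 0` it is below `θ/(1 + θ)`,
and `θ < n/(n - 2)` bounds this by `n/(2 (n - 1))`, the complement of the required constant. -/
lemma one_sub_div_lt {d : ℕ} {s F f f' : ℝ} (hs : 0 < s) (hF : 0 < F) (hf : 0 < f)
    (h1 : (1 + s * f' / f) * F < s * f) (h2 : s * f' / f < ((d : ℝ) + 3) / (d + 1)) :
    (d + 1 : ℝ) / (2 * (d + 2)) < 1 - F * f' / f ^ 2 := by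
  set θ := s * f' / f with hθ
  have hd : (0 : ℝ) ≤ d := d.cast_nonneg
  have e : F * f' / f ^ 2 = θ * F / (s * f) := by rw [hθ]; field_simp
  rw [e]
  have h3 : (d + 1 : ℝ) / (2 * (d + 2)) < 1 := by
    rw [div_lt_one (by positivity)]; linarith
  rcases le_or_gt θ 0 with h | h
  · have : θ * F / (s * f) ≤ 0 := div_nonpos_of_nonpos_of_nonneg
      (mul_nonpos_of_nonpos_of_nonneg h hF.le) (by positivity)
    linarith
  · have h4 : θ * F / (s * f) < θ / (1 + θ) := by
      rw [div_lt_div_iff₀ (by positivity) (by positivity)]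
      nlinarith
    rw [lt_div_iff₀ (by positivity)] at h2
    have h5 : θ / (1 + θ) < 1 - (d + 1 : ℝ) / (2 * (d + 2)) := by
      rw [one_sub_div (by positivity), div_lt_div_iff₀ (by positivity) (by positivity)]
      nlinarith
    linarith

/-- Monotonicity of `s f'/f` is used twice: its values at regular points on both sides of the range
bound `f'`, and its integration from `β` yields the inequality for `(F/f)'`. -/
theorem H1.nice {d : ℕ} (h1 : H1 f b β) (h3 : H3 (d + 3) f b β) (α₁ : ℝ) :
    ∃ D : Set ℝ, Nice d f b β ((b + β) / 2) α₁ D := by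
  have hf := h1.shape
  have hb := hf.b_pos
  have hbβ := hf.b_lt
  obtain ⟨D, hD⟩ := h1.regular.c1
  have hdiff : ∀ s, 0 < s → s ∉ D → DifferentiableAt ℝ f s := fun s hs hsD =>
    (hD s hs hsD).differentiableAt (by norm_num)
  refine ⟨(D : Set ℝ), hf, by linarith, by linarith, D.finite_toSet, ?_,
    fun s hs hsD => hD s (by linarith [hs.1]) hsD, ?_⟩
  · obtain ⟨p, hp, hpD⟩ : ∃ p ∈ Ioo b ((b + β) / 2), p ∉ D :=
      (Ioo_infinite (by linarith)).exists_notMem_finset D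
    obtain ⟨q, hq, hqD⟩ : ∃ q ∈ Ioi (max α₁ β), q ∉ D :=
      (Ioi_infinite (max α₁ β)).exists_notMem_finset D
    obtain ⟨hqα, hqβ⟩ := max_lt_iff.1 hq.out
    have hqb : b < q := hbβ.trans hqβ
    obtain ⟨M, hM⟩ := (isCompact_Icc (a := (b + β) / 2) (b := α₁)).exists_bound_of_continuousOn
      (f := f) hf.cont.continuousOn
    set θ : ℝ → ℝ := fun s => s * deriv f s / f s with hθ
    set K := max |θ p| |θ q| with hK
    have hder : ∀ s ∈ Icc ((b + β) / 2) α₁, s ∉ D → |deriv f s| ≤ K * |M| / ((b + β) / 2) := by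
      intro s hs hsD
      have hs0 : 0 < s := by linarith [hs.1]
      have hsb : b < s := by linarith [hs.1]
      have m1 : θ s ≤ θ p := h3.decreasing ⟨hp.1, hdiff p (hb.trans hp.1) hpD⟩
        ⟨hsb, hdiff s hs0 hsD⟩ (by linarith [hs.1, hp.2])
      have m2 : θ q ≤ θ s := h3.decreasing ⟨hsb, hdiff s hs0 hsD⟩
        ⟨hqb, hdiff q (hb.trans hqb) hqD⟩ (by linarith [hs.2])
      have hθs : |θ s| ≤ K := abs_le_max_abs_abs m2 m1 |>.trans (by rw [max_comm])
      have hfs := h1.pos s hsb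
      have e : deriv f s = θ s * f s / s := by simp only [hθ]; field_simp
      rw [e, abs_div, abs_mul, abs_of_pos hs0]
      have hMs : |f s| ≤ |M| := (hM s hs).trans (le_abs_self M)
      have hK0 : 0 ≤ K := (abs_nonneg _).trans hθs
      have := hs.1
      have : 0 < (b + β) / 2 := by linarith
      gcongr
    have hL : 0 ≤ K * |M| / ((b + β) / 2) :=
      div_nonneg (mul_nonneg ((abs_nonneg _).trans (le_max_left _ _)) (abs_nonneg _)) (by linarith)
    refine ⟨_, hL, ?_⟩
    have key : ∀ x ∈ Icc ((b + β) / 2) α₁, ∀ y ∈ Icc ((b + β) / 2) α₁, x ≤ y →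
        |f y - f x| ≤ K * |M| / ((b + β) / 2) * (y - x) := by
      intro x hx y hy hxy
      exact abs_sub_le_of_hasDerivAt_off_finite D.finite_toSet hxy hf.cont.continuousOn
        (fun z hz hzD => (hdiff z (by linarith [hz.1, hx.1]) hzD).hasDerivAt)
        (fun z hz hzD => hder z ⟨hx.1.trans hz.1.le, hz.2.le.trans hy.2⟩ hzD)
    intro x hx y hy
    rcases le_total x y with h | h
    · have := key x hx y hy h
      rwa [abs_sub_comm, abs_sub_comm x, abs_of_nonneg (sub_nonneg.2 h)]
    · have := key y hy x hx h
      rwa [abs_of_nonneg (sub_nonneg.2 h)]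
  · intro s hs hsD
    have hs0 : 0 < s := hf.beta_pos.trans hs.1
    have hsb : b < s := hbβ.trans hs.1
    refine one_sub_div_lt hs0 (hf.prim_pos hs.1) (h1.pos s hsb) ?_ ?_
    · set c := s * deriv f s / f s with hc
      -- Since `t f'/f ≥ c` on `(β, s)`, the function `t f - (1 + c) F` is nondecreasing; at `β` it
      -- equals `β f(β) > 0`.
      have m1 := le_of_hasDerivAt_nonneg_off_finite (g := fun t => t * f t - (1 + c) * prim f t)
        (g' := fun t => f t * (t * deriv f t / f t - c)) D.finite_toSet hs.1.le
        (by have := hf.cont; have := continuous_prim hf.cont; fun_prop) (fun t ht htD => by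
          have hft := h1.pos t (hbβ.trans ht.1)
          refine (((hasDerivAt_id t).mul
            (hdiff t (hf.beta_pos.trans ht.1) htD).hasDerivAt).sub
            ((hasDerivAt_prim hf.cont t).const_mul (1 + c))).congr_deriv ?_
          simp only [id]
          field_simp
          ring) fun t ht htD => by
          have hft := h1.pos t (hbβ.trans ht.1)
          refine mul_nonneg hft.le (sub_nonneg.2 ?_)
          exact h3.decreasing ⟨hbβ.trans ht.1, hdiff t (hf.beta_pos.trans ht.1) htD⟩
            ⟨hsb, hdiff s hs0 hsD⟩ ht.2.le
      simp only [hf.prim_beta] at m1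
      have m2 := mul_pos hf.beta_pos (h1.pos β hbβ)
      linarith
    · have m1 := h3.decreasing ⟨hbβ, h3.diff_beta⟩ ⟨hsb, hdiff s hs0 hsD⟩ hs.1.le
      have m2 := h3.lt_beta
      push_cast at m2
      have e : (d : ℝ) + 3 - 2 = d + 1 := by ring
      rw [e] at m2
      exact m1.trans_lt m2

lemma Nice.congr {d : ℕ} {g : ℝ → ℝ} {b₀ α₁ : ℝ} {D : Set ℝ} (h : Nice d f b β b₀ α₁ D)
    (hg : Shape g b β) (hfg : ∀ s, |s| ≤ α₁ → f s = g s) : Nice d g b β b₀ α₁ D := by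
  have hb := h.shape.b_pos
  have h1 := h.lt_b₀
  have h2 := h.b₀_lt
  have he : ∀ s ∈ Icc b₀ α₁, f s = g s := fun s hs => hfg s (by
    rw [abs_of_pos (by linarith [hs.1])]; exact hs.2)
  have hev : ∀ s ∈ Ioo b₀ α₁, f =ᶠ[𝓝 s] g := fun s hs => by
    filter_upwards [Ioo_mem_nhds hs.1 hs.2] with t ht using he t ⟨ht.1.le, ht.2.le⟩
  refine ⟨hg, h1, h2, h.fin, ?_, fun s hs hsD => (h.smooth s hs hsD).congr_of_eventuallyEq
    (hev s hs).symm, fun s hs hsD => ?_⟩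
  · obtain ⟨L, hL, hl⟩ := h.lip
    exact ⟨L, hL, fun x hx y hy => by rw [← he x hx, ← he y hy]; exact hl x hx y hy⟩
  · have hs' : s ∈ Ioo b₀ α₁ := ⟨h2.trans hs.1, hs.2⟩
    rw [← (hev s hs').deriv_eq, ← he s (Ioo_subset_Icc_self hs'), ← prim_congr hfg]
    · exact h.quot s hs hsD
    · rw [abs_of_pos (by linarith [hs'.1])]; exact hs.2.le

end

/-! ### Bound states below and above a given one -/

section

variable {d : ℕ} {f : ℝ → ℝ} {b β b₀ α₁ : ℝ} {D : Set ℝ} {u u' v v' : ℝ → ℝ}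

lemma Sol.not_altFrom_of_energy_neg (hf : Continuous f) (h : Sol d f u u') {r : ℝ} (hr : 0 ≤ r)
    (hpos : ∀ t ∈ Icc 0 r, 0 < u t) (hE : energy f u u' r < 0) (j : ℕ) :
    ¬ AltFrom u (j + 1) 0 := by
  rintro ⟨t, h1, _, h3, _⟩
  have hall : ∀ x, 0 ≤ x → 0 < u x := fun x hx => by
    rcases le_total x r with hxr | hxr
    · exact hpos x ⟨hx, hxr⟩
    · exact (pos_iff_pos_of_mul_pos (h.mul_pos_of_energy_neg hf hr hxr hE)).1
        (hpos r ⟨hr, le_rfl⟩)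
  exact absurd h3 (not_lt.2 (mul_pos (hall 0 le_rfl) (hall t h1.le)).le)

/-- Uniqueness of solutions may fail at zero energy, but alternation points are never zeros, so
agreement where `u ≠ 0` suffices. -/
lemma AltFrom.of_eq_on_ne_zero : ∀ {j : ℕ} {r : ℝ}, 0 ≤ r → u r = v r →
    (∀ x, 0 ≤ x → u x ≠ 0 → u x = v x) → AltFrom u j r → AltFrom v j r
  | 0, _, _, _, _, _ => trivial
  | j + 1, r, hr, hur, h, ⟨t, h1, _, h3, h4⟩ => by
    have ht := h t (hr.trans h1.le) fun h0 => by simp [h0] at h3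
    exact ⟨t, h1, trivial, by rwa [← hur, ← ht],
      AltFrom.of_eq_on_ne_zero (hr.trans h1.le) ht h h4⟩

/-- A solution stays decreasing as long as it is above `b`. -/
lemma Sol.deriv_neg_of_gt (hf : Shape f b β) (h : Sol d f u u') {r : ℝ} (hr : 0 < r)
    (hgt : ∀ t ∈ Icc 0 r, b < u t) : u' r < 0 := by
  obtain ⟨y, hy, hmin⟩ := isCompact_Icc.exists_isMinOn (s := Icc 0 r) ⟨0, left_mem_Icc.2 hr.le⟩
    (hf.cont.comp_continuousOn (h.cont.mono fun x hx => hx.1))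
  have h1 := (h.solOn (r + 1)).deriv_le_of_le (m := f (u y)) hr.le (by linarith)
    fun t ht htr => hmin ⟨ht.le, htr.le⟩
  have h2 : 0 < f (u y) * r / (d + 3) := by
    have := hf.pos _ (hgt y hy)
    positivity
  linarith

/-- The energy starts at `F(β) = 0` and drops strictly while the solution is still above `b`, so the
solution remains positive. -/
lemma Sol.not_altFrom_of_init_eq (hf : Shape f b β) (h : Sol d f u u') (h0 : u 0 = β) (j : ℕ) :
    ¬ AltFrom u (j + 1) 0 := by
  have hev : ∀ᶠ x in 𝓝[≥] (0 : ℝ), b < u x :=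
    (h.cont 0 (mem_Ici.2 le_rfl)).eventually_const_lt (by rw [h0]; exact hf.b_lt)
  obtain ⟨τ, hτ, hgt⟩ := exists_Icc_of_eventually hev
  rw [zero_add] at hgt
  refine h.not_altFrom_of_energy_neg hf.cont hτ.le (fun t ht => hf.b_pos.trans (hgt t ht)) ?_ j
  have h1 : energy f u u' τ < energy f u u' 0 :=
    gt_of_hasDerivAt_neg hτ ((h.continuousOn_energy hf.cont).mono fun x hx => hx.1)
      (fun x hx => h.hasDerivAt_energy hf.cont hx.1) fun x hx => by
        have h2 := h.deriv_neg_of_gt hf hx.1 fun t ht => hgt t ⟨ht.1, ht.2.trans hx.2.le⟩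
        have h3 : 0 < (d + 2 : ℝ) / x * u' x ^ 2 := mul_pos (div_pos (by positivity) hx.1)
          (sq_pos_iff.2 h2.ne)
        linarith
  rwa [energy_of_deriv_eq_zero h.init, h0, hf.prim_beta] at h1

/-- Below a bound state with more than `j` sign changes there is one with exactly `j`. -/
theorem exists_boundState_below (hN : Nice d f b β b₀ α₁ D) {C : ℝ} (hC : ∀ s, |f s| ≤ C)
    (hu : Sol d f u u') (h0 : 0 < u 0) (hα : u 0 < α₁) (hlim : Tendsto u atTop (𝓝 0)) {j : ℕ}
    (hj : AltFrom u (j + 1) 0) :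
    ∃ w w' : ℝ → ℝ, Sol d f w w' ∧ w 0 ∈ Icc β (u 0) ∧ Tendsto w atTop (𝓝 0) ∧
      AltFrom w j 0 ∧ ¬ AltFrom w (j + 1) 0 := by
  have hf := hN.shape
  have hu0 := hu.beta_lt_init_of_tendsto hf h0 hlim
  by_contra hcon
  push Not at hcon
  -- In the absence of the desired bound state, having fewer than `j + 1` alternations is open and
  -- closed; it holds at `β` and fails at `u 0`.
  refine solutions_connected (d := d) hf.cont hC hu0.le (fun w _ => ¬ AltFrom w (j + 1) 0) ?_
    (fun w w' hw hw0 => hw.not_altFrom_of_init_eq hf hw0 j) ?_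
  · intro w w' v v' hw _ hv hv0 hc hc'
    refine ⟨fun hvj => ?_, fun hvj => ?_⟩
    · rcases eventually_hyp_or_not (fun m => AltFrom (w m) (j + 1) 0) with h | h
      · obtain ⟨h1, h2⟩ := tendsto_zero_of_altFrom_lost hf (Eventually.of_forall hw) hv hv0.1
          hc hc' h hvj
        exact absurd (hcon v v' hv hv0 h1 h2) hvj
      · exact h
    · filter_upwards [eventually_altFrom hc le_rfl (not_not.1 hvj)] with m hm using not_not.2 hm
  · intro w w' hw hw0
    refine not_not.2 (hj.of_eq_on_ne_zero le_rfl hw0.symm fun x hx hux => ?_)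
    exact (hu.eq_of_energy_pos hN hw hw0.symm hu0.le hα hx
      (hu.energy_pos_of_tendsto hf.cont hlim hx hux)).1

/-- Above a bound state with at least `j` sign changes there is one with exactly `j`, provided
that solutions that start high enough fall below a level `s₀ ∈ (b, β)` before the radius `η`, and
that solutions that reach this level at `η` have negative energy there. -/
theorem exists_boundState_above (hN : Nice d f b β b₀ α₁ D) {C : ℝ} (hC : ∀ s, |f s| ≤ C)
    (hu : Sol d f u u') (h0 : 0 < u 0) (hα : u 0 < α₁) (hlim : Tendsto u atTop (𝓝 0)) {j : ℕ}
    (hj : AltFrom u j 0) {s₀ η A : ℝ} (hs : b < s₀) (hη : 0 < η) (hαA : α₁ ≤ A)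
    (hstay : ∀ w w', Sol d f w w' → w 0 ∈ Icc (u 0) α₁ → ∀ r ∈ Icc 0 η, s₀ < w r)
    (henergy : ∀ w w', Sol d f w w' → w 0 ∈ Icc α₁ A → (∀ r ∈ Ico 0 η, s₀ < w r) → w η = s₀ →
      energy f w w' η < 0)
    (hleave : ∀ w w', Sol d f w w' → w 0 = A → ¬ ∀ r ∈ Icc 0 η, s₀ < w r) :
    ∃ w w' : ℝ → ℝ, Sol d f w w' ∧ w 0 ∈ Ioc (u 0) A ∧ Tendsto w atTop (𝓝 0) ∧
      AltFrom w j 0 ∧ ¬ AltFrom w (j + 1) 0 := by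
  have hf := hN.shape
  have hu0 := hu.beta_lt_init_of_tendsto hf h0 hlim
  obtain ⟨e, he, hstart⟩ := exists_altFrom_succ_above hN hC hu h0 hα hlim hj (sub_pos.2 hα)
  by_contra hcon
  push Not at hcon
  have hs0 : 0 < s₀ := hf.b_pos.trans hs
  -- The first clause is what fails at `A`; the rest of the argument excludes that it fails while
  -- sign changes persist.
  refine solutions_connected (d := d) (a := u 0 + e) (b := A) hf.cont hC (by linarith [he.2])
    (fun w _ => (∀ r ∈ Icc 0 η, s₀ < w r) ∧ AltFrom w (j + 1) 0) ?_
    (fun w w' hw hw0 => ⟨hstay w w' hw ⟨by linarith [he.1], by linarith [he.2]⟩,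
      hstart w w' hw hw0⟩) fun w w' hw hw0 h => hleave w w' hw hw0 h.1
  intro w w' v v' hw _ hv hv0 hc hc'
  have hvu : u 0 < v 0 := by linarith [hv0.1, he.1]
  refine ⟨fun hvP => ?_, fun hvP => ?_⟩
  · have h1 := eventually_neg_of_convOn (u' := fun x => s₀ - v x) (U' := fun m x => s₀ - w m x)
      hη.le (continuousOn_const.sub (hv.cont.mono fun x hx => hx.1))
      (fun x y hx hy hxy => tendsto_const_nhds.sub (hc x y (hx.mono fun _ h => h.1) hy.1 hxy))
      fun x hx => by linarith [hvP.1 x hx]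
    filter_upwards [h1, eventually_altFrom hc le_rfl hvP.2] with m hm hm'
    exact ⟨fun r hr => by linarith [hm r hr], hm'⟩
  rcases eventually_hyp_or_not (fun m => (∀ r ∈ Icc 0 η, s₀ < w m r) ∧ AltFrom (w m) (j + 1) 0)
    with h | h
  swap
  · exact h
  exfalso
  have hvj : AltFrom v (j + 1) 0 := by
    by_contra hvj
    obtain ⟨h1, h2⟩ := tendsto_zero_of_altFrom_lost hf (Eventually.of_forall hw) hv
      (hu0.trans hvu).le hc hc' (h.mono fun m hm => hm.2) hvj
    exact hvj (hcon v v' hv ⟨hvu, hv0.2⟩ h1 h2)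
  have hge : ∀ r ∈ Icc 0 η, s₀ ≤ v r := fun r hr =>
    ge_of_tendsto (hc.tendsto (y := r) hr.1) (h.mono fun m hm => (hm.1 r hr).le)
  have hdec : ∀ r ∈ Ico 0 η, s₀ < v r := fun r hr => by
    refine (hge η ⟨hη.le, le_rfl⟩).trans_lt ?_
    exact gt_of_hasDerivAt_neg hr.2 (hv.cont.mono fun x hx => hr.1.trans hx.1)
      (fun x hx => hv.hasDeriv x (hr.1.trans_lt hx.1)) fun x hx =>
        hv.deriv_neg_of_gt hf (hr.1.trans_lt hx.1) fun t ht =>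
          hs.trans_le (hge t ⟨ht.1, ht.2.trans hx.2.le⟩)
  -- A limit of solutions with the property can violate it only by touching `s₀`, and being
  -- decreasing it does so exactly at `η`. Small initial values exclude this by `hstay`; for large
  -- ones `henergy` rules out any sign change.
  have hη' : v η = s₀ := by
    refine le_antisymm ?_ (hge η ⟨hη.le, le_rfl⟩)
    by_contra hlt
    push Not at hlt
    refine hvP ⟨fun r hr => ?_, hvj⟩
    rcases hr.2.eq_or_lt with rfl | h1
    · exact hlt
    · exact hdec r ⟨hr.1, h1⟩
  rcases le_or_gt α₁ (v 0) with h1 | h1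
  · exact hv.not_altFrom_of_energy_neg hf.cont hη.le (fun t ht => hs0.trans_le (hge t ht))
      (henergy v v' hv ⟨h1, hv0.2⟩ hdec hη') j hvj
  · exact (hstay v v' hv ⟨hvu.le, h1.le⟩ η ⟨hη.le, le_rfl⟩).ne' hη'

end

/-! ### Quantitative estimates for the first descent -/

section

variable {d : ℕ} {f : ℝ → ℝ} {b β α₁ : ℝ} {w w' : ℝ → ℝ}

/-- With moderate initial values the slope on `[0, η]` is at most `C η`, so the drop is at most `C
η^2`. -/
lemma Sol.gt_of_init (hf : Shape f b β) (hw : Sol d f w w') {C s₀ η : ℝ}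
    (hC : ∀ s, |s| ≤ α₁ → |f s| ≤ C) (h0 : w 0 ∈ Icc β α₁) (hη : C * η ^ 2 < β - s₀) :
    ∀ r ∈ Icc 0 η, s₀ < w r := by
  intro r hr
  have hfw : ∀ t, 0 ≤ t → |f (w t)| ≤ C := fun t ht =>
    hC _ ((hw.abs_le_init hf h0.1 ht).trans h0.2)
  have hC0 : 0 ≤ C := (abs_nonneg _).trans (hfw 0 le_rfl)
  have h1 : |w r - w 0| ≤ C * η * (r - 0) := abs_sub_le_of_hasDerivAt hr.1
    (hw.cont.mono fun x hx => hx.1) (fun x hx => hw.hasDeriv x hx.1) fun x hx =>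
      ((hw.solOn (x + 1)).abs_deriv_le hx.1.le (by linarith) fun t ht _ => hfw t ht.le).trans
        (mul_le_mul_of_nonneg_left (hx.2.le.trans hr.2) hC0)
  have h2 : C * η * (r - 0) ≤ C * η ^ 2 := by
    have := mul_le_mul_of_nonneg_left hr.2 (mul_nonneg hC0 (hr.1.trans hr.2))
    linarith
  linarith [(abs_le.1 h1).1, h0.1]

lemma Sol.flux_antitone (hf : Shape f b β) (hw : Sol d f w w') {x y : ℝ} (hx : 0 ≤ x) (hxy : x ≤ y)
    (hgt : ∀ t ∈ Icc x y, b < w t) : y ^ (d + 2) * w' y ≤ x ^ (d + 2) * w' x :=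
  ge_of_hasDerivAt_nonpos hxy
    ((hw.solOn (y + 1)).continuousOn_flux.mono fun t ht => ⟨hx.trans ht.1, by linarith [ht.2]⟩)
    (fun t ht => (hw.solOn (t + 1)).hasDerivAt_flux (hx.trans_lt ht.1) (by linarith))
    fun t ht => by
      have h1 := hf.pos _ (hgt t ⟨ht.1.le, ht.2.le⟩)
      have h2 : 0 < t ^ (d + 2) := pow_pos (hx.trans_lt ht.1) _
      linarith [mul_pos h2 h1]

/-- A solution that is above `b` drops by a definite amount between `x` and `2 x`. -/
lemma Sol.le_of_flux (hf : Shape f b β) (hw : Sol d f w w') {x : ℝ} (hx : 0 < x)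
    (hgt : ∀ t ∈ Icc 0 (2 * x), b < w t) : w (2 * x) ≤ w x + x * w' x / 2 ^ (d + 2) := by
  -- The flux is nonincreasing above `b`; passing from the radius `x` to `t ≤ 2 x` costs at most the
  -- factor `2^(n-1)` in the slope.
  have h1 : ∀ t ∈ Ioo x (2 * x), w' t ≤ w' x / 2 ^ (d + 2) := by
    intro t ht
    have h2 := hw.flux_antitone hf hx.le ht.1.le fun s hs => hgt s
      ⟨hx.le.trans hs.1, hs.2.trans ht.2.le⟩
    have ht0 : 0 < t := hx.trans ht.1
    have h3 := hw.deriv_neg_of_gt hf ht0 fun s hs => hgt s ⟨hs.1, hs.2.trans ht.2.le⟩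
    rw [le_div_iff₀ (by positivity)]
    have h4 : t ^ (d + 2) ≤ (2 * x) ^ (d + 2) := pow_le_pow_left₀ ht0.le ht.2.le _
    rw [mul_pow] at h4
    have h5 : 0 < x ^ (d + 2) := by positivity
    have h6 : x ^ (d + 2) * (w' t * 2 ^ (d + 2)) ≤ x ^ (d + 2) * w' x := by nlinarith
    exact le_of_mul_le_mul_left h6 h5
  have h2 := ge_of_hasDerivAt_nonpos (g := fun t => w t - w' x / 2 ^ (d + 2) * t)
    (g' := fun t => w' t - w' x / 2 ^ (d + 2)) (a := x) (b := 2 * x) (by linarith)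
    ((hw.cont.mono fun t ht => hx.le.trans ht.1).sub (by fun_prop))
    (fun t ht => ((hw.hasDeriv t (hx.trans ht.1)).sub
      ((hasDerivAt_id t).const_mul (w' x / 2 ^ (d + 2)))).congr_deriv (by simp))
    fun t ht => by linarith [h1 t ht]
  have e : x * w' x / 2 ^ (d + 2) = w' x / 2 ^ (d + 2) * (2 * x) - w' x / 2 ^ (d + 2) * x := by
    ring
  linarith

/-- If `f` is at least `Λ (s - α₁)` with `Λ` large, solutions fall below `α₁` before `ρ`. -/
lemma Sol.le_of_linear_lower_bound (hf : Shape f b β) (hw : Sol d f w w') {A Λ ρ : ℝ}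
    (h0 : w 0 ≤ A) (hρ : 0 < ρ)
    (hΛ : ∀ s ∈ Icc α₁ A, Λ * (s - α₁) ≤ f s) (hΛρ : (d + 3) * 2 ^ (d + 4) < Λ * ρ ^ 2)
    (hgt : ∀ r ∈ Icc 0 ρ, b < w r) : w ρ ≤ α₁ := by
  by_contra hcon
  push Not at hcon
  have hanti : ∀ x y, 0 ≤ x → x ≤ y → y ≤ ρ → w y ≤ w x := fun x y hx hxy hy =>
    ge_of_hasDerivAt_nonpos hxy (hw.cont.mono fun t ht => hx.trans ht.1)
      (fun t ht => hw.hasDeriv t (hx.trans_lt ht.1)) fun t ht =>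
        (hw.deriv_neg_of_gt hf (hx.trans_lt ht.1) fun s hs =>
          hgt s ⟨hs.1, hs.2.trans (ht.2.le.trans hy)⟩).le
  set x := ρ / 2 with hx
  have hx0 : 0 < x := by positivity
  have hρx : ρ = 2 * x := by rw [hx]; ring
  rw [hρx] at hcon hΛρ hanti hgt
  have hΛ0 : 0 < Λ := by
    by_contra hneg
    have h1 : (0 : ℝ) < (d + 3) * 2 ^ (d + 4) := by positivity
    have h2 : Λ * (2 * x) ^ 2 ≤ 0 := mul_nonpos_of_nonpos_of_nonneg (not_lt.1 hneg) (sq_nonneg _)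
    linarith
  have hwx : w (2 * x) ≤ w x := hanti x (2 * x) hx0.le (by linarith) le_rfl
  have hd : (0 : ℝ) < d + 3 := by positivity
  -- Up to `x = ρ/2` the values are at least `w x`, so the slope at `x` is so negative that the drop
  -- between `x` and `2 x` exceeds `w x - α₁`.
  have h1 := (hw.solOn (x + 1)).deriv_le_of_le (m := Λ * (w x - α₁)) hx0.le (by linarith)
    fun t ht htx => by
      have m1 := hanti t x ht.le htx.le (by linarith)
      have m2 := hanti 0 t le_rfl ht.le (by linarith)
      refine le_trans ?_ (hΛ (w t) ⟨by linarith, by linarith⟩)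
      exact mul_le_mul_of_nonneg_left (by linarith) hΛ0.le
  have h2 := hw.le_of_flux hf hx0 hgt
  have h3 : x * w' x / 2 ^ (d + 2) ≤ x * -(Λ * (w x - α₁) * x / (d + 3)) / 2 ^ (d + 2) := by
    gcongr
  have h4 : x * -(Λ * (w x - α₁) * x / (d + 3)) / 2 ^ (d + 2) < -(w x - α₁) := by
    have hy : 0 < w x - α₁ := by linarith
    rw [div_lt_iff₀ (by positivity)]
    have e : x * -(Λ * (w x - α₁) * x / (d + 3)) = -(w x - α₁) * (Λ * x ^ 2 / (d + 3)) := by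
      field_simp
    rw [e]
    have h5 : (2 : ℝ) ^ (d + 2) < Λ * x ^ 2 / (d + 3) := by
      rw [lt_div_iff₀ hd]
      have : (2 : ℝ) ^ (d + 4) = 4 * 2 ^ (d + 2) := by ring
      rw [this] at hΛρ
      nlinarith
    nlinarith
  linarith

/-- If a solution reaches the level `s₀` at `η` but was below `α₁` already at `ρ`, and `ρ` is small
compared with `η`, then its energy at `η` is negative. -/
lemma Sol.energy_neg_of_slow (hw : Sol d f w w') {C p s₀ η ρ : ℝ}
    (hC : ∀ s ∈ Icc s₀ α₁, f s ≤ C) (hC0 : 0 ≤ C) (hF : prim f s₀ ≤ -(p ^ 2 / 2))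
    (hη : C * η ≤ p / 2) (hρ : 0 < ρ) (hρη : ρ < η)
    (hlarge : α₁ < s₀ + p / 2 * η ^ (d + 2) / (d + 1) * ((ρ ^ (d + 1))⁻¹ - (η ^ (d + 1))⁻¹))
    (hanti : ∀ r ∈ Icc ρ η, w r ∈ Icc s₀ (w ρ)) (hwρ : w ρ ≤ α₁) (hwη : w η = s₀)
    (hle : w' η ≤ 0) : energy f w w' η < 0 := by
  by_contra hcon
  push Not at hcon
  have hη0 : 0 < η := hρ.trans hρη
  -- Nonnegative energy at the level `s₀` requires a slope of modulus at least `p`. Backwards from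
  -- `η` at least half of this flux persists because `C η ≤ p/2`, and integration puts `w ρ` above
  -- `α₁`.
  have hw'η : w' η ≤ -p := by
    rw [energy, hwη] at hcon
    have h1 : p ^ 2 ≤ (-w' η) ^ 2 := by nlinarith
    linarith [abs_le_of_sq_le_sq' h1 (by linarith) |>.2]
  have hd1 : (0 : ℝ) < d + 1 := by positivity
  have hslope : ∀ r ∈ Ioo ρ η, w' r + p / 2 * η ^ (d + 2) * (r ^ (d + 2))⁻¹ ≤ 0 := by
    intro r hr
    have hr0 : 0 < r := hρ.trans hr.1
    have h1 := le_of_hasDerivAt_nonneg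
      (g := fun t => t ^ (d + 2) * w' t + C * η ^ (d + 2) * t)
      (g' := fun t => -(t ^ (d + 2) * f (w t)) + C * η ^ (d + 2)) hr.2.le
      (((continuousOn_pow _).mul (hw.cont'.mono fun t ht => hr0.le.trans ht.1)).add (by fun_prop))
      (fun t ht => (((hw.solOn (t + 1)).hasDerivAt_flux (hr0.trans ht.1) (by linarith)).add
        ((hasDerivAt_id t).const_mul (C * η ^ (d + 2)))).congr_deriv (by simp))
      fun t ht => by
        have ht0 : 0 < t := hr0.trans ht.1
        have m0 := hanti t ⟨hr.1.le.trans ht.1.le, ht.2.le⟩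
        have m1 := hC (w t) ⟨m0.1, m0.2.trans hwρ⟩
        have m2 : t ^ (d + 2) ≤ η ^ (d + 2) := pow_le_pow_left₀ ht0.le ht.2.le _
        have m3 : 0 < t ^ (d + 2) := by positivity
        nlinarith
    have h2 : r ^ (d + 2) * w' r ≤ -(p / 2 * η ^ (d + 2)) := by
      have m1 : 0 < η ^ (d + 2) := by positivity
      have m2 : C * (η - r) ≤ p / 2 :=
        (mul_le_mul_of_nonneg_left (by linarith) hC0).trans hη
      nlinarith
    have h3 : 0 < r ^ (d + 2) := by positivity
    have h4 : w' r ≤ -(p / 2 * η ^ (d + 2)) * (r ^ (d + 2))⁻¹ := by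
      rw [← div_eq_mul_inv, le_div_iff₀ h3]; linarith
    linarith
  have h1 := ge_of_hasDerivAt_nonpos
    (g := fun t => w t - p / 2 * η ^ (d + 2) / (d + 1) * (t ^ (d + 1))⁻¹)
    (g' := fun t => w' t + p / 2 * η ^ (d + 2) * (t ^ (d + 2))⁻¹) hρη.le
    ((hw.cont.mono fun t ht => hρ.le.trans ht.1).sub (continuousOn_const.mul
      ((continuousOn_pow _).inv₀ fun t ht => (pow_pos (hρ.trans_le ht.1) _).ne')))
    (fun t ht => by
      have ht0 : 0 < t := hρ.trans ht.1
      refine ((hw.hasDeriv t ht0).sub (((hasDerivAt_pow (d + 1) t).inv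
        (pow_pos ht0 _).ne').const_mul (p / 2 * η ^ (d + 2) / (d + 1)))).congr_deriv ?_
      simp only [Nat.add_sub_cancel, Nat.cast_add, Nat.cast_one]
      field_simp
      ring) hslope
  simp only [hwη] at h1
  linarith [mul_sub (p / 2 * η ^ (d + 2) / (d + 1)) (ρ ^ (d + 1))⁻¹ (η ^ (d + 1))⁻¹]

/-- The radius `ρ` of the previous lemma exists. -/
lemma exists_radius_slow (d : ℕ) {p η : ℝ} (hp : 0 < p) (hη : 0 < η) (s₀ α₁ : ℝ) :
    ∃ ρ ∈ Ioo 0 η,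
      α₁ < s₀ + p / 2 * η ^ (d + 2) / (d + 1) * ((ρ ^ (d + 1))⁻¹ - (η ^ (d + 1))⁻¹) := by
  have h1 : Tendsto (fun ρ : ℝ => (ρ ^ (d + 1))⁻¹) (𝓝[>] 0) atTop := by
    refine tendsto_inv_nhdsGT_zero.comp (tendsto_nhdsWithin_iff.2 ⟨?_, ?_⟩)
    · have : Tendsto (fun ρ : ℝ => ρ ^ (d + 1)) (𝓝 0) (𝓝 (0 ^ (d + 1))) :=
        (continuous_pow _).tendsto _
      rw [zero_pow (by omega)] at this
      exact this.mono_left nhdsWithin_le_nhds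
    · filter_upwards [self_mem_nhdsWithin] with x hx using pow_pos hx.out _
  have hc : 0 < p / 2 * η ^ (d + 2) / ((d : ℝ) + 1) := by positivity
  have h2 : Tendsto (fun ρ : ℝ => s₀ + p / 2 * η ^ (d + 2) / (d + 1) *
      ((ρ ^ (d + 1))⁻¹ - (η ^ (d + 1))⁻¹)) (𝓝[>] 0) atTop :=
    tendsto_atTop_add_const_left _ _ (Tendsto.const_mul_atTop hc
      (tendsto_atTop_add_const_right _ _ h1))
  obtain ⟨ρ, h3, h4⟩ := ((h2.eventually_gt_atTop α₁).and (Ioo_mem_nhdsGT hη)).exists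
  exact ⟨ρ, h4, h3⟩

end

/-! ### Scaling of the solution for the second nonlinearity -/

section

variable {d : ℕ} {f f₂ : ℝ → ℝ} {b β α αhat : ℝ} {u u' v v' w w' : ℝ → ℝ}

lemma SolvesIVP.sol (h : SolvesIVP (d + 3) f α (Ici 0) u u') : Sol d f u u' where
  init := h.init_deriv
  cont := fun r hr => (h.hasDeriv r hr).continuousWithinAt
  cont' := h.cont_deriv
  hasDeriv := fun r hr => (h.hasDeriv r (mem_Ici.2 hr.le)).hasDerivAt (Ici_mem_nhds hr)
  hasDeriv' := fun r hr => by
    refine ((h.equation r (mem_Ici.2 hr.le) hr).hasDerivAt (Ici_mem_nhds hr)).congr_deriv ?_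
    push_cast
    ring

lemma SolvesIVP.solOn {R : ℝ} (h : SolvesIVP (d + 3) f α (Icc 0 R) u u') : SolOn d f R u u' where
  init := h.init_deriv
  cont := fun r hr => (h.hasDeriv r ⟨hr.1, hr.2.le⟩).continuousWithinAt.mono Ico_subset_Icc_self
  cont' := h.cont_deriv.mono Ico_subset_Icc_self
  hasDeriv := fun r hr hrR => (h.hasDeriv r ⟨hr.le, hrR.le⟩).hasDerivAt (Icc_mem_nhds hr hrR)
  hasDeriv' := fun r hr hrR => by
    refine ((h.equation r ⟨hr.le, hrR.le⟩ hr).hasDerivAt (Icc_mem_nhds hr hrR)).congr_deriv ?_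
    push_cast
    ring

/-- The part of the solution in `(H₅)` that the construction uses: just before its zero, the slope
is so steep that the flux carries the solution through zero. -/
lemma H5.exists_core (h : H5 (d + 3) f₂ α αhat) (hf₂ : Regular f₂) (hpos : ∀ s, 0 < s → 0 < f₂ s) :
    ∃ (v v' : ℝ → ℝ) (t₁ t₂ m : ℝ), 0 < t₁ ∧ t₁ < t₂ ∧ 0 < m ∧ SolOn d f₂ t₂ v v' ∧ v 0 = αhat ∧
      (∀ t ∈ Ico 0 t₂, v t ∈ Icc m αhat) ∧ (∀ t ∈ Ioo 0 t₂, v' t < 0) ∧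
      v t₁ + t₁ * v' t₁ / 2 ^ (d + 2) < 0 := by
  obtain ⟨_, v, v', r₀, hr₀, hv, hvpos, hv0, hv'0⟩ := h
  have hs := hv.solOn
  have hvc : ContinuousOn v (Icc 0 r₀) := fun r hr => (hv.hasDeriv r hr).continuousWithinAt
  have hdec : ∀ t ∈ Ioo 0 r₀, v' t < 0 := by
    intro t ht
    have hsub : Icc 0 t ⊆ Ico 0 r₀ := fun x hx => ⟨hx.1, hx.2.trans_lt ht.2⟩
    obtain ⟨y, hy, hmin⟩ := isCompact_Icc.exists_isMinOn (s := Icc 0 t) ⟨0, left_mem_Icc.2 ht.1.le⟩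
      (hf₂.cont.comp (hs.cont.mono hsub) fun x hx => (hvpos x (hsub hx)).le)
    have h1 := hs.deriv_le_of_le (m := f₂ (v y)) ht.1.le ht.2
      fun s hs hst => hmin ⟨hs.le, hst.le⟩
    have h2 : 0 < f₂ (v y) * t / (d + 3) := by
      have := hpos _ (hvpos y (hsub hy))
      have := ht.1
      positivity
    linarith
  -- At `r₀` the expression equals `r₀ v'(r₀) / 2^(n-1) < 0`, so it is still negative slightly
  -- earlier, where `v` is positive.
  have hev : ∀ᶠ t in 𝓝[Icc 0 r₀] r₀, v t + t * v' t / 2 ^ (d + 2) < 0 := by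
    have h1 : ContinuousOn (fun t => v t + t * v' t / 2 ^ (d + 2)) (Icc 0 r₀) :=
      hvc.add ((continuousOn_id.mul hv.cont_deriv).div_const _)
    refine (h1 r₀ ⟨hr₀.le, le_rfl⟩).eventually_lt_const ?_
    simp only [hv0, zero_add]
    exact div_neg_of_neg_of_pos (mul_neg_of_pos_of_neg hr₀ hv'0) (by positivity)
  have hev' : ∀ᶠ t in 𝓝[<] r₀, v t + t * v' t / 2 ^ (d + 2) < 0 :=
    nhdsWithin_le_iff.2 (mem_of_superset (Ioo_mem_nhdsLT hr₀) Ioo_subset_Icc_self) hev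
  obtain ⟨t₁, ht₁, ht⟩ := (hev'.and (Ioo_mem_nhdsLT hr₀)).exists
  obtain ⟨t₂, ht₂, ht₂'⟩ := exists_between ht.2
  have hsub : Icc 0 t₂ ⊆ Ico 0 r₀ := fun x hx => ⟨hx.1, hx.2.trans_lt ht₂'⟩
  have ht₂0 : 0 < t₂ := ht.1.trans ht₂
  have hanti : ∀ x y, 0 ≤ x → x ≤ y → y ≤ t₂ → v y ≤ v x := fun x y hx hxy hy =>
    ge_of_hasDerivAt_nonpos hxy (hs.cont.mono fun s hs => hsub ⟨hx.trans hs.1, hs.2.trans hy⟩)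
      (fun t ht => hs.hasDeriv t (hx.trans_lt ht.1) ((ht.2.le.trans hy).trans_lt ht₂'))
      fun t ht => (hdec t ⟨hx.trans_lt ht.1, (ht.2.le.trans hy).trans_lt ht₂'⟩).le
  refine ⟨v, v', t₁, t₂, v t₂, ht.1, ht₂, hvpos t₂ ⟨ht₂0.le, ht₂'⟩, hs.mono ht₂'.le, hv.init,
    fun t ht => ⟨hanti t t₂ ht.1 ht.2.le le_rfl, ?_⟩, fun t ht => hdec t ⟨ht.1, ht.2.trans ht₂'⟩,
    ht₁⟩
  rw [← hv.init]
  exact hanti 0 t le_rfl ht.1 ht.2.le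

/-- With `κ = l/√μ` the factor `μ κ^2` is `l^2`, which is the form of the modified nonlinearity at
large values. -/
lemma SolOn.scale {R μ κ : ℝ} (h : SolOn d f R v v') (hμ : 0 < μ) (hκ : 0 < κ) :
    SolOn d (fun s => μ * κ ^ 2 * f (s / μ)) (R / κ) (fun r => μ * v (κ * r))
      (fun r => μ * κ * v' (κ * r)) := by
  have hmap : ∀ r, r < R / κ → κ * r < R := fun r hr => by
    rw [lt_div_iff₀ hκ] at hr; linarith
  have hmaps : MapsTo (fun r => κ * r) (Ico 0 (R / κ)) (Ico 0 R) := fun r hr =>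
    ⟨mul_nonneg hκ.le hr.1, hmap r hr.2⟩
  refine ⟨by simp [h.init], continuousOn_const.mul (h.cont.comp (by fun_prop) hmaps),
    continuousOn_const.mul (h.cont'.comp (by fun_prop) hmaps), fun r hr hrR => ?_,
    fun r hr hrR => ?_⟩
  · have h1 := (h.hasDeriv (κ * r) (mul_pos hκ hr) (hmap r hrR)).comp r
      ((hasDerivAt_id r).const_mul κ)
    exact (h1.const_mul μ).congr_deriv (by ring)
  · have h1 := (h.hasDeriv' (κ * r) (mul_pos hκ hr) (hmap r hrR)).comp r
      ((hasDerivAt_id r).const_mul κ)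
    refine (h1.const_mul (μ * κ)).congr_deriv ?_
    rw [mul_div_cancel_left₀ _ hμ.ne']
    field_simp

/-- A solution whose first part is the scaled solution of `(H₅)` drops below any level `s₀ > b`
before the radius `η`, if the scale is large. -/
lemma Sol.leaves (hf : Shape f b β) (hw : Sol d f w w') {t₁ t₂ m μ κ s₀ η : ℝ} (ht₁ : 0 < t₁)
    (ht : t₁ < t₂) (hv : SolOn d f₂ t₂ v v') (hmem : ∀ t ∈ Ico 0 t₂, v t ∈ Icc m αhat)
    (hdec : ∀ t ∈ Ioo 0 t₂, v' t < 0) (hdrop : v t₁ + t₁ * v' t₁ / 2 ^ (d + 2) < 0) (hμ : 0 < μ)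
    (hκ : 0 < κ) (hff : ∀ s ∈ Icc (μ * m) (μ * αhat), f s = μ * κ ^ 2 * f₂ (s / μ))
    (hw0 : w 0 = μ * v 0) (hbw : b < w 0) (hs : b < s₀) (hη : 2 * t₁ / κ ≤ η) :
    ¬ ∀ r ∈ Icc 0 η, s₀ < w r := by
  intro hgt
  have hW : SolOn d f (t₂ / κ) (fun r => μ * v (κ * r)) (fun r => μ * κ * v' (κ * r)) := by
    refine (hv.scale hμ hκ).congr fun r hr hrR => ?_
    rw [lt_div_iff₀ hκ] at hrR
    have h1 := hmem (κ * r) ⟨mul_nonneg hκ.le hr.le, by linarith⟩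
    exact (hff _ ⟨mul_le_mul_of_nonneg_left h1.1 hμ.le,
      mul_le_mul_of_nonneg_left h1.2 hμ.le⟩).symm
  -- The scaled solution has nonzero slope at positive radii, so uniqueness holds without any
  -- Lipschitz condition and identifies `w` with it up to `t₁/κ`.
  have h1 := SolOn.unique hf.cont hW (hw.solOn _) (by simp [hw0])
    (by simp only [mul_zero, ← hw0]; exact (hf.pos _ hbw).ne')
    (fun r hr hrR => Or.inl (by
      rw [lt_div_iff₀ hκ] at hrR
      have := hdec (κ * r) ⟨mul_pos hκ hr, by linarith⟩
      exact mul_ne_zero (mul_pos hμ hκ).ne' this.ne)) (t₁ / κ)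
    ⟨by positivity, by gcongr⟩
  rw [mul_div_cancel₀ _ hκ.ne'] at h1
  have hη' : 2 * (t₁ / κ) ≤ η := by rw [← mul_div_assoc]; exact hη
  have hx : 0 < t₁ / κ := by positivity
  -- After `t₁/κ` only positivity of `f` above `b` is used: the flux alone would bring `w` below
  -- zero at `2 t₁/κ`.
  have h2 := hw.le_of_flux hf hx fun t ht => hs.trans (hgt t ⟨ht.1, ht.2.trans hη'⟩)
  rw [← h1.1, ← h1.2] at h2
  have e : μ * v t₁ + t₁ / κ * (μ * κ * v' t₁) / 2 ^ (d + 2)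
      = μ * (v t₁ + t₁ * v' t₁ / 2 ^ (d + 2)) := by field_simp
  have h3 := mul_neg_of_pos_of_neg hμ hdrop
  have h4 := hgt (2 * (t₁ / κ)) ⟨by positivity, hη'⟩
  linarith [hf.b_pos]

end

/-! ### The glued nonlinearity -/

section

variable {f f₁ f₂ : ℝ → ℝ} {b β a ε μ l : ℝ}

/-- Clamping the argument writes the three pieces as a sum of continuous terms, which avoids
checking the junctions separately. -/
lemma glued_eq (hε : 0 < ε) (s : ℝ) :
    glued f₁ f₂ a ε μ l s = f₁ (min s a) + (max a (min s (a + ε)) - a) / ε *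
      (l ^ 2 * f₂ ((a + ε) / μ) - f₁ a) +
      (l ^ 2 * f₂ (max s (a + ε) / μ) - l ^ 2 * f₂ ((a + ε) / μ)) := by
  unfold glued
  split_ifs with h1 h2
  · rw [min_eq_left h1, min_eq_left (by linarith), max_eq_left h1, max_eq_right (by linarith)]
    simp
  · push Not at h1
    rw [min_eq_right h1.le, min_eq_left h2, max_eq_right h1.le, max_eq_right h2]
    simp
  · push Not at h1 h2
    rw [min_eq_right h1.le, min_eq_right h2.le, max_eq_right (by linarith), max_eq_left h2.le,
      add_sub_cancel_left, div_self hε.ne']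
    ring

lemma continuous_glued (hf₁ : Continuous f₁) (hf₂ : ContinuousOn f₂ (Ici 0)) (ha : 0 ≤ a)
    (hε : 0 < ε) (hμ : 0 < μ) : Continuous (glued f₁ f₂ a ε μ l) := by
  rw [show glued f₁ f₂ a ε μ l = _ from funext (glued_eq hε)]
  have h : Continuous fun s => f₂ (max s (a + ε) / μ) :=
    hf₂.comp_continuous (by fun_prop) fun s =>
      mem_Ici.2 (div_nonneg (le_max_of_le_right (by linarith)) hμ.le)
  exact ((hf₁.comp (by fun_prop)).add (Continuous.mul (by fun_prop) continuous_const)).add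
    ((continuous_const.mul h).sub continuous_const)

lemma fMu_of_nonneg {s : ℝ} (hs : 0 ≤ s) : fMu f₁ f₂ a ε μ l s = glued f₁ f₂ a ε μ l s :=
  if_pos hs

lemma fMu_zero (h0 : f₁ 0 = 0) (ha : 0 ≤ a) : fMu f₁ f₂ a ε μ l 0 = 0 := by
  rw [fMu_of_nonneg le_rfl, glued, if_pos ha, h0]

lemma fMu_neg (h0 : f₁ 0 = 0) (ha : 0 ≤ a) (s : ℝ) :
    fMu f₁ f₂ a ε μ l (-s) = -fMu f₁ f₂ a ε μ l s := by
  rcases lt_trichotomy s 0 with h | rfl | h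
  · rw [fMu_of_nonneg (by linarith), fMu, if_neg (by linarith), neg_neg]
  · rw [neg_zero, fMu_zero h0 ha, neg_zero]
  · rw [fMu_of_nonneg h.le, fMu, if_neg (by linarith), neg_neg]

lemma fMu_of_abs_le (hodd : ∀ s, f₁ (-s) = -f₁ s) {s : ℝ} (hs : |s| ≤ a) :
    fMu f₁ f₂ a ε μ l s = f₁ s := by
  rw [abs_le] at hs
  rcases le_or_gt 0 s with h | h
  · rw [fMu_of_nonneg h, glued, if_pos hs.2]
  · rw [fMu, if_neg (by linarith), glued, if_pos (by linarith), hodd, neg_neg]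

lemma continuous_fMu (hf₁ : Continuous f₁) (h0 : f₁ 0 = 0) (hf₂ : ContinuousOn f₂ (Ici 0))
    (ha : 0 ≤ a) (hε : 0 < ε) (hμ : 0 < μ) : Continuous (fMu f₁ f₂ a ε μ l) :=
  continuous_of_odd (fMu_zero h0 ha) (fMu_neg h0 ha)
    ((continuous_glued hf₁ hf₂ ha hε hμ).continuousOn.congr fun _ hs => fMu_of_nonneg hs)

lemma fMu_of_ge (ha : 0 ≤ a) (hε : 0 < ε) {s : ℝ} (hs : a + ε ≤ s) :
    fMu f₁ f₂ a ε μ l s = l ^ 2 * f₂ (s / μ) := by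
  rw [fMu_of_nonneg (by linarith), glued_eq hε, min_eq_right (by linarith), min_eq_right hs,
    max_eq_right (by linarith), max_eq_left hs, add_sub_cancel_left, div_self hε.ne']
  ring

lemma fMu_of_mem {s : ℝ} (ha : 0 ≤ a) (hs : s ∈ Icc a (a + ε)) (hε : 0 < ε) :
    fMu f₁ f₂ a ε μ l s =
      (1 - (s - a) / ε) * f₁ a + (s - a) / ε * (l ^ 2 * f₂ ((a + ε) / μ)) := by
  rw [fMu_of_nonneg (ha.trans hs.1), glued_eq hε, min_eq_right hs.1, min_eq_left hs.2,
    max_eq_right hs.1, max_eq_right hs.2]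
  ring

/-- One linear lower bound covers the affine and the scaled piece. Its slope is proportional to
`l^2`, which makes solutions fall below `a` quickly. -/
lemma fMu_ge_linear (ha : 0 < a) (hfa : 0 < f₁ a) (hε : 0 < ε) (hμ : 0 < μ) {A m : ℝ}
    (hA : a + ε ≤ A) (hm : 0 ≤ m) (hmin : ∀ t ∈ Icc ((a + ε) / μ) (A / μ), m ≤ f₂ t) :
    ∀ s ∈ Icc a A, l ^ 2 * m / A * (s - a) ≤ fMu f₁ f₂ a ε μ l s := by
  intro s hs
  have hA0 : 0 < A := by linarith
  have hl : 0 ≤ l ^ 2 := sq_nonneg l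
  rcases le_or_gt s (a + ε) with h | h
  · rw [fMu_of_mem ha.le ⟨hs.1, h⟩ hε]
    have h1 := hmin ((a + ε) / μ) ⟨le_rfl, by gcongr⟩
    have h2 : 0 ≤ (1 - (s - a) / ε) * f₁ a :=
      mul_nonneg (sub_nonneg.2 ((div_le_one hε).2 (by linarith))) hfa.le
    have h3 : (s - a) / A ≤ (s - a) / ε :=
      div_le_div_of_nonneg_left (by linarith [hs.1]) hε (by linarith)
    have h4 : 0 ≤ (s - a) / A := div_nonneg (by linarith [hs.1]) hA0.le
    have h4' := h4.trans h3
    have h5 : (s - a) / A * (l ^ 2 * m) ≤ (s - a) / ε * (l ^ 2 * f₂ ((a + ε) / μ)) := by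
      gcongr
    calc l ^ 2 * m / A * (s - a) = (s - a) / A * (l ^ 2 * m) := by ring
      _ ≤ _ := by linarith
  · rw [fMu_of_ge ha.le hε h.le]
    have h1 := hmin (s / μ) ⟨by gcongr, by gcongr; exact hs.2⟩
    have h2 : (s - a) / A ≤ 1 := (div_le_one hA0).2 (by linarith [hs.2])
    calc l ^ 2 * m / A * (s - a) = l ^ 2 * m * ((s - a) / A) := by ring
      _ ≤ l ^ 2 * m * 1 := by gcongr
      _ ≤ _ := by rw [mul_one]; gcongr

lemma fMu_pos (ha : 0 < a) (hfa : 0 < f₁ a) (hε : 0 < ε) (hμ : 0 < μ) (hl : 0 < l)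
    (hf₂ : ∀ s, 0 < s → 0 < f₂ s) {s : ℝ} (hs : a ≤ s) : 0 < fMu f₁ f₂ a ε μ l s := by
  have hK : 0 < l ^ 2 * f₂ ((a + ε) / μ) := mul_pos (by positivity) (hf₂ _ (by positivity))
  rcases le_or_gt s (a + ε) with h | h
  · rw [fMu_of_mem ha.le ⟨hs, h⟩ hε]
    have h0 : 0 ≤ (s - a) / ε := div_nonneg (by linarith) hε.le
    have h1 : (s - a) / ε ≤ 1 := (div_le_one hε).2 (by linarith)
    rcases h0.eq_or_lt with h2 | h2
    · rw [← h2]; simpa using hfa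
    · exact add_pos_of_nonneg_of_pos (mul_nonneg (sub_nonneg.2 h1) hfa.le) (mul_pos h2 hK)
  · rw [fMu_of_ge ha.le hε h.le]
    exact mul_pos (by positivity) (hf₂ _ (div_pos (by linarith) hμ))

/-- The truncation of `f` to `[-A, A]`, extended by constants. -/
def truncate (f : ℝ → ℝ) (A s : ℝ) : ℝ := f (max (-A) (min A s))

lemma truncate_of_abs_le {A s : ℝ} (hs : |s| ≤ A) : truncate f A s = f s := by
  rw [abs_le] at hs
  rw [truncate, min_eq_right hs.2, max_eq_right hs.1]

lemma truncate_neg (hodd : ∀ s, f (-s) = -f s) {A : ℝ} (hA : 0 ≤ A) (s : ℝ) :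
    truncate f A (-s) = -truncate f A s := by
  have h : max (-A) (min A (-s)) = -max (-A) (min A s) := by
    rcases le_total A s with h1 | h1
    · rw [min_eq_right (by linarith : -s ≤ A), min_eq_left h1, max_eq_left (by linarith),
        max_eq_right (by linarith)]
    · rw [min_eq_right h1]
      rcases le_total (-A) s with h2 | h2
      · rw [min_eq_right (by linarith), max_eq_right h2, max_eq_right (by linarith)]
      · rw [min_eq_left (by linarith), max_eq_left h2, max_eq_right (by linarith), neg_neg]
  rw [truncate, truncate, h, hodd]

lemma continuous_truncate (hf : Continuous f) (A : ℝ) : Continuous (truncate f A) := by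
  unfold truncate; fun_prop

lemma exists_bound_truncate (hf : Continuous f) {A : ℝ} (hA : 0 ≤ A) :
    ∃ C, ∀ s, |truncate f A s| ≤ C := by
  obtain ⟨C, hC⟩ := (isCompact_Icc (a := -A) (b := A)).exists_bound_of_continuousOn
    hf.continuousOn
  exact ⟨C, fun s => hC _ ⟨le_max_left _ _, max_le (by linarith) (min_le_left _ _)⟩⟩

lemma Shape.congr {g : ℝ → ℝ} (hf : Shape f b β) (hβ : β ≤ a) (hc : Continuous g)
    (hodd : ∀ s, g (-s) = -g s) (hfg : ∀ s, |s| ≤ a → f s = g s) (hpos : ∀ s, a ≤ s → 0 < g s) :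
    Shape g b β := by
  have hb := hf.b_pos
  have hbβ := hf.b_lt
  refine ⟨hc, hodd, hb, hbβ, fun s hs => ?_, fun s hs => ?_, fun s hs => ?_, ?_⟩
  · rcases le_total a s with h | h
    · exact hpos s h
    · rw [← hfg s (by rwa [abs_of_pos (hb.trans hs)])]
      exact hf.pos s hs
  · rw [← hfg s (by rw [abs_of_nonneg hs.1]; linarith [hs.2])]
    exact hf.nonpos s hs
  · rw [← prim_congr hfg (by rw [abs_of_pos hs.1]; linarith [hs.2])]
    exact hf.prim_neg s hs
  · rw [← prim_congr hfg (by rwa [abs_of_pos hf.beta_pos])]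
    exact hf.prim_beta

end

/-! ### Existence of two radial profiles -/

section

variable {d : ℕ} {f f₁ f₂ : ℝ → ℝ} {b β α αhat ε : ℝ} {w w' : ℝ → ℝ}

/-- `w` is a solution that is positive at the origin, tends to `0` and changes sign exactly `j`
times. -/
structure IsProfile (d : ℕ) (f : ℝ → ℝ) (j : ℕ) (w w' : ℝ → ℝ) : Prop where
  sol : Sol d f w w'
  pos : 0 < w 0
  lim : Tendsto w atTop (𝓝 0)
  alt : AltFrom w j 0
  not_alt : ¬ AltFrom w (j + 1) 0

/-- The truncation serves only to have a bounded nonlinearity; a solution starting above `β` never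
exceeds its initial value in modulus and does not notice it. -/
lemma IsProfile.of_truncate {A : ℝ} {j : ℕ} (hf : Shape (truncate f A) b β)
    (h : IsProfile d (truncate f A) j w w') (hβ : β ≤ w 0) (hA : w 0 ≤ A) :
    IsProfile d f j w w' :=
  ⟨h.sol.congr fun _ hr => truncate_of_abs_le ((h.sol.abs_le_init hf hβ hr.le).trans hA),
    h.pos, h.lim, h.alt, h.not_alt⟩

lemma exists_small_radius {C p q : ℝ} (hC : 0 ≤ C) (hp : 0 < p) (hq : 0 < q) :
    ∃ η, 0 < η ∧ C * η ≤ p ∧ C * η ^ 2 < q := by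
  refine ⟨min 1 (min p (q / 2) / (C + 1)), by positivity, ?_, ?_⟩
  all_goals
    set η := min 1 (min p (q / 2) / (C + 1))
    have h0 : 0 < η := by positivity
    have h1 : η ≤ 1 := min_le_left _ _
    have h2 : η * (C + 1) ≤ min p (q / 2) := by
      rw [← le_div_iff₀ (by positivity)]; exact min_le_right _ _
    have h3 := min_le_left p (q / 2)
    have h4 := min_le_right p (q / 2)
    nlinarith

/-- The constants `s₀`, `p`, `η`, `ρ` are fixed before `μ` and `l`: below `α + ε` only `f₁` matters.
Here `p` is the least slope at the level `s₀` compatible with nonnegative energy. -/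
theorem exists_two_profiles (k : ℕ) (h1 : H1 f₁ b β) (h3 : H3 (d + 3) f₁ b β)
    (h4 : H4 (d + 3) f₁ k α) (hf₂ : Regular f₂) (hf₂pos : ∀ s, 0 < s → 0 < f₂ s)
    (h5 : H5 (d + 3) f₂ α αhat) (hε : 0 < ε) (hε' : ε < (αhat - α) / 2) :
    ∃ μbar : ℝ, 0 < μbar ∧ ∀ μ : ℝ, μbar < μ →
      ∃ lbar : ℝ, 0 < lbar ∧ ∀ l : ℝ, lbar < l → ∀ j : ℕ, j ≤ k - 1 →
        ∃ w₁ w₁' w₂ w₂' : ℝ → ℝ, IsProfile d (fMu f₁ f₂ (α + ε) ε μ l) j w₁ w₁' ∧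
          IsProfile d (fMu f₁ f₂ (α + ε) ε μ l) j w₂ w₂' ∧ w₁ 0 < w₂ 0 := by
  have hf₁ := h1.shape
  have hb := hf₁.b_pos
  have hbβ := hf₁.b_lt
  obtain ⟨hα0, u, u', hu, hlim, hsign⟩ := h4
  have hu0 : u 0 = α := hu.init
  replace hu := hu.sol
  rw [ChangesSign, alternates_iff_altFrom (by rw [hu0]; exact hα0.ne'),
    alternates_iff_altFrom (by rw [hu0]; exact hα0.ne')] at hsign
  have hβα : β < α := hu0 ▸ hu.beta_lt_init_of_tendsto hf₁ (by rw [hu0]; exact hα0) hlim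
  set a := α + ε with ha
  set s₀ := (b + β) / 2 with hs₀
  have hbs : b < s₀ := by linarith
  have hsβ : s₀ < β := by linarith
  have hfa : 0 < f₁ a := hf₁.pos a (by linarith)
  obtain ⟨C, hC⟩ := (isCompact_Icc (a := -a) (b := a)).exists_bound_of_continuousOn
    hf₁.cont.continuousOn
  have hC : ∀ s, |s| ≤ a → |f₁ s| ≤ C := fun s hs => hC s (abs_le.1 hs)
  have hC0 : 0 ≤ C := (abs_nonneg _).trans (hC 0 (by rw [abs_zero]; linarith))
  have hF : prim f₁ s₀ < 0 := hf₁.prim_neg s₀ ⟨by linarith, hsβ⟩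
  set p := √(-(2 * prim f₁ s₀)) with hp
  have hp0 : 0 < p := Real.sqrt_pos.2 (by linarith)
  have hp2 : p ^ 2 = -(2 * prim f₁ s₀) := Real.sq_sqrt (by linarith)
  obtain ⟨η, hη, hη1, hη2⟩ := exists_small_radius hC0 (half_pos hp0) (sub_pos.2 hsβ)
  obtain ⟨ρ, hρ, hρ'⟩ := exists_radius_slow d hp0 hη s₀ a
  obtain ⟨v, v', t₁, t₂, m, ht₁, ht, hm, hv, hv0, hvmem, hvdec, hdrop⟩ := h5.exists_core hf₂ hf₂pos
  -- `μ > 1` puts `A = μ αhat` above `a + ε`, and `μ m > a + ε` keeps the scaled solution in the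
  -- range where the nonlinearity is `l^2 f₂(s/μ)`.
  refine ⟨max 1 ((a + ε) / m), by positivity, fun μ hμ => ?_⟩
  obtain ⟨hμ1, hμm⟩ := max_lt_iff.1 hμ
  rw [div_lt_iff₀ hm] at hμm
  have hμ0 : 0 < μ := by linarith
  set A := μ * αhat with hA
  have hhat : a + ε < αhat := by linarith
  have haA : a + ε < A :=
    hhat.trans_le (le_mul_of_one_le_left (by linarith) hμ1.le)
  have hAμ : A / μ = αhat := by rw [hA]; field_simp
  have hlow : (a + ε) / μ ≤ A / μ := by gcongr
  have hlow0 : 0 < (a + ε) / μ := by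
    have : 0 < a + ε := by linarith
    positivity
  obtain ⟨y, hy, hmin⟩ := isCompact_Icc.exists_isMinOn (s := Icc ((a + ε) / μ) (A / μ))
    ⟨_, left_mem_Icc.2 hlow⟩ (hf₂.cont.mono fun x hx => hlow0.le.trans hx.1)
  have hm2 : 0 < f₂ y := hf₂pos y (hlow0.trans_le hy.1)
  have hA0 : 0 < A := by linarith
  -- The second entry makes the solution from `A` leave before `η`; the third makes solutions
  -- starting in `[a, A]` fall below `a` by `ρ`. The bound `1` allows `l ≤ l^2`.
  refine ⟨max 1 (max (2 * t₁ * √μ / η) ((d + 3) * 2 ^ (d + 4) * A / (f₂ y * ρ ^ 2))), by positivity,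
    fun l hl j hj => ?_⟩
  obtain ⟨hl1, hl'⟩ := max_lt_iff.1 hl
  obtain ⟨hl2, hl3⟩ := max_lt_iff.1 hl'
  have hl0 : 0 < l := by linarith
  set g := truncate (fMu f₁ f₂ a ε μ l) A with hg
  have ha0 : 0 < a := by linarith
  have hfg : ∀ s, |s| ≤ a → f₁ s = g s := fun s hs => by
    rw [hg, truncate_of_abs_le (hs.trans (by linarith)), fMu_of_abs_le h1.odd hs]
  have hcont := continuous_fMu (l := l) hf₁.cont h1.zero hf₂.cont ha0.le hε hμ0
  have hshape : Shape g b β := hf₁.congr (a := a) (by linarith) (continuous_truncate hcont A)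
    (truncate_neg (fMu_neg h1.zero ha0.le) hA0.le) hfg fun s hs =>
      fMu_pos ha0 hfa hε hμ0 hl0 hf₂pos (le_max_of_le_right (le_min (by linarith) hs))
  obtain ⟨D, hD⟩ := h1.nice h3 a
  have hN : Nice d g b β s₀ a D := hD.congr hshape hfg
  obtain ⟨C', hC'⟩ := exists_bound_truncate hcont hA0.le
  have hug : Sol d g u u' := hu.congr fun r hr => hfg _
    ((hu.abs_le_init hf₁ (by rw [hu0]; exact hβα.le) hr.le).trans (by rw [hu0]; linarith))
  have hCg : ∀ s, |s| ≤ a → |g s| ≤ C := fun s hs => hfg s hs ▸ hC s hs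
  have hgA : ∀ s ∈ Icc a A, l ^ 2 * f₂ y / A * (s - a) ≤ g s := fun s hs => by
    rw [hg, truncate_of_abs_le (by rw [abs_of_pos (by linarith [hs.1])]; exact hs.2)]
    exact fMu_ge_linear ha0 hfa hε hμ0 haA.le hm2.le (fun t ht => hmin ht) s hs
  have hΛ : (d + 3) * 2 ^ (d + 4) < l ^ 2 * f₂ y / A * ρ ^ 2 := by
    have hρ0 := hρ.1
    rw [div_lt_iff₀ (by positivity)] at hl3
    rw [div_mul_eq_mul_div, lt_div_iff₀ hA0]
    have h6 : l ≤ l ^ 2 := le_self_pow₀ hl1.le two_ne_zero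
    have h7 : 0 < f₂ y * ρ ^ 2 := by positivity
    linarith [mul_le_mul_of_nonneg_right h6 h7.le]
  obtain ⟨w₂, w₂', hw₂, hw₂0, hw₂lim, hw₂alt, hw₂not⟩ := exists_boundState_above hN hC' hug
    (by rw [hu0]; exact hα0) (by rw [hu0]; linarith) hlim (hsign.1.of_le hj) hbs hη
    (show a ≤ A by linarith)
    (fun w w' hw hw0 => hw.gt_of_init hshape hCg ⟨by linarith [hw0.1], hw0.2⟩ hη2)
    (fun w w' hw hw0 hgt hwη => by
      have hge : ∀ r ∈ Icc 0 η, s₀ ≤ w r := fun r hr => by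
        rcases hr.2.eq_or_lt with rfl | h
        · exact hwη.ge
        · exact (hgt r ⟨hr.1, h⟩).le
      have hwρ := hw.le_of_linear_lower_bound hshape hw0.2 hρ.1 hgA hΛ
        fun r hr => hbs.trans (hgt r ⟨hr.1, hr.2.trans_lt hρ.2⟩)
      have hdec : ∀ r ∈ Ioc 0 η, w' r < 0 := fun r hr => hw.deriv_neg_of_gt hshape hr.1
        fun t ht => hbs.trans_le (hge t ⟨ht.1, ht.2.trans hr.2⟩)
      refine hw.energy_neg_of_slow (C := C) (p := p) (fun s hs => ?_) hC0 ?_ hη1 hρ.1 hρ.2 hρ'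
        (fun r hr => ⟨hge r ⟨hρ.1.le.trans hr.1, hr.2⟩, ?_⟩) hwρ hwη (hdec η ⟨hη, le_rfl⟩).le
      · exact (le_abs_self _).trans
          (hCg s (by rw [abs_of_pos (by linarith [hs.1])]; exact hs.2))
      · rw [← prim_congr hfg (by rw [abs_of_pos (by linarith)]; linarith)]
        linarith
      · exact ge_of_hasDerivAt_nonpos hr.1 (hw.cont.mono fun t ht => hρ.1.le.trans ht.1)
          (fun t ht => hw.hasDeriv t (hρ.1.trans ht.1))
          fun t ht => (hdec t ⟨hρ.1.trans ht.1, ht.2.le.trans hr.2⟩).le)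
    (fun w w' hw hw0 => by
      have hκ : 0 < l / √μ := by positivity
      have hμκ : μ * (l / √μ) ^ 2 = l ^ 2 := by
        rw [div_pow, Real.sq_sqrt hμ0.le]; field_simp
      refine hw.leaves hshape ht₁ ht hv hvmem hvdec hdrop hμ0 hκ (fun s hs => ?_)
        (by rw [hw0, hv0]) (by rw [hw0]; linarith) hbs ?_
      · have hs0 : a + ε ≤ s := by linarith [hs.1]
        rw [hg, truncate_of_abs_le (by rw [abs_of_pos (by linarith)]; exact hs.2),
          fMu_of_ge ha0.le hε hs0, hμκ]
      · rw [div_lt_iff₀ hη] at hl2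
        rw [div_div_eq_mul_div, div_le_iff₀ hl0]
        linarith)
  have hβ2 : β ≤ w₂ 0 := by linarith [hw₂0.1]
  have hp2 : IsProfile d (fMu f₁ f₂ a ε μ l) j w₂ w₂' :=
    IsProfile.of_truncate hshape ⟨hw₂, by linarith, hw₂lim, hw₂alt, hw₂not⟩ hβ2 hw₂0.2
  obtain ⟨w₁, w₁', hw₁, hw₁0, hw₁lim, hw₁alt, hw₁not⟩ : ∃ w w' : ℝ → ℝ, Sol d g w w' ∧
      w 0 ∈ Icc β (u 0) ∧ Tendsto w atTop (𝓝 0) ∧ AltFrom w j 0 ∧ ¬ AltFrom w (j + 1) 0 := by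
    -- For `j = k - 1` the given bound state itself is the lower profile.
    rcases hj.eq_or_lt with rfl | hj
    · exact ⟨u, u', hug, ⟨by linarith, le_rfl⟩, hlim, hsign⟩
    · exact exists_boundState_below hN hC' hug (by rw [hu0]; exact hα0) (by rw [hu0]; linarith)
        hlim (hsign.1.of_le hj)
  exact ⟨w₁, w₁', w₂, w₂', IsProfile.of_truncate hshape ⟨hw₁, by linarith [hw₁0.1], hw₁lim, hw₁alt,
    hw₁not⟩ hw₁0.1 (by linarith [hw₁0.2]), hp2, hw₁0.2.trans_lt hw₂0.1⟩

end

/-! ### Radial profiles define classical solutions -/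

section

variable {d : ℕ} {f : ℝ → ℝ} {w w' : ℝ → ℝ}
variable {E : Type*} [NormedAddCommGroup E] [InnerProductSpace ℝ E]

lemma hasFDerivAt_comp_norm {φ : ℝ → ℝ} {φ' : ℝ} {x : E} (hx : x ≠ 0)
    (h : HasDerivAt φ φ' ‖x‖) :
    HasFDerivAt (fun y : E => φ ‖y‖) ((φ' / ‖x‖) • (innerSL ℝ x : E →L[ℝ] ℝ)) x := by
  have hx0 : 0 < ‖x‖ := norm_pos_iff.2 hx
  have h1 : HasDerivAt (fun t => φ (√t)) (φ' * (1 / (2 * √(‖x‖ ^ 2)))) (‖x‖ ^ 2) := by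
    refine HasDerivAt.comp (h₂ := φ) (h := Real.sqrt) _ ?_
      (Real.hasDerivAt_sqrt (by positivity))
    rwa [Real.sqrt_sq hx0.le]
  have h2 := h1.comp_hasFDerivAt x (hasStrictFDerivAt_norm_sq x).hasFDerivAt
  have e : (fun t => φ (√t)) ∘ (fun y : E => ‖y‖ ^ 2) = fun y : E => φ ‖y‖ := by
    funext y
    simp [Real.sqrt_sq]
  rw [e] at h2
  refine h2.congr_fderiv ?_
  rw [Real.sqrt_sq hx0.le]
  ext y
  simp
  field_simp

/-- The function `w'(r)/r`, with its limit at `r = 0`. -/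
def slopeQuot (d : ℕ) (f w w' : ℝ → ℝ) (r : ℝ) : ℝ :=
  if r = 0 then -(f (w 0) / (d + 3)) else w' r / r

/-- Near the origin `f(w)` is almost constant, and comparison with constant nonlinearities pins
`w'/r` to `-f(w 0)/n`. -/
lemma Sol.continuousOn_slopeQuot (hf : Continuous f) (h : Sol d f w w') :
    ContinuousOn (slopeQuot d f w w') (Ici 0) := by
  intro r hr
  rcases hr.out.eq_or_lt with rfl | hr
  · rw [Metric.continuousWithinAt_iff']
    intro δ hδ
    have hc : ∀ᶠ t in 𝓝[≥] (0 : ℝ), |f (w t) - f (w 0)| < δ := by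
      have := (hf.comp_continuousOn h.cont) 0 (mem_Ici.2 le_rfl)
      exact Metric.continuousWithinAt_iff'.1 this δ hδ
    obtain ⟨τ, hτ, hb⟩ := exists_Icc_of_eventually hc
    rw [zero_add] at hb
    filter_upwards [Icc_mem_nhdsGE hτ] with t ht
    rcases ht.1.eq_or_lt with rfl | ht0
    · simpa using hδ
    have h1 := (h.solOn (t + 1)).deriv_le_of_le (m := f (w 0) - δ) ht.1 (by linarith)
      fun s hs hst => by linarith [(abs_lt.1 (hb s ⟨hs.le, hst.le.trans ht.2⟩)).1]
    have h2 := (h.solOn (t + 1)).le_deriv_of_le (M := f (w 0) + δ) ht.1 (by linarith)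
      fun s hs hst => by linarith [(abs_lt.1 (hb s ⟨hs.le, hst.le.trans ht.2⟩)).2]
    have hd : (0 : ℝ) ≤ d := d.cast_nonneg
    have h3 : δ / (d + 3) < δ := by
      rw [div_lt_iff₀ (by positivity)]; nlinarith
    have h4 : w' t / t ≤ -((f (w 0) - δ) / (d + 3)) := by
      rw [div_le_iff₀ ht0]; calc w' t ≤ _ := h1
        _ = _ := by ring
    have h5 : -((f (w 0) + δ) / (d + 3)) ≤ w' t / t := by
      rw [le_div_iff₀ ht0]; calc _ = -((f (w 0) + δ) * t / (d + 3)) := by ring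
        _ ≤ _ := h2
    rw [Real.dist_eq, slopeQuot, slopeQuot, if_neg ht0.ne', if_pos rfl, abs_lt]
    rw [sub_div] at h4
    rw [add_div] at h5
    constructor <;> linarith
  · have h1 : ContinuousAt (fun t => w' t / t) r :=
      (h.hasDeriv' r hr).continuousAt.div continuousAt_id hr.ne'
    refine (h1.congr ?_).continuousWithinAt
    filter_upwards [Ioi_mem_nhds hr] with t ht
    rw [slopeQuot, if_neg (ne_of_gt ht.out)]

/-- The function `w''(r) - w'(r)/r`, extended continuously by `0` to `r = 0`. -/
def slopeDefect (d : ℕ) (f w w' : ℝ → ℝ) (r : ℝ) : ℝ :=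
  -((d + 3) * slopeQuot d f w w' r) - f (w r)

lemma slopeDefect_zero : slopeDefect d f w w' 0 = 0 := by
  rw [slopeDefect, slopeQuot, if_pos rfl]
  field_simp
  ring

lemma Sol.continuousOn_slopeDefect (hf : Continuous f) (h : Sol d f w w') :
    ContinuousOn (slopeDefect d f w w') (Ici 0) :=
  (continuousOn_const.mul (h.continuousOn_slopeQuot hf)).neg.sub (hf.comp_continuousOn h.cont)

lemma Sol.hasDerivAt_slopeQuot (h : Sol d f w w') {r : ℝ} (hr : 0 < r) :
    HasDerivAt (slopeQuot d f w w') (slopeDefect d f w w' r / r) r := by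
  have h1 := (h.hasDeriv' r hr).div (hasDerivAt_id r) hr.ne'
  refine (h1.congr_of_eventuallyEq ?_).congr_deriv ?_
  · filter_upwards [Ioi_mem_nhds hr] with t ht
    rw [slopeQuot, if_neg (ne_of_gt ht.out)]
    rfl
  · rw [slopeDefect, slopeQuot, if_neg hr.ne']
    simp only [id]
    field_simp
    ring

lemma continuous_comp_norm {E : Type*} [NormedAddCommGroup E] {φ : ℝ → ℝ} (h : ContinuousOn φ (Ici 0)) :
    Continuous fun x : E => φ ‖x‖ :=
  h.comp_continuous continuous_norm fun x => mem_Ici.2 (norm_nonneg x)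

/-- The gradient of `x ↦ w ‖x‖`. -/
def radialGrad (d : ℕ) (f w w' : ℝ → ℝ) (x : E) : E := slopeQuot d f w w' ‖x‖ • x

/-- The Hessian of `x ↦ w ‖x‖`. -/
def radialHess (d : ℕ) (f w w' : ℝ → ℝ) (x : E) : E →L[ℝ] E :=
  slopeQuot d f w w' ‖x‖ • ContinuousLinearMap.id ℝ E +
    (slopeDefect d f w w' ‖x‖ / ‖x‖ ^ 2) • (innerSL ℝ x : E →L[ℝ] ℝ).smulRight x

lemma Sol.hasFDerivAt_comp_norm (h : Sol d f w w') (x : E) :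
    HasFDerivAt (fun y : E => w ‖y‖) (innerSL ℝ (radialGrad d f w w' x) : E →L[ℝ] ℝ) x := by
  by_cases hx : x = 0
  · subst hx
    rw [hasFDerivAt_iff_isLittleO_nhds_zero, Asymptotics.isLittleO_iff]
    intro δ hδ
    have hc : ∀ᶠ t in 𝓝[≥] (0 : ℝ), |w' t| < δ := by
      have h1 : Tendsto (fun t => |w' t|) (𝓝[≥] 0) (𝓝 |w' 0|) :=
        (h.cont' 0 (mem_Ici.2 le_rfl)).abs
      rw [h.init, abs_zero] at h1
      exact h1.eventually_lt_const hδ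
    obtain ⟨τ, hτ, hb⟩ := exists_Icc_of_eventually hc
    rw [zero_add] at hb
    filter_upwards [Metric.ball_mem_nhds (0 : E) hτ] with y hy
    rw [mem_ball_zero_iff] at hy
    have h1 : |w ‖y‖ - w 0| ≤ δ * (‖y‖ - 0) := abs_sub_le_of_hasDerivAt (norm_nonneg y)
      (h.cont.mono fun t ht => ht.1) (fun t ht => h.hasDeriv t ht.1)
      fun t ht => (hb t ⟨ht.1.le, ht.2.le.trans hy.le⟩).le
    simpa [radialGrad] using h1
  · have hx0 : 0 < ‖x‖ := norm_pos_iff.2 hx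
    refine (RadialBoundStates.hasFDerivAt_comp_norm hx (h.hasDeriv _ hx0)).congr_fderiv ?_
    ext y
    simp [radialGrad, slopeQuot, hx0.ne']

/-- At the origin continuity of `w'/r` is enough; elsewhere its derivative `slopeDefect / r`
produces the rank-one term. -/
lemma Sol.hasFDerivAt_radialGrad (hf : Continuous f) (h : Sol d f w w') (x : E) :
    HasFDerivAt (radialGrad d f w w') (radialHess d f w w' x) x := by
  by_cases hx : x = 0
  · subst hx
    rw [hasFDerivAt_iff_isLittleO_nhds_zero, Asymptotics.isLittleO_iff]
    intro δ hδ
    have hc := (continuous_comp_norm (E := E) (h.continuousOn_slopeQuot hf)).tendsto 0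
    filter_upwards [Metric.tendsto_nhds.1 hc δ hδ] with y hy
    rw [Real.dist_eq] at hy
    have e : radialGrad d f w w' (0 + y) - radialGrad d f w w' 0 - radialHess d f w w' 0 y =
        (slopeQuot d f w w' ‖y‖ - slopeQuot d f w w' ‖(0 : E)‖) • y := by
      simp [radialGrad, radialHess, sub_smul]
    rw [e, norm_smul, Real.norm_eq_abs]
    gcongr
  · have hx0 : 0 < ‖x‖ := norm_pos_iff.2 hx
    have h1 := (RadialBoundStates.hasFDerivAt_comp_norm hx (h.hasDerivAt_slopeQuot hx0)).smul
      (hasFDerivAt_id x)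
    refine h1.congr_fderiv ?_
    ext y
    simp only [radialHess, add_apply, smul_apply,
      ContinuousLinearMap.smulRight_apply, id]
    congr 1
    rw [smul_smul, smul_eq_mul, div_div, ← sq]

/-- The norm of the rank-one term is `|slopeDefect|`, which vanishes at the origin, so there is no
singularity. -/
lemma Sol.continuous_radialHess (hf : Continuous f) (h : Sol d f w w') :
    Continuous (radialHess d f w w' : E → E →L[ℝ] E) := by
  refine ((continuous_comp_norm (h.continuousOn_slopeQuot hf)).smul continuous_const).add ?_
  have hq := continuous_comp_norm (E := E) (h.continuousOn_slopeDefect hf)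
  have hb : Continuous fun x : E => (innerSL ℝ x : E →L[ℝ] ℝ).smulRight x :=
    ((ContinuousLinearMap.smulRightL ℝ E E).continuous₂).comp
      ((innerSL ℝ : E →L[ℝ] E →L[ℝ] ℝ).continuous.prodMk continuous_id)
  rw [continuous_iff_continuousAt]
  intro x
  by_cases hx : x = 0
  · subst hx
    rw [ContinuousAt]
    have e : (slopeDefect d f w w' ‖(0 : E)‖ / ‖(0 : E)‖ ^ 2) •
        (innerSL ℝ (0 : E) : E →L[ℝ] ℝ).smulRight (0 : E) = 0 := by simp
    rw [e]
    have hq0 := (hq.tendsto 0).abs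
    simp only [norm_zero, slopeDefect_zero, abs_zero] at hq0
    refine squeeze_zero_norm (fun y => ?_) hq0
    rw [norm_smul, ContinuousLinearMap.norm_smulRight_apply, innerSL_apply_norm, Real.norm_eq_abs,
      abs_div, abs_of_nonneg (sq_nonneg ‖y‖), ← sq]
    rcases (sq_nonneg ‖y‖).eq_or_lt with h0 | h0
    · rw [← h0, mul_zero]; exact abs_nonneg _
    · rw [div_mul_cancel₀ _ h0.ne']
  · have hx0 : ‖x‖ ^ 2 ≠ 0 := by simpa using hx
    exact (hq.continuousAt.div (by fun_prop) hx0).smul hb.continuousAt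

lemma Sol.contDiff_two (hf : Continuous f) (h : Sol d f w w') :
    ContDiff ℝ 2 fun x : E => w ‖x‖ := by
  rw [show (2 : WithTop ℕ∞) = ((1 : ℕ) : WithTop ℕ∞) + 1 by norm_num,
    contDiff_succ_iff_hasFDerivAt]
  refine ⟨_, ?_, h.hasFDerivAt_comp_norm⟩
  have h1 : ContDiff ℝ 1 (radialGrad d f w w' : E → E) :=
    contDiff_one_iff_hasFDerivAt.2 ⟨_, h.continuous_radialHess hf, h.hasFDerivAt_radialGrad hf⟩
  exact (innerSL ℝ : E →L[ℝ] E →L[ℝ] ℝ).contDiff.comp h1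

/-- The trace of the Hessian is `n w'/r` plus the defect `w'' - w'/r`, with both terms continued to
the origin. -/
lemma Sol.laplacian_eq (hf : Continuous f) (h : Sol d f w w')
    (x : EuclideanSpace ℝ (Fin (d + 3))) :
    Laplacian.laplacian (fun x : EuclideanSpace ℝ (Fin (d + 3)) => w ‖x‖) x = -f (w ‖x‖) := by
  set B := EuclideanSpace.basisFun (Fin (d + 3)) ℝ
  rw [InnerProductSpace.laplacian_eq_iteratedFDeriv_orthonormalBasis _ B]
  have h1 : fderiv ℝ (fun x : EuclideanSpace ℝ (Fin (d + 3)) => w ‖x‖) =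
      fun x => (innerSL ℝ : _ →L[ℝ] _ →L[ℝ] ℝ) (radialGrad d f w w' x) :=
    funext fun y => (h.hasFDerivAt_comp_norm y).fderiv
  have h2 : ∀ y z, fderiv ℝ (fderiv ℝ
      (fun x : EuclideanSpace ℝ (Fin (d + 3)) => w ‖x‖)) x y z =
      inner ℝ (radialHess d f w w' x y) z := by
    intro y z
    have h0 := ((innerSL ℝ : _ →L[ℝ] _ →L[ℝ] ℝ).hasFDerivAt).comp x
      (h.hasFDerivAt_radialGrad (E := EuclideanSpace ℝ (Fin (d + 3))) hf x)
    have e : fderiv ℝ (fderiv ℝ (fun x : EuclideanSpace ℝ (Fin (d + 3)) => w ‖x‖)) x = _ :=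
      (congrArg (fun F => fderiv ℝ F x) h1).trans h0.fderiv
    rw [e]
    rfl
  have h3 : ∀ i, inner ℝ (radialHess d f w w' x (B i)) (B i) = slopeQuot d f w w' ‖x‖ +
      slopeDefect d f w w' ‖x‖ / ‖x‖ ^ 2 * inner ℝ x (B i) ^ 2 := by
    intro i
    simp only [radialHess, add_apply, smul_apply,
      ContinuousLinearMap.smulRight_apply, ContinuousLinearMap.id_apply, innerSL_apply_apply,
      inner_add_left, inner_smul_left, real_inner_self_eq_norm_sq, B.norm_eq_one]
    simp only [conj_trivial]
    ring
  simp_rw [iteratedFDeriv_two_apply, h2]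
  simp only [Matrix.cons_val_zero, Matrix.cons_val_one, h3]
  rw [Finset.sum_add_distrib, ← Finset.mul_sum, B.sum_sq_inner_left]
  have h4 : slopeDefect d f w w' ‖x‖ / ‖x‖ ^ 2 * ‖x‖ ^ 2 = slopeDefect d f w w' ‖x‖ := by
    by_cases hx : x = 0
    · subst hx; rw [norm_zero, slopeDefect_zero]; simp
    · rw [div_mul_cancel₀]; simpa using hx
  rw [h4, slopeDefect]
  simp
  ring

theorem IsProfile.isRadialBoundState {j : ℕ} (hf : Continuous f) (h : IsProfile d f j w w') :
    IsRadialBoundState (d + 3) f j w where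
  boundState :=
    { smooth := h.sol.contDiff_two hf
      equation := fun x => by rw [h.sol.laplacian_eq hf]; ring
      decay := h.lim.comp tendsto_norm_cocompact_atTop
      nonconstant := by
        obtain ⟨r, hr, hr0⟩ :=
          ((h.lim.eventually_lt_const h.pos).and (eventually_ge_atTop (0 : ℝ))).exists
        refine ⟨EuclideanSpace.single 0 r, 0, ?_⟩
        simp only [PiLp.norm_single, norm_zero, Real.norm_eq_abs, abs_of_nonneg hr0]
        exact hr.ne }
  pos_origin := h.pos
  signChanges := by
    rw [ChangesSign, alternates_iff_altFrom h.pos.ne', alternates_iff_altFrom h.pos.ne']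
    exact ⟨h.alt, h.not_alt⟩

end

end RadialBoundStates

end

open RadialBoundStates in
theorem theoremA (N : ℕ) (hN : 2 < N) (k : ℕ) (hk : 1 ≤ k)
    (f₁ f₂ : ℝ → ℝ) (b β α αhat ε : ℝ)
    (h1 : H1 f₁ b β) (h2 : H2 N f₁ β) (h3 : H3 N f₁ b β) (h4 : H4 N f₁ k α)
    (hf₂ : Regular f₂) (hf₂pos : ∀ s, 0 < s → 0 < f₂ s) (h5 : H5 N f₂ α αhat)
    (hε : 0 < ε) (hε' : ε < min (β / 4) ((αhat - α) / 2)) :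
    ∃ μbar : ℝ, 0 < μbar ∧ ∀ μ : ℝ, μbar < μ →
      ∃ lbar : ℝ, 0 < lbar ∧ ∀ l : ℝ, lbar < l →
        ∀ j : ℕ, 1 ≤ j → j ≤ k - 1 →
          ∃ w₁ w₂ : ℝ → ℝ,
            IsRadialBoundState N (fMu f₁ f₂ (α + ε) ε μ l) j w₁ ∧
            IsRadialBoundState N (fMu f₁ f₂ (α + ε) ε μ l) j w₂ ∧
            w₁ 0 ≠ w₂ 0 := by
  obtain ⟨d, rfl⟩ : ∃ d, N = d + 3 := ⟨N - 3, by omega⟩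
  obtain ⟨μbar, hμbar, h⟩ := exists_two_profiles k h1 h3 h4 hf₂ hf₂pos h5 hε
    (hε'.trans_le (min_le_right _ _))
  refine ⟨μbar, hμbar, fun μ hμ => ?_⟩
  obtain ⟨lbar, hlbar, h⟩ := h μ hμ
  refine ⟨lbar, hlbar, fun l hl j _ hj => ?_⟩
  obtain ⟨w₁, w₁', w₂, w₂', hw₁, hw₂, hlt⟩ := h l hl j hj
  have hcont : Continuous (fMu f₁ f₂ (α + ε) ε μ l) :=
    continuous_fMu h1.continuous h1.zero hf₂.cont (by linarith [h4.1]) hε (hμbar.trans hμ)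
  exact ⟨w₁, w₂, hw₁.isRadialBoundState hcont, hw₂.isRadialBoundState hcont, hlt.ne⟩
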